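/- Let $k$ be a field and let $H$ be a finite-dimensional Hopf algebra over $k$ with antipode $S$. Let $\iota:B\to H$ be an injection of left $H$-comodule algebras and $\pi:H\to C$ a surjection of right $H$-module coalgebras (coaction $b\mapsto\sum b_{(1)}\otimes b_{(2)}\in H\otimes B$, action $x\otimes h\mapsto x\blacktriangleleft h$) such that the image of $\iota$ is the space of coinvariants $\{h:\sum h_{(1)}\otimes\pi(h_{(2)})=h\otimes\pi(1)\}$; in the situation below $\ker\pi=B^+H$, so that $C\cong H/B^+H$, where $B$ is a left coideal subalgebra of $H$ via $\iota$ and $B^+=\{b\in B:\varepsilon(\iota(b))=0\}$. A *partially admissible mapping system* $(\zeta,\gamma^*)$ for $\iota$ consists of linear maps $\zeta:H\to B$ and $\gamma:C\to H$ with convolution inverses $\bar\zeta,\bar\gamma$, such that $\zeta(\iota(b)h)=b\,\zeta(h)$, $\sum\gamma(x)_{(1)}\otimes\pi(\gamma(x)_{(2)})=\sum\gamma(x_{(1)})\otimes x_{(2)}$, $\zeta(1)=1$, $\varepsilon\iota\zeta=\varepsilon$, $\gamma(\pi(1))=1$, $\varepsilon\gamma=\varepsilon_C$, and $(\iota\zeta)*(\gamma\pi)=\mathrm{id}_H$.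 Fix such a system. On the algebra $A=C^*\#B$, which is the space $C^*\otimes B$ with product $(f\#b)(g\#c)=\sum f\,(b_{(1)}\rightharpoonup g)\#b_{(2)}c$, where $(h\rightharpoonup g)(x)=g(x\blacktriangleleft h)$ and $C^*$ has the convolution product, define with a basis $\{b_i\}$ of $B$ with dual basis $\{b_i^*\}$ and a basis $\{f_i\}$ of $C^*$ with dual basis $\{f_i^*\}$ of $C$: - $\boldsymbol\Delta(f\#b)=\boldsymbol\Delta(f\#1)\boldsymbol\Delta(\varepsilon\#b)$, $\boldsymbol\Delta(f\#1)=\sum_i(f_{(1)}\#b_i)\otimes(\gamma^*[f_{(2)}\zeta^*(b_i^*)]\#1)$, $\boldsymbol\Delta(\varepsilon\#b)=\sum_i(\varepsilon\#\zeta[\gamma(f_i^*)b_{(1)}])\otimes(f_i\#b_{(2)})$, where $\sum f_{(1)}(x)f_{(2)}(h)=f(x\blacktriangleleft h)$; - $\boldsymbol\varepsilon(f\#b)=f(\pi(1))\,\varepsilon(\iota(b))$; - $\boldsymbol\phi=\sum_{i,j}(\varepsilon\#b_i)\otimes(\varepsilon\#b_j)(\bar\gamma^*[S^{-1}(\bar\zeta^*(b_i^*)_{(1)})]\#1)\otimes(\bar\gamma^*[S^{-1}(\bar\zeta^*(b_j^*)\bar\zeta^*(b_i^*)_{(2)})]\#1)$,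 with $S$ the antipode of $H^*$ here; - $\mathbf T(f\#b)=\sum_i(\varepsilon\#b_i)(\bar\gamma^*[\pi^*(f)(\iota(b)\rightharpoonup\bar\zeta^*(b_i^*))]\#1)$, where $(h\rightharpoonup h^*)(x)=h^*(xh)$, and $\boldsymbol\upsilon=\mathbf T(\varepsilon\#1)$. The algebra $A$ with $\boldsymbol\Delta,\boldsymbol\varepsilon,\boldsymbol\phi$ is the *left partial dual* of $H$ determined by $(\zeta,\gamma^*)$. Quasi-bialgebras and antipodes $(S,\alpha,\beta)$ are in the sense of Drinfeld: $(\mathrm{id}\otimes\Delta)\Delta(a)\,\phi=\phi\,(\Delta\otimes\mathrm{id})\Delta(a)$, $\sum S(a_{(1)})\alpha a_{(2)}=\varepsilon(a)\alpha$, $\sum a_{(1)}\beta S(a_{(2)})=\varepsilon(a)\beta$, $\sum\phi^1\beta S(\phi^2)\alpha\phi^3=1$, and, with $\phi^{-1}=\sum\psi^1\otimes\psi^2\otimes\psi^3$, $\sum S(\psi^1)\alpha\psi^2\beta S(\psi^3)=1$, where $S$ is a unital algebra anti-endomorphism. For a quasi-bialgebra $Q$, $Q^{\mathrm{biop}}$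 has the opposite product, the coopposite comultiplication, the same counit and the associator $\phi^3\otimes\phi^2\otimes\phi^1$. For an algebra $B$ and a coalgebra $C$, $B^{\mathrm{biop}}$ and $C^{*\,\mathrm{biop}}$ are obtained from the (co)opposite structures, and $H^{*\,\mathrm{biop}}$ is the Hopf algebra $H^*$ with opposite product and coproduct. **Proposition.** $(\gamma^*,\zeta)$ is a partially admissible mapping system for $\pi^*:C^{*\,\mathrm{biop}}\to H^{*\,\mathrm{biop}}$, with quotient $\iota^*:H^{*\,\mathrm{biop}}\to B^{*\,\mathrm{biop}}$. Let $B^{\mathrm{biop}}\#C^{*\,\mathrm{biop}}$ be the left partial dual of $H^{*\,\mathrm{biop}}$ that it determines, where $B$ is identified with $B^{**}$. Then $(C^*\#B)^{\mathrm{biop}}$ and $B^{\mathrm{biop}}\#C^{*\,\mathrm{biop}}$ are quasi-bialgebras, and $$\vartheta:(C^*\#B)^{\mathrm{biop}}\to B^{\mathrm{biop}}\#C^{*\,\mathrm{biop}},\qquad f\#b\mapsto b\#f,$$ is an isomorphism of quasi-bialgebras, that is, an isomorphism of algebras which preserves the comultiplications, the counits and the associators. Furthermore, if $\boldsymbol\upsilon$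 is invertible, put $\mathbf S_1=\mathbf T(-)\boldsymbol\upsilon^{-1}$ and $\mathbf S_2=\boldsymbol\upsilon^{-1}\mathbf T(-)$, with the product of $C^*\#B$. Then: 1. $(\mathbf S_1,\varepsilon\#1,\boldsymbol\upsilon)$ is an antipode of $(C^*\#B)^{\mathrm{biop}}$, and $(\vartheta\mathbf S_1\vartheta^{-1},1\#\varepsilon,\vartheta(\boldsymbol\upsilon))$ is an antipode of $B^{\mathrm{biop}}\#C^{*\,\mathrm{biop}}$; 2. $(\mathbf S_2,\boldsymbol\upsilon,\varepsilon\#1)$ is an antipode of $(C^*\#B)^{\mathrm{biop}}$, and $(\vartheta\mathbf S_2\vartheta^{-1},\vartheta(\boldsymbol\upsilon),1\#\varepsilon)$ is an antipode of $B^{\mathrm{biop}}\#C^{*\,\mathrm{biop}}$. -/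

import Mathlib

open TensorProduct Coalgebra

noncomputable section

namespace LeftPartialDual

section Transpose

variable {k M N P : Type*} [Field k] [AddCommGroup M] [Module k M] [AddCommGroup N] [Module k N]
  [AddCommGroup P] [Module k P]

/-- The transpose of a linear map `T : M → N ⊗ P`, as a bilinear operation on dual spaces:
`(f, g) ↦ (f ⊗ g) ∘ T`. -/
def transposeMul (T : M →ₗ[k] N ⊗[k] P) :
    Module.Dual k N →ₗ[k] Module.Dual k P →ₗ[k] Module.Dual k M :=
  TensorProduct.curry (T.dualMap ∘ₗ TensorProduct.dualDistrib k N P)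

/-- The transpose of a bilinear map `β : M × N → P` with `M` finite dimensional, as a map
`f ↦ ∑ f₁ ⊗ f₂` on dual spaces, where `∑ f₁ m * f₂ n = f (β m n)`. -/
def transposeComul [FiniteDimensional k M] (β : M →ₗ[k] N →ₗ[k] P) :
    Module.Dual k P →ₗ[k] Module.Dual k M ⊗[k] Module.Dual k N :=
  (dualTensorHomEquiv k M (Module.Dual k N)).symm.toLinearMap ∘ₗ
    (Module.Dual.transpose ∘ₗ β).flip

theorem transposeMul_apply (T : M →ₗ[k] N ⊗[k] P) (f : Module.Dual k N) (g : Module.Dual k P)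
    (m : M) : transposeMul T f g m = dualDistrib k N P (f ⊗ₜ g) (T m) := rfl

theorem dualDistrib_eq (t : Module.Dual k M ⊗[k] Module.Dual k N) (m : M) (n : N) :
    dualDistrib k M N t (m ⊗ₜ n) = dualTensorHom k M (Module.Dual k N) t m n := by
  induction t with
  | zero => simp
  | tmul f g => simp
  | add s t hs ht => simp only [map_add, LinearMap.add_apply, hs, ht]

theorem dualTensorHom_ext [FiniteDimensional k M] {t s : Module.Dual k M ⊗[k] P}
    (h : ∀ m, dualTensorHom k M P t m = dualTensorHom k M P s m) : t = s := by
  apply (dualTensorHomEquiv k M P).injective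
  ext m
  exact h m

theorem dualDistrib_ext [FiniteDimensional k M] {t s : Module.Dual k M ⊗[k] Module.Dual k N}
    (h : ∀ m n, dualDistrib k M N t (m ⊗ₜ n) = dualDistrib k M N s (m ⊗ₜ n)) : t = s := by
  apply dualTensorHom_ext
  intro m
  ext n
  rw [← dualDistrib_eq, ← dualDistrib_eq, h]

theorem dualTensorHom_transposeComul [FiniteDimensional k M] (β : M →ₗ[k] N →ₗ[k] P)
    (f : Module.Dual k P) (m : M) :
    dualTensorHom k M (Module.Dual k N) (transposeComul β f) m = f ∘ₗ β m :=
  LinearMap.congr_fun ((dualTensorHomEquiv k M (Module.Dual k N)).apply_symm_apply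
    ((Module.Dual.transpose ∘ₗ β).flip f)) m

theorem dualDistrib_transposeComul [FiniteDimensional k M] (β : M →ₗ[k] N →ₗ[k] P)
    (f : Module.Dual k P) (m : M) (n : N) :
    dualDistrib k M N (transposeComul β f) (m ⊗ₜ n) = f (β m n) := by
  rw [dualDistrib_eq, dualTensorHom_transposeComul]; rfl

variable {Q R : Type*} [AddCommGroup Q] [Module k Q] [AddCommGroup R] [Module k R]

/-- Pairing of `M* ⊗ (N* ⊗ P*)` with `M × N × P`. -/
def pair₃ (t : Module.Dual k M ⊗[k] (Module.Dual k N ⊗[k] Module.Dual k P))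
    (m : M) (n : N) (p : P) : k :=
  dualDistrib k N P (dualTensorHom k M _ t m) (n ⊗ₜ p)

theorem pair₃_ext [FiniteDimensional k M] [FiniteDimensional k N]
    {t s : Module.Dual k M ⊗[k] (Module.Dual k N ⊗[k] Module.Dual k P)}
    (h : ∀ m n p, pair₃ t m n p = pair₃ s m n p) : t = s :=
  dualTensorHom_ext (P := Module.Dual k N ⊗[k] Module.Dual k P) fun m => by
    apply dualDistrib_ext
    intro n p
    exact h m n p

theorem pair₃_tmul (f : Module.Dual k M) (u : Module.Dual k N ⊗[k] Module.Dual k P)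
    (m : M) (n : N) (p : P) : pair₃ (f ⊗ₜ u) m n p = f m * dualDistrib k N P u (n ⊗ₜ p) := by
  simp [pair₃]

theorem pair₃_assoc (u : Module.Dual k M ⊗[k] Module.Dual k N) (g : Module.Dual k P)
    (m : M) (n : N) (p : P) :
    pair₃ (TensorProduct.assoc k _ _ _ (u ⊗ₜ g)) m n p = dualDistrib k M N u (m ⊗ₜ n) * g p := by
  induction u with
  | zero => simp [pair₃]
  | tmul f g => simp [pair₃, mul_assoc]
  | add s t hs ht =>
    simp only [pair₃, add_tmul, map_add, LinearMap.add_apply, add_mul] at hs ht ⊢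
    rw [hs, ht]

theorem pair₃_rTensor [FiniteDimensional k M] (β : M →ₗ[k] N →ₗ[k] Q)
    (t : Module.Dual k Q ⊗[k] Module.Dual k P) (m : M) (n : N) (p : P) :
    pair₃ (TensorProduct.assoc k _ _ _ ((transposeComul β).rTensor _ t)) m n p =
      dualDistrib k Q P t (β m n ⊗ₜ p) := by
  induction t with
  | zero => simp [pair₃]
  | tmul f g => simp [pair₃_assoc, dualDistrib_transposeComul]
  | add s t hs ht =>
    simp only [pair₃, map_add, LinearMap.add_apply] at hs ht ⊢
    rw [hs, ht]

theorem pair₃_lTensor [FiniteDimensional k N] (β : N →ₗ[k] P →ₗ[k] Q)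
    (t : Module.Dual k M ⊗[k] Module.Dual k Q) (m : M) (n : N) (p : P) :
    pair₃ ((transposeComul β).lTensor _ t) m n p =
      dualDistrib k M Q t (m ⊗ₜ β n p) := by
  induction t with
  | zero => simp [pair₃]
  | tmul f g => simp [pair₃_tmul, dualDistrib_transposeComul]
  | add s t hs ht =>
    simp only [pair₃, map_add, LinearMap.add_apply] at hs ht ⊢
    rw [hs, ht]

theorem transposeComul_assoc [FiniteDimensional k M] [FiniteDimensional k N]
    (β : M →ₗ[k] N →ₗ[k] Q) (β' : Q →ₗ[k] P →ₗ[k] R) [FiniteDimensional k Q]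
    {S : Type*} [AddCommGroup S] [Module k S]
    (γ : N →ₗ[k] P →ₗ[k] S) (γ' : M →ₗ[k] S →ₗ[k] R)
    (h : ∀ m n p, β' (β m n) p = γ' m (γ n p)) (f : Module.Dual k R) :
    TensorProduct.assoc k _ _ _ ((transposeComul β).rTensor _ (transposeComul β' f)) =
      (transposeComul γ).lTensor _ (transposeComul γ' f) := by
  apply pair₃_ext
  intro m n p
  rw [pair₃_rTensor, pair₃_lTensor, dualDistrib_transposeComul, dualDistrib_transposeComul, h]

theorem transposeMul_assoc
    (T : M →ₗ[k] N ⊗[k] Q) (U : N →ₗ[k] P ⊗[k] R)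
    {S : Type*} [AddCommGroup S] [Module k S]
    (T' : M →ₗ[k] P ⊗[k] S) (U' : S →ₗ[k] R ⊗[k] Q)
    (h : ∀ m, TensorProduct.assoc k _ _ _ (U.rTensor _ (T m)) = U'.lTensor _ (T' m))
    (f : Module.Dual k P) (g : Module.Dual k R) (e : Module.Dual k Q) :
    transposeMul T (transposeMul U f g) e = transposeMul T' f (transposeMul U' g e) := by
  have key : ∀ t : (P ⊗[k] R) ⊗[k] Q, dualDistrib k _ _ (dualDistrib k _ _ (f ⊗ₜ g) ⊗ₜ e) t =
      dualDistrib k _ _ (f ⊗ₜ dualDistrib k _ _ (g ⊗ₜ e)) (TensorProduct.assoc k _ _ _ t) := by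
    intro t
    induction t with
    | zero => simp
    | add s t hs ht => simp only [map_add, hs, ht]
    | tmul s q =>
      induction s with
      | zero => simp
      | add s t hs ht => simp only [map_add, add_tmul, hs, ht]
      | tmul p r => simp [mul_assoc]
  have h1 : ∀ t : N ⊗[k] Q, dualDistrib k _ _ (transposeMul U f g ⊗ₜ e) t =
      dualDistrib k _ _ (dualDistrib k _ _ (f ⊗ₜ g) ⊗ₜ e) (U.rTensor _ t) := by
    intro t
    induction t with
    | zero => simp
    | add s t hs ht => simp only [map_add, hs, ht]
    | tmul s q => simp [transposeMul_apply]
  have h2 : ∀ t : P ⊗[k] S, dualDistrib k _ _ (f ⊗ₜ transposeMul U' g e) t =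
      dualDistrib k _ _ (f ⊗ₜ dualDistrib k _ _ (g ⊗ₜ e)) (U'.lTensor _ t) := by
    intro t
    induction t with
    | zero => simp
    | add s t hs ht => simp only [map_add, hs, ht]
    | tmul s q => simp [transposeMul_apply]
  ext m
  rw [transposeMul_apply, transposeMul_apply, h1, h2, ← h, key]

end Transpose

/-! ### Comodule algebras, module coalgebras, smash products -/

/-- `B` is a left `H`-comodule algebra. -/
class LeftComoduleAlgebra (k H B : Type*) [Field k] [Ring H] [Bialgebra k H] [Ring B]
    [Algebra k B] where
  /-- the coaction `b ↦ ∑ b₍₁₎ ⊗ b₍₂₎` -/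
  coact : B →ₗ[k] H ⊗[k] B
  coassoc (b : B) : TensorProduct.assoc k H H B ((comul (R := k) (A := H)).rTensor B (coact b)) =
    coact.lTensor H (coact b)
  counit_coact (b : B) :
    TensorProduct.lid k B ((counit (R := k) (A := H)).rTensor B (coact b)) = b
  coact_one : coact 1 = 1
  coact_mul (b c : B) : coact (b * c) = coact b * coact c

/-- `C` is a right `H`-module coalgebra. -/
class RightModuleCoalgebra (k H C : Type*) [Field k] [Ring H] [Bialgebra k H] [AddCommGroup C]
    [Module k C] [Coalgebra k C] where
  /-- the action `(x, h) ↦ x ◁ h` -/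
  act : C →ₗ[k] H →ₗ[k] C
  act_one (x : C) : act x 1 = x
  act_mul (x : C) (h h' : H) : act x (h * h') = act (act x h) h'
  comul_act (x : C) (h : H) :
    comul (R := k) (act x h) =
      TensorProduct.map₂ act act (comul (R := k) x) (comul (R := k) h)
  counit_act (x : C) (h : H) :
    counit (R := k) (act x h) = counit (R := k) x * counit (R := k) h

open LeftComoduleAlgebra RightModuleCoalgebra

section Smash

variable (k H B C : Type*) [Field k] [Ring H] [Bialgebra k H]
  [Ring B] [Algebra k B] [LeftComoduleAlgebra k H B]
  [AddCommGroup C] [Module k C] [Coalgebra k C] [RightModuleCoalgebra k H C]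

/-- The convolution product of the dual algebra `C*`: `(f g)(x) = ∑ f(x₍₁₎) g(x₍₂₎)`. -/
def dualMul : Module.Dual k C →ₗ[k] Module.Dual k C →ₗ[k] Module.Dual k C :=
  transposeMul (comul (R := k) (A := C))

/-- The hit action `(h ⇀ f)(x) = f(x ◁ h)` of `H` on `C*`. -/
def hit : H →ₗ[k] Module.Dual k C →ₗ[k] Module.Dual k C :=
  Module.Dual.transpose ∘ₗ (act (k := k) (H := H) (C := C)).flip

/-- The underlying space of the smash product `C* # B`. -/
def Smash (k H B C : Type*) [Field k] [Ring H] [Bialgebra k H]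
    [Ring B] [Algebra k B] [LeftComoduleAlgebra k H B]
    [AddCommGroup C] [Module k C] [Coalgebra k C] [RightModuleCoalgebra k H C] : Type _ :=
  Module.Dual k C ⊗[k] B

instance : AddCommGroup (Smash k H B C) := inferInstanceAs (AddCommGroup (Module.Dual k C ⊗[k] B))
instance : Module k (Smash k H B C) := inferInstanceAs (Module k (Module.Dual k C ⊗[k] B))

/-- `f, b ↦ f # b`. -/
def smk : Module.Dual k C →ₗ[k] B →ₗ[k] Smash k H B C := TensorProduct.mk k (Module.Dual k C) B

/-- Left multiplication by `f # 1`: `g # c ↦ f g # c`. -/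
def smashLeft : Module.Dual k C →ₗ[k] Module.End k (Module.Dual k C ⊗[k] B) :=
  LinearMap.rTensorHom B ∘ₗ dualMul k C

/-- Left multiplication by `ε # b`: `g # c ↦ ∑ (b₍₁₎ ⇀ g) # b₍₂₎ c`. -/
def smashRight : B →ₗ[k] Module.End k (Module.Dual k C ⊗[k] B) :=
  TensorProduct.map₂ (hit k H C) (LinearMap.mul k B) ∘ₗ coact (k := k) (H := H)

/-- The product of `C* # B`: `(f # b)(g # c) = ∑ f (b₍₁₎ ⇀ g) # b₍₂₎ c`. -/
def smashMul : Module.Dual k C ⊗[k] B →ₗ[k] Module.End k (Module.Dual k C ⊗[k] B) :=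
  TensorProduct.lift
    ((LinearMap.mul k (Module.End k (Module.Dual k C ⊗[k] B))).compl₁₂
      (smashLeft k B C) (smashRight k H B C))

variable {k H B C}

theorem dualMul_assoc (f g e : Module.Dual k C) :
    dualMul k C (dualMul k C f g) e = dualMul k C f (dualMul k C g e) :=
  transposeMul_assoc _ _ _ _ (fun m => coassoc_apply m) f g e

theorem dualMul_counit (f : Module.Dual k C) : dualMul k C f counit = f := by
  ext x
  have : ∀ t : C ⊗[k] C, dualDistrib k C C (f ⊗ₜ counit) t =
      f (TensorProduct.rid k C (counit.lTensor C t)) := by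
    intro t
    induction t with
    | zero => simp
    | add s t hs ht => simp only [map_add, hs, ht]
    | tmul s q => simp [mul_comm]
  simp [dualMul, transposeMul_apply, this]

theorem counit_dualMul (f : Module.Dual k C) : dualMul k C counit f = f := by
  ext x
  have : ∀ t : C ⊗[k] C, dualDistrib k C C (counit ⊗ₜ f) t =
      f (TensorProduct.lid k C (counit.rTensor C t)) := by
    intro t
    induction t with
    | zero => simp
    | add s t hs ht => simp only [map_add, hs, ht]
    | tmul s q => simp
  simp [dualMul, transposeMul_apply, this]

theorem hit_apply (h : H) (f : Module.Dual k C) (x : C) :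
    hit k H C h f x = f (act (k := k) x h) := rfl


theorem hit_one (f : Module.Dual k C) : hit k H C 1 f = f := by
  ext x
  rw [hit_apply, act_one]

theorem hit_mul (h h' : H) (f : Module.Dual k C) :
    hit k H C (h * h') f = hit k H C h (hit k H C h' f) := by
  ext x
  rw [hit_apply, hit_apply, hit_apply, act_mul]

theorem hit_counit (h : H) : hit k H C h counit = counit (R := k) h • counit := by
  ext x
  rw [hit_apply, counit_act, LinearMap.smul_apply, smul_eq_mul, mul_comm]

theorem hit_dualMul (h : H) (f g : Module.Dual k C) :
    hit k H C h (dualMul k C f g) =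
      TensorProduct.lift ((dualMul k C).compl₁₂ ((hit k H C).flip f) ((hit k H C).flip g))
        (comul (R := k) h) := by
  have key : ∀ (s : H ⊗[k] H) (x : C),
      TensorProduct.lift ((dualMul k C).compl₁₂ ((hit k H C).flip f) ((hit k H C).flip g)) s x =
        dualDistrib k C C (f ⊗ₜ g)
          (TensorProduct.map₂ (act (k := k)) (act (k := k)) (comul (R := k) x) s) := by
    intro s x
    induction s with
    | zero => simp
    | add s t hs ht => simp only [map_add, LinearMap.add_apply, hs, ht]
    | tmul a b =>
      simp only [TensorProduct.lift.tmul, LinearMap.compl₁₂_apply, LinearMap.flip_apply]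
      rw [dualMul, transposeMul_apply]
      generalize comul (R := k) x = t
      induction t with
      | zero => simp
      | add s t hs ht => simp only [map_add, LinearMap.add_apply, hs, ht]
      | tmul x y => simp [hit_apply]
  ext x
  rw [hit_apply, key, ← comul_act]
  rfl

theorem smashLeft_tmul (f g : Module.Dual k C) (b : B) :
    smashLeft k B C f (g ⊗ₜ b) = dualMul k C f g ⊗ₜ b := rfl

theorem smashLeft_mul (f g : Module.Dual k C) :
    smashLeft k B C (dualMul k C f g) = smashLeft k B C f * smashLeft k B C g := by
  apply TensorProduct.ext'
  intro e b
  rw [Module.End.mul_apply, smashLeft_tmul, smashLeft_tmul, smashLeft_tmul, dualMul_assoc]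

theorem smashLeft_counit : smashLeft k B C counit = 1 := by
  apply TensorProduct.ext'
  intro e b
  rw [smashLeft_tmul, counit_dualMul, Module.End.one_apply]

theorem smashRight_one : smashRight k H B C 1 = 1 := by
  apply TensorProduct.ext'
  intro e b
  rw [smashRight, LinearMap.comp_apply, coact_one, Algebra.TensorProduct.one_def,
    TensorProduct.map₂_apply_tmul, TensorProduct.map_tmul, hit_one, LinearMap.mul_apply', one_mul,
    Module.End.one_apply]

theorem smashRight_mul (b c : B) :
    smashRight k H B C (b * c) = smashRight k H B C b * smashRight k H B C c := by
  have key : ∀ s t : H ⊗[k] B, TensorProduct.map₂ (hit k H C) (LinearMap.mul k B) (s * t) =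
      (TensorProduct.map₂ (hit k H C) (LinearMap.mul k B) s : Module.End k _) *
        TensorProduct.map₂ (hit k H C) (LinearMap.mul k B) t := by
    intro s t
    induction s with
    | zero => simp
    | add s s' hs hs' => simp only [map_add, add_mul, hs, hs']
    | tmul h b =>
      induction t with
      | zero => simp
      | add t t' ht ht' => simp only [map_add, mul_add, ht, ht']
      | tmul h' b' =>
        apply TensorProduct.ext'
        intro e c
        simp [hit_mul, mul_assoc]
  rw [smashRight, LinearMap.comp_apply, coact_mul, key]
  rfl

theorem smashMul_tmul (f : Module.Dual k C) (b : B) :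
    smashMul k H B C (f ⊗ₜ b) = smashLeft k B C f * smashRight k H B C b := rfl

theorem smashRight_mul_smashLeft (b : B) (g : Module.Dual k C) :
    smashRight k H B C b * smashLeft k B C g =
      smashMul k H B C (((hit k H C).flip g).rTensor B (coact (k := k) b)) := by
  apply TensorProduct.ext'
  intro e c
  let F : H ⊗[k] (H ⊗[k] B) →ₗ[k] Module.Dual k C ⊗[k] B :=
    TensorProduct.lift ((smashLeft k B C ∘ₗ (hit k H C).flip g).compl₂
      ((TensorProduct.map₂ (hit k H C) (LinearMap.mul k B)).flip (e ⊗ₜ[k] c)))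
  have hF : ∀ (h : H) (t : H ⊗[k] B), F (h ⊗ₜ t) = smashLeft k B C (hit k H C h g)
      (TensorProduct.map₂ (hit k H C) (LinearMap.mul k B) t (e ⊗ₜ c)) := fun _ _ => rfl
  have h1 : ∀ t : H ⊗[k] B, TensorProduct.map₂ (hit k H C) (LinearMap.mul k B) t
      (dualMul k C g e ⊗ₜ c) =
      F (TensorProduct.assoc k H H B ((comul (R := k) (A := H)).rTensor B t)) := by
    intro t
    induction t with
    | zero => simp
    | add s t hs ht => simp only [map_add, LinearMap.add_apply, hs, ht]
    | tmul h b =>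
      have : ∀ s : H ⊗[k] H, F (TensorProduct.assoc k H H B (s ⊗ₜ b)) =
          TensorProduct.lift ((dualMul k C).compl₁₂ ((hit k H C).flip g) ((hit k H C).flip e)) s
            ⊗ₜ (b * c) := by
        intro s
        induction s with
        | zero => simp
        | add s t hs ht => simp only [map_add, add_tmul, hs, ht]
        | tmul h h' =>
          rw [TensorProduct.assoc_tmul, hF]
          simp [smashLeft_tmul]
      rw [LinearMap.rTensor_tmul, this, ← hit_dualMul]
      simp
  have h2 : ∀ t : H ⊗[k] B, smashMul k H B C (((hit k H C).flip g).rTensor B t) (e ⊗ₜ c) =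
      F ((coact (k := k) (H := H) (B := B)).lTensor H t) := by
    intro t
    induction t with
    | zero => simp
    | add s t hs ht => simp only [map_add, LinearMap.add_apply, hs, ht]
    | tmul h b => rfl
  rw [h2, ← LeftComoduleAlgebra.coassoc, ← h1]
  rfl

theorem smashMul_smashLeft (f : Module.Dual k C) (z : Module.Dual k C ⊗[k] B) :
    smashMul k H B C (smashLeft k B C f z) = smashLeft k B C f * smashMul k H B C z := by
  induction z with
  | zero => simp
  | add s t hs ht => simp only [map_add, mul_add, hs, ht]
  | tmul g b => rw [smashLeft_tmul, smashMul_tmul, smashMul_tmul, smashLeft_mul, mul_assoc]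

theorem smashMul_smashRight (b : B) (z : Module.Dual k C ⊗[k] B) :
    smashMul k H B C (smashRight k H B C b z) = smashRight k H B C b * smashMul k H B C z := by
  induction z with
  | zero => simp
  | add s t hs ht => simp only [map_add, mul_add, hs, ht]
  | tmul g c =>
    rw [smashMul_tmul, ← mul_assoc, smashRight_mul_smashLeft, smashRight, LinearMap.comp_apply]
    generalize coact (k := k) (H := H) b = t
    induction t with
    | zero => simp
    | add s t hs ht => simp only [map_add, LinearMap.add_apply, add_mul, hs, ht]
    | tmul h b' =>
      rw [TensorProduct.map₂_apply_tmul, TensorProduct.map_tmul, smashMul_tmul,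
        LinearMap.mul_apply', smashRight_mul, LinearMap.rTensor_tmul, smashMul_tmul, mul_assoc]
      rfl

theorem smashMul_smashMul (x y : Module.Dual k C ⊗[k] B) :
    smashMul k H B C (smashMul k H B C x y) = smashMul k H B C x * smashMul k H B C y := by
  induction x with
  | zero => simp
  | add s t hs ht => simp only [map_add, LinearMap.add_apply, add_mul, hs, ht]
  | tmul f b =>
    rw [smashMul_tmul, Module.End.mul_apply, smashMul_smashLeft, smashMul_smashRight, mul_assoc]

theorem smashMul_one (x : Module.Dual k C ⊗[k] B) :
    smashMul k H B C x (counit ⊗ₜ 1) = x := by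
  induction x with
  | zero => simp
  | add s t hs ht => simp only [map_add, LinearMap.add_apply, hs, ht]
  | tmul f b =>
    have : ∀ t : H ⊗[k] B, TensorProduct.map₂ (hit k H C) (LinearMap.mul k B) t (counit ⊗ₜ 1) =
        counit ⊗ₜ (TensorProduct.lid k B ((counit (R := k) (A := H)).rTensor B t)) := by
      intro t
      induction t with
      | zero => simp
      | add s t hs ht => simp only [map_add, LinearMap.add_apply, tmul_add, hs, ht]
      | tmul h b => simp [hit_counit, smul_tmul]
    rw [smashMul_tmul, Module.End.mul_apply, smashRight, LinearMap.comp_apply, this, counit_coact,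
      smashLeft_tmul, dualMul_counit]

theorem one_smashMul (x : Module.Dual k C ⊗[k] B) :
    smashMul k H B C (counit ⊗ₜ 1) x = x := by
  rw [smashMul_tmul, smashLeft_counit, smashRight_one, one_mul, Module.End.one_apply]

variable (k H B C) in
/-- The algebra `C* # B`, with unit `ε # 1` and
product `(f # b)(g # c) = ∑ f (b₍₁₎ ⇀ g) # b₍₂₎ c`. -/
instance : Ring (Smash k H B C) where
  __ := (inferInstance : AddCommGroup (Smash k H B C))
  mul x y := smashMul k H B C x y
  one := smk k H B C counit 1
  mul_assoc x y z := LinearMap.congr_fun (smashMul_smashMul x y) z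
  one_mul := one_smashMul
  mul_one := smashMul_one
  left_distrib x y z := map_add (smashMul k H B C x) y z
  right_distrib x y z := LinearMap.congr_fun (map_add (smashMul k H B C) x y) z
  zero_mul x := LinearMap.congr_fun (map_zero (smashMul k H B C)) x
  mul_zero x := map_zero (smashMul k H B C x)

instance : Algebra k (Smash k H B C) :=
  Algebra.ofModule
    (fun r x y => LinearMap.congr_fun (map_smul (smashMul k H B C) r x) y)
    (fun r x y => map_smul (smashMul k H B C x) r y)

end Smash

/-! ### The biopposite of the dual -/

/-- The dual space `V*`, carrying the opposite multiplication `(f g)(v) = ∑ f(v₍₂₎) g(v₍₁₎)` when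
`V` is a coalgebra, and the coopposite comultiplication `f ↦ ∑ f₁ ⊗ f₂`, where
`∑ f₁(a) f₂(b) = f(b a)`, when `V` is a finite-dimensional algebra. -/
def BiopDual (k V : Type*) [Field k] [AddCommGroup V] [Module k V] : Type _ := Module.Dual k V

section BiopDual

variable {k V : Type*} [Field k]

instance [AddCommGroup V] [Module k V] : AddCommGroup (BiopDual k V) :=
  inferInstanceAs (AddCommGroup (Module.Dual k V))
instance [AddCommGroup V] [Module k V] : Module k (BiopDual k V) :=
  inferInstanceAs (Module k (Module.Dual k V))
instance [AddCommGroup V] [Module k V] [FiniteDimensional k V] :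
    FiniteDimensional k (BiopDual k V) :=
  inferInstanceAs (FiniteDimensional k (Module.Dual k V))

section Alg

variable [AddCommGroup V] [Module k V] [Coalgebra k V]

instance : Ring (BiopDual k V) where
  __ := (inferInstance : AddCommGroup (BiopDual k V))
  mul f g := dualMul k V g f
  one := (counit (R := k) (A := V) : Module.Dual k V)
  mul_assoc f g e := (dualMul_assoc (k := k) (C := V) e g f).symm
  one_mul f := dualMul_counit (k := k) (C := V) f
  mul_one f := counit_dualMul (k := k) (C := V) f
  left_distrib f g e := LinearMap.congr_fun (map_add (dualMul k V) g e) f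
  right_distrib f g e := map_add (dualMul k V e) f g
  zero_mul f := map_zero (dualMul k V f)
  mul_zero f := LinearMap.congr_fun (map_zero (dualMul k V)) f

instance : Algebra k (BiopDual k V) :=
  Algebra.ofModule
    (fun r x y => map_smul (dualMul k V y) r x)
    (fun r x y => LinearMap.congr_fun (map_smul (dualMul k V) r y) x)

end Alg

section Coalg

variable [Ring V] [Algebra k V] [FiniteDimensional k V]

theorem lid_eval_transposeComul (f : Module.Dual k V) :
    (Module.Dual.eval k V 1).rTensor _ (transposeComul (LinearMap.mul k V).flip f) = 1 ⊗ₜ f := by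
  have : ∀ t : Module.Dual k V ⊗[k] Module.Dual k V, (Module.Dual.eval k V 1).rTensor _ t =
      1 ⊗ₜ dualTensorHom k V _ t 1 := by
    intro t
    induction t with
    | zero => simp
    | add s t hs ht => simp only [map_add, LinearMap.add_apply, hs, ht, tmul_add]
    | tmul f g => simp [tmul_smul, smul_tmul']
  rw [this, dualTensorHom_transposeComul]
  congr 1
  ext v
  simp

theorem rid_eval_transposeComul (f : Module.Dual k V) :
    (Module.Dual.eval k V 1).lTensor _ (transposeComul (LinearMap.mul k V).flip f) = f ⊗ₜ 1 := by
  have : ∀ t : Module.Dual k V ⊗[k] Module.Dual k V, (Module.Dual.eval k V 1).lTensor _ t =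
      ((Module.Dual.eval k V 1) ∘ₗ dualTensorHom k V _ t) ⊗ₜ 1 := by
    intro t
    induction t with
    | zero => simp
    | add s t hs ht => simp only [map_add, LinearMap.comp_add, hs, ht, add_tmul]
    | tmul f g =>
      have : (Module.Dual.eval k V 1) ∘ₗ dualTensorHom k V _ (f ⊗ₜ g) = g 1 • f := by
        ext v; simp [mul_comm]
      rw [this, LinearMap.lTensor_tmul, Module.Dual.eval_apply, smul_tmul]
      simp
  rw [this]
  congr 1
  ext v
  simp [dualTensorHom_transposeComul]

instance : Coalgebra k (BiopDual k V) where
  comul := transposeComul (LinearMap.mul k V).flip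
  counit := Module.Dual.eval k V 1
  coassoc := LinearMap.ext fun f =>
    transposeComul_assoc (LinearMap.mul k V).flip (LinearMap.mul k V).flip
      (LinearMap.mul k V).flip (LinearMap.mul k V).flip (fun a b c => (mul_assoc c b a).symm) f
  rTensor_counit_comp_comul := LinearMap.ext fun f => lid_eval_transposeComul f
  lTensor_counit_comp_comul := LinearMap.ext fun f => rid_eval_transposeComul f

end Coalg

/-- An element of `V*`, regarded as an element of `V* ^ biop`. -/
def toBiopDual (k V : Type*) [Field k] [AddCommGroup V] [Module k V] :
    Module.Dual k V ≃ₗ[k] BiopDual k V := LinearEquiv.refl k _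

/-- The canonical map `V → V** = (V* ^ biop)*`. For finite-dimensional `V` it identifies `V` with
the dual space of `V* ^ biop`. -/
def bidual (k V : Type*) [Field k] [AddCommGroup V] [Module k V] :
    V →ₗ[k] Module.Dual k (BiopDual k V) := Module.Dual.eval k V

/-- The transpose of a linear map. -/
def BiopDual.map {W : Type*} [AddCommGroup V] [Module k V] [AddCommGroup W] [Module k W]
    (f : V →ₗ[k] W) : BiopDual k W →ₗ[k] BiopDual k V := f.dualMap


section Pair

variable {W : Type*} [AddCommGroup V] [Module k V] [AddCommGroup W] [Module k W]

/-- The pairing of `V* ⊗ W*` with `V ⊗ W`. -/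
def bpair : BiopDual k V ⊗[k] BiopDual k W →ₗ[k] Module.Dual k (V ⊗[k] W) :=
  TensorProduct.dualDistrib k V W

theorem bpair_ext [FiniteDimensional k V] {s t : BiopDual k V ⊗[k] BiopDual k W}
    (h : ∀ v w, bpair s (v ⊗ₜ w) = bpair t (v ⊗ₜ w)) : s = t :=
  dualDistrib_ext h

/-- Evaluation of elements of `V*`. -/
def BiopDual.ev : BiopDual k V →ₗ[k] Module.Dual k V := LinearMap.id

theorem biopDual_ext {f g : BiopDual k V} (h : ∀ v, f.ev v = g.ev v) : f = g :=
  LinearMap.ext (f := (f : Module.Dual k V)) h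

theorem bpair_tmul (f : BiopDual k V) (g : BiopDual k W) (v : V) (w : W) :
    bpair (f ⊗ₜ g) (v ⊗ₜ w) = f.ev v * g.ev w := rfl

theorem biopDual_mul_ev [Coalgebra k V] (f g : BiopDual k V) (v : V) :
    (f * g).ev v = bpair (g ⊗ₜ f) (comul (R := k) v) := rfl

theorem biopDual_one_ev [Coalgebra k V] (v : V) :
    (1 : BiopDual k V).ev v = counit (R := k) v := rfl

theorem bpair_mul_aux (f g : BiopDual k V) (f' g' : BiopDual k W) (u : V ⊗[k] V) (v : W ⊗[k] W) :
    bpair (g ⊗ₜ f) u * bpair (g' ⊗ₜ f') v =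
      dualDistrib k _ _ (bpair (g ⊗ₜ g') ⊗ₜ bpair (f ⊗ₜ f'))
        (TensorProduct.tensorTensorTensorComm k V V W W (u ⊗ₜ v)) := by
  induction u with
  | zero => simp
  | add u u' h h' => simp only [map_add, add_tmul, add_mul, h, h']
  | tmul u u' =>
    induction v with
    | zero => simp
    | add v v' h h' => simp only [map_add, tmul_add, mul_add, h, h']
    | tmul v v' =>
      rw [TensorProduct.tensorTensorTensorComm_tmul, TensorProduct.dualDistrib_apply]
      simp only [bpair_tmul]
      ring

theorem bpair_mul [Coalgebra k V] [Coalgebra k W] (s t : BiopDual k V ⊗[k] BiopDual k W)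
    (a : V) (b : W) : bpair (s * t) (a ⊗ₜ b) =
      dualDistrib k _ _ (bpair t ⊗ₜ bpair s) (TensorProduct.tensorTensorTensorComm k V V W W
          (comul (R := k) a ⊗ₜ comul (R := k) b)) := by
  induction s with
  | zero => simp
  | add s s' hs hs' => simp only [add_mul, map_add, LinearMap.add_apply, tmul_add, hs, hs']
  | tmul f f' =>
    induction t with
    | zero => simp
    | add s s' hs hs' => simp only [mul_add, map_add, LinearMap.add_apply, add_tmul, hs, hs']
    | tmul g g' =>
      rw [Algebra.TensorProduct.tmul_mul_tmul, bpair_tmul, biopDual_mul_ev, biopDual_mul_ev,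
        bpair_mul_aux]

end Pair

section Hopf

variable {H : Type*} [Ring H]

theorem bpair_comul [Algebra k H] [FiniteDimensional k H] (f : BiopDual k H) (x : H ⊗[k] H) :
    bpair (comul (R := k) f) x = f.ev (LinearMap.mul' k H (TensorProduct.comm k H H x)) := by
  induction x with
  | zero => simp
  | add x y hx hy => simp only [map_add, hx, hy]
  | tmul a b =>
    exact (dualDistrib_transposeComul _ (f : Module.Dual k H) a b)

theorem bpair_comul_tmul [Algebra k H] [FiniteDimensional k H] (f : BiopDual k H) (a b : H) :
    bpair (comul (R := k) f) (a ⊗ₜ b) = f.ev (b * a) := by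
  rw [bpair_comul]; simp

theorem biopDual_counit [Algebra k H] [FiniteDimensional k H] (f : BiopDual k H) :
    counit (R := k) f = f.ev 1 := rfl

/-- The Hopf algebra (here: its bialgebra part) dual to `H`, with opposite multiplication and
coopposite comultiplication. -/
instance [Bialgebra k H] [FiniteDimensional k H] : Bialgebra k (BiopDual k H) :=
  Bialgebra.mk' k (BiopDual k H)
    (by rw [biopDual_counit, biopDual_one_ev, Bialgebra.counit_one])
    (by
      intro f g
      rw [biopDual_counit, biopDual_mul_ev, Bialgebra.comul_one, Algebra.TensorProduct.one_def,
        bpair_tmul, mul_comm]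
      rfl)
    (by
      apply bpair_ext
      intro a b
      rw [bpair_comul_tmul, biopDual_one_ev, Bialgebra.counit_mul, Algebra.TensorProduct.one_def,
        bpair_tmul, mul_comm]
      rfl)
    (by
      intro f g
      apply bpair_ext
      intro a b
      rw [bpair_comul_tmul, biopDual_mul_ev, bpair_mul, Bialgebra.comul_mul]
      generalize comul (R := k) a = u
      generalize comul (R := k) b = v
      induction u with
      | zero => simp
      | add u u' h h' => simp only [map_add, add_tmul, mul_add, h, h']
      | tmul u u' =>
        induction v with
        | zero => simp
        | add v v' h h' => simp only [map_add, tmul_add, add_mul, h, h']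
        | tmul v v' =>
          rw [TensorProduct.tensorTensorTensorComm_tmul, TensorProduct.dualDistrib_apply,
            bpair_comul_tmul, bpair_comul_tmul, Algebra.TensorProduct.tmul_mul_tmul, bpair_tmul])

theorem biopDual_algebraMap_ev [Bialgebra k H] (r : k) (h : H) :
    (algebraMap k (BiopDual k H) r).ev h = r * counit (R := k) h := by
  rw [Algebra.algebraMap_eq_smul_one, map_smul, LinearMap.smul_apply, biopDual_one_ev, smul_eq_mul]

/-- The Hopf algebra `H* ^ biop`. -/
instance [HopfAlgebra k H] [FiniteDimensional k H] : HopfAlgebra k (BiopDual k H) where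
  antipode := BiopDual.map (HopfAlgebra.antipode k)
  mul_antipode_rTensor_comul := by
    have key : ∀ (t : BiopDual k H ⊗[k] BiopDual k H) (h : H),
        (LinearMap.mul' k (BiopDual k H)
          ((BiopDual.map (HopfAlgebra.antipode k)).rTensor _ t)).ev h =
        bpair t (TensorProduct.comm k H H
          ((HopfAlgebra.antipode k).lTensor H (comul (R := k) h))) := by
      intro t h
      induction t with
      | zero => simp
      | add s t hs ht => simp only [map_add, LinearMap.add_apply, hs, ht]
      | tmul f g =>
        rw [LinearMap.rTensor_tmul, LinearMap.mul'_apply, biopDual_mul_ev]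
        generalize comul (R := k) h = u
        induction u with
        | zero => simp
        | add u u' h h' => simp only [map_add, h, h']
        | tmul u u' =>
          rw [LinearMap.lTensor_tmul, TensorProduct.comm_tmul, bpair_tmul, bpair_tmul, mul_comm]
          rfl
    ext f
    apply biopDual_ext
    intro h
    rw [LinearMap.comp_apply, LinearMap.comp_apply, key, bpair_comul, LinearMap.comp_apply,
      Algebra.linearMap_apply, biopDual_algebraMap_ev, biopDual_counit]
    simp [Algebra.algebraMap_eq_smul_one, mul_comm]
  mul_antipode_lTensor_comul := by
    have key : ∀ (t : BiopDual k H ⊗[k] BiopDual k H) (h : H),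
        (LinearMap.mul' k (BiopDual k H)
          ((BiopDual.map (HopfAlgebra.antipode k)).lTensor _ t)).ev h =
        bpair t (TensorProduct.comm k H H
          ((HopfAlgebra.antipode k).rTensor H (comul (R := k) h))) := by
      intro t h
      induction t with
      | zero => simp
      | add s t hs ht => simp only [map_add, LinearMap.add_apply, hs, ht]
      | tmul f g =>
        rw [LinearMap.lTensor_tmul, LinearMap.mul'_apply, biopDual_mul_ev]
        generalize comul (R := k) h = u
        induction u with
        | zero => simp
        | add u u' h h' => simp only [map_add, h, h']
        | tmul u u' =>
          rw [LinearMap.rTensor_tmul, TensorProduct.comm_tmul, bpair_tmul, bpair_tmul, mul_comm]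
          rfl
    ext f
    apply biopDual_ext
    intro h
    rw [LinearMap.comp_apply, LinearMap.comp_apply, key, bpair_comul, LinearMap.comp_apply,
      Algebra.linearMap_apply, biopDual_algebraMap_ev, biopDual_counit]
    simp [Algebra.algebraMap_eq_smul_one, mul_comm]

variable [Bialgebra k H] [FiniteDimensional k H]

section

variable {C : Type*} [AddCommGroup C] [Module k C] [Coalgebra k C] [RightModuleCoalgebra k H C]

/-- The coaction of `H* ^ biop` on `C* ^ biop`: `f ↦ ∑ f₁ ⊗ f₂` with
`∑ f₁(h) f₂(x) = f(x ◁ h)`. -/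
def biopCoact : BiopDual k C →ₗ[k] BiopDual k H ⊗[k] BiopDual k C :=
  transposeComul (act (k := k) (H := H) (C := C)).flip

theorem bpair_biopCoact (f : BiopDual k C) (h : H) (x : C) :
    bpair (biopCoact (H := H) f) (h ⊗ₜ x) = f.ev (act (k := k) x h) :=
  dualDistrib_transposeComul (act (k := k) (H := H) (C := C)).flip (f : Module.Dual k C) h x

instance : LeftComoduleAlgebra k (BiopDual k H) (BiopDual k C) where
  coact := biopCoact
  coassoc f :=
    transposeComul_assoc (LinearMap.mul k H).flip (act (k := k) (H := H) (C := C)).flip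
      (act (k := k) (H := H) (C := C)).flip (act (k := k) (H := H) (C := C)).flip
      (fun a b c => act_mul c b a) f
  counit_coact f := by
    have : ∀ t : BiopDual k H ⊗[k] BiopDual k C,
        ∀ x, (TensorProduct.lid k _ ((counit (R := k)).rTensor _ t)).ev x =
          bpair t (1 ⊗ₜ x) := by
      intro t x
      induction t with
      | zero => simp
      | add s t hs ht => simp only [map_add, LinearMap.add_apply, hs, ht]
      | tmul f g =>
        rw [LinearMap.rTensor_tmul, TensorProduct.lid_tmul, map_smul, bpair_tmul]
        rfl
    apply biopDual_ext
    intro x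
    rw [this, bpair_biopCoact, act_one]
  coact_one := by
    apply bpair_ext
    intro h x
    rw [bpair_biopCoact, biopDual_one_ev, counit_act, Algebra.TensorProduct.one_def, bpair_tmul,
      mul_comm]
    rfl
  coact_mul f g := by
    apply bpair_ext
    intro h x
    rw [bpair_biopCoact, biopDual_mul_ev, comul_act, bpair_mul]
    generalize comul (R := k) h = u
    generalize comul (R := k) x = v
    induction u with
    | zero => simp
    | add u u' h h' => simp only [map_add, add_tmul, h, h']
    | tmul u u' =>
      induction v with
      | zero => simp
      | add v v' h h' => simp only [map_add, LinearMap.add_apply, tmul_add, h, h']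
      | tmul v v' =>
        rw [TensorProduct.tensorTensorTensorComm_tmul, TensorProduct.dualDistrib_apply,
          bpair_biopCoact, bpair_biopCoact, TensorProduct.map₂_apply_tmul, TensorProduct.map_tmul,
          bpair_tmul]

end

section

variable {B : Type*} [Ring B] [Algebra k B] [FiniteDimensional k B] [LeftComoduleAlgebra k H B]

/-- The action of `H* ^ biop` on `B* ^ biop`: `(b* ◁ h*)(b) = ∑ h*(b₍₁₎) b*(b₍₂₎)`. -/
def biopAct : BiopDual k B →ₗ[k] BiopDual k H →ₗ[k] BiopDual k B :=
  (transposeMul (coact (k := k) (H := H) (B := B))).flip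

theorem biopAct_ev (f : BiopDual k B) (h : BiopDual k H) (b : B) :
    (biopAct f h).ev b = bpair (h ⊗ₜ f) (coact (k := k) b) := rfl

instance : RightModuleCoalgebra k (BiopDual k H) (BiopDual k B) where
  act := biopAct
  act_one f := by
    have : ∀ t : H ⊗[k] B, bpair ((1 : BiopDual k H) ⊗ₜ f) t =
        f.ev (TensorProduct.lid k B ((counit (R := k) (A := H)).rTensor B t)) := by
      intro t
      induction t with
      | zero => simp
      | add s t hs ht => simp only [map_add, hs, ht]
      | tmul h b =>
        rw [LinearMap.rTensor_tmul, TensorProduct.lid_tmul, map_smul, bpair_tmul]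
        rfl
    apply biopDual_ext
    intro b
    rw [biopAct_ev, this, counit_coact]
  act_mul f h h' :=
    transposeMul_assoc (coact (k := k) (H := H) (B := B)) (comul (R := k) (A := H))
      (coact (k := k) (H := H) (B := B)) (coact (k := k) (H := H) (B := B))
      LeftComoduleAlgebra.coassoc h' h f
  comul_act f h := by
    have key : ∀ (s : BiopDual k B ⊗[k] BiopDual k B) (t : BiopDual k H ⊗[k] BiopDual k H)
        (c d : B), bpair (TensorProduct.map₂ biopAct biopAct s t) (c ⊗ₜ d) =
          dualDistrib k _ _ (bpair t ⊗ₜ bpair s) (TensorProduct.tensorTensorTensorComm k H B H B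
            (coact (k := k) c ⊗ₜ coact (k := k) d)) := by
      intro s t c d
      induction s with
      | zero => simp
      | add s s' hs hs' => simp only [map_add, LinearMap.add_apply, tmul_add, hs, hs']
      | tmul f f' =>
        induction t with
        | zero => simp
        | add s s' hs hs' => simp only [map_add, LinearMap.add_apply, add_tmul, hs, hs']
        | tmul g g' =>
          rw [TensorProduct.map₂_apply_tmul, TensorProduct.map_tmul, bpair_tmul, biopAct_ev,
            biopAct_ev]
          generalize coact (k := k) (H := H) c = u
          generalize coact (k := k) (H := H) d = v
          induction u with
          | zero => simp
          | add u u' h h' => simp only [map_add, add_tmul, add_mul, h, h']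
          | tmul u u' =>
            induction v with
            | zero => simp
            | add v v' h h' => simp only [map_add, tmul_add, mul_add, h, h']
            | tmul v v' =>
              rw [TensorProduct.tensorTensorTensorComm_tmul, TensorProduct.dualDistrib_apply]
              simp only [bpair_tmul]
              ring
    apply bpair_ext
    intro c d
    rw [bpair_comul_tmul, biopAct_ev, key, coact_mul]
    generalize coact (k := k) (H := H) c = u
    generalize coact (k := k) (H := H) d = v
    induction u with
    | zero => simp
    | add u u' h h' => simp only [map_add, add_tmul, mul_add, h, h']
    | tmul u u' =>
      induction v with
      | zero => simp
      | add v v' h h' => simp only [map_add, tmul_add, add_mul, h, h']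
      | tmul v v' =>
        rw [TensorProduct.tensorTensorTensorComm_tmul, TensorProduct.dualDistrib_apply,
          bpair_comul_tmul, bpair_comul_tmul, Algebra.TensorProduct.tmul_mul_tmul, bpair_tmul]
  counit_act f h := by
    rw [biopDual_counit, biopAct_ev, coact_one, Algebra.TensorProduct.one_def, bpair_tmul, mul_comm]
    rfl

end

end Hopf
end BiopDual

/-! ### Quasi-bialgebras and antipodes -/

/-- The structure maps of a quasi-bialgebra on an algebra `A`:
comultiplication, counit and associator. The axioms are `IsQuasiBialgebra`. -/
structure QuasiBialgebraData (k A : Type*) [Field k] [Ring A] [Algebra k A] where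
  comul : A →ₗ[k] A ⊗[k] A
  counit : A →ₗ[k] k
  associator : A ⊗[k] (A ⊗[k] A)

namespace QuasiBialgebraData

variable {k A A' : Type*} [Field k] [Ring A] [Algebra k A] [Ring A'] [Algebra k A']

/-- The axioms of a quasi-bialgebra `(A, Δ, ε, φ)`:
`Δ` and `ε` are algebra maps, `φ` is invertible, `(id ⊗ Δ)Δ(a) φ = φ (Δ ⊗ id)Δ(a)`,
`(id ⊗ id ⊗ Δ)(φ) (Δ ⊗ id ⊗ id)(φ) = (1 ⊗ φ) (id ⊗ Δ ⊗ id)(φ) (φ ⊗ 1)`,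
`(ε ⊗ id)Δ = id = (id ⊗ ε)Δ`, and `(id ⊗ ε ⊗ id)(φ) = 1 ⊗ 1`. -/
structure IsQuasiBialgebra (Q : QuasiBialgebraData k A) : Prop where
  comul_one : Q.comul 1 = 1
  comul_mul (a b : A) : Q.comul (a * b) = Q.comul a * Q.comul b
  counit_one : Q.counit 1 = 1
  counit_mul (a b : A) : Q.counit (a * b) = Q.counit a * Q.counit b
  isUnit_associator : IsUnit Q.associator
  quasi_coassoc (a : A) :
    Q.comul.lTensor A (Q.comul a) * Q.associator =
      Q.associator * TensorProduct.assoc k A A A (Q.comul.rTensor A (Q.comul a))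
  pentagon :
    (Q.comul.lTensor A).lTensor A Q.associator *
        TensorProduct.assoc k A A (A ⊗[k] A) (Q.comul.rTensor (A ⊗[k] A) Q.associator) =
      (1 ⊗ₜ[k] Q.associator) *
        ((TensorProduct.assoc k A A A).toLinearMap ∘ₗ Q.comul.rTensor A).lTensor A Q.associator *
        (((TensorProduct.mk k A A).flip 1).lTensor A).lTensor A Q.associator
  counit_comul (a : A) : TensorProduct.lid k A (Q.counit.rTensor A (Q.comul a)) = a
  comul_counit (a : A) : TensorProduct.rid k A (Q.counit.lTensor A (Q.comul a)) = a
  counit_associator :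
    ((TensorProduct.lid k A).toLinearMap ∘ₗ Q.counit.rTensor A).lTensor A Q.associator = 1

/-- `(S, α, β)` is an antipode of the quasi-bialgebra `(A, Δ, ε, φ)`: `S` is a unital algebra
anti-endomorphism such that, writing `φ = ∑ φ¹ ⊗ φ² ⊗ φ³` and `φ⁻¹ = ∑ ψ¹ ⊗ ψ² ⊗ ψ³`,
`∑ S(a₁) α a₂ = ε(a) α`, `∑ a₁ β S(a₂) = ε(a) β`, `∑ φ¹ β S(φ²) α φ³ = 1`,
`∑ S(ψ¹) α ψ² β S(ψ³) = 1`. -/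
structure IsAntipode (Q : QuasiBialgebraData k A) (S : A →ₗ[k] A) (α β : A) : Prop where
  map_one : S 1 = 1
  map_mul (a b : A) : S (a * b) = S b * S a
  left (a : A) :
    LinearMap.mul' k A (TensorProduct.map (LinearMap.mulRight k α ∘ₗ S) LinearMap.id (Q.comul a)) =
      Q.counit a • α
  right (a : A) :
    LinearMap.mul' k A (TensorProduct.map (LinearMap.mulRight k β) S (Q.comul a)) = Q.counit a • β
  associator :
    LinearMap.mul' k A ((LinearMap.mul' k A).lTensor A
      (TensorProduct.map (LinearMap.mulRight k β)
        (TensorProduct.map (LinearMap.mulRight k α ∘ₗ S) LinearMap.id) Q.associator)) = 1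
  associator_inv :
    LinearMap.mul' k A ((LinearMap.mul' k A).lTensor A
      (TensorProduct.map (LinearMap.mulRight k α ∘ₗ S)
        (TensorProduct.map (LinearMap.mulRight k β) S) (Ring.inverse Q.associator))) = 1

/-- `x ⊗ y ⊗ z ↦ z ⊗ y ⊗ x`. -/
def reverse₃ (k A : Type*) [Field k] [Ring A] [Algebra k A] :
    A ⊗[k] (A ⊗[k] A) →ₗ[k] A ⊗[k] (A ⊗[k] A) :=
  (TensorProduct.assoc k A A A).toLinearMap ∘ₗ
    (TensorProduct.comm k A (A ⊗[k] A)).toLinearMap ∘ₗ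
      (TensorProduct.comm k A A).toLinearMap.lTensor A

/-- The biopposite quasi-bialgebra: opposite multiplication, coopposite comultiplication, same
counit, and associator `φ³ ⊗ φ² ⊗ φ¹`. -/
def biop (Q : QuasiBialgebraData k A) : QuasiBialgebraData k Aᵐᵒᵖ where
  comul :=
    let op := (MulOpposite.opLinearEquiv k (M := A)).toLinearMap
    TensorProduct.map op op ∘ₗ (TensorProduct.comm k A A).toLinearMap ∘ₗ Q.comul ∘ₗ
      (MulOpposite.opLinearEquiv k (M := A)).symm.toLinearMap
  counit := Q.counit ∘ₗ (MulOpposite.opLinearEquiv k (M := A)).symm.toLinearMap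
  associator :=
    let op := (MulOpposite.opLinearEquiv k (M := A)).toLinearMap
    TensorProduct.map op (TensorProduct.map op op) (reverse₃ k A Q.associator)

/-- An algebra isomorphism is an isomorphism of quasi-bialgebras if it preserves the
comultiplications, the counits and the associators. -/
structure IsIso (Q : QuasiBialgebraData k A) (Q' : QuasiBialgebraData k A') (e : A ≃ₐ[k] A') :
    Prop where
  comul (a : A) :
    Q'.comul (e a) = TensorProduct.map e.toLinearMap e.toLinearMap (Q.comul a)
  counit (a : A) : Q'.counit (e a) = Q.counit a
  associator : Q'.associator =
    TensorProduct.map e.toLinearMap (TensorProduct.map e.toLinearMap e.toLinearMap) Q.associator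

end QuasiBialgebraData

/-! ### Partially admissible mapping systems and left partial duals -/

/-- The linear maps occurring in a partially admissible mapping system
`B ⇄ H ⇄ C`, given by `ι : B → H`, `ζ : H → B`, `π : H → C`, `γ : C → H`,
together with the convolution inverses of `ζ` and `γ`. The conditions are `IsPAMS`. -/
structure MappingSystem (k H B C : Type*) [Field k] [Ring H] [HopfAlgebra k H] [Ring B]
    [Algebra k B] [LeftComoduleAlgebra k H B] [AddCommGroup C] [Module k C] [Coalgebra k C]
    [RightModuleCoalgebra k H C] where
  ι : B →ₗ[k] H
  π : H →ₗ[k] C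
  ζ : H →ₗ[k] B
  γ : C →ₗ[k] H
  ζbar : H →ₗ[k] B
  γbar : C →ₗ[k] H

namespace MappingSystem

section

variable {k H B C : Type*} [Field k] [Ring H] [HopfAlgebra k H] [Ring B]
    [Algebra k B] [LeftComoduleAlgebra k H B] [AddCommGroup C] [Module k C] [Coalgebra k C]
    [RightModuleCoalgebra k H C]

open WithConv in
/-- `(ζ, γ*)` is a partially admissible mapping system for `ι : B → H` (with quotient
`π : H → C`). -/
structure IsPAMS (D : MappingSystem k H B C) : Prop where
  /-- `ι` is an injection of left `H`-comodule algebras -/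
  ι_injective : Function.Injective D.ι
  ι_one : D.ι 1 = 1
  ι_mul (b c : B) : D.ι (b * c) = D.ι b * D.ι c
  ι_coact (b : B) : comul (R := k) (D.ι b) = D.ι.lTensor H (coact (k := k) b)
  /-- `π` is a surjection of right `H`-module coalgebras -/
  π_surjective : Function.Surjective D.π
  π_act (h h' : H) : D.π (h * h') = act (k := k) (D.π h) h'
  π_counit (h : H) : counit (R := k) (D.π h) = counit (R := k) h
  π_comul (h : H) : comul (R := k) (D.π h) = TensorProduct.map D.π D.π (comul (R := k) h)
  /-- the image of `ι` is the space of coinvariants of the right `C`-comodule `H` -/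
  mem_range_ι_iff (h : H) :
    h ∈ LinearMap.range D.ι ↔ D.π.lTensor H (comul (R := k) h) = h ⊗ₜ[k] D.π 1
  /-- `ζbar` and `γbar` are the convolution inverses of `ζ` and `γ` -/
  ζ_mul_ζbar : toConv D.ζ * toConv D.ζbar = 1
  ζbar_mul_ζ : toConv D.ζbar * toConv D.ζ = 1
  γ_mul_γbar : toConv D.γ * toConv D.γbar = 1
  γbar_mul_γ : toConv D.γbar * toConv D.γ = 1
  /-- `ζ` preserves left `B`-actions -/
  ζ_mul (b : B) (h : H) : D.ζ (D.ι b * h) = b * D.ζ h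
  /-- `γ` preserves right `C`-coactions -/
  γ_coact (x : C) : D.π.lTensor H (comul (R := k) (D.γ x)) = D.γ.rTensor C (comul (R := k) x)
  /-- `ζ` and `γ` preserve the units and counits, where the counit of `B` and the unit of `C` are
  induced by those of `H` -/
  ζ_one : D.ζ 1 = 1
  ζ_counit (h : H) : counit (R := k) (D.ι (D.ζ h)) = counit (R := k) h
  γ_one : D.γ (D.π 1) = 1
  γ_counit (x : C) : counit (R := k) (D.γ x) = counit (R := k) x
  /-- `(ι ∘ ζ) * (γ ∘ π) = id` -/
  conv_eq_id : toConv (D.ι ∘ₗ D.ζ) * toConv (D.γ ∘ₗ D.π) = toConv LinearMap.id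

/-- In a partially admissible mapping system the kernel of `π` is `B⁺H`,
so that `C` is identified with `H/B⁺H`. -/
theorem IsPAMS.ker_π {D : MappingSystem k H B C} (hD : D.IsPAMS) :
    LinearMap.ker D.π =
      Submodule.span k {x | ∃ (b : B) (h : H), counit (R := k) (D.ι b) = 0 ∧ D.ι b * h = x} := by
  set I := Submodule.span k
    {x | ∃ (b : B) (h : H), counit (R := k) (D.ι b) = 0 ∧ D.ι b * h = x}
  apply le_antisymm
  · intro h hh
    have key : ∀ t : H ⊗[k] H,
        LinearMap.mul' k H (TensorProduct.map (D.ι ∘ₗ D.ζ) (D.γ ∘ₗ D.π) t) -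
          D.γ (D.π (TensorProduct.lid k H ((counit (R := k)).rTensor H t))) ∈ I := by
      intro t
      induction t with
      | zero => simp
      | add s t hs ht =>
        simp only [map_add]
        rw [add_sub_add_comm]
        exact I.add_mem hs ht
      | tmul a b =>
        apply Submodule.subset_span
        refine ⟨D.ζ a - counit (R := k) a • 1, D.γ (D.π b), ?_, ?_⟩
        · simp [hD.ζ_counit, hD.ι_one]
        · simp [hD.ι_one, sub_mul]
    have h1 := congrArg (fun f => f.ofConv h) hD.conv_eq_id
    have h2 := key (comul (R := k) h)
    have h3 : LinearMap.mul' k H (TensorProduct.map (D.ι ∘ₗ D.ζ) (D.γ ∘ₗ D.π)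
        (comul (R := k) h)) = h := h1
    rw [h3, rTensor_counit_comul, TensorProduct.lid_tmul, one_smul, LinearMap.mem_ker.1 hh,
      map_zero, sub_zero] at h2
    exact h2
  · refine Submodule.span_le.2 ?_
    rintro x ⟨b, h, hb, rfl⟩
    have h1 := (hD.mem_range_ι_iff (D.ι b)).1 ⟨b, rfl⟩
    have h2 := congrArg (fun t => TensorProduct.lid k C ((counit (R := k)).rTensor C t)) h1
    have h3 : ∀ t : H ⊗[k] H, TensorProduct.lid k C ((counit (R := k)).rTensor C
        (D.π.lTensor H t)) = D.π (TensorProduct.lid k H ((counit (R := k)).rTensor H t)) := by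
      intro t
      induction t with
      | zero => simp
      | add s t hs ht => simp only [map_add, hs, ht]
      | tmul a b => simp
    simp only [h3, rTensor_counit_comul, TensorProduct.lid_tmul, one_smul,
      LinearMap.rTensor_tmul, hb, zero_smul] at h2
    rw [SetLike.mem_coe, LinearMap.mem_ker, hD.π_act, h2, map_zero, LinearMap.zero_apply]

variable [FiniteDimensional k H] [FiniteDimensional k B] [FiniteDimensional k C]

/-- The mapping system `(γ*, ζ)` for `π* : (C*)^biop → (H*)^biop`, with quotient
`ι* : (H*)^biop → (B*)^biop`. -/
def dual (D : MappingSystem k H B C) :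
    MappingSystem k (BiopDual k H) (BiopDual k C) (BiopDual k B) where
  ι := BiopDual.map D.π
  π := BiopDual.map D.ι
  ζ := BiopDual.map D.γ
  γ := BiopDual.map D.ζ
  ζbar := BiopDual.map D.γbar
  γbar := BiopDual.map D.ζbar

variable (D : MappingSystem k H B C)

/-- `f ↦ f # 1` -/
def inl (k H B C : Type*) [Field k] [Ring H] [Bialgebra k H]
    [Ring B] [Algebra k B] [LeftComoduleAlgebra k H B]
    [AddCommGroup C] [Module k C] [Coalgebra k C] [RightModuleCoalgebra k H C] :
    Module.Dual k C →ₗ[k] Smash k H B C := (smk k H B C).flip 1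

/-- `b ↦ ε # b` -/
def inr (k H B C : Type*) [Field k] [Ring H] [Bialgebra k H]
    [Ring B] [Algebra k B] [LeftComoduleAlgebra k H B]
    [AddCommGroup C] [Module k C] [Coalgebra k C] [RightModuleCoalgebra k H C] :
    B →ₗ[k] Smash k H B C := smk k H B C counit

/-- The comultiplication on `C* # 1`: if `(bᵢ)` is a basis of `B` with dual basis `(bᵢ*)`, then
`f ↦ ∑ᵢ (f₍₁₎ # bᵢ) ⊗ (γ*(f₍₂₎ ζ*(bᵢ*)) # 1)`, where `∑ f₍₁₎(x) f₍₂₎(h) = f(x ◁ h)`. -/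
def comulLeft : Module.Dual k C →ₗ[k] Smash k H B C ⊗[k] Smash k H B C :=
  (∑ i, TensorProduct.map ((smk k H B C).flip (Module.finBasis k B i))
      (inl k H B C ∘ₗ D.γ.dualMap ∘ₗ
        (dualMul k H).flip (D.ζ.dualMap ((Module.finBasis k B).coord i)))) ∘ₗ
    transposeComul (act (k := k) (H := H) (C := C))

/-- The comultiplication on `ε # B`: if `(xᵢ)` is a basis of `C` with dual basis `(fᵢ)`, then
`b ↦ ∑ᵢ (ε # ζ(γ(xᵢ) b₍₁₎)) ⊗ (fᵢ # b₍₂₎)`. -/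
def comulRight : B →ₗ[k] Smash k H B C ⊗[k] Smash k H B C :=
  (∑ i, TensorProduct.map
      (inr k H B C ∘ₗ D.ζ ∘ₗ LinearMap.mulLeft k (D.γ (Module.finBasis k C i)))
      (smk k H B C ((Module.finBasis k C).coord i))) ∘ₗ
    coact (k := k) (H := H) (B := B)

/-- The comultiplication of the left partial dual, `Δ(f # b) = Δ(f # 1) Δ(ε # b)`. -/
def comul : Smash k H B C →ₗ[k] Smash k H B C ⊗[k] Smash k H B C :=
  TensorProduct.lift
    ((LinearMap.mul k (Smash k H B C ⊗[k] Smash k H B C)).compl₁₂ D.comulLeft D.comulRight)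

/-- The counit of the left partial dual, `f # b ↦ f(π(1)) ε(ι(b))`. -/
def counit : Smash k H B C →ₗ[k] k :=
  TensorProduct.lift ((LinearMap.mul k k).compl₁₂ (Module.Dual.eval k C (D.π 1))
    (CoalgebraStruct.counit (R := k) (A := H) ∘ₗ D.ι))

/-- The inverse of the antipode of `H`. -/
def antipodeInv (k H : Type*) [Field k] [Ring H] [HopfAlgebra k H] : H →ₗ[k] H :=
  Ring.inverse (HopfAlgebra.antipode k (A := H) : Module.End k H)

/-- The associator of the left partial dual: if `(bᵢ)` is a basis of `B` with dual basis `(bᵢ*)`,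
`φ = ∑ᵢⱼ (ε # bᵢ) ⊗ (ε # bⱼ)(γbar*[S⁻¹(ζbar*(bᵢ*)₍₁₎)] # 1) ⊗
  (γbar*[S⁻¹(ζbar*(bⱼ*) ζbar*(bᵢ*)₍₂₎)] # 1)`. Here `transposeComul (LinearMap.mul k H)` is the
comultiplication of the dual `H*`. -/
def associator : Smash k H B C ⊗[k] (Smash k H B C ⊗[k] Smash k H B C) :=
  let b := Module.finBasis k B
  let g : Module.Dual k H →ₗ[k] Smash k H B C :=
    inl k H B C ∘ₗ D.γbar.dualMap ∘ₗ (antipodeInv k H).dualMap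
  ∑ i, ∑ j, inr k H B C (b i) ⊗ₜ[k]
    TensorProduct.map
      (LinearMap.mulLeft k (inr k H B C (b j)) ∘ₗ g)
      (g ∘ₗ dualMul k H (D.ζbar.dualMap (b.coord j)))
      (transposeComul (LinearMap.mul k H) (D.ζbar.dualMap (b.coord i)))

/-- The left partial dual `C* # B` of `H` determined by the mapping system `(ζ, γ*)`. -/
def partialDual : QuasiBialgebraData k (Smash k H B C) where
  comul := D.comul
  counit := D.counit
  associator := D.associator

/-- The map `T(f # b) = ∑ᵢ (ε # bᵢ)(γbar*[π*(f) (ι(b) ⇀ ζbar*(bᵢ*))] # 1)`, where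
`(h ⇀ h*)(x) = h*(x h)`. -/
def T : Smash k H B C →ₗ[k] Smash k H B C :=
  ∑ i, LinearMap.mulLeft k (inr k H B C (Module.finBasis k B i)) ∘ₗ
    inl k H B C ∘ₗ D.γbar.dualMap ∘ₗ
      TensorProduct.lift ((dualMul k H).compl₁₂ D.π.dualMap
        ((Module.Dual.transpose ∘ₗ (LinearMap.mul k H).flip).flip
          (D.ζbar.dualMap ((Module.finBasis k B).coord i)) ∘ₗ D.ι))

/-- The element `υ = T(ε # 1)`. -/
def upsilon : Smash k H B C := D.T 1

/-- `S₁ = T(-) υ⁻¹` -/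
def S₁ : Smash k H B C →ₗ[k] Smash k H B C :=
  LinearMap.mulRight k (Ring.inverse D.upsilon) ∘ₗ D.T

/-- `S₂ = υ⁻¹ T(-)` -/
def S₂ : Smash k H B C →ₗ[k] Smash k H B C :=
  LinearMap.mulLeft k (Ring.inverse D.upsilon) ∘ₗ D.T

end

end MappingSystem

end LeftPartialDual

end

/-! The structure of `C* # B` is a Drinfeld twist seen from inside a subalgebra. Through `π*` the
algebra `C* # B` embeds into `X = H* # B` (`embed`, `embed_injective`). On `X` there is an algebra
map `∇(f # b) = ∑ (f₁ # 1) ⊗ (f₂ # b)`, coassociative because multiplication in `H` is associative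
(`nabla_coassoc`), and `X ⊗ X` contains the unit `J = ∑ (ε # ζbar(eᵢ)) ⊗ (eᵢ* # 1)`, whose inverse
has `ζ` in place of `ζbar` (`twist`). On the embedded subalgebra `Δ = J ∇(-) J⁻¹` (`embed_comul`)
and `φ = J₂₃ (id ⊗ ∇)(J) (J₁₂ (∇ ⊗ id)(J))⁻¹` (`embed_associator`). Quasi-coassociativity and the
pentagon are then formal (`twist_quasi_coassoc`, `twist_pentagon_eq`). Since `∇` is not counital,
the counit axioms are checked on generators.

The dual bases disappear once an element of `M ⊗ (C* # 1)` is read as a linear map `C → M` (`hat`):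
products become convolutions. Two rules then do most of the work. If `Ψ(ι(b)g) = p(b)Ψ(g)`, then
`Ψγπ = (pζbar) * Ψ` (`comp_γπ`); if `Ψ(S⁻¹(ι(b))g) = Ψ(g)p(b)`, then `ΨS⁻¹γbarπ = Ψ * (pζ)`
(`comp_antipodeInv_γbarπ`). The factors `ζbar` and `ζ` that they create are `J` and `J⁻¹`. The
inverse of `S` exists because finite dimension provides a nonzero integral, constructed as a trace,
which forces `S` to be injective (`antipode_injective`).

For the antipodes, `C* # B` acts on `H` from the right by `h · (f # b) = ∑ f(π(h₁)) h₂ ι(b)`, and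
`T(a) = ∑ ζbar(γbar(xᵢ) · a) fᵢ` for dual bases `xᵢ` of `C` and `fᵢ` of `C*` (`T_eq`). Convolution
calculus yields `∑ a₁ T(F a₂) = ε(a) T(F) = ∑ T(a₁ F) a₂`, `∑ φ¹ T(φ²) φ³ = 1` and `∑ T(ψ¹) ψ² T(ψ³)
= υ`, where `ψ = φ⁻¹`. The remaining point is `T(ab) = T(b) υ⁻¹ T(a)` (`T_mul`). It comes from a
dimension count: modulo the relations `S⁻¹(ι(b))h ⊗ m = h ⊗ bm`, the invariants of `H ⊗ (C* # B)`
have dimension at most that of `C* # B`. If `υ` is a unit, the elements `∑ γbar(xᵢ) ⊗ fᵢ m`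
therefore exhaust them. This set is stable under the right action, which forces the formula.

Finally, transposing all maps gives the dual system (`isPAMS_dual`). The map `ϑ` intertwines the two
sets of structure maps because each is the other with the roles of `B` and `C*` exchanged and all
products reversed (`comul_swap`, `counit_swap`, `associator_swap`). The twist argument applied to
the dual system makes its partial dual a quasi-bialgebra, and `ϑ` transports quasi-bialgebra and
antipode structures. -/

open TensorProduct Coalgebra

noncomputable section

namespace LeftPartialDual

/-! ### Additivity of linear maps as direct instances -/

section Shortcuts

variable {k M N : Type*} [Semiring k] [AddCommMonoid M] [AddCommMonoid N] [Module k M]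
  [Module k N]

instance : ZeroHomClass (M →ₗ[k] N) M N := ⟨LinearMap.map_zero⟩

instance : AddHomClass (M →ₗ[k] N) M N := ⟨LinearMap.map_add⟩

instance : ZeroHomClass (M ≃ₗ[k] N) M N := ⟨LinearEquiv.map_zero⟩

instance : AddHomClass (M ≃ₗ[k] N) M N := ⟨LinearEquiv.map_add⟩

end Shortcuts

/-! ### Convolution of linear maps from a coalgebra to an algebra -/

section Convolution

variable {k C R R' : Type*} [Field k] [AddCommGroup C] [Module k C] [Coalgebra k C]
  [Ring R] [Algebra k R] [Ring R'] [Algebra k R']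

/-- The convolution product `(f ⊚ g)(x) = ∑ f(x₍₁₎) g(x₍₂₎)`. -/
def conv (f g : C →ₗ[k] R) : C →ₗ[k] R := (WithConv.toConv f * WithConv.toConv g).ofConv

infixl:70 " ⊚ " => conv

variable (k C R) in
/-- The unit of the convolution product. -/
def convUnit : C →ₗ[k] R := Algebra.linearMap k R ∘ₗ counit

theorem conv_apply (f g : C →ₗ[k] R) (x : C) :
    (f ⊚ g) x = LinearMap.mul' k R (TensorProduct.map f g (comul (R := k) x)) := rfl

theorem convUnit_apply (x : C) : convUnit k C R x = algebraMap k R (counit (R := k) x) := rfl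

theorem conv_assoc (f g h : C →ₗ[k] R) : f ⊚ g ⊚ h = f ⊚ (g ⊚ h) :=
  congrArg WithConv.ofConv
    (mul_assoc (WithConv.toConv f) (WithConv.toConv g) (WithConv.toConv h))

@[simp] theorem conv_unit (f : C →ₗ[k] R) : f ⊚ convUnit k C R = f :=
  congrArg WithConv.ofConv (mul_one (WithConv.toConv f))

@[simp] theorem unit_conv (f : C →ₗ[k] R) : convUnit k C R ⊚ f = f :=
  congrArg WithConv.ofConv (one_mul (WithConv.toConv f))

theorem comp_conv (p : R →ₐ[k] R') (f g : C →ₗ[k] R) :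
    p.toLinearMap ∘ₗ (f ⊚ g) = (p.toLinearMap ∘ₗ f) ⊚ (p.toLinearMap ∘ₗ g) :=
  LinearMap.algHom_comp_convMul_distrib p _ _

theorem comp_convUnit (p : R →ₐ[k] R') :
    p.toLinearMap ∘ₗ convUnit k C R = convUnit k C R' := by
  ext x; simp [convUnit]

theorem conv_comp {D : Type*} [AddCommGroup D] [Module k D] [Coalgebra k D] (p : D →ₗ[k] C)
    (hp : ∀ d, comul (R := k) (p d) = TensorProduct.map p p (comul (R := k) d))
    (f g : C →ₗ[k] R) : (f ⊚ g) ∘ₗ p = (f ∘ₗ p) ⊚ (g ∘ₗ p) := by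
  ext d
  rw [LinearMap.comp_apply, conv_apply, conv_apply, hp, TensorProduct.map_comp]
  rfl

theorem convUnit_comp {D : Type*} [AddCommGroup D] [Module k D] [Coalgebra k D] (p : D →ₗ[k] C)
    (hp : ∀ d, counit (R := k) (p d) = counit (R := k) d) :
    convUnit k C R ∘ₗ p = convUnit k D R := by
  ext d
  simp [convUnit, hp]

theorem conv_cancel_left {f f' : C →ₗ[k] R} (h : f' ⊚ f = convUnit k C R) (g : C →ₗ[k] R) :
    f' ⊚ (f ⊚ g) = g := by
  rw [← conv_assoc, h, unit_conv]

theorem conv_cancel_right {f f' : C →ₗ[k] R} (h : f ⊚ f' = convUnit k C R) (g : C →ₗ[k] R) :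
    g ⊚ f ⊚ f' = g := by
  rw [conv_assoc, h, conv_unit]

theorem conv_inv_unique {f g g' : C →ₗ[k] R} (h : g ⊚ f = convUnit k C R)
    (h' : f ⊚ g' = convUnit k C R) : g = g' := by
  rw [← conv_unit g, ← h', ← conv_assoc, h, unit_conv]

end Convolution

/-! ### The antipode reverses the comultiplication -/

section Antipode

variable {k H : Type*} [Field k] [Ring H] [HopfAlgebra k H]

open HopfAlgebra

/-- `h ↦ h ⊗ 1` -/
abbrev i₁ (k H K : Type*) [Field k] [Ring H] [Algebra k H] [Ring K] [Algebra k K] :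
    H →ₐ[k] H ⊗[k] K := Algebra.TensorProduct.includeLeft

/-- `h ↦ 1 ⊗ h` -/
abbrev i₂ (k H K : Type*) [Field k] [Ring H] [Algebra k H] [Ring K] [Algebra k K] :
    K →ₐ[k] H ⊗[k] K := Algebra.TensorProduct.includeRight

theorem antipode_conv_id : antipode k (A := H) ⊚ LinearMap.id = convUnit k H H :=
  congrArg WithConv.ofConv (LinearMap.antipode_mul_id (R := k) (C := H))

theorem id_conv_antipode : LinearMap.id ⊚ antipode k (A := H) = convUnit k H H :=
  congrArg WithConv.ofConv (LinearMap.id_mul_antipode (R := k) (C := H))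

theorem i₁_conv_i₂ {K : Type*} [Ring K] [Algebra k K] {C : Type*} [AddCommGroup C] [Module k C]
    [Coalgebra k C] (f : C →ₗ[k] H) (g : C →ₗ[k] K) :
    ((i₁ k H K).toLinearMap ∘ₗ f) ⊚ ((i₂ k H K).toLinearMap ∘ₗ g) =
      TensorProduct.map f g ∘ₗ comul := by
  ext x
  rw [conv_apply, LinearMap.comp_apply]
  induction comul (R := k) x with
  | zero => simp
  | add s t hs ht => simp only [map_add, hs, ht]
  | tmul a b => simp

/-- Both sides are convolution inverses of `comul` among maps `H → H ⊗ H`: the left one because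
`comul` is an algebra map, the right one because `comul` is the convolution of the two inclusions,
whose factors cancel one leg after the other. -/
theorem comul_comp_antipode : comul ∘ₗ antipode k (A := H) =
    ((i₂ k H H).toLinearMap ∘ₗ antipode k) ⊚ ((i₁ k H H).toLinearMap ∘ₗ antipode k) := by
  have h0 : (comul : H →ₗ[k] H ⊗[k] H) =
      ((i₁ k H H).toLinearMap ∘ₗ LinearMap.id) ⊚ ((i₂ k H H).toLinearMap ∘ₗ LinearMap.id) := by
    rw [i₁_conv_i₂, TensorProduct.map_id, LinearMap.id_comp]
  have hc : (comul : H →ₗ[k] H ⊗[k] H) = (Bialgebra.comulAlgHom k H).toLinearMap ∘ₗ LinearMap.id :=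
    rfl
  have h1 : (comul ∘ₗ antipode k (A := H)) ⊚ comul = convUnit k H (H ⊗[k] H) := by
    conv_lhs => arg 2; rw [hc]
    change ((Bialgebra.comulAlgHom k H).toLinearMap ∘ₗ antipode k) ⊚ _ = _
    rw [← comp_conv, antipode_conv_id, comp_convUnit]
  refine conv_inv_unique h1 ?_
  conv_lhs => arg 1; rw [h0]
  rw [conv_assoc, ← conv_assoc ((i₂ k H H).toLinearMap ∘ₗ LinearMap.id), ← comp_conv (i₂ k H H), id_conv_antipode,
    comp_convUnit, unit_conv, ← comp_conv, id_conv_antipode, comp_convUnit]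

theorem comul_antipode (h : H) : comul (R := k) (antipode k h) =
    TensorProduct.map (antipode k) (antipode k) (TensorProduct.comm k H H (comul (R := k) h)) := by
  change (comul ∘ₗ antipode k (A := H)) h = _
  rw [comul_comp_antipode, conv_apply]
  induction comul (R := k) h with
  | zero => simp
  | add s t hs ht => simp only [map_add, hs, ht]
  | tmul a b => simp

end Antipode

end LeftPartialDual

end

open TensorProduct Coalgebra

noncomputable section

namespace LeftPartialDual

/-! ### Integrals and the bijectivity of the antipode -/

section Integral

variable {k H : Type*} [Field k] [Ring H] [HopfAlgebra k H] [FiniteDimensional k H]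

open HopfAlgebra

/-- `f, y ↦ ∑ y₁ f(y₂)` -/
def dualHit (f : Module.Dual k H) : H →ₗ[k] H :=
  (TensorProduct.rid k H).toLinearMap ∘ₗ f.lTensor H ∘ₗ comul

/-- `x ↦ Tr(y ↦ x S²(y₁) f(y₂))` -/
def traceIntegral (f : Module.Dual k H) : Module.Dual k H :=
  LinearMap.trace k H ∘ₗ (LinearMap.lcomp k H (antipode k ∘ₗ antipode k ∘ₗ dualHit f)) ∘ₗ
    LinearMap.mul k H

theorem traceIntegral_apply (f : Module.Dual k H) (x : H) : traceIntegral f x =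
    LinearMap.trace k H (LinearMap.mulLeft k x ∘ₗ antipode k ∘ₗ antipode k ∘ₗ dualHit f) := rfl

/-- `dualHit f` is `id * f` with `f` regarded as scalar valued, so `S * id = ε` leaves only `f`. -/
theorem dualHit_convUnit (f : Module.Dual k H) (y : H) :
    LinearMap.mul' k H (TensorProduct.map (antipode k) (dualHit f) (comul (R := k) y)) =
      f y • 1 := by
  have h1 : dualHit f = LinearMap.id ⊚ (Algebra.linearMap k H ∘ₗ f) := by
    ext y
    rw [conv_apply, dualHit, LinearMap.comp_apply, LinearMap.comp_apply]
    induction comul (R := k) y with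
    | zero => simp
    | add s t hs ht => simp only [map_add, hs, ht]
    | tmul a b => simp [Algebra.algebraMap_eq_smul_one]
  rw [← conv_apply, h1, conv_cancel_left antipode_conv_id]
  simp [Algebra.algebraMap_eq_smul_one]

theorem trace_eq_sum (b : Module.Basis (Fin (Module.finrank k H)) k H) (M : H →ₗ[k] H) :
    LinearMap.trace k H M = ∑ i, b.coord i (M (b i)) := by
  rw [LinearMap.trace_eq_matrix_trace k b, Matrix.trace]
  simp [LinearMap.toMatrix_apply]

/-- Under a single trace, the sum becomes the rank one operator `y ↦ f(y) x`, whose trace is `f(x)`.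
Hence every functional is a combination of translates of trace integrals, and these cannot all
vanish when `H` is nonzero. -/
theorem sum_traceIntegral (f : Module.Dual k H) (x : H) :
    ∑ i, traceIntegral ((Module.finBasis k H).coord i)
      (x * antipode k (dualHit f (Module.finBasis k H i))) = f x := by
  set b := Module.finBasis k H
  -- Summation over `i` puts `y₂` in place of the basis vector. The result is `S` applied to `∑
  -- S(y₁) dualHit f (y₂) = f(y)`.
  have h1 : ∀ y, ∑ i, antipode k (dualHit f (b i)) * antipode k (antipode k
      (dualHit (b.coord i) y)) = f y • 1 := by
    intro y
    have h2 : ∀ t : H ⊗[k] H, ∑ i, dualHit f (b i) ⊗ₜ[k]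
        ((TensorProduct.rid k H) ((b.coord i).lTensor H t)) =
          TensorProduct.comm k H H ((dualHit f).lTensor H t) := by
      intro t
      induction t with
      | zero => simp
      | add s t hs ht => simp only [map_add, tmul_add, Finset.sum_add_distrib, hs, ht]
      | tmul u v =>
        simp only [LinearMap.lTensor_tmul, TensorProduct.rid_tmul, TensorProduct.comm_tmul]
        simp only [tmul_smul, smul_tmul', ← TensorProduct.sum_tmul, ← map_smul, ← map_sum]
        congr
        exact b.sum_repr v
    have h3 := congrArg (fun t => antipode k (LinearMap.mul' k H
      (TensorProduct.comm k H H (TensorProduct.map LinearMap.id (antipode k) t))))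
      (h2 (comul (R := k) y))
    simp only [map_sum, TensorProduct.map_tmul, TensorProduct.comm_tmul, LinearMap.mul'_apply,
      antipode_mul_antidistrib, LinearMap.id_apply] at h3
    refine (Eq.trans ?_ h3).trans ?_
    · rfl
    · have h4 := congrArg (antipode k) (dualHit_convUnit f y)
      rw [map_smul, antipode_one] at h4
      rw [← h4]
      congr 1
      induction comul (R := k) y with
      | zero => simp
      | add s t hs ht => simp only [map_add, hs, ht]
      | tmul u v => simp
  have h5 : ∀ i, traceIntegral (b.coord i) (x * antipode k (dualHit f (b i))) =
      LinearMap.trace k H (LinearMap.mulLeft k x ∘ₗ LinearMap.mulLeft k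
        (antipode k (dualHit f (b i))) ∘ₗ antipode k ∘ₗ antipode k ∘ₗ dualHit (b.coord i)) := by
    intro i
    rw [traceIntegral_apply, LinearMap.mulLeft_mul, LinearMap.comp_assoc]
  simp only [h5]
  rw [← map_sum]
  have h6 : ∑ i, LinearMap.mulLeft k x ∘ₗ LinearMap.mulLeft k (antipode k (dualHit f (b i))) ∘ₗ
      antipode k ∘ₗ antipode k ∘ₗ dualHit (b.coord i) = f.smulRight x := by
    ext y
    simp [← Finset.mul_sum, h1]
  rw [h6]
  simp

theorem antipode_dualHit (f : Module.Dual k H) :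
    antipode k ∘ₗ dualHit f = antipode k ⊚ (Algebra.linearMap k H ∘ₗ f) := by
  ext y
  rw [conv_apply, dualHit, LinearMap.comp_apply, LinearMap.comp_apply, LinearMap.comp_apply]
  induction comul (R := k) y with
  | zero => simp
  | add s t hs ht => simp only [map_add, hs, ht]
  | tmul a b => simp [Algebra.algebraMap_eq_smul_one]

theorem comul_dualHit (f : Module.Dual k H) (y : H) :
    comul (R := k) (dualHit f y) = (dualHit f).lTensor H (comul (R := k) y) := by
  have h := congrArg (fun t => (TensorProduct.rid k _).toLinearMap.lTensor H
    ((f.lTensor H).lTensor H t)) (coassoc_apply (R := k) y)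
  have h2 : ∀ t : H ⊗[k] H, (TensorProduct.rid k _).toLinearMap.lTensor H
      ((f.lTensor H).lTensor H (comul.lTensor H t)) = (dualHit f).lTensor H t := by
    intro t
    induction t with
    | zero => simp
    | add s t hs ht => simp only [map_add, hs, ht]
    | tmul a b => simp [dualHit]
  have h3 : ∀ t : H ⊗[k] H, (TensorProduct.rid k _).toLinearMap.lTensor H
      ((f.lTensor H).lTensor H (TensorProduct.assoc k H H H (comul.rTensor H t))) =
        comul (R := k) (TensorProduct.rid k H (f.lTensor H t)) := by
    intro t
    induction t with
    | zero => simp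
    | add s t hs ht => simp only [map_add, hs, ht]
    | tmul a b =>
      simp only [LinearMap.rTensor_tmul, LinearMap.lTensor_tmul, TensorProduct.rid_tmul, map_smul]
      induction comul (R := k) a with
      | zero => simp
      | add s t hs ht => simp only [map_add, add_tmul, smul_add, hs, ht]
      | tmul a a' => simp [tmul_smul]
  exact (h3 _).symm.trans (h.trans (h2 _))

theorem comul_antipode_antipode (h : H) : comul (R := k) (antipode k (antipode k h)) =
    TensorProduct.map (antipode k ∘ₗ antipode k) (antipode k ∘ₗ antipode k)
      (comul (R := k) h) := by
  rw [comul_antipode, comul_antipode]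
  induction comul (R := k) h with
  | zero => simp
  | add s t hs ht => simp only [map_add, hs, ht]
  | tmul a b => simp

/-- `λ` is a left integral in `H*`: `∑ x₁ λ(x₂) = λ(x) 1`. -/
theorem dualHit_traceIntegral (f : Module.Dual k H) (x : H) :
    dualHit (traceIntegral f) x = traceIntegral f x • 1 := by
  set b := Module.finBasis k H
  let M : H →ₗ[k] H := LinearMap.mulLeft k x ∘ₗ antipode k ∘ₗ antipode k ∘ₗ dualHit f
  have hM : ∀ x : H, traceIntegral f x = ∑ i, b.coord i (x * antipode k (antipode k
      (dualHit f (b i)))) := fun x => trace_eq_sum b _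
  let e : Module.Dual k H → H ⊗[k] H →ₗ[k] H := fun g =>
    (TensorProduct.rid k H).toLinearMap ∘ₗ g.lTensor H
  have he : ∀ g u v, e g (u ⊗ₜ v) = g v • u := fun g u v => by simp [e]
  -- `x₁ ⊗ x₂ S²(θ y) = ∑ M(y₂)₁ S(y₁) ⊗ M(y₂)₂`
  let G : H ⊗[k] H →ₗ[k] H ⊗[k] H := LinearMap.mul' k (H ⊗[k] H) ∘ₗ
    (TensorProduct.map (comul ∘ₗ M) ((i₁ k H H).toLinearMap ∘ₗ antipode k)) ∘ₗ
      (TensorProduct.comm k H H).toLinearMap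
  have hG0 : ∀ a y, G (a ⊗ₜ y) = comul (R := k) (M y) * (antipode k a ⊗ₜ 1) := fun _ _ => rfl
  have hG : ∀ y, G (comul (R := k) y) =
      comul (R := k) x * (1 ⊗ₜ antipode k (antipode k (dualHit f y))) := by
    intro y
    have h1 : ∀ y, comul (R := k) (M y) = comul (R := k) x *
        TensorProduct.map (antipode k ∘ₗ antipode k) (antipode k ∘ₗ antipode k ∘ₗ dualHit f)
          (comul (R := k) y) := by
      intro y
      change comul (x * _) = _
      rw [Bialgebra.comul_mul, LinearMap.comp_apply, LinearMap.comp_apply,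
        comul_antipode_antipode, comul_dualHit]
      congr 1
      induction comul (R := k) y with
      | zero => simp
      | add s t hs ht => simp only [map_add, hs, ht]
      | tmul u v => simp
    -- Since `S²(y₂) S(y₁) = S(y₁ S(y₂))`, coassociativity and the antipode axiom remove the first
    -- leg. `Ψ` records the expression before this collapse.
    let Ψ : (H ⊗[k] H) ⊗[k] H →ₗ[k] H ⊗[k] H :=
      TensorProduct.map (antipode k ∘ₗ LinearMap.mul' k H ∘ₗ (antipode k).lTensor H)
        (antipode k ∘ₗ antipode k ∘ₗ dualHit f)
    have h2 : ∀ t : H ⊗[k] H, G t = comul (R := k) x *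
        Ψ ((TensorProduct.assoc k H H H).symm (comul.lTensor H t)) := by
      intro t
      induction t with
      | zero => simp
      | add s t hs ht => simp only [map_add, mul_add, hs, ht]
      | tmul a y =>
        rw [hG0, h1, LinearMap.lTensor_tmul, mul_assoc]
        congr 1
        induction comul (R := k) y with
        | zero => simp
        | add s t hs ht => simp only [map_add, add_mul, tmul_add, hs, ht]
        | tmul u v => simp [Ψ, antipode_mul_antidistrib]
    have h3 : ∀ t : H ⊗[k] H, Ψ (comul.rTensor H t) =
        1 ⊗ₜ antipode k (antipode k (dualHit f (TensorProduct.lid k H (counit.rTensor H t)))) := by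
      intro t
      induction t with
      | zero => simp
      | add s t hs ht => simp only [map_add, tmul_add, hs, ht]
      | tmul a y => simp [Ψ, mul_antipode_lTensor_comul_apply, Algebra.algebraMap_eq_smul_one,
          smul_tmul]
    rw [h2, coassoc_symm_apply, h3]
    simp
  have h4 : dualHit (traceIntegral f) x = ∑ i, e (b.coord i) (G (comul (R := k) (b i))) := by
    simp only [hG, dualHit, LinearMap.comp_apply]
    induction comul (R := k) x with
    | zero => simp
    | add s t hs ht => simp only [map_add, add_mul, hs, ht, Finset.sum_add_distrib]
    | tmul u v =>
      simp [hM, he, Finset.sum_smul, dualHit]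
  have h5 : ∀ t : H ⊗[k] H, G t = ∑ j, comul (R := k) (M (b j)) *
      (antipode k (e (b.coord j) t) ⊗ₜ 1) := by
    intro t
    induction t with
    | zero => simp
    | add s t hs ht => simp only [map_add, add_tmul, mul_add, hs, ht, Finset.sum_add_distrib]
    | tmul a y =>
      rw [hG0]
      refine (congrArg (fun z => comul (R := k) (M z) * (antipode k a ⊗ₜ[k] (1 : H)))
        (b.sum_repr y).symm).trans ?_
      simp [-Module.Basis.sum_repr, he, Finset.sum_mul, ← smul_tmul']
  have h6 : ∀ (g : Module.Dual k H) (u : H ⊗[k] H),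
      ∑ i, e (b.coord i) (u * (antipode k (e g (comul (R := k) (b i))) ⊗ₜ 1)) =
        LinearMap.mul' k H (TensorProduct.map LinearMap.id (antipode k ∘ₗ dualHit g) u) := by
    intro g u
    induction u with
    | zero => simp
    | add s t hs ht => simp only [map_add, add_mul, hs, ht, Finset.sum_add_distrib]
    | tmul p q =>
      simp only [Algebra.TensorProduct.tmul_mul_tmul, he, mul_one, TensorProduct.map_tmul,
        LinearMap.mul'_apply, LinearMap.id_apply]
      refine Eq.trans ?_ (congrArg (fun z => p * (antipode k ∘ₗ dualHit g) z)
        (b.sum_repr q))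
      simp [-Module.Basis.sum_repr, Finset.mul_sum, dualHit, e]
  have h7 : ∀ (g : Module.Dual k H) (m : H), LinearMap.mul' k H (TensorProduct.map LinearMap.id
      (antipode k ∘ₗ dualHit g) (comul (R := k) m)) = g m • 1 := by
    intro g m
    rw [← conv_apply, antipode_dualHit, conv_cancel_left id_conv_antipode]
    simp [Algebra.algebraMap_eq_smul_one]
  rw [h4]
  simp only [h5, map_sum]
  -- After the exchange, the inner sum is `∑ u₁ S(dualHit g (u₂))` for `u = Δ(M eⱼ)` and `g = eⱼ*`.
  -- It equals `g(M eⱼ)`, and the outer sum is the trace of `M`.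
  rw [Finset.sum_comm]
  simp only [h6, h7]
  rw [← Finset.sum_smul, hM]
  rfl

theorem mulLeft_comp_conv {C R : Type*} [AddCommGroup C] [Module k C] [Coalgebra k C]
    [Ring R] [Algebra k R] (u : R) (f g : C →ₗ[k] R) :
    (LinearMap.mulLeft k u ∘ₗ f) ⊚ g = LinearMap.mulLeft k u ∘ₗ (f ⊚ g) := by
  ext x
  rw [LinearMap.comp_apply, conv_apply, conv_apply]
  induction comul (R := k) x with
  | zero => simp
  | add s t hs ht => simp only [map_add, hs, ht]
  | tmul a b => simp [mul_assoc]

/-- `x₁ l(x₂ S(h)) = l(x S(h₁)) h₂` for a left integral `l`. -/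
theorem dualHit_mul_antipode {l : Module.Dual k H} (hl : ∀ x, dualHit l x = l x • 1) (x h : H) :
    TensorProduct.lid k H ((l ∘ₗ LinearMap.mulLeft k x ∘ₗ
      antipode k).rTensor H (comul (R := k) h)) =
        TensorProduct.rid k H ((l ∘ₗ LinearMap.mulRight k (antipode k h)).lTensor H
          (comul (R := k) x)) := by
  -- `Λ t h = (id ⊗ l)(t Δ(S h))`. For `t = Δ x` the integral property makes it `l(x S(h)) 1`. For
  -- `t = u ⊗ v` it is a convolution ending in `S`, which cancels against the identity. Evaluating
  -- `Λ(Δ x) * id` in both ways gives the claim.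
  let Λ : H ⊗[k] H → H →ₗ[k] H := fun t =>
    (TensorProduct.rid k H).toLinearMap ∘ₗ l.lTensor H ∘ₗ LinearMap.mulLeft k t ∘ₗ comul ∘ₗ
      antipode k
  have hadd : ∀ s t, Λ (s + t) = Λ s + Λ t := fun s t => by
    ext h; simp [Λ, add_mul]
  have hzero : Λ 0 = 0 := by ext h; simp [Λ]
  have h1 : ∀ u v, Λ (u ⊗ₜ v) = LinearMap.mulLeft k u ∘ₗ
      ((Algebra.linearMap k H ∘ₗ l ∘ₗ LinearMap.mulLeft k v ∘ₗ antipode k) ⊚ antipode k) := by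
    intro u v
    ext h
    simp only [Λ, LinearMap.comp_apply, conv_apply, comul_antipode]
    induction comul (R := k) h with
    | zero => simp
    | add s t hs ht => simp only [map_add, hs, ht]
    | tmul a b => simp [Algebra.algebraMap_eq_smul_one]
  have h2 : ∀ t, (Λ t ⊚ LinearMap.id) h =
      TensorProduct.rid k H ((l ∘ₗ LinearMap.mulRight k (antipode k h)).lTensor H t) := by
    intro t
    induction t with
    | zero =>
      rw [hzero]; simp [conv_apply]
    | add s t hs ht =>
      rw [hadd]
      rw [conv_apply] at hs ht ⊢
      rw [map_add, map_add, ← hs, ← ht, TensorProduct.map_add_left, LinearMap.add_apply, map_add]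
    | tmul u v =>
      rw [h1, mulLeft_comp_conv, conv_cancel_right antipode_conv_id]
      simp [Algebra.algebraMap_eq_smul_one]
  rw [← h2, conv_apply]
  have h3 : Λ (comul (R := k) x) = (l ∘ₗ LinearMap.mulLeft k x ∘ₗ antipode k).smulRight 1 := by
    ext h
    have := hl (x * antipode k h)
    rw [dualHit, LinearMap.comp_apply, LinearMap.comp_apply, Bialgebra.comul_mul] at this
    exact this
  rw [h3]
  induction comul (R := k) h with
  | zero => simp
  | add s t hs ht => simp only [map_add, hs, ht]
  | tmul a b => simp

/-- If `S(h) = 0`, then `dualHit_mul_antipode` gives `∑ l(y S(h₁)) h₂ = 0` for every integral `l`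
and every `y`. Substituting `x S²(-)` for `y` recovers `l(x) h`, which is nonzero for a suitable `x`
when `h` is nonzero. -/
theorem antipode_injective : Function.Injective (antipode k (A := H)) := by
  refine (injective_iff_map_eq_zero (antipode k (A := H))).2 fun h hh => ?_
  by_contra hne
  -- an integral `l` with `l x ≠ 0`
  obtain ⟨f, x, hlx⟩ : ∃ (f : Module.Dual k H) (x : H), traceIntegral f x ≠ 0 := by
    by_contra hcon
    push Not at hcon
    apply hne
    rw [← Module.forall_dual_apply_eq_zero_iff k]
    intro f
    rw [← sum_traceIntegral f h]
    exact Finset.sum_eq_zero fun i _ => hcon _ _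
  set l := traceIntegral f
  let F : H →ₗ[k] Module.Dual k H := (LinearMap.llcomp k H H k l) ∘ₗ
    (LinearMap.mul k H).flip ∘ₗ antipode k
  have hF : ∀ h x, F h x = l (x * antipode k h) := fun _ _ => rfl
  have h1 : F.rTensor H (comul (R := k) h) = 0 := by
    apply dualTensorHom_ext
    intro x
    have h2 := dualHit_mul_antipode (dualHit_traceIntegral f) x h
    rw [hh, LinearMap.mulRight_zero_eq_zero, LinearMap.comp_zero, LinearMap.lTensor_zero,
      LinearMap.zero_apply, map_zero] at h2
    rw [map_zero, LinearMap.zero_apply, ← h2]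
    induction comul (R := k) h with
    | zero => simp
    | add s t hs ht => simp only [map_add, LinearMap.add_apply, hs, ht]
    | tmul a b => simp [hF, l]
  -- `Θ(g ⊗ y) = ∑ g(x S²(y₁)) y₂`. Applied to `∑ l(- S(h₁)) ⊗ h₂` it gives `∑ l(x S(h₁ S(h₂))) h₃ =
  -- l(x) h`.
  let Θ : Module.Dual k H ⊗[k] H →ₗ[k] H := TensorProduct.lift
    ((LinearMap.llcomp k H (H ⊗[k] H) H).flip comul ∘ₗ
      (LinearMap.llcomp k (H ⊗[k] H) (k ⊗[k] H) H (TensorProduct.lid k H).toLinearMap) ∘ₗ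
      LinearMap.rTensorHom H ∘ₗ
      (LinearMap.lcomp k k (LinearMap.mulLeft k x ∘ₗ antipode k ∘ₗ antipode k)))
  have hΘ : ∀ g y, Θ (g ⊗ₜ y) = TensorProduct.lid k H ((g ∘ₗ LinearMap.mulLeft k x ∘ₗ antipode k ∘ₗ
      antipode k).rTensor H (comul (R := k) y)) := fun _ _ => rfl
  let Ψ : (H ⊗[k] H) ⊗[k] H →ₗ[k] H := (TensorProduct.lid k H).toLinearMap ∘ₗ
    (l ∘ₗ LinearMap.mulLeft k x ∘ₗ antipode k ∘ₗ LinearMap.mul' k H ∘ₗ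
      (antipode k).lTensor H).rTensor H
  have h3 : ∀ t : H ⊗[k] H, Θ (F.rTensor H t) =
      Ψ ((TensorProduct.assoc k H H H).symm (comul.lTensor H t)) := by
    intro t
    induction t with
    | zero => simp
    | add s t hs ht => simp only [map_add, hs, ht]
    | tmul a y =>
      rw [LinearMap.rTensor_tmul, LinearMap.lTensor_tmul, hΘ]
      induction comul (R := k) y with
      | zero => simp
      | add s t hs ht => simp only [map_add, tmul_add, hs, ht]
      | tmul u v => simp [Ψ, hF, antipode_mul_antidistrib, mul_assoc]
  have h4 : ∀ t : H ⊗[k] H, Ψ (comul.rTensor H t) =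
      l x • TensorProduct.lid k H (counit.rTensor H t) := by
    intro t
    induction t with
    | zero => simp
    | add s t hs ht => simp only [map_add, smul_add, hs, ht]
    | tmul a y => simp [Ψ, mul_antipode_lTensor_comul_apply, Algebra.algebraMap_eq_smul_one,
          smul_smul, mul_comm]
  have h5 := h3 (comul (R := k) h)
  rw [h1, map_zero, coassoc_symm_apply, h4, rTensor_counit_comul, TensorProduct.lid_tmul,
    one_smul] at h5
  exact hne ((smul_eq_zero.1 h5.symm).resolve_left hlx)

theorem isUnit_antipode : IsUnit (antipode k (A := H) : Module.End k H) :=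
  (Module.End.isUnit_iff _).2 ⟨antipode_injective, LinearMap.injective_iff_surjective.1
    antipode_injective⟩

end Integral

end LeftPartialDual

end

open TensorProduct Coalgebra

noncomputable section

namespace LeftPartialDual

open LeftComoduleAlgebra RightModuleCoalgebra HopfAlgebra

namespace MappingSystem

/-! ### The inverse antipode -/

section AntipodeInv

variable {k H : Type*} [Field k] [Ring H] [HopfAlgebra k H] [FiniteDimensional k H]

@[simp] theorem antipode_antipodeInv (h : H) : antipode k (antipodeInv k H h) = h :=
  LinearMap.congr_fun (Ring.mul_inverse_cancel (M₀ := Module.End k H) _ isUnit_antipode) h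

@[simp] theorem antipodeInv_antipode (h : H) : antipodeInv k H (antipode k h) = h :=
  LinearMap.congr_fun (Ring.inverse_mul_cancel (M₀ := Module.End k H) _ isUnit_antipode) h

theorem antipodeInv_mul (a b : H) :
    antipodeInv k H (a * b) = antipodeInv k H b * antipodeInv k H a := by
  apply antipode_injective (k := k)
  rw [antipode_mul_antidistrib]
  simp

@[simp] theorem antipodeInv_one : antipodeInv k H (1 : H) = 1 := by
  apply antipode_injective (k := k)
  simp

theorem comul_antipodeInv (h : H) : CoalgebraStruct.comul (R := k) (antipodeInv k H h) =
    TensorProduct.map (antipodeInv k H) (antipodeInv k H)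
      (TensorProduct.comm k H H (CoalgebraStruct.comul (R := k) h)) := by
  conv_rhs => rw [← antipode_antipodeInv (k := k) h, comul_antipode]
  induction CoalgebraStruct.comul (R := k) (antipodeInv k H h) with
  | zero => simp
  | add s t hs ht => simp only [map_add, ← hs, ← ht]
  | tmul a b => simp

/-- `∑ h₂ S⁻¹(h₁) = ε(h)` -/
theorem mul_antipodeInv_comul (h : H) : LinearMap.mul' k H (TensorProduct.comm k H H
    ((antipodeInv k H).rTensor H (CoalgebraStruct.comul (R := k) h))) = CoalgebraStruct.counit (R := k) h • 1 := by
  apply antipode_injective (k := k)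
  have := mul_antipode_lTensor_comul_apply (R := k) h
  rw [map_smul, antipode_one, ← Algebra.algebraMap_eq_smul_one, ← this]
  induction CoalgebraStruct.comul (R := k) h with
  | zero => simp
  | add s t hs ht => simp only [map_add, ← hs, ← ht]
  | tmul a b => simp [antipode_mul_antidistrib]

/-- `∑ S⁻¹(h₂) h₁ = ε(h)` -/
theorem antipodeInv_mul_comul (h : H) : LinearMap.mul' k H (TensorProduct.comm k H H
    ((antipodeInv k H).lTensor H (CoalgebraStruct.comul (R := k) h))) = CoalgebraStruct.counit (R := k) h • 1 := by
  apply antipode_injective (k := k)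
  have := mul_antipode_rTensor_comul_apply (R := k) h
  rw [map_smul, antipode_one, ← Algebra.algebraMap_eq_smul_one, ← this]
  induction CoalgebraStruct.comul (R := k) h with
  | zero => simp
  | add s t hs ht => simp only [map_add, ← hs, ← ht]
  | tmul a b => simp [antipode_mul_antidistrib]

end AntipodeInv

variable {k H B C : Type*} [Field k] [Ring H] [HopfAlgebra k H] [Ring B]
    [Algebra k B] [LeftComoduleAlgebra k H B] [AddCommGroup C] [Module k C] [Coalgebra k C]
    [RightModuleCoalgebra k H C] {D : MappingSystem k H B C}

/-! ### Convolution calculus of a mapping system -/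

namespace IsPAMS

/-- `ι` as an algebra map. -/
def ιAlg (hD : D.IsPAMS) : B →ₐ[k] H := AlgHom.ofLinearMap D.ι hD.ι_one hD.ι_mul

variable (hD : D.IsPAMS)

include hD

@[simp] theorem ιAlg_toLinearMap : hD.ιAlg.toLinearMap = D.ι := rfl

theorem ζ_conv_ζbar : D.ζ ⊚ D.ζbar = convUnit k H B := congrArg WithConv.ofConv hD.ζ_mul_ζbar
theorem ζbar_conv_ζ : D.ζbar ⊚ D.ζ = convUnit k H B := congrArg WithConv.ofConv hD.ζbar_mul_ζ
theorem γ_conv_γbar : D.γ ⊚ D.γbar = convUnit k C H := congrArg WithConv.ofConv hD.γ_mul_γbar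
theorem γbar_conv_γ : D.γbar ⊚ D.γ = convUnit k C H := congrArg WithConv.ofConv hD.γbar_mul_γ

theorem ιζ_conv_γπ : (D.ι ∘ₗ D.ζ) ⊚ (D.γ ∘ₗ D.π) = LinearMap.id :=
  congrArg WithConv.ofConv hD.conv_eq_id

theorem ιζbar_conv_ιζ : (D.ι ∘ₗ D.ζbar) ⊚ (D.ι ∘ₗ D.ζ) = convUnit k H H := by
  rw [← hD.ιAlg_toLinearMap, ← comp_conv, hD.ζbar_conv_ζ, comp_convUnit]

theorem ιζ_conv_ιζbar : (D.ι ∘ₗ D.ζ) ⊚ (D.ι ∘ₗ D.ζbar) = convUnit k H H := by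
  rw [← hD.ιAlg_toLinearMap, ← comp_conv, hD.ζ_conv_ζbar, comp_convUnit]

theorem γbarπ_conv_γπ : (D.γbar ∘ₗ D.π) ⊚ (D.γ ∘ₗ D.π) = convUnit k H H := by
  rw [← conv_comp D.π hD.π_comul, hD.γbar_conv_γ, convUnit_comp _ hD.π_counit]

/-- `γπ = ιζbar * id` -/
theorem γπ_eq : D.γ ∘ₗ D.π = (D.ι ∘ₗ D.ζbar) ⊚ LinearMap.id := by
  rw [← hD.ιζ_conv_γπ, conv_cancel_left hD.ιζbar_conv_ιζ]

/-- `γbarπ = S * ιζ` -/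
theorem γbarπ_eq : D.γbar ∘ₗ D.π = antipode k ⊚ (D.ι ∘ₗ D.ζ) := by
  refine conv_inv_unique hD.γbarπ_conv_γπ ?_
  rw [hD.γπ_eq, ← conv_assoc, conv_cancel_right id_conv_antipode, hD.ιζbar_conv_ιζ]

/-- `ιζbar = γπ * S` -/
theorem ιζbar_eq : D.ι ∘ₗ D.ζbar = (D.γ ∘ₗ D.π) ⊚ antipode k := by
  rw [hD.γπ_eq, conv_cancel_right id_conv_antipode]

/-- `S = γbarπ * ιζbar` -/
theorem antipode_eq : antipode k (A := H) = (D.γbar ∘ₗ D.π) ⊚ (D.ι ∘ₗ D.ζbar) := by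
  rw [hD.γbarπ_eq, conv_cancel_right hD.ιζ_conv_ιζbar]

/-- `ιζ = id * γbarπ` -/
theorem ιζ_eq : D.ι ∘ₗ D.ζ = LinearMap.id ⊚ (D.γbar ∘ₗ D.π) := by
  rw [hD.γbarπ_eq, conv_cancel_left id_conv_antipode]

theorem ζ_ι (b : B) : D.ζ (D.ι b) = b := by
  have := hD.ζ_mul b 1
  rwa [mul_one, hD.ζ_one, mul_one] at this

theorem ζbar_one : D.ζbar 1 = 1 := by
  have h := LinearMap.congr_fun hD.ζ_conv_ζbar 1
  rw [conv_apply, Bialgebra.comul_one, Algebra.TensorProduct.one_def] at h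
  simpa [hD.ζ_one, convUnit_apply] using h

/-- Coinvariance of `ι(b)` with the counit applied to the first leg. -/
theorem π_ι (b : B) : D.π (D.ι b) = CoalgebraStruct.counit (R := k) (D.ι b) • D.π 1 := by
  have h1 := (hD.mem_range_ι_iff (D.ι b)).1 ⟨b, rfl⟩
  have h2 := congrArg (fun t => TensorProduct.lid k C ((CoalgebraStruct.counit (R := k)).rTensor C t)) h1
  have h3 : ∀ t : H ⊗[k] H, TensorProduct.lid k C ((CoalgebraStruct.counit (R := k)).rTensor C
      (D.π.lTensor H t)) = D.π (TensorProduct.lid k H ((CoalgebraStruct.counit (R := k)).rTensor H t)) := by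
    intro t
    induction t with
    | zero => simp
    | add s t hs ht => simp only [map_add, hs, ht]
    | tmul a b => simp
  simpa [h3] using h2

theorem π_ι_mul (b : B) (h : H) : D.π (D.ι b * h) = CoalgebraStruct.counit (R := k) (D.ι b) • D.π h := by
  rw [hD.π_act, hD.π_ι, map_smul, LinearMap.smul_apply, ← hD.π_act, one_mul]

/-- `∑ b₁ ε(b₂) = b` -/
theorem coact_counit (b : B) : TensorProduct.rid k H ((CoalgebraStruct.counit ∘ₗ D.ι).lTensor H
    (coact (k := k) b)) = D.ι b := by
  have h := lTensor_counit_comul (R := k) (D.ι b)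
  rw [hD.ι_coact] at h
  have h2 := congrArg (TensorProduct.rid k H) h
  rw [TensorProduct.rid_tmul, one_smul] at h2
  rw [← h2, LinearMap.lTensor_comp]
  rfl

/-- `ε ι ζ` is the unit of convolution, hence so is its inverse `ε ι ζbar`. -/
theorem counit_ζbar (h : H) : CoalgebraStruct.counit (R := k) (D.ι (D.ζbar h)) = CoalgebraStruct.counit (R := k) h := by
  have h1 : (Bialgebra.counitAlgHom k H).toLinearMap ∘ₗ D.ι ∘ₗ D.ζ = convUnit k H k := by
    ext x
    simp [convUnit, hD.ζ_counit]
  have h2 := congrArg (fun f => (Bialgebra.counitAlgHom k H).toLinearMap ∘ₗ f) hD.ιζ_conv_ιζbar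
  simp only [comp_conv, h1, unit_conv, comp_convUnit] at h2
  exact LinearMap.congr_fun h2 h

variable [FiniteDimensional k H]

/-- Apply `π` to `∑ b₂ S⁻¹(b₁) h = ε(b) h`. As `b₂` lies in `B`, `π` absorbs it, and what remains on
the left is `π(S⁻¹(b) h)`. -/
theorem π_antipodeInv_mul (b : B) (h : H) :
    D.π (antipodeInv k H (D.ι b) * h) = CoalgebraStruct.counit (R := k) (D.ι b) • D.π h := by
  let F : H ⊗[k] H →ₗ[k] C := D.π ∘ₗ LinearMap.mulRight k h ∘ₗ LinearMap.mul' k H ∘ₗ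
    (TensorProduct.comm k H H).toLinearMap ∘ₗ (antipodeInv k H).rTensor H
  have h1 : F (CoalgebraStruct.comul (R := k) (D.ι b)) = CoalgebraStruct.counit (R := k) (D.ι b) • D.π h := by
    have := mul_antipodeInv_comul (k := k) (D.ι b)
    simp only [F, LinearMap.comp_apply, LinearEquiv.coe_coe, this]
    simp
  have h2 : ∀ t : H ⊗[k] B, F (D.ι.lTensor H t) = D.π (antipodeInv k H
      (TensorProduct.rid k H ((CoalgebraStruct.counit ∘ₗ D.ι).lTensor H t)) * h) := by
    intro t
    induction t with
    | zero => simp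
    | add s t hs ht => simp only [map_add, add_mul, hs, ht]
    | tmul a c => simp [F, mul_assoc, hD.π_ι_mul]
  rw [← h1, hD.ι_coact, h2, hD.coact_counit]

/-- The counterpart for `ζbar` of the left `B`-linearity of `ζ`. In `ιζbar = γπ * S`, the first leg
of `Δ(S⁻¹(b))` is absorbed by `π`, and the antipode turns the second into right multiplication by
`b`. -/
theorem ζbar_antipodeInv_mul (b : B) (h : H) :
    D.ζbar (antipodeInv k H (D.ι b) * h) = D.ζbar h * b := by
  apply hD.ι_injective
  have h1 : ∀ (t : H ⊗[k] B) (u : H ⊗[k] H),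
      LinearMap.mul' k H (TensorProduct.map (D.γ ∘ₗ D.π) (antipode k)
        (TensorProduct.map (antipodeInv k H) (antipodeInv k H)
          (TensorProduct.comm k H H (D.ι.lTensor H t)) * u)) =
      LinearMap.mul' k H (TensorProduct.map (D.γ ∘ₗ D.π) (antipode k) u) *
        TensorProduct.rid k H ((CoalgebraStruct.counit ∘ₗ D.ι).lTensor H t) := by
    intro t u
    induction t with
    | zero => simp
    | add s t hs ht => simp only [map_add, add_mul, mul_add, hs, ht]
    | tmul a c =>
      induction u with
      | zero => simp
      | add s t hs ht => simp only [map_add, add_mul, mul_add, hs, ht]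
      | tmul u v => simp [hD.π_antipodeInv_mul, antipode_mul_antidistrib, mul_assoc]
  have h2 : ∀ h, D.ι (D.ζbar h) = LinearMap.mul' k H (TensorProduct.map (D.γ ∘ₗ D.π) (antipode k)
      (CoalgebraStruct.comul (R := k) h)) := fun h => LinearMap.congr_fun hD.ιζbar_eq h
  rw [hD.ι_mul, h2, h2, Bialgebra.comul_mul, comul_antipodeInv, hD.ι_coact, h1, hD.coact_counit]

/-- `S⁻¹(γbar(π(h))) = ∑ S⁻¹(ζ(h₂)) h₁` -/
theorem antipodeInv_γbar_π (h : H) : antipodeInv k H (D.γbar (D.π h)) =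
    LinearMap.mul' k H (TensorProduct.comm k H H
      ((antipodeInv k H ∘ₗ D.ι ∘ₗ D.ζ).lTensor H (CoalgebraStruct.comul (R := k) h))) := by
  have h1 := LinearMap.congr_fun hD.γbarπ_eq h
  rw [LinearMap.comp_apply, conv_apply] at h1
  rw [h1]
  induction CoalgebraStruct.comul (R := k) h with
  | zero => simp
  | add s t hs ht => simp only [map_add, hs, ht]
  | tmul u v => simp [antipodeInv_mul]

/-- `h = ∑ S⁻¹(ζbar(h₂)) S⁻¹(γbar(π(h₁)))` -/
theorem eq_antipodeInv_mul (h : H) : h = LinearMap.mul' k H (TensorProduct.comm k H H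
      (TensorProduct.map (antipodeInv k H ∘ₗ D.γbar ∘ₗ D.π) (antipodeInv k H ∘ₗ D.ι ∘ₗ D.ζbar)
        (CoalgebraStruct.comul (R := k) h))) := by
  apply antipode_injective (k := k)
  have h1 := LinearMap.congr_fun hD.antipode_eq h
  rw [conv_apply] at h1
  rw [h1]
  induction CoalgebraStruct.comul (R := k) h with
  | zero => simp
  | add s t hs ht => simp only [map_add, hs, ht]
  | tmul u v => simp [antipode_mul_antidistrib]

/-- `S⁻¹ γbar` is a second section of `π` besides `γ`: in `∑ S⁻¹(ζ(h₂)) h₁` the factor from `B` is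
absorbed by `π`. -/
theorem π_antipodeInv_γbar_π (h : H) :
    D.π (antipodeInv k H (D.γbar (D.π h))) = D.π h := by
  rw [hD.antipodeInv_γbar_π]
  have : ∀ t : H ⊗[k] H, D.π (LinearMap.mul' k H (TensorProduct.comm k H H
      ((antipodeInv k H ∘ₗ D.ι ∘ₗ D.ζ).lTensor H t))) =
      D.π (TensorProduct.rid k H (CoalgebraStruct.counit.lTensor H t)) := by
    intro t
    induction t with
    | zero => simp
    | add s t hs ht => simp only [map_add, hs, ht]
    | tmul a b => simp [hD.π_antipodeInv_mul, hD.ζ_counit]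
  rw [this]
  simp

omit [FiniteDimensional k H] in
/-- If `Ψ(ι(b) g) = p(b) Ψ(g)` then `Ψ ∘ γ ∘ π = (p ∘ ζbar) * Ψ`. -/
theorem comp_γπ {R : Type*} [Ring R] [Algebra k R] (Ψ : H →ₗ[k] R) (p : B →ₗ[k] R)
    (h : ∀ b g, Ψ (D.ι b * g) = p b * Ψ g) : Ψ ∘ₗ D.γ ∘ₗ D.π = (p ∘ₗ D.ζbar) ⊚ Ψ := by
  rw [hD.γπ_eq]
  ext x
  rw [LinearMap.comp_apply, conv_apply, conv_apply]
  induction CoalgebraStruct.comul (R := k) x with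
  | zero => simp
  | add s t hs ht => simp only [map_add, hs, ht]
  | tmul u v => simp [h]

end IsPAMS

end MappingSystem

end LeftPartialDual

end

open TensorProduct Coalgebra

noncomputable section

namespace LeftPartialDual

open LeftComoduleAlgebra RightModuleCoalgebra HopfAlgebra
open MappingSystem (inl inr antipodeInv)

/-! ### The smash product: generators, universal property and functoriality -/

section Smash

variable {k H B C : Type*} [Field k] [Ring H] [Bialgebra k H]
  [Ring B] [Algebra k B] [LeftComoduleAlgebra k H B]
  [AddCommGroup C] [Module k C] [Coalgebra k C] [RightModuleCoalgebra k H C]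

theorem inl_mul_inr (f : Module.Dual k C) (b : B) :
    inl k H B C f * inr k H B C b = smk k H B C f b := by
  change smashLeft k B C f (smashRight k H B C 1 (counit ⊗ₜ b)) = f ⊗ₜ b
  rw [smashRight_one, Module.End.one_apply, smashLeft_tmul, dualMul_counit]

theorem inl_mul_inl (f g : Module.Dual k C) :
    inl k H B C f * inl k H B C g = inl k H B C (dualMul k C f g) := by
  change smashLeft k B C f (smashRight k H B C 1 (g ⊗ₜ 1)) = dualMul k C f g ⊗ₜ 1
  rw [smashRight_one, Module.End.one_apply, smashLeft_tmul]

theorem inl_counit : inl k H B C counit = 1 := rfl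

theorem inr_one : inr k H B C 1 = 1 := rfl

theorem inr_mul_inl (b : B) (f : Module.Dual k C) :
    inr k H B C b * inl k H B C f = LinearMap.mul' k (Smash k H B C) (TensorProduct.map
      (inl k H B C ∘ₗ (hit k H C).flip f) (inr k H B C) (coact (k := k) b)) := by
  change smashLeft k B C counit (smashRight k H B C b (f ⊗ₜ 1)) = _
  rw [smashLeft_counit, Module.End.one_apply, smashRight, LinearMap.comp_apply]
  induction coact (k := k) (H := H) b with
  | zero => simp; rfl
  | add s t hs ht => simp only [map_add, LinearMap.add_apply, hs, ht]; rfl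
  | tmul h b =>
    rw [TensorProduct.map_tmul, LinearMap.mul'_apply, LinearMap.comp_apply, inl_mul_inr]
    simp [smk]; rfl

theorem inr_mul_inr (b c : B) :
    inr k H B C b * inr k H B C c = inr k H B C (b * c) := by
  change smashLeft k B C counit (smashRight k H B C b (counit ⊗ₜ c)) = counit ⊗ₜ (b * c)
  rw [smashLeft_counit, Module.End.one_apply, smashRight, LinearMap.comp_apply]
  conv_rhs => rw [← counit_coact (k := k) (H := H) b]
  induction coact (k := k) (H := H) b with
  | zero => simp
  | add s t hs ht => simp only [map_add, LinearMap.add_apply, add_mul, tmul_add, hs, ht]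
  | tmul h b => simp [hit_counit, smul_tmul']

theorem smash_induction {P : Smash k H B C → Prop} (hadd : ∀ x y, P x → P y → P (x + y))
    (hmul : ∀ f b, P (inl k H B C f * inr k H B C b)) (x : Smash k H B C) : P x := by
  have hz : P 0 := by simpa using hmul 0 0
  exact TensorProduct.induction_on (motive := P) x hz
    (fun f b => by have h := hmul f b; rw [inl_mul_inr] at h; exact h) hadd

variable (k H B C) in
/-- `b ↦ ε # b` as an algebra map. -/
def inrAlg : B →ₐ[k] Smash k H B C :=
  AlgHom.ofLinearMap (inr k H B C) inr_one fun b c => (inr_mul_inr b c).symm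

@[simp] theorem inrAlg_apply (b : B) : inrAlg k H B C b = inr k H B C b := rfl

section Lift

variable {R : Type*} [Ring R] [Algebra k R]

/-- The algebra map `f # b ↦ u(f) v(b)`. -/
def liftAlg (u : Module.Dual k C →ₗ[k] R) (v : B →ₗ[k] R)
    (hu₁ : u counit = 1) (hu : ∀ f g, u (dualMul k C f g) = u f * u g)
    (hv₁ : v 1 = 1) (hv : ∀ b c, v (b * c) = v b * v c)
    (h : ∀ b f, v b * u f = LinearMap.mul' k R
      (TensorProduct.map (u ∘ₗ (hit k H C).flip f) v (coact (k := k) b))) :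
    Smash k H B C →ₐ[k] R :=
  let F : Smash k H B C →ₗ[k] R := LinearMap.mul' k R ∘ₗ TensorProduct.map u v
  have hF : ∀ f b, F (inl k H B C f * inr k H B C b) = u f * v b := fun f b => by
    rw [inl_mul_inr]
    exact (congrArg (LinearMap.mul' k R) (TensorProduct.map_tmul u v f b)).trans
      (LinearMap.mul'_apply ..)
  have hl : ∀ f x, F (inl k H B C f * x) = u f * F x := fun f x => by
    induction x using smash_induction with
    | hadd x y hx hy => simp only [mul_add, map_add, hx, hy]
    | hmul g b => rw [← mul_assoc, inl_mul_inl, hF, hF, hu, mul_assoc]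
  have hr : ∀ x b, F (x * inr k H B C b) = F x * v b := fun x b => by
    induction x using smash_induction with
    | hadd x y hx hy => simp only [add_mul, map_add, hx, hy]
    | hmul g c => rw [mul_assoc, inr_mul_inr, hF, hF, hv, mul_assoc]
  -- The straightening rule `inr_mul_inl` is the only relation between the two factors, and `h` is
  -- its image in `R`.
  have hm : ∀ b g, F (inr k H B C b * inl k H B C g) = v b * u g := fun b g => by
    rw [inr_mul_inl, h]
    induction coact (k := k) (H := H) b with
    | zero => simp
    | add s t hs ht => simp only [map_add, hs, ht]
    | tmul h b =>
      rw [TensorProduct.map_tmul, LinearMap.mul'_apply, LinearMap.comp_apply, hF,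
        TensorProduct.map_tmul, LinearMap.mul'_apply, LinearMap.comp_apply]
  AlgHom.ofLinearMap F
    (by
      have := hF counit 1
      rwa [inl_counit, inr_one, mul_one, hu₁, hv₁, mul_one] at this)
    (fun x y => by
      induction x using smash_induction with
      | hadd x x' hx hy => simp only [add_mul, map_add, hx, hy]
      | hmul f b =>
        induction y using smash_induction with
        | hadd x x' hx hy => simp only [mul_add, map_add, hx, hy]
        | hmul g c =>
          rw [mul_assoc, ← mul_assoc (inr k H B C b), hl, hr, hm, hF, hF]
          simp only [mul_assoc])

variable {u : Module.Dual k C →ₗ[k] R} {v : B →ₗ[k] R} {hu₁ : u counit = 1}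
  {hu : ∀ f g, u (dualMul k C f g) = u f * u g} {hv₁ : v 1 = 1}
  {hv : ∀ b c, v (b * c) = v b * v c}
  {h : ∀ b f, v b * u f = LinearMap.mul' k R
      (TensorProduct.map (u ∘ₗ (hit k H C).flip f) v (coact (k := k) b))}

theorem liftAlg_smk (f : Module.Dual k C) (b : B) :
    liftAlg u v hu₁ hu hv₁ hv h (smk k H B C f b) = u f * v b :=
  (congrArg (LinearMap.mul' k R) (TensorProduct.map_tmul u v f b)).trans
    (LinearMap.mul'_apply ..)

@[simp] theorem liftAlg_inl (f : Module.Dual k C) :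
    liftAlg u v hu₁ hu hv₁ hv h (inl k H B C f) = u f := by
  change liftAlg u v hu₁ hu hv₁ hv h (smk k H B C f 1) = u f
  rw [liftAlg_smk, hv₁, mul_one]

@[simp] theorem liftAlg_inr (b : B) : liftAlg u v hu₁ hu hv₁ hv h (inr k H B C b) = v b := by
  change liftAlg u v hu₁ hu hv₁ hv h (smk k H B C counit b) = v b
  rw [liftAlg_smk, hu₁, one_mul]

theorem smash_algHom_ext {F G : Smash k H B C →ₐ[k] R}
    (hl : ∀ f, F (inl k H B C f) = G (inl k H B C f))
    (hr : ∀ b, F (inr k H B C b) = G (inr k H B C b)) : F = G := by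
  ext x
  induction x using smash_induction with
  | hadd x y hx hy => simp only [map_add, hx, hy]
  | hmul f b => rw [map_mul, map_mul, hl, hr]

end Lift

section Pullback

variable {C' : Type*} [AddCommGroup C'] [Module k C'] [Coalgebra k C']
  [RightModuleCoalgebra k H C'] (p : C' →ₗ[k] C)
  (hc : ∀ x, comul (R := k) (p x) = TensorProduct.map p p (comul (R := k) x))
  (he : ∀ x, counit (R := k) (p x) = counit (R := k) x)
  (ha : ∀ x (h : H), p (act (k := k) x h) = act (k := k) (p x) h)

include hc in
omit [Bialgebra k H] [RightModuleCoalgebra k H C] [RightModuleCoalgebra k H C'] in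
theorem dualMul_comp (f g : Module.Dual k C) :
    dualMul k C f g ∘ₗ p = dualMul k C' (f ∘ₗ p) (g ∘ₗ p) := by
  ext x
  rw [LinearMap.comp_apply, dualMul, dualMul, transposeMul_apply, transposeMul_apply, hc]
  induction comul (R := k) x with
  | zero => simp
  | add s t hs ht => simp only [map_add, hs, ht]
  | tmul a b => simp

/-- The algebra map `f # b ↦ (f ∘ p) # b` induced by a map `p` of `H`-module coalgebras. -/
def smashPullback : Smash k H B C →ₐ[k] Smash k H B C' :=
  liftAlg (inl k H B C' ∘ₗ p.dualMap) (inr k H B C')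
    (by
      rw [LinearMap.comp_apply, ← inl_counit]
      congr 1
      ext x
      exact he x)
    (fun f g => by
      simp only [LinearMap.comp_apply, inl_mul_inl, LinearMap.dualMap_apply']
      rw [dualMul_comp p hc])
    inr_one (fun b c => (inr_mul_inr b c).symm)
    (fun b f => by
      rw [LinearMap.comp_apply, inr_mul_inl]
      congr 3
      ext h : 1
      simp only [LinearMap.comp_apply, LinearMap.flip_apply]
      congr 1
      ext x
      simp [hit_apply, ha])

theorem smashPullback_inl (f : Module.Dual k C) :
    smashPullback (B := B) p hc he ha (inl k H B C f) = inl k H B C' (f ∘ₗ p) :=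
  liftAlg_inl f

theorem smashPullback_inr (b : B) :
    smashPullback p hc he ha (inr k H B C b) = inr k H B C' b :=
  liftAlg_inr b

/-- As a linear map the pullback is `p* ⊗ id`, and over a field `- ⊗ B` preserves the injectivity of
`p*`. -/
theorem smashPullback_injective (hp : Function.Surjective p) :
    Function.Injective (smashPullback (B := B) p hc he ha) := by
  have h1 : Function.Injective (p.dualMap.rTensor B) :=
    Module.Flat.rTensor_preserves_injective_linearMap _
      (LinearMap.dualMap_injective_of_surjective hp)
  have h2 : ∀ x : Smash k H B C, smashPullback p hc he ha x = p.dualMap.rTensor B x := by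
    intro x
    induction x using smash_induction with
    | hadd x y hx hy =>
      rw [map_add, hx, hy]
      exact (map_add (p.dualMap.rTensor B) _ _).symm
    | hmul f b =>
      rw [map_mul, smashPullback_inl, smashPullback_inr, inl_mul_inr, inl_mul_inr]
      rfl
  intro x y hxy
  rw [h2, h2] at hxy
  exact h1 hxy

end Pullback

/-- `H` as a right module coalgebra over itself. -/
instance regularModuleCoalgebra : RightModuleCoalgebra k H H where
  act := LinearMap.mul k H
  act_one := mul_one
  act_mul x h h' := (mul_assoc x h h').symm
  comul_act x h := by
    rw [LinearMap.mul_apply', Bialgebra.comul_mul]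
    induction comul (R := k) x with
    | zero => simp
    | add s t hs ht => simp only [map_add, LinearMap.add_apply, add_mul, hs, ht]
    | tmul a b =>
      induction comul (R := k) h with
      | zero => simp
      | add s t hs ht => simp only [map_add, mul_add, hs, ht]
      | tmul c d => simp
  counit_act x h := by simp

@[simp] theorem act_regular (x h : H) : act (k := k) x h = x * h := rfl

end Smash

/-! ### Linear maps out of `C` as elements of a tensor product, and the map `∇` -/

section Hat

variable {k H B C : Type*} [Field k] [Ring H] [Bialgebra k H]
  [Ring B] [Algebra k B] [LeftComoduleAlgebra k H B]
  [AddCommGroup C] [Module k C] [Coalgebra k C] [RightModuleCoalgebra k H C]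
  [FiniteDimensional k C]
  {M N R R' : Type*} [AddCommGroup M] [Module k M] [AddCommGroup N] [Module k N]
  [Ring R] [Algebra k R] [Ring R'] [Algebra k R']

omit [Coalgebra k C] in
theorem hom_induction {P : (C →ₗ[k] M) → Prop} (hadd : ∀ f g, P f → P g → P (f + g))
    (hr : ∀ (f : Module.Dual k C) r, P (f.smulRight r)) (f : C →ₗ[k] M) : P f := by
  obtain ⟨t, rfl⟩ := (dualTensorHomEquiv k C M).surjective f
  induction t with
  | zero => simpa using hr 0 0
  | add s t hs ht => rw [map_add]; exact hadd _ _ hs ht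
  | tmul f r =>
    convert hr f r using 1
    ext x
    simp

variable (H B) in
/-- The element `∑ᵢ Ψ(xᵢ) ⊗ (fᵢ # 1)` of `M ⊗ (C* # B)`, for a basis `(xᵢ)` of `C` with dual basis
`(fᵢ)`. -/
def hat : (C →ₗ[k] M) →ₗ[k] M ⊗[k] Smash k H B C :=
  (inl k H B C).lTensor M ∘ₗ (TensorProduct.comm k (Module.Dual k C) M).toLinearMap ∘ₗ
    (dualTensorHomEquiv k C M).symm.toLinearMap

theorem hat_smulRight (f : Module.Dual k C) (r : M) :
    hat H B (f.smulRight r) = r ⊗ₜ inl k H B C f := by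
  have : f.smulRight r = dualTensorHomEquiv k C M (f ⊗ₜ r) := by
    ext x
    simp
  rw [this]
  simp only [hat, LinearMap.comp_apply, LinearEquiv.coe_coe, LinearEquiv.symm_apply_apply,
    TensorProduct.comm_tmul, LinearMap.lTensor_tmul]

omit [FiniteDimensional k C] in
theorem smulRight_conv (f g : Module.Dual k C) (r s : R) :
    f.smulRight r ⊚ g.smulRight s = (dualMul k C f g).smulRight (r * s) := by
  ext x
  rw [conv_apply, LinearMap.smulRight_apply, dualMul, transposeMul_apply]
  induction comul (R := k) x with
  | zero => simp
  | add s t hs ht => simp only [map_add, add_smul, hs, ht]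
  | tmul a b => simp [smul_smul, mul_comm]

omit [FiniteDimensional k C] [Bialgebra k H] [RightModuleCoalgebra k H C] [Ring H] in
theorem add_conv (f g h : C →ₗ[k] R) : (f + g) ⊚ h = f ⊚ h + g ⊚ h := by
  ext x
  simp [conv_apply, TensorProduct.map_add_left]

omit [FiniteDimensional k C] [Bialgebra k H] [RightModuleCoalgebra k H C] [Ring H] in
theorem conv_add (f g h : C →ₗ[k] R) : f ⊚ (g + h) = f ⊚ g + f ⊚ h := by
  ext x
  simp [conv_apply, TensorProduct.map_add_right]

/-- `C* # 1` carries the convolution product dual to the comultiplication of `C`, so multiplying in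
`R ⊗ (C* # 1)` amounts to convolving the corresponding maps `C → R`. This removes dual bases from
the computations. -/
theorem hat_conv (Ψ Ψ' : C →ₗ[k] R) :
    hat H B (Ψ ⊚ Ψ') = hat H B Ψ * hat H B Ψ' := by
  induction Ψ using hom_induction with
  | hadd f g hf hg => simp only [add_conv, map_add, add_mul, hf, hg]
  | hr f r =>
    induction Ψ' using hom_induction with
    | hadd f g hf hg => simp only [conv_add, map_add, mul_add, hf, hg]
    | hr g s =>
      rw [smulRight_conv, hat_smulRight, hat_smulRight, hat_smulRight,
        Algebra.TensorProduct.tmul_mul_tmul, inl_mul_inl]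

variable (k C R) in
theorem hat_convUnit : hat H B (convUnit k C R) = 1 := by
  have : convUnit k C R = (counit (R := k)).smulRight 1 := by
    ext x
    simp [convUnit, Algebra.algebraMap_eq_smul_one]
  rw [this, hat_smulRight, inl_counit, Algebra.TensorProduct.one_def]

theorem rTensor_hat (p : M →ₗ[k] N) (Ψ : C →ₗ[k] M) :
    p.rTensor (Smash k H B C) (hat H B Ψ) = hat H B (p ∘ₗ Ψ) := by
  induction Ψ using hom_induction with
  | hadd f g hf hg => simp only [LinearMap.comp_add, map_add, hf, hg]
  | hr f r =>
    have : p ∘ₗ f.smulRight r = f.smulRight (p r) := by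
      ext x
      simp
    rw [this, hat_smulRight, hat_smulRight, LinearMap.rTensor_tmul]

theorem lTensor_smashPullback_hat {C' : Type*} [AddCommGroup C'] [Module k C'] [Coalgebra k C']
    [RightModuleCoalgebra k H C'] [FiniteDimensional k C'] {p : C' →ₗ[k] C}
    {hc : ∀ x, comul (R := k) (p x) = TensorProduct.map p p (comul (R := k) x)}
    {he : ∀ x, counit (R := k) (p x) = counit (R := k) x}
    {ha : ∀ x (h : H), p (act (k := k) x h) = act (k := k) (p x) h} (Ψ : C →ₗ[k] M) :
    (smashPullback p hc he ha).toLinearMap.lTensor M (hat H B Ψ) = hat H B (Ψ ∘ₗ p) := by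
  induction Ψ using hom_induction with
  | hadd f g hf hg => simp only [LinearMap.add_comp, map_add, hf, hg]
  | hr f r =>
    have : f.smulRight r ∘ₗ p = (f ∘ₗ p).smulRight r := by
      ext x
      simp
    rw [this, hat_smulRight, hat_smulRight, LinearMap.lTensor_tmul, AlgHom.toLinearMap_apply,
      smashPullback_inl]

variable (H) in
/-- `shift H Ψ h x = Ψ(x ◁ h)` -/
def shift (Ψ : C →ₗ[k] M) : H →ₗ[k] C →ₗ[k] M :=
  LinearMap.llcomp k C C M Ψ ∘ₗ (act (k := k) (H := H) (C := C)).flip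

omit [FiniteDimensional k C] in
@[simp] theorem shift_apply (Ψ : C →ₗ[k] M) (h : H) (x : C) :
    shift H Ψ h x = Ψ (act (k := k) x h) := rfl

omit [FiniteDimensional k C] in
theorem shift_smulRight (f : Module.Dual k C) (r : M) (h : H) :
    shift H (f.smulRight r) h = (hit k H C h f).smulRight r := rfl

omit [FiniteDimensional k C] in
theorem shift_add (Ψ Ψ' : C →ₗ[k] M) : shift H (Ψ + Ψ') = shift H Ψ + shift H Ψ' := rfl

/-- Commuting `b` past the leg in `C*` makes `b₁` act on functionals. On the corresponding map `Ψ`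
this is a translation of the argument. -/
theorem one_tmul_inr_mul_hat (b : B) (Ψ : C →ₗ[k] R) :
    (1 ⊗ₜ inr k H B C b) * hat H B Ψ = LinearMap.mul' k (R ⊗[k] Smash k H B C)
      (TensorProduct.map (hat H B ∘ₗ shift H Ψ)
        ((TensorProduct.mk k R (Smash k H B C) 1) ∘ₗ inr k H B C) (coact (k := k) b)) := by
  induction Ψ using hom_induction with
  | hadd f g hf hg =>
    simp only [shift_add, LinearMap.comp_add, TensorProduct.map_add_left, map_add,
      LinearMap.add_apply, mul_add, hf, hg]
  | hr f r =>
    rw [hat_smulRight, Algebra.TensorProduct.tmul_mul_tmul, one_mul, inr_mul_inl]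
    induction coact (k := k) (H := H) b with
    | zero => simp
    | add s t hs ht => simp only [map_add, tmul_add, hs, ht]
    | tmul h b => simp [shift_smulRight, hat_smulRight]

/-- `h ↦ (h ⇀ f) # 1` -/
def hitInl (H B : Type*) [Ring H] [Bialgebra k H] [Ring B] [Algebra k B] [LeftComoduleAlgebra k H B]
    [RightModuleCoalgebra k H C] (f : Module.Dual k C) : H →ₗ[k] Smash k H B C :=
  inl k H B C ∘ₗ (hit k H C).flip f

omit [FiniteDimensional k C] in
@[simp] theorem hitInl_apply (f : Module.Dual k C) (h : H) :
    hitInl H B f h = inl k H B C (hit k H C h f) := rfl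

omit [FiniteDimensional k C] in
theorem hitInl_counit : hitInl H B (counit (R := k) (A := C)) = convUnit k H (Smash k H B C) := by
  ext h
  rw [hitInl_apply, hit_counit, map_smul, inl_counit, convUnit_apply,
    Algebra.algebraMap_eq_smul_one]

omit [FiniteDimensional k C] in
theorem hitInl_dualMul (f g : Module.Dual k C) :
    hitInl H B (dualMul k C f g) = hitInl H B f ⊚ hitInl H B g := by
  ext h
  rw [hitInl_apply, hit_dualMul, conv_apply]
  induction comul (R := k) h with
  | zero => simp
  | add s t hs ht => simp only [map_add, hs, ht]
  | tmul a b => simp [inl_mul_inl]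

omit [FiniteDimensional k C] in
theorem shift_hitInl (f : Module.Dual k C) (h : H) :
    shift H (hitInl H B f) h = hitInl H B (hit k H C h f) := by
  ext x
  rw [shift_apply, hitInl_apply, hitInl_apply, act_regular, hit_mul]

variable [FiniteDimensional k H]

omit [FiniteDimensional k C]

variable (k H B C) in
/-- The algebra map `f # b ↦ (f₍₁₎ # 1) ⊗ (f₍₂₎ # b)`, where `∑ f₍₁₎(x) f₍₂₎(h) = f(x ◁ h)`. -/
def nabla : Smash k H B C →ₐ[k] Smash k H B C ⊗[k] Smash k H B H :=
  liftAlg (hat H B ∘ₗ (LinearMap.llcomp k H (Module.Dual k C) (Smash k H B C) (inl k H B C)) ∘ₗ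
      (hit k H C).flip)
    (TensorProduct.mk k _ _ 1 ∘ₗ inr k H B H)
    ((congrArg (hat H B) hitInl_counit).trans (hat_convUnit ..))
    (fun f g => (congrArg (hat H B) (hitInl_dualMul f g)).trans (hat_conv ..))
    rfl
    (fun b c => by simp [inr_mul_inr])
    (fun b f => by
      refine (one_tmul_inr_mul_hat b (hitInl H B f)).trans ?_
      congr 3
      ext h : 1
      exact congrArg (hat H B) (shift_hitInl f h))

theorem nabla_inl (f : Module.Dual k C) : nabla k H B C (inl k H B C f) = hat H B (hitInl H B f) :=
  liftAlg_inl f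

theorem nabla_inr (b : B) : nabla k H B C (inr k H B C b) = 1 ⊗ₜ inr k H B H b :=
  liftAlg_inr b

theorem assoc_hat_tmul (r : M) (Ψ : H →ₗ[k] N) :
    TensorProduct.assoc k M N (Smash k H B H) (hat H B (TensorProduct.mk k M N r ∘ₗ Ψ)) =
      r ⊗ₜ hat H B Ψ := by
  induction Ψ using hom_induction with
  | hadd f g hf hg => simp only [LinearMap.comp_add, map_add, tmul_add, hf, hg]
  | hr f s =>
    have : TensorProduct.mk k M N r ∘ₗ f.smulRight s = f.smulRight (r ⊗ₜ s) := by
      ext x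
      simp
    rw [this, hat_smulRight, hat_smulRight, TensorProduct.assoc_tmul]

variable [FiniteDimensional k C]

/-- On `C* # 1` the map `∇` is dual to the action `C × H → C`. Applying it to the functional leg
therefore yields two nested coevaluations of `(x, h) ↦ Ψ(x ◁ h)`. -/
theorem lTensor_nabla_hat (Ψ : C →ₗ[k] M) :
    (nabla k H B C).toLinearMap.lTensor M (hat H B Ψ) =
      TensorProduct.assoc k M (Smash k H B C) (Smash k H B H)
        (hat H B (hat H B ∘ₗ shift H Ψ)) := by
  induction Ψ using hom_induction with
  | hadd f g hf hg => simp only [shift_add, LinearMap.comp_add, map_add, hf, hg]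
  | hr f r =>
    rw [hat_smulRight, LinearMap.lTensor_tmul, AlgHom.toLinearMap_apply, nabla_inl,
      ← assoc_hat_tmul]
    congr 2
    ext h
    simp [shift_smulRight, hat_smulRight]

end Hat

section NablaCoassoc

variable {k H B : Type*} [Field k] [Ring H] [Bialgebra k H] [FiniteDimensional k H]
  [Ring B] [Algebra k B] [LeftComoduleAlgebra k H B]

/-- Both sides are algebra maps, so generators suffice. On `H* # 1` the identity is dual to
associativity in `H`, and on `ε # B` both sides are `1 ⊗ 1 ⊗ b`. -/
theorem nabla_coassoc (a : Smash k H B H) :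
    (nabla k H B H).toLinearMap.lTensor _ (nabla k H B H a) =
      TensorProduct.assoc k _ _ _ ((nabla k H B H).toLinearMap.rTensor _ (nabla k H B H a)) := by
  have : (Algebra.TensorProduct.map (AlgHom.id k _) (nabla k H B H)).comp (nabla k H B H) =
      (Algebra.TensorProduct.assoc k k k (Smash k H B H) (Smash k H B H)
        (Smash k H B H)).toAlgHom.comp
      ((Algebra.TensorProduct.map (nabla k H B H) (AlgHom.id k _)).comp (nabla k H B H)) := by
    apply smash_algHom_ext
    · intro f
      have h1 := lTensor_nabla_hat (k := k) (H := H) (B := B) (C := H) (M := Smash k H B H)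
        (hitInl H B f)
      have h2 := rTensor_hat (H := H) (B := B) (C := H) (M := Smash k H B H)
        (N := Smash k H B H ⊗[k] Smash k H B H) (nabla k H B H).toLinearMap (hitInl H B f)
      simp only [AlgHom.comp_apply, nabla_inl]
      refine h1.trans ?_
      refine Eq.trans ?_ (congrArg (TensorProduct.assoc k (Smash k H B H) (Smash k H B H)
        (Smash k H B H)) h2).symm
      refine congrArg (TensorProduct.assoc k _ _ _) (congrArg (hat H B) ?_)
      ext h : 1
      rw [LinearMap.comp_apply, LinearMap.comp_apply, shift_hitInl, AlgHom.toLinearMap_apply,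
        hitInl_apply, nabla_inl]
    · intro b
      simp only [AlgHom.comp_apply, nabla_inr]
      simp [nabla_inr, Algebra.TensorProduct.one_def]
  exact DFunLike.congr_fun this a

end NablaCoassoc

end LeftPartialDual

end

open TensorProduct Coalgebra

noncomputable section

namespace LeftPartialDual

/-! ### Twisting a coassociative comultiplication -/

section Twist

variable {k A X : Type*} [Field k] [Ring A] [Algebra k A] [Ring X] [Algebra k X]

/-- The pentagon as a word identity among units. `j12`, `j23`, `j34` stand for the twist in
neighbouring legs, the other letters for its images under `∇`. Everything telescopes except one
commutation of twists in disjoint legs. -/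
theorem twist_pentagon {G : Type*} [Group G] (j12 j23 j34 a b c p q s t : G)
    (h : j12 * j34 = j34 * j12) :
    (j34 * ((p * a) * (j12 * b)⁻¹) * j34⁻¹) * (j12 * ((j34 * b) * (s * c)⁻¹) * j12⁻¹) =
      ((j34 * p) * (j23 * q)⁻¹) * (j23 * ((q * a) * (t * c)⁻¹) * j23⁻¹) *
        ((j23 * t) * (j12 * s)⁻¹) := by
  have h' : j34⁻¹ * (j12 * j34) = j12 := by rw [h]; group
  have h1 : (j34 * ((p * a) * (j12 * b)⁻¹) * j34⁻¹) * (j12 * ((j34 * b) * (s * c)⁻¹) * j12⁻¹) =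
      j34 * p * a * b⁻¹ * j12⁻¹ * (j34⁻¹ * (j12 * j34)) * b * c⁻¹ * s⁻¹ * j12⁻¹ := by
    group
  rw [h1, h']
  group

variable (k X) in
/-- `x ⊗ y ↦ x ⊗ (y ⊗ 1)` -/
def leg12 : X ⊗[k] X →ₐ[k] X ⊗[k] (X ⊗[k] X) :=
  Algebra.TensorProduct.map (AlgHom.id k X) Algebra.TensorProduct.includeLeft

variable (k X) in
/-- `x ⊗ y ↦ 1 ⊗ (x ⊗ y)` -/
def leg23 : X ⊗[k] X →ₐ[k] X ⊗[k] (X ⊗[k] X) := Algebra.TensorProduct.includeRight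

/-- `x ⊗ y ↦ ∇(x) ⊗ y` -/
def applyLeft (n : X →ₐ[k] X ⊗[k] X) (Y : Type*) [Ring Y] [Algebra k Y] :
    X ⊗[k] Y →ₐ[k] X ⊗[k] (X ⊗[k] Y) :=
  (Algebra.TensorProduct.assoc k k k X X Y).toAlgHom.comp
    (Algebra.TensorProduct.map n (AlgHom.id k Y))

/-- `x ⊗ y ↦ x ⊗ F(y)` -/
def applyRight (X : Type*) [Ring X] [Algebra k X] {Y Z : Type*} [Ring Y] [Algebra k Y] [Ring Z]
    [Algebra k Z] (F : Y →ₐ[k] Z) : X ⊗[k] Y →ₐ[k] X ⊗[k] Z :=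
  Algebra.TensorProduct.map (AlgHom.id k X) F

@[simp] theorem leg12_tmul (x y : X) : leg12 k X (x ⊗ₜ y) = x ⊗ₜ (y ⊗ₜ 1) := rfl

@[simp] theorem leg23_apply (x : X ⊗[k] X) : leg23 k X x = 1 ⊗ₜ x := rfl

@[simp] theorem applyLeft_tmul (n : X →ₐ[k] X ⊗[k] X) {Y : Type*} [Ring Y] [Algebra k Y] (x : X)
    (y : Y) : applyLeft n Y (x ⊗ₜ y) = TensorProduct.assoc k X X Y (n x ⊗ₜ y) := rfl

@[simp] theorem applyRight_tmul {Y Z : Type*} [Ring Y] [Algebra k Y] [Ring Z]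
    [Algebra k Z] (F : Y →ₐ[k] Z) (x : X) (y : Y) : applyRight X F (x ⊗ₜ y) = x ⊗ₜ F y := rfl

theorem applyRight_comp {Y Z W : Type*} [Ring Y] [Algebra k Y] [Ring Z]
    [Algebra k Z] [Ring W] [Algebra k W] (F : Y →ₐ[k] Z) (G : Z →ₐ[k] W) :
    (applyRight X G).comp (applyRight X F) = applyRight X (G.comp F) := by
  ext <;> simp

/-- This and the composition rules below describe `∇` in one leg combined with leg embeddings or
with `∇` in another leg. They show which of the twists arising in the pentagon coincide. -/
theorem applyLeft_applyLeft (n : X →ₐ[k] X ⊗[k] X)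
    (hn : (applyLeft n X).comp n = (applyRight X n).comp n) :
    (applyLeft n (X ⊗[k] X)).comp (applyLeft n X) =
      (applyRight X (applyLeft n X)).comp (applyLeft n X) := by
  have h1 : ∀ (s : X ⊗[k] X) (y : X), applyLeft n (X ⊗[k] X) (TensorProduct.assoc k X X X
      (s ⊗ₜ y)) = TensorProduct.assoc k X X (X ⊗[k] X) ((TensorProduct.assoc k (X ⊗[k] X) X X)
        ((TensorProduct.assoc k X X X).symm (applyLeft n X s) ⊗ₜ y)) := by
    intro s y
    induction s with
    | zero => simp
    | add s t hs ht => simp only [map_add, add_tmul, hs, ht]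
    | tmul x z => simp
  have h2 : ∀ (s : X ⊗[k] X) (y : X), applyRight X (applyLeft n X) (TensorProduct.assoc k X X X
      (s ⊗ₜ y)) = TensorProduct.assoc k X X (X ⊗[k] X) ((TensorProduct.assoc k (X ⊗[k] X) X X)
        ((TensorProduct.assoc k X X X).symm (applyRight X n s) ⊗ₜ y)) := by
    intro s y
    induction s with
    | zero => simp
    | add s t hs ht => simp only [map_add, add_tmul, hs, ht]
    | tmul x z =>
      simp only [TensorProduct.assoc_tmul, applyRight_tmul, applyLeft_tmul]
      induction n z with
      | zero => simp
      | add s t hs ht => simp only [map_add, tmul_add, add_tmul, hs, ht]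
      | tmul x z => simp
  apply AlgHom.toLinearMap_injective
  apply TensorProduct.ext'
  intro x y
  simp only [AlgHom.toLinearMap_apply, AlgHom.comp_apply, applyLeft_tmul]
  rw [h1, h2]
  have := DFunLike.congr_fun hn x
  simp only [AlgHom.comp_apply] at this
  rw [this]

theorem applyRight_applyLeft (n : X →ₐ[k] X ⊗[k] X) :
    (applyRight X (applyRight X n)).comp (applyLeft n X) =
      (applyLeft n (X ⊗[k] X)).comp (applyRight X n) := by
  apply AlgHom.toLinearMap_injective
  apply TensorProduct.ext'
  intro x y
  simp only [AlgHom.toLinearMap_apply, AlgHom.comp_apply, applyLeft_tmul, applyRight_tmul]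
  induction n x with
  | zero => simp
  | add s t hs ht => simp only [map_add, add_tmul, hs, ht]
  | tmul x z => simp

theorem applyRight_leg12 (n : X →ₐ[k] X ⊗[k] X) :
    (applyRight X (applyRight X n)).comp (leg12 k X) =
      (applyRight X (leg12 k X)).comp (leg12 k X) := by
  apply AlgHom.toLinearMap_injective
  apply TensorProduct.ext'
  intro x y
  simp [Algebra.TensorProduct.one_def]

theorem applyLeft_leg23 (n : X →ₐ[k] X ⊗[k] X) :
    (applyLeft n (X ⊗[k] X)).comp (leg23 k X) =
      Algebra.TensorProduct.includeRight.comp (leg23 k X) := by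
  apply AlgHom.toLinearMap_injective
  apply TensorProduct.ext'
  intro x y
  simp [Algebra.TensorProduct.one_def]

theorem applyLeft_leg12 (n : X →ₐ[k] X ⊗[k] X) :
    (applyLeft n (X ⊗[k] X)).comp (leg12 k X) =
      (applyRight X (leg12 k X)).comp (applyLeft n X) := by
  apply AlgHom.toLinearMap_injective
  apply TensorProduct.ext'
  intro x y
  simp only [AlgHom.toLinearMap_apply, AlgHom.comp_apply, applyLeft_tmul, leg12_tmul]
  induction n x with
  | zero => simp
  | add s t hs ht => simp only [map_add, add_tmul, hs, ht]
  | tmul a b => simp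

theorem applyRight_applyLeft_leg12 (n : X →ₐ[k] X ⊗[k] X) :
    (applyRight X (applyLeft n X)).comp (leg12 k X) =
      (applyRight X (leg12 k X)).comp (applyRight X n) := by
  apply AlgHom.toLinearMap_injective
  apply TensorProduct.ext'
  intro x y
  simp only [AlgHom.toLinearMap_apply, AlgHom.comp_apply, applyRight_tmul, leg12_tmul,
    applyLeft_tmul]
  congr 1
  induction n y with
  | zero => simp
  | add s t hs ht => simp only [map_add, add_tmul, hs, ht]
  | tmul a b => simp

theorem leg12_leg34_commute (s t : X ⊗[k] X) :
    Commute (applyRight X (leg12 k X) (leg12 k X s))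
      ((Algebra.TensorProduct.includeRight : _ →ₐ[k] X ⊗[k] (X ⊗[k] (X ⊗[k] X)))
        (leg23 k X t)) := by
  induction s with
  | zero =>
    rw [map_zero, map_zero]
    exact Commute.zero_left _
  | add s t hs ht =>
    rw [map_add, map_add]
    exact hs.add_left ht
  | tmul x y =>
    simp [Commute, SemiconjBy, leg12_tmul, applyRight_tmul, leg23_apply,
      Algebra.TensorProduct.tmul_mul_tmul, ← Algebra.TensorProduct.one_def]

/-- The map on units induced by an algebra map. -/
def umap {Y Z : Type*} [Ring Y] [Algebra k Y] [Ring Z] [Algebra k Z] (F : Y →ₐ[k] Z) : Yˣ →* Zˣ :=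
  Units.map F.toRingHom.toMonoidHom

theorem umap_val {Y Z : Type*} [Ring Y] [Algebra k Y] [Ring Z] [Algebra k Z] (F : Y →ₐ[k] Z)
    (u : Yˣ) : (umap F u : Z) = F u := rfl

theorem umap_inv_val {Y Z : Type*} [Ring Y] [Algebra k Y] [Ring Z] [Algebra k Z] (F : Y →ₐ[k] Z)
    (u : Yˣ) : (((umap F u)⁻¹ : Zˣ) : Z) = F ↑u⁻¹ := rfl

theorem umap_umap_eq {Y Z Z' W : Type*} [Ring Y] [Algebra k Y] [Ring Z] [Algebra k Z]
    [Ring Z'] [Algebra k Z'] [Ring W] [Algebra k W] {F : Y →ₐ[k] Z} {G : Z →ₐ[k] W}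
    {F' : Y →ₐ[k] Z'} {G' : Z' →ₐ[k] W} (h : G.comp F = G'.comp F') (u : Yˣ) :
    umap G (umap F u) = umap G' (umap F' u) :=
  Units.ext (DFunLike.congr_fun h (u : Y))

/-- The associator obtained by twisting a coassociative comultiplication. -/
def twistAssociator (n : X →ₐ[k] X ⊗[k] X) (J : (X ⊗[k] X)ˣ) : (X ⊗[k] (X ⊗[k] X))ˣ :=
  (umap (leg23 k X) J * umap (applyRight X n) J) *
    (umap (leg12 k X) J * umap (applyLeft n X) J)⁻¹

variable {n : X →ₐ[k] X ⊗[k] X} {J : (X ⊗[k] X)ˣ} {i : A →ₐ[k] X}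
  {Q : QuasiBialgebraData k A}

theorem lTensor_comul_twist {Δ : A →ₗ[k] A ⊗[k] A}
    (hΔ : ∀ a, TensorProduct.map i.toLinearMap i.toLinearMap (Δ a) = J * n (i a) * ↑J⁻¹)
    (t : A ⊗[k] A) :
    TensorProduct.map i.toLinearMap (TensorProduct.map i.toLinearMap i.toLinearMap)
      (Δ.lTensor A t) = leg23 k X J * applyRight X n
        (TensorProduct.map i.toLinearMap i.toLinearMap t) * leg23 k X ↑J⁻¹ := by
  induction t with
  | zero => simp
  | add s t hs ht => simp only [map_add, add_mul, mul_add, hs, ht]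
  | tmul x y => simp [hΔ]

/-- The last leg is an arbitrary algebra map `Y → Z`, so that the statement serves both for `Δ ⊗ id`
and for `Δ ⊗ id ⊗ id`. -/
theorem rTensor_comul_twist {Δ : A →ₗ[k] A ⊗[k] A} {Y Z : Type*} [Ring Y] [Algebra k Y] [Ring Z]
    [Algebra k Z] {j : Y →ₐ[k] Z}
    (hΔ : ∀ a, TensorProduct.map i.toLinearMap i.toLinearMap (Δ a) = J * n (i a) * ↑J⁻¹)
    (t : A ⊗[k] Y) :
    TensorProduct.map i.toLinearMap (TensorProduct.map i.toLinearMap j.toLinearMap)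
      (TensorProduct.assoc k A A Y (Δ.rTensor Y t)) =
      Algebra.TensorProduct.map (AlgHom.id k X)
        (Algebra.TensorProduct.includeLeft : X →ₐ[k] X ⊗[k] Z) J *
        applyLeft n Z (TensorProduct.map i.toLinearMap j.toLinearMap t) *
        Algebra.TensorProduct.map (AlgHom.id k X)
        (Algebra.TensorProduct.includeLeft : X →ₐ[k] X ⊗[k] Z) ↑J⁻¹ := by
  have h1 : ∀ (s : A ⊗[k] A) (y : Y), TensorProduct.map i.toLinearMap
      (TensorProduct.map i.toLinearMap j.toLinearMap) (TensorProduct.assoc k A A Y (s ⊗ₜ y)) =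
      Algebra.TensorProduct.assoc k k k X X Z
        (TensorProduct.map i.toLinearMap i.toLinearMap s ⊗ₜ j y) := by
    intro s y
    induction s with
    | zero => simp
    | add s t hs ht => simp only [map_add, add_tmul, hs, ht]
    | tmul x z => simp
  have h2 : ∀ s : X ⊗[k] X, Algebra.TensorProduct.map (AlgHom.id k X)
        (Algebra.TensorProduct.includeLeft : X →ₐ[k] X ⊗[k] Z) s =
        Algebra.TensorProduct.assoc k k k X X Z (s ⊗ₜ 1) := by
    intro s
    induction s with
    | zero => simp
    | add s t hs ht => simp only [map_add, add_tmul, hs, ht]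
    | tmul x z => simp
  induction t with
  | zero => simp
  | add s t hs ht => simp only [map_add, add_mul, mul_add, hs, ht]
  | tmul x y =>
    have h3 : ∀ (s : X ⊗[k] X) (z : Z), TensorProduct.assoc k X X Z (s ⊗ₜ z) =
      Algebra.TensorProduct.assoc k k k X X Z (s ⊗ₜ z) := fun _ _ => rfl
    rw [LinearMap.rTensor_tmul, h1, hΔ, h2, h2, TensorProduct.map_tmul, applyLeft_tmul, h3,
      ← map_mul, ← map_mul, Algebra.TensorProduct.tmul_mul_tmul,
      Algebra.TensorProduct.tmul_mul_tmul, one_mul, mul_one]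
    rfl

/-- Inside `X`, the two iterated comultiplications are conjugates of the same element by `J₂₃ (id ⊗
∇)(J)` and `J₁₂ (∇ ⊗ id)(J)`, and `φ` is the quotient of these units. Injectivity of `i` is
essential, as `J` need not come from `A ⊗ A`. -/
theorem twist_quasi_coassoc
    (hi : Function.Injective (TensorProduct.map i.toLinearMap
      (TensorProduct.map i.toLinearMap i.toLinearMap)))
    (hn : (applyLeft n X).comp n = (applyRight X n).comp n)
    (hΔ : ∀ a, TensorProduct.map i.toLinearMap i.toLinearMap (Q.comul a) = J * n (i a) * ↑J⁻¹)
    (hφ : TensorProduct.map i.toLinearMap (TensorProduct.map i.toLinearMap i.toLinearMap)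
      Q.associator = twistAssociator n J) (a : A) :
    Q.comul.lTensor A (Q.comul a) * Q.associator =
      Q.associator * TensorProduct.assoc k A A A (Q.comul.rTensor A (Q.comul a)) := by
  apply hi
  have hmul : ∀ s t, TensorProduct.map i.toLinearMap
      (TensorProduct.map i.toLinearMap i.toLinearMap) (s * t) = TensorProduct.map i.toLinearMap
      (TensorProduct.map i.toLinearMap i.toLinearMap) s * TensorProduct.map i.toLinearMap
      (TensorProduct.map i.toLinearMap i.toLinearMap) t :=
    map_mul (Algebra.TensorProduct.map i (Algebra.TensorProduct.map i i))
  have hn' := DFunLike.congr_fun hn (i a)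
  simp only [AlgHom.comp_apply] at hn'
  rw [hmul, hmul, hφ, lTensor_comul_twist hΔ, rTensor_comul_twist hΔ, hΔ, map_mul, map_mul,
    map_mul, map_mul, hn']
  have h1 : Algebra.TensorProduct.map (AlgHom.id k X)
    (Algebra.TensorProduct.includeLeft : X →ₐ[k] X ⊗[k] X) = leg12 k X := rfl
  rw [h1, twistAssociator]
  simp only [mul_inv_rev, Units.val_mul, umap_val, umap_inv_val, mul_assoc]
  have c : ∀ (F : X ⊗[k] X →ₐ[k] X ⊗[k] (X ⊗[k] X)) (z : X ⊗[k] (X ⊗[k] X)),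
      F ↑J⁻¹ * (F ↑J * z) = z := fun F z => by
    rw [← mul_assoc, ← map_mul, Units.inv_mul, map_one, one_mul]
  rw [c, c, c, c]

/-- All five factors of the pentagon are units of `X ⊗ X ⊗ X ⊗ X` built from `J`; written in these
letters the equation is `twist_pentagon`. -/
theorem twist_pentagon_eq
    (hi : Function.Injective (TensorProduct.map i.toLinearMap (TensorProduct.map i.toLinearMap
      (TensorProduct.map i.toLinearMap i.toLinearMap))))
    (hn : (applyLeft n X).comp n = (applyRight X n).comp n)
    (hΔ : ∀ a, TensorProduct.map i.toLinearMap i.toLinearMap (Q.comul a) = J * n (i a) * ↑J⁻¹)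
    (hφ : TensorProduct.map i.toLinearMap (TensorProduct.map i.toLinearMap i.toLinearMap)
      Q.associator = twistAssociator n J) :
    (Q.comul.lTensor A).lTensor A Q.associator *
        TensorProduct.assoc k A A (A ⊗[k] A) (Q.comul.rTensor (A ⊗[k] A) Q.associator) =
      (1 ⊗ₜ[k] Q.associator) *
        ((TensorProduct.assoc k A A A).toLinearMap ∘ₗ Q.comul.rTensor A).lTensor A Q.associator *
        (((TensorProduct.mk k A A).flip 1).lTensor A).lTensor A Q.associator := by
  set i2 := TensorProduct.map i.toLinearMap i.toLinearMap with hi2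
  set i3 := TensorProduct.map i.toLinearMap i2 with hi3
  set i4 := TensorProduct.map i.toLinearMap i3 with hi4
  apply hi
  have hmul : ∀ s t, i4 (s * t) = i4 s * i4 t :=
    map_mul (Algebra.TensorProduct.map i (Algebra.TensorProduct.map i
      (Algebra.TensorProduct.map i i)))
  let L := umap (applyRight X (leg12 k X))
  let R := umap (Algebra.TensorProduct.includeRight :
    X ⊗[k] (X ⊗[k] X) →ₐ[k] X ⊗[k] (X ⊗[k] (X ⊗[k] X)))
  let j12 := L (umap (leg12 k X) J)
  let j23 := R (umap (leg12 k X) J)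
  let j34 := R (umap (leg23 k X) J)
  let d1 := umap (applyLeft n (X ⊗[k] X))
  let d2 := umap (applyRight X (applyLeft n X))
  let d3 := umap (applyRight X (applyRight X n))
  let e1 := umap (applyLeft n X)
  let e2 := umap (applyRight X n)
  -- `k1` to `k5` identify the images of the five factors: a factor containing `Δ` becomes the
  -- `∇`-image of the associator conjugated by the twist in the two new legs.
  have k1 : i4 ((Q.comul.lTensor A).lTensor A Q.associator) =
      ↑(j34 * d3 (twistAssociator n J) * j34⁻¹) := by
    simp only [Units.val_mul, d3, umap_val, ← hφ]
    induction Q.associator with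
    | zero => simp
    | add s t hs ht => simp only [map_add, add_mul, mul_add, hs, ht]
    | tmul x u =>
      have := lTensor_comul_twist hΔ u
      simp only [hi4, LinearMap.lTensor_tmul, TensorProduct.map_tmul, hi3, hi2, this]
      simp only [j34, R, umap_val, umap_inv_val, Algebra.TensorProduct.includeRight_apply,
        applyRight_tmul, Algebra.TensorProduct.tmul_mul_tmul, one_mul, mul_one]
  have k2 : i4 (TensorProduct.assoc k A A (A ⊗[k] A) (Q.comul.rTensor (A ⊗[k] A) Q.associator)) =
      ↑(j12 * d1 (twistAssociator n J) * j12⁻¹) := by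
    have := rTensor_comul_twist (j := Algebra.TensorProduct.map i i) hΔ Q.associator
    refine this.trans ?_
    have h1 : Algebra.TensorProduct.map (AlgHom.id k X)
        (Algebra.TensorProduct.includeLeft : X →ₐ[k] X ⊗[k] (X ⊗[k] X)) =
        (applyRight X (leg12 k X)).comp (leg12 k X) := by
      apply AlgHom.toLinearMap_injective
      apply TensorProduct.ext'
      intro x y
      simp [Algebra.TensorProduct.one_def]
    rw [h1]
    simp only [Units.val_mul, d1, umap_val, ← hφ]
    rfl
  have k3 : i4 (1 ⊗ₜ[k] Q.associator) = ↑(R (twistAssociator n J)) := by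
    simp [hi4, R, umap_val, ← hφ]
  have k4 : i4 (((TensorProduct.assoc k A A A).toLinearMap ∘ₗ Q.comul.rTensor A).lTensor A
      Q.associator) = ↑(j23 * d2 (twistAssociator n J) * j23⁻¹) := by
    simp only [Units.val_mul, d2, umap_val, ← hφ]
    induction Q.associator with
    | zero => simp
    | add s t hs ht => simp only [map_add, add_mul, mul_add, hs, ht]
    | tmul x u =>
      have := rTensor_comul_twist (j := i) hΔ u
      simp only [hi4, LinearMap.lTensor_tmul, TensorProduct.map_tmul, hi3, hi2,
        LinearMap.comp_apply, LinearEquiv.coe_coe, this]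
      simp only [j23, R, umap_val, umap_inv_val, Algebra.TensorProduct.includeRight_apply,
        applyRight_tmul, Algebra.TensorProduct.tmul_mul_tmul, one_mul, mul_one]
      rfl
  have k5 : i4 ((((TensorProduct.mk k A A).flip 1).lTensor A).lTensor A Q.associator) =
      ↑(L (twistAssociator n J)) := by
    simp only [L, umap_val, ← hφ]
    induction Q.associator with
    | zero => simp
    | add s t hs ht => simp only [map_add, hs, ht]
    | tmul x u =>
      induction u with
      | zero => simp
      | add s t hs ht => simp only [map_add, tmul_add, hs, ht]
      | tmul y z => simp [hi4, hi3, hi2]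
  -- `m1` to `m5` expand the associator in the letters of `twist_pentagon`; coassociativity of `∇`
  -- is what makes letters from different factors agree.
  have m1 : d3 (twistAssociator n J) = (R (e2 J) * d3 (e2 J)) * (j12 * d3 (e1 J))⁻¹ := by
    simp only [twistAssociator, map_mul, map_inv]
    rw [show d3 (umap (leg23 k X) J) = R (e2 J) from umap_umap_eq rfl J,
      show d3 (umap (leg12 k X) J) = j12 from umap_umap_eq (applyRight_leg12 n) J]
  have m2 : d1 (twistAssociator n J) = (j34 * d3 (e1 J)) * (L (e1 J) * d1 (e1 J))⁻¹ := by
    simp only [twistAssociator, map_mul, map_inv]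
    rw [show d1 (umap (leg23 k X) J) = j34 from umap_umap_eq (applyLeft_leg23 n) J,
      show d1 (umap (leg12 k X) J) = L (e1 J) from umap_umap_eq (applyLeft_leg12 n) J,
      show d1 (umap (applyRight X n) J) = d3 (e1 J) from
        umap_umap_eq (applyRight_applyLeft n).symm J]
  have m3 : d2 (twistAssociator n J) = (R (e1 J) * d3 (e2 J)) * (L (e2 J) * d1 (e1 J))⁻¹ := by
    simp only [twistAssociator, map_mul, map_inv]
    rw [show d2 (umap (leg23 k X) J) = R (e1 J) from umap_umap_eq rfl J,
      show d2 (umap (leg12 k X) J) = L (e2 J) from umap_umap_eq (applyRight_applyLeft_leg12 n) J,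
      show d2 (umap (applyRight X n) J) = d3 (e2 J) from
        umap_umap_eq (by rw [applyRight_comp, applyRight_comp, hn]) J,
      show d2 (umap (applyLeft n X) J) = d1 (e1 J) from
        umap_umap_eq (applyLeft_applyLeft n hn).symm J]
  have m4 : L (twistAssociator n J) = (j23 * L (e2 J)) * (j12 * L (e1 J))⁻¹ := by
    simp only [twistAssociator, map_mul, map_inv]
    rw [show L (umap (leg23 k X) J) = j23 from umap_umap_eq rfl J]
  have m5 : R (twistAssociator n J) = (j34 * R (e2 J)) * (j23 * R (e1 J))⁻¹ := by
    simp only [twistAssociator, map_mul, map_inv]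
    rfl
  have hc : j12 * j34 = j34 * j12 := Units.ext (leg12_leg34_commute _ _)
  rw [hmul, hmul, hmul, k1, k2, k3, k4, k5, m1, m2, m3, m4, m5]
  simp only [← Units.val_mul]
  congr 1
  exact twist_pentagon _ _ _ _ _ _ _ _ _ _ hc

end Twist

end LeftPartialDual

end

open TensorProduct Coalgebra

noncomputable section

namespace LeftPartialDual

open LeftComoduleAlgebra RightModuleCoalgebra HopfAlgebra
open MappingSystem (inl inr antipodeInv)

/-! ### Recombining dual-basis sums -/

section BasisExpansion

variable {k H B C : Type*} [Field k] [Ring H] [Bialgebra k H]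
  [Ring B] [Algebra k B] [LeftComoduleAlgebra k H B]
  [AddCommGroup C] [Module k C] [Coalgebra k C] [RightModuleCoalgebra k H C]
  {V M N R : Type*} [AddCommGroup V] [Module k V] [AddCommGroup M] [Module k M]
  [AddCommGroup N] [Module k N] [Ring R] [Algebra k R]

/-- The sums over dual bases of `B` in the definitions of `Δ`, `φ` and `T` are expansions of `ζ`,
`ζbar` or of a map built from `ζbar`, and this identity absorbs them. -/
theorem sum_coord_smulRight [FiniteDimensional k M] (p : M →ₗ[k] N) (Ψ : V →ₗ[k] M) :
    ∑ i, ((Module.finBasis k M).coord i ∘ₗ Ψ).smulRight (p (Module.finBasis k M i)) = p ∘ₗ Ψ := by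
  ext x
  simp only [LinearMap.sum_apply, LinearMap.smulRight_apply, LinearMap.comp_apply,
    Module.Basis.coord_apply, ← map_smul, ← map_sum, Module.Basis.sum_repr]

theorem sum_smulRight_coord [FiniteDimensional k M] (Ψ : M →ₗ[k] N) :
    ∑ i, ((Module.finBasis k M).coord i).smulRight (Ψ (Module.finBasis k M i)) = Ψ := by
  ext x
  simp only [LinearMap.sum_apply, LinearMap.smulRight_apply,
    Module.Basis.coord_apply, ← map_smul, ← map_sum, Module.Basis.sum_repr]

theorem sum_comp_linearMap {ι : Type*} (s : Finset ι) (f : M →ₗ[k] V) (g : ι → V →ₗ[k] N) :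
    (∑ i ∈ s, g i) ∘ₗ f = ∑ i ∈ s, g i ∘ₗ f := by
  ext x
  simp [LinearMap.sum_apply]

theorem conv_sum {ι : Type*} (s : Finset ι) (f : C →ₗ[k] R) (g : ι → C →ₗ[k] R) :
    f ⊚ ∑ i ∈ s, g i = ∑ i ∈ s, f ⊚ g i := by
  classical
  induction s using Finset.induction_on with
  | empty => ext x; simp [conv_apply]
  | insert a s ha ih => rw [Finset.sum_insert ha, Finset.sum_insert ha, conv_add, ih]

theorem sum_conv {ι : Type*} (s : Finset ι) (f : C →ₗ[k] R) (g : ι → C →ₗ[k] R) :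
    (∑ i ∈ s, g i) ⊚ f = ∑ i ∈ s, g i ⊚ f := by
  classical
  induction s using Finset.induction_on with
  | empty => ext x; simp [conv_apply]
  | insert a s ha ih => rw [Finset.sum_insert ha, Finset.sum_insert ha, add_conv, ih]

theorem hat_mulRight [FiniteDimensional k C] (r : R) (Ψ : C →ₗ[k] R) :
    hat H B (LinearMap.mulRight k r ∘ₗ Ψ) = hat H B Ψ * (r ⊗ₜ 1) := by
  rw [← rTensor_hat]
  induction hat H B Ψ with
  | zero => simp
  | add s t hs ht => simp only [map_add, add_mul, hs, ht]
  | tmul a b => simp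

theorem hat_mulLeft [FiniteDimensional k C] (r : R) (Ψ : C →ₗ[k] R) :
    hat H B (LinearMap.mulLeft k r ∘ₗ Ψ) = (r ⊗ₜ 1) * hat H B Ψ := by
  rw [← rTensor_hat]
  induction hat H B Ψ with
  | zero => simp
  | add s t hs ht => simp only [map_add, mul_add, hs, ht]
  | tmul a b => simp

end BasisExpansion

/-! ### Basis-free forms of the comultiplication and the associator -/

section Formulas

variable {k H B C : Type*} [Field k] [Ring H] [HopfAlgebra k H] [Ring B]
    [Algebra k B] [LeftComoduleAlgebra k H B] [AddCommGroup C] [Module k C] [Coalgebra k C]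
    [RightModuleCoalgebra k H C] [FiniteDimensional k H] [FiniteDimensional k B]
    [FiniteDimensional k C] (D : MappingSystem k H B C)

omit [FiniteDimensional k H] in
-- The sum over `bᵢ` is the expansion of `ζ`, and `f₍₂₎` merges with it into a convolution on `H`,
-- pulled back along `γ`.
theorem comulLeft_eq (f : Module.Dual k C) :
    D.comulLeft f = hat H B ((hitInl H B f ⊚ (inr k H B C ∘ₗ D.ζ)) ∘ₗ D.γ) := by
  have key : ∀ t : Module.Dual k C ⊗[k] Module.Dual k H,
      (∑ i, TensorProduct.map ((smk k H B C).flip (Module.finBasis k B i))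
      (inl k H B C ∘ₗ D.γ.dualMap ∘ₗ
        (dualMul k H).flip (D.ζ.dualMap ((Module.finBasis k B).coord i)))) t =
      hat H B (((inl k H B C ∘ₗ dualTensorHom k H _ (TensorProduct.comm k _ _ t)) ⊚
        (inr k H B C ∘ₗ D.ζ)) ∘ₗ D.γ) := by
    intro t
    induction t with
    | zero =>
      have : (0 : H →ₗ[k] Smash k H B C) ⊚ (inr k H B C ∘ₗ D.ζ) = 0 := by
        ext x
        simp [conv_apply]
      simp [this]
    | add s t hs ht =>
      simp only [map_add, LinearMap.comp_add, add_conv, LinearMap.add_comp, hs, ht]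
    | tmul f g =>
      have h1 : inl k H B C ∘ₗ dualTensorHom k H _ (TensorProduct.comm k _ _ (f ⊗ₜ[k] g)) =
          g.smulRight (inl k H B C f) := by
        ext h
        simp
      rw [h1, ← sum_coord_smulRight (inr k H B C) D.ζ, conv_sum, LinearMap.sum_apply]
      simp only [smulRight_conv]
      rw [sum_comp_linearMap, map_sum]
      refine Finset.sum_congr rfl fun i _ => ?_
      have h2 : ∀ (u : Module.Dual k H) (r : Smash k H B C),
          u.smulRight r ∘ₗ D.γ = (u ∘ₗ D.γ).smulRight r := fun _ _ => rfl
      rw [h2, hat_smulRight, TensorProduct.map_tmul, inl_mul_inr]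
      rfl
  rw [MappingSystem.comulLeft, LinearMap.comp_apply, key]
  congr 3
  ext h : 1
  simp only [LinearMap.comp_apply, hitInl_apply]
  congr 1
  ext x
  rw [hit_apply, ← dualDistrib_transposeComul (act (k := k) (H := H) (C := C)) f x h]
  induction transposeComul (act (k := k) (H := H) (C := C)) f with
  | zero => simp
  | add s t hs ht => simp only [map_add, LinearMap.add_apply, hs, ht]
  | tmul f g => simp [mul_comm]

omit [FiniteDimensional k H] [FiniteDimensional k B] in
theorem comulRight_eq (b : B) :
    D.comulRight b = LinearMap.mul' k _ (TensorProduct.map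
      (hat H B ∘ₗ D.γ.lcomp k _ ∘ₗ shift H (inr k H B C ∘ₗ D.ζ))
      (TensorProduct.mk k _ _ 1 ∘ₗ inr k H B C) (coact (k := k) b)) := by
  rw [MappingSystem.comulRight, LinearMap.comp_apply]
  induction coact (k := k) (H := H) b with
  | zero => simp
  | add s t hs ht => simp only [map_add, hs, ht]
  | tmul h b =>
    rw [TensorProduct.map_tmul, LinearMap.mul'_apply, LinearMap.comp_apply, LinearMap.comp_apply,
      LinearMap.comp_apply, TensorProduct.mk_apply, LinearMap.sum_apply,
      ← sum_smulRight_coord ((LinearMap.lcomp k _ D.γ) (shift H (inr k H B C ∘ₗ D.ζ) h)), map_sum,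
      Finset.sum_mul]
    refine Finset.sum_congr rfl fun i _ => ?_
    rw [hat_smulRight, Algebra.TensorProduct.tmul_mul_tmul, mul_one, inl_mul_inr,
      TensorProduct.map_tmul]
    rfl

/-- `h ↦ ∑ᵢ (ε # ζbar(S⁻¹(γbar(xᵢ)) h)) ⊗ (fᵢ # 1)` -/
def associatorAux : H →ₗ[k] Smash k H B C ⊗[k] Smash k H B C :=
  hat H B ∘ₗ (antipodeInv k H ∘ₗ D.γbar).lcomp k _ ∘ₗ shift H (inr k H B C ∘ₗ D.ζbar)

/-- The sum over `j` is absorbed into the factor `ζbar` in the second leg and the sum over `i` into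
`associatorAux`. The comultiplication of `ζbar*(bᵢ*)` becomes the product `S⁻¹(γbar(x)) h` inside
`ζbar`. -/
theorem associator_eq : D.associator = TensorProduct.assoc k _ _ _ (hat H B
    (((TensorProduct.mk k (Smash k H B C) (Smash k H B C) 1 ∘ₗ inr k H B C ∘ₗ D.ζbar) ⊚
      associatorAux D) ∘ₗ (antipodeInv k H ∘ₗ D.γbar))) := by
  set s := antipodeInv k H ∘ₗ D.γbar with hs
  let P : B →ₗ[k] Smash k H B C ⊗[k] Smash k H B C := TensorProduct.mk k _ _ 1 ∘ₗ inr k H B C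
  have key : ∀ (x : Smash k H B C) (t : Module.Dual k H ⊗[k] Module.Dual k H),
      ∑ j, x ⊗ₜ[k] TensorProduct.map
        (LinearMap.mulLeft k (inr k H B C (Module.finBasis k B j)) ∘ₗ
          (inl k H B C ∘ₗ D.γbar.dualMap ∘ₗ (antipodeInv k H).dualMap))
        ((inl k H B C ∘ₗ D.γbar.dualMap ∘ₗ (antipodeInv k H).dualMap) ∘ₗ
          dualMul k H (D.ζbar.dualMap ((Module.finBasis k B).coord j))) t =
      TensorProduct.assoc k _ _ _ (hat H B (((P ∘ₗ D.ζbar) ⊚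
        ((TensorProduct.mk k (Smash k H B C) (Smash k H B C) x ∘ₗ inl k H B C ∘ₗ s.dualMap) ∘ₗ
          dualTensorHom k H _ (TensorProduct.comm k _ _ t))) ∘ₗ s)) := by
    intro x t
    induction t with
    | zero =>
      have : (P ∘ₗ D.ζbar) ⊚ (0 : H →ₗ[k] Smash k H B C ⊗[k] Smash k H B C) = 0 := by
        ext x
        simp [conv_apply]
      simp [this]
    | add s t hs ht =>
      simp only [map_add, LinearMap.comp_add, conv_add, LinearMap.add_comp, tmul_add,
        Finset.sum_add_distrib, hs, ht]
    | tmul u v =>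
      have h1 : (TensorProduct.mk k (Smash k H B C) (Smash k H B C) x ∘ₗ inl k H B C ∘ₗ
          s.dualMap) ∘ₗ dualTensorHom k H _ (TensorProduct.comm k _ _ (u ⊗ₜ[k] v)) =
          v.smulRight (x ⊗ₜ inl k H B C (u ∘ₗ s)) := by
        ext h
        simp
        rfl
      rw [h1, ← sum_coord_smulRight P D.ζbar, sum_conv]
      simp only [smulRight_conv]
      rw [sum_comp_linearMap, map_sum, map_sum]
      refine Finset.sum_congr rfl fun j _ => ?_
      have h2 : ∀ (u : Module.Dual k H) (r : Smash k H B C ⊗[k] Smash k H B C),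
          u.smulRight r ∘ₗ s = (u ∘ₗ s).smulRight r := fun _ _ => rfl
      rw [h2, hat_smulRight, TensorProduct.map_tmul,
        show P (Module.finBasis k B j) = 1 ⊗ₜ inr k H B C (Module.finBasis k B j) from rfl,
        Algebra.TensorProduct.tmul_mul_tmul, one_mul, TensorProduct.assoc_tmul]
      rfl
  simp only [MappingSystem.associator, key]
  rw [← map_sum, ← map_sum, ← sum_comp_linearMap, ← conv_sum]
  congr 4
  ext h : 1
  rw [LinearMap.sum_apply, associatorAux, LinearMap.comp_apply, LinearMap.comp_apply,
    LinearMap.lcomp_apply']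
  have h3 : shift H (inr k H B C ∘ₗ D.ζbar) h ∘ₗ s = inr k H B C ∘ₗ (shift H D.ζbar h ∘ₗ s) := rfl
  rw [h3, ← sum_coord_smulRight (inr k H B C), map_sum]
  refine Finset.sum_congr rfl fun i _ => ?_
  rw [hat_smulRight]
  simp only [LinearMap.comp_apply, TensorProduct.mk_apply]
  congr 2
  ext x
  rw [LinearMap.dualMap_apply', LinearMap.comp_apply, LinearMap.comp_apply]
  have := dualDistrib_transposeComul (LinearMap.mul k H)
    (D.ζbar.dualMap ((Module.finBasis k B).coord i)) (s x) h
  refine Eq.trans ?_ this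
  induction transposeComul (LinearMap.mul k H) (D.ζbar.dualMap ((Module.finBasis k B).coord i)) with
  | zero => simp
  | add s t hs ht => simp only [map_add, LinearMap.add_apply, hs, ht]
  | tmul f g => simp [mul_comm, hs]

end Formulas

end LeftPartialDual

end

open TensorProduct Coalgebra

noncomputable section

namespace LeftPartialDual

open LeftComoduleAlgebra RightModuleCoalgebra HopfAlgebra
open MappingSystem (inl inr antipodeInv)

/-- When `(∇ ⊗ id)(J) = 1 ⊗ J`, the last factor of the inverse is `J₂₃`. This is the case for the
twist used here, whose first leg lies in `B`. -/
theorem twistAssociator_val {k X : Type*} [Field k] [Ring X] [Algebra k X]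
    (n : X →ₐ[k] X ⊗[k] X) (J : (X ⊗[k] X)ˣ) (h : applyLeft n X J = 1 ⊗ₜ J.val) :
    (twistAssociator n J).val = leg23 k X J.val * applyRight X n J.val *
      leg23 k X J⁻¹.val * leg12 k X J⁻¹.val := by
  have h1 : umap (applyLeft n X) J = umap (leg23 k X) J := Units.ext h
  rw [twistAssociator, h1, mul_inv_rev, ← mul_assoc]
  rfl

/-! ### The embedding into `H* # B` and the twisted comultiplication -/

section Embedding

variable {k H B C : Type*} [Field k] [Ring H] [HopfAlgebra k H] [Ring B]
    [Algebra k B] [LeftComoduleAlgebra k H B] [AddCommGroup C] [Module k C] [Coalgebra k C]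
    [RightModuleCoalgebra k H C] {D : MappingSystem k H B C} (hD : D.IsPAMS)

/-- The embedding `f # b ↦ (f ∘ π) # b` of `C* # B` into `H* # B`. -/
def embed : Smash k H B C →ₐ[k] Smash k H B H :=
  smashPullback D.π hD.π_comul hD.π_counit hD.π_act

theorem embed_inl (f : Module.Dual k C) :
    embed hD (inl k H B C f) = inl k H B H (f ∘ₗ D.π) := smashPullback_inl ..

theorem embed_inr (b : B) : embed hD (inr k H B C b) = inr k H B H b := smashPullback_inr ..

theorem embed_comp_inr : (embed hD).toLinearMap ∘ₗ inr k H B C = inr k H B H := by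
  ext b
  exact embed_inr hD b

theorem embed_injective : Function.Injective (embed hD) :=
  smashPullback_injective _ _ _ _ hD.π_surjective

theorem embed_comp_hitInl (f : Module.Dual k C) :
    (embed hD).toLinearMap ∘ₗ hitInl H B f = hitInl H B (f ∘ₗ D.π) := by
  ext h
  simp only [LinearMap.comp_apply, hitInl_apply, AlgHom.toLinearMap_apply, embed_inl]
  congr 1
  ext x
  simp [hit_apply, hD.π_act]

include hD in
/-- `Ψ(ι(b) g) = b Ψ(g)` for `Ψ(g) = ∑ (g₁ ⇀ f) ζ(g₂)`. -/
theorem hitInl_conv_ζ_mul {C' : Type*} [AddCommGroup C'] [Module k C'] [Coalgebra k C']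
    [RightModuleCoalgebra k H C'] (f : Module.Dual k C') (b : B) (g : H) :
    (hitInl H B f ⊚ (inr k H B C' ∘ₗ D.ζ)) (D.ι b * g) =
      inr k H B C' b * (hitInl H B f ⊚ (inr k H B C' ∘ₗ D.ζ)) g := by
  rw [conv_apply, conv_apply, Bialgebra.comul_mul, hD.ι_coact]
  induction comul (R := k) g with
  | zero => simp
  | add s t hs ht => simp only [map_add, mul_add, hs, ht]
  | tmul g₁ g₂ =>
    rw [TensorProduct.map_tmul, LinearMap.mul'_apply, ← mul_assoc, hitInl_apply, inr_mul_inl]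
    induction coact (k := k) (H := H) b with
    | zero => simp
    | add s t hs ht => simp only [map_add, add_mul, hs, ht]
    | tmul h c =>
      simp [hD.ζ_mul, ← inr_mul_inr, hit_mul, mul_assoc]

variable [FiniteDimensional k H]

/-- The twist `∑ᵢ (ε # ζbar(eᵢ)) ⊗ (eᵢ* # 1)`, with `(eᵢ)` a basis of `H`. -/
def twist : (Smash k H B H ⊗[k] Smash k H B H)ˣ where
  val := hat H B (inr k H B H ∘ₗ D.ζbar)
  inv := hat H B (inr k H B H ∘ₗ D.ζ)
  val_inv := by
    rw [← hat_conv, ← hat_convUnit, ← comp_convUnit (inrAlg k H B H), ← hD.ζbar_conv_ζ, comp_conv]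
    rfl
  inv_val := by
    rw [← hat_conv, ← hat_convUnit, ← comp_convUnit (inrAlg k H B H), ← hD.ζ_conv_ζbar, comp_conv]
    rfl

theorem twist_val : (twist hD).val = hat H B (inr k H B H ∘ₗ D.ζbar) := rfl

theorem twist_inv : (twist hD)⁻¹.val = hat H B (inr k H B H ∘ₗ D.ζ) := rfl

variable [FiniteDimensional k B] [FiniteDimensional k C]

omit [FiniteDimensional k B] in
theorem map_embed_hat {A A' : Type*} [Ring A] [Algebra k A] [Ring A'] [Algebra k A']
    (j : A →ₐ[k] A') (Ψ : C →ₗ[k] A) :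
    TensorProduct.map j.toLinearMap (embed hD).toLinearMap (hat H B Ψ) =
      hat H B (j.toLinearMap ∘ₗ Ψ ∘ₗ D.π) := by
  have h : (embed hD).toLinearMap.lTensor A (hat H B Ψ) = hat H B (Ψ ∘ₗ D.π) :=
    lTensor_smashPullback_hat Ψ
  rw [← LinearMap.rTensor_comp_lTensor, LinearMap.comp_apply, h, rTensor_hat]

/-- The map `g ↦ ∑ (g₁ ⇀ f) ζ(g₂)` is left `B`-linear, so composing it with `γπ` puts `ζbar` in
front (`comp_γπ`). Under `hat` the three convolution factors are `J`, `∇(f)` and `J⁻¹`. -/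
theorem embed_comulLeft (f : Module.Dual k C) :
    TensorProduct.map (embed hD).toLinearMap (embed hD).toLinearMap (D.comulLeft f) =
      (twist hD).val * nabla k H B H (inl k H B H (f ∘ₗ D.π)) * (twist hD)⁻¹.val := by
  have h1 : (embed hD).toLinearMap ∘ₗ ((hitInl H B f ⊚ (inr k H B C ∘ₗ D.ζ)) ∘ₗ D.γ) ∘ₗ D.π =
      (hitInl H B (f ∘ₗ D.π) ⊚ (inr k H B H ∘ₗ D.ζ)) ∘ₗ D.γ ∘ₗ D.π := by
    rw [LinearMap.comp_assoc, ← LinearMap.comp_assoc, comp_conv, embed_comp_hitInl,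
      ← LinearMap.comp_assoc D.ζ, embed_comp_inr]
  rw [comulLeft_eq, map_embed_hat, h1, hD.comp_γπ _ (inr k H B H) (hitInl_conv_ζ_mul hD _),
    hat_conv, hat_conv, nabla_inl, twist_val, twist_inv, mul_assoc]

omit [FiniteDimensional k B] in
-- Moving `1 ⊗ b` past `J⁻¹` translates `ζ` by `b₁`. A translate of `ζ` is still left `B`-linear, so
-- `comp_γπ` accounts for the factor `J`.
theorem embed_comulRight (b : B) :
    TensorProduct.map (embed hD).toLinearMap (embed hD).toLinearMap (D.comulRight b) =
      (twist hD).val * nabla k H B H (inr k H B H b) * (twist hD)⁻¹.val := by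
  rw [comulRight_eq, nabla_inr, twist_inv, mul_assoc, one_tmul_inr_mul_hat]
  induction coact (k := k) (H := H) b with
  | zero => simp
  | add s t hs ht => simp only [map_add, mul_add, hs, ht]
  | tmul h c =>
    have hmul : ∀ s t, TensorProduct.map (embed hD).toLinearMap (embed hD).toLinearMap (s * t) =
      TensorProduct.map (embed hD).toLinearMap (embed hD).toLinearMap s *
      TensorProduct.map (embed hD).toLinearMap (embed hD).toLinearMap t :=
      map_mul (Algebra.TensorProduct.map (embed hD) (embed hD))
    have h1 : (embed hD).toLinearMap ∘ₗ (shift H (inr k H B C ∘ₗ D.ζ) h ∘ₗ D.γ) ∘ₗ D.π =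
        shift H (inr k H B H ∘ₗ D.ζ) h ∘ₗ D.γ ∘ₗ D.π := by
      ext x
      simp [embed_inr]
    have h2 : ∀ c g, shift H (inr k H B H ∘ₗ D.ζ) h (D.ι c * g) =
        inr k H B H c * shift H (inr k H B H ∘ₗ D.ζ) h g := by
      intro c g
      simp [inr_mul_inr, mul_assoc, hD.ζ_mul]
    simp only [TensorProduct.map_tmul, LinearMap.mul'_apply, LinearMap.comp_apply,
      LinearMap.lcomp_apply', TensorProduct.mk_apply]
    rw [hmul, map_embed_hat, h1, hD.comp_γπ _ (inr k H B H) h2, hat_conv, TensorProduct.map_tmul,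
      AlgHom.toLinearMap_apply, AlgHom.toLinearMap_apply, map_one, embed_inr, twist_val, mul_assoc]

theorem embed_comul (a : Smash k H B C) :
    TensorProduct.map (embed hD).toLinearMap (embed hD).toLinearMap (D.partialDual.comul a) =
      (twist hD).val * nabla k H B H (embed hD a) * (twist hD)⁻¹.val := by
  induction a using smash_induction with
  | hadd x y hx hy => simp only [map_add, mul_add, add_mul, hx, hy]
  | hmul f b =>
    have h1 : D.partialDual.comul (inl k H B C f * inr k H B C b) =
        D.comulLeft f * D.comulRight b := by
      rw [inl_mul_inr]
      rfl
    have hmul : ∀ s t, TensorProduct.map (embed hD).toLinearMap (embed hD).toLinearMap (s * t) =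
      TensorProduct.map (embed hD).toLinearMap (embed hD).toLinearMap s *
      TensorProduct.map (embed hD).toLinearMap (embed hD).toLinearMap t :=
      map_mul (Algebra.TensorProduct.map (embed hD) (embed hD))
    rw [h1, hmul, embed_comulLeft, embed_comulRight, map_mul, map_mul, embed_inl, embed_inr]
    simp only [mul_assoc, Units.inv_mul_cancel_left]

end Embedding

/-! ### The associator as a twist -/

section Associator

variable {k H B C : Type*} [Field k] [Ring H] [HopfAlgebra k H] [Ring B]
    [Algebra k B] [LeftComoduleAlgebra k H B] [AddCommGroup C] [Module k C] [Coalgebra k C]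
    [RightModuleCoalgebra k H C] {D : MappingSystem k H B C} (hD : D.IsPAMS)
    [FiniteDimensional k H]

include hD in
/-- If `Ψ(S⁻¹(ι(b)) g) = Ψ(g) p(b)` then `Ψ ∘ S⁻¹ ∘ γbar ∘ π = Ψ * (p ∘ ζ)`. -/
theorem comp_antipodeInv_γbarπ {R : Type*} [Ring R] [Algebra k R] (Ψ : H →ₗ[k] R) (p : B →ₗ[k] R)
    (h : ∀ b g, Ψ (antipodeInv k H (D.ι b) * g) = Ψ g * p b) :
    Ψ ∘ₗ (antipodeInv k H ∘ₗ D.γbar) ∘ₗ D.π = Ψ ⊚ (p ∘ₗ D.ζ) := by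
  ext x
  simp only [LinearMap.comp_apply]
  rw [hD.antipodeInv_γbar_π, conv_apply]
  induction comul (R := k) x with
  | zero => simp
  | add s t hs ht => simp only [map_add, hs, ht]
  | tmul u v => simp [h]

omit [AddCommGroup C] [Module k C] [Coalgebra k C] [RightModuleCoalgebra k H C] in
-- Applying `h` to the `B`-leg turns `∑ p(b₂) Ψ(S⁻¹(b₁)g)` into `∑ Ψ(b₂ S⁻¹(b₁) g) p(b₃)`, where `∑
-- b₂ S⁻¹(b₁) = ε(b)` collapses.
theorem coact_antipodeInv_mul {R : Type*} [Ring R] [Algebra k R] (Ψ : H →ₗ[k] R) (p : B →ₗ[k] R)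
    (h : ∀ b g, p b * Ψ g = LinearMap.mul' k R
      (TensorProduct.map (Ψ ∘ₗ LinearMap.mulRight k g) p (coact (k := k) b))) (b : B) (g : H) :
    LinearMap.mul' k R (TensorProduct.comm k R R (TensorProduct.map
      (Ψ ∘ₗ LinearMap.mulRight k g ∘ₗ antipodeInv k H) p (coact (k := k) b))) = Ψ g * p b := by
  let Y : H ⊗[k] (H ⊗[k] B) →ₗ[k] R := LinearMap.mul' k R ∘ₗ
    TensorProduct.map (Ψ ∘ₗ LinearMap.mulRight k g ∘ₗ LinearMap.mul' k H ∘ₗ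
      (TensorProduct.comm k H H).toLinearMap ∘ₗ (antipodeInv k H).rTensor H) p ∘ₗ
    (TensorProduct.assoc k H H B).symm.toLinearMap
  have h1 : ∀ t : H ⊗[k] B, LinearMap.mul' k R (TensorProduct.comm k R R (TensorProduct.map
      (Ψ ∘ₗ LinearMap.mulRight k g ∘ₗ antipodeInv k H) p t)) =
      Y ((coact (k := k) (H := H)).lTensor H t) := by
    intro t
    induction t with
    | zero => simp
    | add s t hs ht => simp only [map_add, hs, ht]
    | tmul u c =>
      simp only [TensorProduct.map_tmul, TensorProduct.comm_tmul, LinearMap.mul'_apply,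
        LinearMap.comp_apply, LinearMap.mulRight_apply, h, LinearMap.lTensor_tmul]
      induction coact (k := k) (H := H) c with
      | zero => simp
      | add s t hs ht => simp only [map_add, tmul_add, hs, ht]
      | tmul v d => simp [Y, mul_assoc]
  have h2 : ∀ t : H ⊗[k] B, Y (TensorProduct.assoc k H H B ((comul (R := k)).rTensor B t)) =
      Ψ g * p (TensorProduct.lid k B ((counit (R := k)).rTensor B t)) := by
    intro t
    induction t with
    | zero => simp
    | add s t hs ht => simp only [map_add, mul_add, hs, ht]
    | tmul u c =>
      have := MappingSystem.mul_antipodeInv_comul (k := k) u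
      simp only [Y, LinearMap.comp_apply, LinearMap.rTensor_tmul, LinearEquiv.coe_coe,
        LinearEquiv.symm_apply_apply, TensorProduct.map_tmul, this]
      simp
  rw [h1, ← LeftComoduleAlgebra.coassoc, h2, counit_coact]

include hD in
/-- If `p(b) Q(g) = ∑ Q(b₁ g) p(b₂)` then `κ = (p ∘ ζbar) * Q` satisfies
`κ(S⁻¹(ι(b)) g) = κ(g) p(b)`. -/
theorem ζbar_conv_antipodeInv_mul {R : Type*} [Ring R] [Algebra k R] (Q : H →ₗ[k] R)
    (p : B →ₐ[k] R)
    (h : ∀ b g, p b * Q g = LinearMap.mul' k R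
      (TensorProduct.map (Q ∘ₗ LinearMap.mulRight k g) p.toLinearMap (coact (k := k) b)))
    (b : B) (g : H) :
    ((p.toLinearMap ∘ₗ D.ζbar) ⊚ Q) (antipodeInv k H (D.ι b) * g) =
      ((p.toLinearMap ∘ₗ D.ζbar) ⊚ Q) g * p b := by
  rw [conv_apply, conv_apply, Bialgebra.comul_mul, MappingSystem.comul_antipodeInv, hD.ι_coact]
  induction comul (R := k) g with
  | zero => simp
  | add s t hs ht => simp only [map_add, add_mul, mul_add, hs, ht]
  | tmul g₁ g₂ =>
    have h1 := coact_antipodeInv_mul Q p.toLinearMap h b g₂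
    rw [TensorProduct.map_tmul, LinearMap.mul'_apply, mul_assoc]
    refine Eq.trans ?_ (congrArg (fun z => p (D.ζbar g₁) * z) h1)
    induction coact (k := k) (H := H) b with
    | zero => simp
    | add s t hs ht => simp only [map_add, add_mul, mul_add, hs, ht]
    | tmul h c => simp [hD.ζbar_antipodeInv_mul, mul_assoc]

/-- The embedding of `B` into the second factor of `(H* # B) ⊗ (H* # B)`. -/
def inrSnd (k H B C : Type*) [Field k] [Ring H] [HopfAlgebra k H] [Ring B]
    [Algebra k B] [LeftComoduleAlgebra k H B] [AddCommGroup C] [Module k C] [Coalgebra k C]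
    [RightModuleCoalgebra k H C] : B →ₐ[k] Smash k H B C ⊗[k] Smash k H B C :=
  Algebra.TensorProduct.includeRight.comp (inrAlg k H B C)

variable [FiniteDimensional k C]

/-- A translate of `ζbar` turns left multiplication by `S⁻¹(ι(c))` into right multiplication by `c`.
Composition with `S⁻¹γbarπ` therefore appends a factor `ζ`, which is `J⁻¹`. -/
theorem embed_associatorAux :
    TensorProduct.map (embed hD).toLinearMap (embed hD).toLinearMap ∘ₗ associatorAux D =
      LinearMap.mulRight k (twist hD)⁻¹.val ∘ₗ
        (hat H B ∘ₗ shift H (inr k H B H ∘ₗ D.ζbar)) := by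
  ext h : 1
  have h1 : (embed hD).toLinearMap ∘ₗ (shift H (inr k H B C ∘ₗ D.ζbar) h ∘ₗ
      (antipodeInv k H ∘ₗ D.γbar)) ∘ₗ D.π =
        shift H (inr k H B H ∘ₗ D.ζbar) h ∘ₗ (antipodeInv k H ∘ₗ D.γbar) ∘ₗ D.π := by
    ext x
    simp [embed_inr]
  have h2 : ∀ c g, shift H (inr k H B H ∘ₗ D.ζbar) h (antipodeInv k H (D.ι c) * g) =
      shift H (inr k H B H ∘ₗ D.ζbar) h g * inr k H B H c := by
    intro c g
    simp [inr_mul_inr, mul_assoc, hD.ζbar_antipodeInv_mul]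
  simp only [LinearMap.comp_apply, associatorAux, LinearMap.lcomp_apply']
  rw [map_embed_hat, h1, comp_antipodeInv_γbarπ hD _ (inr k H B H) h2, hat_conv]
  rfl

omit [FiniteDimensional k C] in
-- The first leg of `J` lies in `ε # B`, where `∇` is `1 ⊗ -`.
theorem applyLeft_twist : applyLeft (nabla k H B H) (Smash k H B H) (twist hD).val =
    1 ⊗ₜ (twist hD).val := by
  have h1 : applyLeft (nabla k H B H) (Smash k H B H) (twist hD).val =
      TensorProduct.assoc k _ _ _ ((nabla k H B H).toLinearMap.rTensor _ (twist hD).val) := rfl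
  have h2 : (nabla k H B H).toLinearMap ∘ₗ inr k H B H ∘ₗ D.ζbar =
      TensorProduct.mk k _ _ 1 ∘ₗ inr k H B H ∘ₗ D.ζbar := by
    ext x
    exact nabla_inr _
  rw [h1, twist_val, rTensor_hat, h2, assoc_hat_tmul]

variable [FiniteDimensional k B]

set_option maxHeartbeats 1000000 in
-- The pulled-back map to `X ⊗ X` is a convolution of three factors followed by right multiplication
-- by `J⁻¹`. The factor `ζbar` in the second leg gives `J₂₃`, `Q` gives `(id ⊗ ∇)(J)`, the `ζ`
-- appended by `S⁻¹γbarπ` gives `J₂₃⁻¹`, and the outer multiplication gives `J₁₂⁻¹`.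
theorem embed_associator :
    TensorProduct.map (embed hD).toLinearMap (TensorProduct.map (embed hD).toLinearMap
      (embed hD).toLinearMap) D.partialDual.associator =
      (twistAssociator (nabla k H B H) (twist hD)).val := by
  let E := Algebra.TensorProduct.map (embed hD) (embed hD)
  let Q : H →ₗ[k] Smash k H B H ⊗[k] Smash k H B H :=
    hat H B ∘ₗ shift H (inr k H B H ∘ₗ D.ζbar)
  have h0 : ∀ t : (Smash k H B C ⊗[k] Smash k H B C) ⊗[k] Smash k H B C,
      TensorProduct.map (embed hD).toLinearMap (TensorProduct.map (embed hD).toLinearMap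
        (embed hD).toLinearMap) (TensorProduct.assoc k _ _ _ t) = TensorProduct.assoc k _ _ _
          (TensorProduct.map E.toLinearMap (embed hD).toLinearMap t) := by
    intro t
    induction t with
    | zero => simp
    | add s t hs ht => simp only [map_add, hs, ht]
    | tmul u z =>
      induction u with
      | zero => simp
      | add s t hs ht => simp only [map_add, add_tmul, hs, ht]
      | tmul x y => simp [E]
  have h1 : E.toLinearMap ∘ₗ (TensorProduct.mk k (Smash k H B C) (Smash k H B C) 1 ∘ₗ
      inr k H B C ∘ₗ D.ζbar) = (inrSnd k H B H).toLinearMap ∘ₗ D.ζbar := by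
    ext x
    simp [E, inrSnd, embed_inr]
  have h2 : E.toLinearMap ∘ₗ associatorAux D = LinearMap.mulRight k (twist hD)⁻¹.val ∘ₗ Q :=
    embed_associatorAux hD
  have h3 : ∀ (f g : H →ₗ[k] Smash k H B H ⊗[k] Smash k H B H) r,
      f ⊚ (LinearMap.mulRight k r ∘ₗ g) = LinearMap.mulRight k r ∘ₗ (f ⊚ g) := by
    intro f g r
    ext x
    simp only [LinearMap.comp_apply, conv_apply]
    induction comul (R := k) x with
    | zero => simp
    | add s t hs ht => simp only [map_add, hs, ht]
    | tmul a b => simp [mul_assoc]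
  have hQ : ∀ b g, inrSnd k H B H b * Q g = LinearMap.mul' k _
      (TensorProduct.map (Q ∘ₗ LinearMap.mulRight k g) (inrSnd k H B H).toLinearMap
        (coact (k := k) b)) := by
    intro b g
    refine (one_tmul_inr_mul_hat b _).trans ?_
    have h : hat H B ∘ₗ shift H (shift H (inr k H B H ∘ₗ D.ζbar) g) =
        Q ∘ₗ LinearMap.mulRight k g := by
      ext x : 1
      simp only [LinearMap.comp_apply, Q]
      congr 1
      ext y
      simp [mul_assoc]
    rw [h]
    rfl
  have h5 : E.toLinearMap ∘ₗ (((TensorProduct.mk k (Smash k H B C) (Smash k H B C) 1 ∘ₗ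
      inr k H B C ∘ₗ D.ζbar) ⊚ associatorAux D) ∘ₗ (antipodeInv k H ∘ₗ D.γbar)) ∘ₗ D.π =
      LinearMap.mulRight k (twist hD)⁻¹.val ∘ₗ (((inrSnd k H B H).toLinearMap ∘ₗ D.ζbar) ⊚ Q ⊚
        ((inrSnd k H B H).toLinearMap ∘ₗ D.ζ)) := by
    rw [LinearMap.comp_assoc, ← LinearMap.comp_assoc, comp_conv, h1, h2, h3, LinearMap.comp_assoc,
      comp_antipodeInv_γbarπ hD _ (inrSnd k H B H).toLinearMap
        (ζbar_conv_antipodeInv_mul hD Q (inrSnd k H B H) hQ)]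
  have ha : ∀ x y : (Smash k H B H ⊗[k] Smash k H B H) ⊗[k] Smash k H B H,
      TensorProduct.assoc k _ _ _ (x * y) =
        TensorProduct.assoc k _ _ _ x * TensorProduct.assoc k _ _ _ y :=
    map_mul (Algebra.TensorProduct.assoc k k k (Smash k H B H) (Smash k H B H) (Smash k H B H))
  have h6 : TensorProduct.assoc k _ _ _ (hat H B ((inrSnd k H B H).toLinearMap ∘ₗ D.ζbar)) =
      leg23 k _ (twist hD).val := assoc_hat_tmul (k := k) (H := H) (B := B) 1 (inr k H B H ∘ₗ D.ζbar)
  have h7 : TensorProduct.assoc k _ _ _ (hat H B ((inrSnd k H B H).toLinearMap ∘ₗ D.ζ)) =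
      leg23 k _ (twist hD)⁻¹.val := assoc_hat_tmul (k := k) (H := H) (B := B) 1 (inr k H B H ∘ₗ D.ζ)
  have h8 : TensorProduct.assoc k _ _ _ (hat H B Q) =
      applyRight _ (nabla k H B H) (twist hD).val :=
    (lTensor_nabla_hat (k := k) (H := H) (B := B) (inr k H B H ∘ₗ D.ζbar)).symm
  have h9 : ∀ t : Smash k H B H ⊗[k] Smash k H B H,
      TensorProduct.assoc k _ _ _ (t ⊗ₜ (1 : Smash k H B H)) = leg12 k _ t := by
    intro t
    induction t with
    | zero => simp
    | add s t hs ht => simp only [map_add, add_tmul, hs, ht]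
    | tmul x y => simp
  have h10 := twistAssociator_val (nabla k H B H) (twist hD) (applyLeft_twist hD)
  rw [h10, ← h6, ← h7, ← h8, ← h9, ← ha, ← ha, ← ha, ← hat_conv, ← hat_conv, ← hat_mulRight, ← h5]
  have h11 := map_embed_hat hD E (((TensorProduct.mk k (Smash k H B C) (Smash k H B C) 1 ∘ₗ
      inr k H B C ∘ₗ D.ζbar) ⊚ associatorAux D) ∘ₗ (antipodeInv k H ∘ₗ D.γbar))
  have h12 : D.partialDual.associator = _ := associator_eq D
  rw [← h11, ← h0, h12]

end Associator

end LeftPartialDual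

end

open TensorProduct Coalgebra

noncomputable section

namespace LeftPartialDual

open LeftComoduleAlgebra RightModuleCoalgebra HopfAlgebra
open MappingSystem (inl inr antipodeInv)

theorem lTensor_lid_assoc {k A : Type*} [Field k] [Ring A] [Algebra k A] (e : A →ₐ[k] k)
    (t : (A ⊗[k] A) ⊗[k] A) :
    ((TensorProduct.lid k A).toLinearMap ∘ₗ e.toLinearMap.rTensor A).lTensor A
      (TensorProduct.assoc k A A A t) = ((Algebra.TensorProduct.rid k k A).toAlgHom.comp
        (Algebra.TensorProduct.map (AlgHom.id k A) e)).toLinearMap.rTensor A t := by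
  induction t with
  | zero => simp
  | add s t hs ht => simp only [map_add, hs, ht]
  | tmul u z =>
    induction u with
    | zero => simp
    | add s t hs ht => simp only [map_add, add_tmul, hs, ht]
    | tmul x y => simp [TensorProduct.smul_tmul']

/-! ### Counit axioms -/

section QuasiBialgebra

variable {k H B C : Type*} [Field k] [Ring H] [HopfAlgebra k H] [Ring B]
    [Algebra k B] [LeftComoduleAlgebra k H B] [AddCommGroup C] [Module k C] [Coalgebra k C]
    [RightModuleCoalgebra k H C] {D : MappingSystem k H B C} (hD : D.IsPAMS)

include hD in
-- Colinearity of `γ` with the counit applied to the first leg.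
theorem π_γ (x : C) : D.π (D.γ x) = x := by
  have h := congrArg (fun t => TensorProduct.lid k C ((counit (R := k)).rTensor C t)) (hD.γ_coact x)
  have h1 : ∀ t : H ⊗[k] H, TensorProduct.lid k C ((counit (R := k)).rTensor C
      (D.π.lTensor H t)) = D.π (TensorProduct.lid k H ((counit (R := k)).rTensor H t)) := by
    intro t
    induction t with
    | zero => simp
    | add s t hs ht => simp only [map_add, hs, ht]
    | tmul a b => simp
  have h2 : (counit (R := k) (A := H)) ∘ₗ D.γ = counit := by
    ext x
    exact hD.γ_counit x
  simp only [h1, rTensor_counit_comul, TensorProduct.lid_tmul, one_smul] at h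
  rw [h, ← LinearMap.comp_apply, ← LinearMap.rTensor_comp, h2, rTensor_counit_comul,
    TensorProduct.lid_tmul, one_smul]

include hD in
theorem π_one_act (h : H) : act (k := k) (D.π 1) h = D.π h := by
  rw [← hD.π_act, one_mul]

include hD in
theorem γbar_π_one : D.γbar (D.π 1) = 1 := by
  have h := LinearMap.congr_fun hD.γbarπ_eq 1
  rw [LinearMap.comp_apply, conv_apply, Bialgebra.comul_one, Algebra.TensorProduct.one_def] at h
  simpa [hD.ζ_one, hD.ι_one] using h

/-- The counit of the left partial dual as an algebra map. -/
def counitAlg : Smash k H B C →ₐ[k] k :=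
  liftAlg (Module.Dual.eval k C (D.π 1)) (counit ∘ₗ D.ι)
    (by simp [hD.π_counit])
    (fun f g => by
      simp only [Module.Dual.eval_apply, dualMul, transposeMul_apply]
      rw [hD.π_comul, Bialgebra.comul_one, Algebra.TensorProduct.one_def]
      simp)
    (by simp [hD.ι_one])
    (fun b c => by simp [hD.ι_mul])
    (fun b f => by
      have h1 : ∀ t : H ⊗[k] B, LinearMap.mul' k k (TensorProduct.map
          (Module.Dual.eval k C (D.π 1) ∘ₗ (hit k H C).flip f) (counit ∘ₗ D.ι) t) =
          f (D.π (TensorProduct.rid k H ((counit ∘ₗ D.ι).lTensor H t))) := by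
        intro t
        induction t with
        | zero => simp
        | add s t hs ht => simp only [map_add, hs, ht]
        | tmul h c => simp [hit_apply, π_one_act hD, mul_comm]
      rw [h1, hD.coact_counit, hD.π_ι]
      simp)

theorem counitAlg_inl (f : Module.Dual k C) : counitAlg hD (inl k H B C f) = f (D.π 1) :=
  liftAlg_inl f

theorem counitAlg_inr (b : B) : counitAlg hD (inr k H B C b) = counit (R := k) (D.ι b) :=
  liftAlg_inr b

theorem counitAlg_toLinearMap : (counitAlg hD).toLinearMap = D.counit := by
  ext x
  induction x using smash_induction with
  | hadd x y hx hy => rw [map_add, map_add, hx, hy]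
  | hmul f b =>
    rw [AlgHom.toLinearMap_apply, map_mul, counitAlg_inl, counitAlg_inr, inl_mul_inr]
    rfl

theorem map_embed_injective : Function.Injective
    (TensorProduct.map (embed hD).toLinearMap (embed hD).toLinearMap) :=
  TensorProduct.map_injective_of_flat_flat _ _ (embed_injective hD) (embed_injective hD)

theorem map_embed_injective₃ : Function.Injective
    (TensorProduct.map (embed hD).toLinearMap
      (TensorProduct.map (embed hD).toLinearMap (embed hD).toLinearMap)) :=
  TensorProduct.map_injective_of_flat_flat _ _ (embed_injective hD) (map_embed_injective hD)

theorem map_embed_injective₄ : Function.Injective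
    (TensorProduct.map (embed hD).toLinearMap (TensorProduct.map (embed hD).toLinearMap
      (TensorProduct.map (embed hD).toLinearMap (embed hD).toLinearMap))) :=
  TensorProduct.map_injective_of_flat_flat _ _ (embed_injective hD) (map_embed_injective₃ hD)

variable [FiniteDimensional k C]

omit D in
theorem lid_hat (g : Module.Dual k C) :
    TensorProduct.lid k (Smash k H B C) (hat H B g) = inl k H B C g := by
  induction g using hom_induction with
  | hadd f g hf hg => simp only [map_add, hf, hg]
  | hr f r =>
    have : (f.smulRight r : C →ₗ[k] k) = r • f := by
      ext x
      simp [mul_comm]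
    rw [hat_smulRight, TensorProduct.lid_tmul, this, map_smul]

theorem rid_counit_hat {M : Type*} [AddCommGroup M] [Module k M] (Ψ : C →ₗ[k] M) :
    TensorProduct.rid k M ((counitAlg hD).toLinearMap.lTensor M (hat H B Ψ)) = Ψ (D.π 1) := by
  induction Ψ using hom_induction with
  | hadd f g hf hg => simp only [map_add, LinearMap.add_apply, hf, hg]
  | hr f r =>
    rw [hat_smulRight]
    simp [counitAlg_inl]

variable [FiniteDimensional k H] [FiniteDimensional k B]

/-- The comultiplication of the left partial dual as an algebra map. -/
def comulAlg : Smash k H B C →ₐ[k] Smash k H B C ⊗[k] Smash k H B C :=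
  AlgHom.ofLinearMap D.comul
    -- Unitality and multiplicativity hold for `J ∇(-) J⁻¹` and descend along the injective map
    -- `embed ⊗ embed`.
    (map_embed_injective hD (by
      have h := embed_comul hD (1 : Smash k H B C)
      rw [map_one (embed hD), map_one (nabla k H B H), mul_one, Units.mul_inv] at h
      refine h.trans ?_
      exact (map_one (Algebra.TensorProduct.map (embed hD) (embed hD))).symm))
    (fun a b => map_embed_injective hD (by
      have hmul := map_mul (Algebra.TensorProduct.map (embed hD) (embed hD)) (D.comul a) (D.comul b)
      refine Eq.trans ?_ hmul.symm
      have h1 := embed_comul hD (a * b)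
      have h2 := embed_comul hD a
      have h3 := embed_comul hD b
      refine h1.trans ?_
      refine Eq.trans ?_ (congrArg₂ (· * ·) h2 h3).symm
      simp only [map_mul, mul_assoc, Units.inv_mul_cancel_left]))

omit [FiniteDimensional k B] [FiniteDimensional k C] [FiniteDimensional k H] in
include hD in
-- `comp_γπ` gives `ζγπ = ζbar * ζ = ε`. This normalisation makes each half of `Δ` send the unit to
-- `1`.
theorem inr_ζ_γ : (inr k H B C ∘ₗ D.ζ) ∘ₗ D.γ = convUnit k C (Smash k H B C) := by
  have h : D.ζ ∘ₗ D.γ ∘ₗ D.π = convUnit k H B := by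
    rw [hD.comp_γπ D.ζ LinearMap.id hD.ζ_mul, LinearMap.id_comp, hD.ζbar_conv_ζ]
  ext x
  obtain ⟨x, rfl⟩ := hD.π_surjective x
  have hx := LinearMap.congr_fun h x
  simp only [LinearMap.comp_apply] at hx ⊢
  rw [hx, convUnit_apply, convUnit_apply, hD.π_counit]
  exact (inrAlg k H B C).commutes _

theorem comulAlg_inl (f : Module.Dual k C) : comulAlg hD (inl k H B C f) =
    hat H B ((hitInl H B f ⊚ (inr k H B C ∘ₗ D.ζ)) ∘ₗ D.γ) := by
  have h1 : D.comulRight 1 = 1 := by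
    have h2 : shift H (inr k H B C ∘ₗ D.ζ) 1 ∘ₗ D.γ = convUnit k C (Smash k H B C) := by
      rw [← inr_ζ_γ hD]
      ext x
      simp
    rw [comulRight_eq, coact_one, Algebra.TensorProduct.one_def, TensorProduct.map_tmul,
      LinearMap.mul'_apply]
    simp only [LinearMap.comp_apply, LinearMap.lcomp_apply', TensorProduct.mk_apply, h2,
      hat_convUnit, inr_one]
    rw [← Algebra.TensorProduct.one_def, one_mul]
  have h2 : comulAlg hD (inl k H B C f) = D.comulLeft f * D.comulRight 1 := rfl
  rw [h2, h1, mul_one, comulLeft_eq]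

theorem comulAlg_inr (b : B) : comulAlg hD (inr k H B C b) =
    LinearMap.mul' k _ (TensorProduct.map
      (hat H B ∘ₗ D.γ.lcomp k _ ∘ₗ shift H (inr k H B C ∘ₗ D.ζ))
      (TensorProduct.mk k _ _ 1 ∘ₗ inr k H B C) (coact (k := k) b)) := by
  have h1 : D.comulLeft counit = 1 := by
    rw [comulLeft_eq, hitInl_counit, unit_conv, inr_ζ_γ hD, hat_convUnit]
  have h2 : comulAlg hD (inr k H B C b) = D.comulLeft counit * D.comulRight b := rfl
  rw [h2, h1, one_mul, comulRight_eq]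

omit [FiniteDimensional k B] [FiniteDimensional k C] [FiniteDimensional k H] in
theorem counitAlg_comp_hitInl (f : Module.Dual k C) :
    (counitAlg hD).toLinearMap ∘ₗ hitInl H B f = f ∘ₗ D.π := by
  ext h
  simp [counitAlg_inl, hit_apply, π_one_act hD]

omit [FiniteDimensional k B] [FiniteDimensional k C] [FiniteDimensional k H] in
theorem counitAlg_comp_inr_ζ :
    (counitAlg hD).toLinearMap ∘ₗ inr k H B C ∘ₗ D.ζ = convUnit k H k := by
  ext h
  simp [counitAlg_inr, hD.ζ_counit, convUnit_apply]

/-- The counit axioms do not follow from the twist, as `∇` is `1 ⊗ -` on `ε # B`. Both sides are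
algebra maps, so they are compared on the generators `f # 1` and `ε # b`. -/
theorem counit_comulAlg (a : Smash k H B C) : TensorProduct.lid k _
    ((counitAlg hD).toLinearMap.rTensor _ (comulAlg hD a)) = a := by
  have key : ((Algebra.TensorProduct.lid k (Smash k H B C)).toAlgHom.comp
      (Algebra.TensorProduct.map (counitAlg hD) (AlgHom.id k _))).comp (comulAlg hD) =
      AlgHom.id k _ := by
    apply smash_algHom_ext
    · intro f
      have h1 : (counitAlg hD).toLinearMap ∘ₗ (hitInl H B f ⊚ (inr k H B C ∘ₗ D.ζ)) ∘ₗ D.γ = f := by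
        rw [← LinearMap.comp_assoc, comp_conv, counitAlg_comp_hitInl, counitAlg_comp_inr_ζ,
          conv_unit]
        ext x
        simp [π_γ hD]
      have h2 := rTensor_hat (H := H) (B := B) (counitAlg hD).toLinearMap
        ((hitInl H B f ⊚ (inr k H B C ∘ₗ D.ζ)) ∘ₗ D.γ)
      rw [AlgHom.comp_apply, comulAlg_inl]
      refine (congrArg (TensorProduct.lid k _) h2).trans ?_
      rw [h1, lid_hat]
      rfl
    · intro b
      have hmul := map_mul ((Algebra.TensorProduct.lid k (Smash k H B C)).toAlgHom.comp
        (Algebra.TensorProduct.map (counitAlg hD) (AlgHom.id k _)))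
      rw [AlgHom.comp_apply, comulAlg_inr, AlgHom.id_apply]
      conv_rhs => rw [← counit_coact (k := k) (H := H) b]
      induction coact (k := k) (H := H) b with
      | zero => simp
      | add s t hs ht => simp only [map_add, hs, ht]
      | tmul h c =>
        have h1 : (counitAlg hD).toLinearMap ∘ₗ (shift H (inr k H B C ∘ₗ D.ζ) h ∘ₗ D.γ) =
            counit (R := k) h • counit := by
          ext x
          simp [counitAlg_inr, hD.ζ_counit, hD.γ_counit, mul_comm]
        have h2 := rTensor_hat (H := H) (B := B) (counitAlg hD).toLinearMap
          (shift H (inr k H B C ∘ₗ D.ζ) h ∘ₗ D.γ)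
        rw [TensorProduct.map_tmul, LinearMap.mul'_apply, hmul]
        have h3 : ((Algebra.TensorProduct.lid k (Smash k H B C)).toAlgHom.comp
            (Algebra.TensorProduct.map (counitAlg hD) (AlgHom.id k _)))
            (hat H B (shift H (inr k H B C ∘ₗ D.ζ) h ∘ₗ D.γ)) =
            counit (R := k) h • 1 := by
          refine (congrArg (TensorProduct.lid k _) h2).trans ?_
          rw [h1, lid_hat, map_smul, inl_counit]
        refine (congrArg (· * _) h3).trans ?_
        simp
  exact DFunLike.congr_fun key a

theorem comulAlg_counit (a : Smash k H B C) : TensorProduct.rid k _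
    ((counitAlg hD).toLinearMap.lTensor _ (comulAlg hD a)) = a := by
  have key : ((Algebra.TensorProduct.rid k k (Smash k H B C)).toAlgHom.comp
      (Algebra.TensorProduct.map (AlgHom.id k _) (counitAlg hD))).comp (comulAlg hD) =
      AlgHom.id k _ := by
    apply smash_algHom_ext
    · intro f
      rw [AlgHom.comp_apply, comulAlg_inl]
      refine (rid_counit_hat hD _).trans ?_
      rw [LinearMap.comp_apply, hD.γ_one, conv_apply, Bialgebra.comul_one,
        Algebra.TensorProduct.one_def]
      simp [hD.ζ_one, inr_one, hit_one]
    · intro b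
      have hmul := map_mul ((Algebra.TensorProduct.rid k k (Smash k H B C)).toAlgHom.comp
        (Algebra.TensorProduct.map (AlgHom.id k _) (counitAlg hD)))
      rw [AlgHom.comp_apply, comulAlg_inr, AlgHom.id_apply]
      -- Rewriting `b` as `∑ ζ(b₁ ε(b₂))` brings it into the shape that the counit leaves after
      -- evaluating `ζ(γ(-) b₁)` at `π(1)`.
      have hb : inr k H B C b = inr k H B C (D.ζ (TensorProduct.rid k H
          ((counit ∘ₗ D.ι).lTensor H (coact (k := k) b)))) := by
        rw [hD.coact_counit, hD.ζ_ι]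
      rw [hb]
      induction coact (k := k) (H := H) b with
      | zero => simp
      | add s t hs ht => simp only [map_add, hs, ht]
      | tmul h c =>
        rw [TensorProduct.map_tmul, LinearMap.mul'_apply, hmul]
        have h3 : ((Algebra.TensorProduct.rid k k (Smash k H B C)).toAlgHom.comp
            (Algebra.TensorProduct.map (AlgHom.id k _) (counitAlg hD)))
            (hat H B (shift H (inr k H B C ∘ₗ D.ζ) h ∘ₗ D.γ)) = inr k H B C (D.ζ h) := by
          refine (rid_counit_hat hD _).trans ?_
          simp [hD.γ_one]
        refine (congrArg (· * _) h3).trans ?_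
        simp [counitAlg_inr]
  exact DFunLike.congr_fun key a

omit [FiniteDimensional k B] [FiniteDimensional k C] in
include hD in
theorem ζbar_antipodeInv_γbar (x : C) :
    D.ζbar (antipodeInv k H (D.γbar x)) = algebraMap k B (counit (R := k) x) := by
  obtain ⟨h, rfl⟩ := hD.π_surjective x
  have h1 := comp_antipodeInv_γbarπ hD D.ζbar LinearMap.id
    (fun b g => hD.ζbar_antipodeInv_mul b g)
  rw [LinearMap.id_comp, hD.ζbar_conv_ζ] at h1
  exact (LinearMap.congr_fun h1 h).trans (by rw [convUnit_apply, hD.π_counit])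

/-- In the middle leg the counit removes the factor `ζbar` and evaluates `associatorAux` at `π(1)`.
What is left is `ζbar S⁻¹ γbar`, which is the counit because `ζbar S⁻¹ γbar π = ζbar * ζ`. -/
theorem counit_associator :
    ((TensorProduct.lid k _).toLinearMap ∘ₗ (counitAlg hD).toLinearMap.rTensor _).lTensor
      (Smash k H B C) D.associator = 1 := by
  let F : Smash k H B C ⊗[k] Smash k H B C →ₐ[k] Smash k H B C :=
    (Algebra.TensorProduct.rid k k (Smash k H B C)).toAlgHom.comp
      (Algebra.TensorProduct.map (AlgHom.id k _) (counitAlg hD))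
  have h1 := lTensor_lid_assoc (counitAlg hD)
  have h2 : F.toLinearMap ∘ₗ TensorProduct.mk k (Smash k H B C) (Smash k H B C) 1 ∘ₗ
      inr k H B C ∘ₗ D.ζbar = convUnit k H _ := by
    ext h
    simp [F, counitAlg_inr, hD.counit_ζbar, convUnit_apply, Algebra.algebraMap_eq_smul_one]
  have h3 : F.toLinearMap ∘ₗ associatorAux D = inr k H B C ∘ₗ D.ζbar := by
    ext h
    refine (rid_counit_hat hD _).trans ?_
    simp [γbar_π_one hD]
  have h4 : (inr k H B C ∘ₗ D.ζbar) ∘ₗ (antipodeInv k H ∘ₗ D.γbar) =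
      convUnit k C (Smash k H B C) := by
    ext x
    simp only [LinearMap.comp_apply, ζbar_antipodeInv_γbar hD, convUnit_apply]
    exact (inrAlg k H B C).commutes _
  rw [associator_eq, h1, rTensor_hat, ← LinearMap.comp_assoc, comp_conv, h2, h3, unit_conv, h4,
    hat_convUnit]

variable (D) in
/-- The inverse of the associator. -/
def associatorInv : Smash k H B C ⊗[k] (Smash k H B C ⊗[k] Smash k H B C) :=
  TensorProduct.assoc k _ _ _ (hat H B
    (((hat H B ∘ₗ D.γ.lcomp k _ ∘ₗ shift H (inr k H B C ∘ₗ D.ζ)) ⊚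
      (TensorProduct.mk k (Smash k H B C) (Smash k H B C) 1 ∘ₗ inr k H B C ∘ₗ D.ζ)) ∘ₗ D.γ))

end QuasiBialgebra

end LeftPartialDual

end

open TensorProduct Coalgebra

noncomputable section

namespace LeftPartialDual

open LeftComoduleAlgebra RightModuleCoalgebra HopfAlgebra
open MappingSystem (inl inr antipodeInv)

theorem twistAssociator_inv_val {k X : Type*} [Field k] [Ring X] [Algebra k X]
    (n : X →ₐ[k] X ⊗[k] X) (J : (X ⊗[k] X)ˣ) (h : applyLeft n X J = 1 ⊗ₜ J.val) :
    (twistAssociator n J)⁻¹.val = leg12 k X J.val * leg23 k X J.val *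
      applyRight X n J⁻¹.val * leg23 k X J⁻¹.val := by
  have h1 : umap (applyLeft n X) J = umap (leg23 k X) J := Units.ext h
  rw [twistAssociator, h1, mul_inv_rev, inv_inv, mul_inv_rev, ← mul_assoc]
  rfl

theorem map_assoc {k A X : Type*} [Field k] [Ring A] [Algebra k A] [Ring X] [Algebra k X]
    (i : A →ₐ[k] X) (t : (A ⊗[k] A) ⊗[k] A) :
    TensorProduct.map i.toLinearMap (TensorProduct.map i.toLinearMap i.toLinearMap)
      (TensorProduct.assoc k _ _ _ t) = TensorProduct.assoc k _ _ _
        (TensorProduct.map (Algebra.TensorProduct.map i i).toLinearMap i.toLinearMap t) := by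
  induction t with
  | zero => simp
  | add s t hs ht => simp only [map_add, hs, ht]
  | tmul u z =>
    induction u with
    | zero => simp
    | add s t hs ht => simp only [map_add, add_tmul, hs, ht]
    | tmul x y => simp

theorem assoc_tmul_one {k X : Type*} [Field k] [Ring X] [Algebra k X] (t : X ⊗[k] X) :
    TensorProduct.assoc k X X X (t ⊗ₜ (1 : X)) = leg12 k X t := by
  induction t with
  | zero => simp
  | add s t hs ht => simp only [map_add, add_tmul, hs, ht]
  | tmul x y => simp

/-! ### The inverse associator and the quasi-bialgebra axioms -/

section

variable {k H B C : Type*} [Field k] [Ring H] [HopfAlgebra k H] [Ring B]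
    [Algebra k B] [LeftComoduleAlgebra k H B] [AddCommGroup C] [Module k C] [Coalgebra k C]
    [RightModuleCoalgebra k H C] {D : MappingSystem k H B C} (hD : D.IsPAMS)
    [FiniteDimensional k H] [FiniteDimensional k C]

theorem embed_comp_hat_shift_ζ :
    TensorProduct.map (embed hD).toLinearMap (embed hD).toLinearMap ∘ₗ
      (hat H B ∘ₗ D.γ.lcomp k _ ∘ₗ shift H (inr k H B C ∘ₗ D.ζ)) =
      LinearMap.mulLeft k (twist hD).val ∘ₗ (hat H B ∘ₗ shift H (inr k H B H ∘ₗ D.ζ)) := by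
  ext h : 1
  have h1 : (embed hD).toLinearMap ∘ₗ (shift H (inr k H B C ∘ₗ D.ζ) h ∘ₗ D.γ) ∘ₗ D.π =
      shift H (inr k H B H ∘ₗ D.ζ) h ∘ₗ D.γ ∘ₗ D.π := by
    ext x
    simp [embed_inr]
  have h2 : ∀ c g, shift H (inr k H B H ∘ₗ D.ζ) h (D.ι c * g) =
      inr k H B H c * shift H (inr k H B H ∘ₗ D.ζ) h g := by
    intro c g
    simp [inr_mul_inr, mul_assoc, hD.ζ_mul]
  simp only [LinearMap.comp_apply, LinearMap.lcomp_apply']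
  rw [map_embed_hat, h1, hD.comp_γπ _ (inr k H B H) h2, hat_conv]
  rfl

omit [FiniteDimensional k H] [FiniteDimensional k C] in
include hD in
-- Pushing `p(b)` through `Q` by `h` produces the two legs of `Δ(ι(b))`, and `ζ` absorbs the second.
-- This supplies the linearity that `comp_γπ` needs for the inverse associator.
theorem conv_ζ_ι_mul {R : Type*} [Ring R] [Algebra k R] (Q : H →ₗ[k] R)
    (p : B →ₐ[k] R)
    (h : ∀ b g, p b * Q g = LinearMap.mul' k R
      (TensorProduct.map (Q ∘ₗ LinearMap.mulRight k g) p.toLinearMap (coact (k := k) b)))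
    (b : B) (g : H) :
    (Q ⊚ (p.toLinearMap ∘ₗ D.ζ)) (D.ι b * g) = p b * (Q ⊚ (p.toLinearMap ∘ₗ D.ζ)) g := by
  rw [conv_apply, conv_apply, Bialgebra.comul_mul, hD.ι_coact]
  induction comul (R := k) g with
  | zero => simp
  | add s t hs ht => simp only [map_add, mul_add, hs, ht]
  | tmul g₁ g₂ =>
    rw [TensorProduct.map_tmul, LinearMap.mul'_apply, ← mul_assoc, h]
    induction coact (k := k) (H := H) b with
    | zero => simp
    | add s t hs ht => simp only [map_add, add_mul, hs, ht]
    | tmul h c => simp [hD.ζ_mul, mul_assoc]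

theorem inrSnd_mul_hat_shift (Ψ : H →ₗ[k] Smash k H B H) (b : B) (g : H) :
    inrSnd k H B H b * (hat H B ∘ₗ shift H Ψ) g = LinearMap.mul' k _
      (TensorProduct.map ((hat H B ∘ₗ shift H Ψ) ∘ₗ LinearMap.mulRight k g)
        (inrSnd k H B H).toLinearMap (coact (k := k) b)) := by
  refine (one_tmul_inr_mul_hat b _).trans ?_
  have h : hat H B ∘ₗ shift H (shift H Ψ g) = (hat H B ∘ₗ shift H Ψ) ∘ₗ LinearMap.mulRight k g := by
    ext x : 1
    simp only [LinearMap.comp_apply]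
    congr 1
    ext y
    simp [mul_assoc]
  rw [h]
  rfl

omit [FiniteDimensional k H] in
theorem conv_mulLeft_comp {R : Type*} [Ring R] [Algebra k R] (f g : H →ₗ[k] R) (r : R) :
    (LinearMap.mulLeft k r ∘ₗ f) ⊚ g = LinearMap.mulLeft k r ∘ₗ (f ⊚ g) := by
  ext x
  simp only [LinearMap.comp_apply, conv_apply]
  induction comul (R := k) x with
  | zero => simp
  | add s t hs ht => simp only [map_add, hs, ht]
  | tmul a b => simp [mul_assoc]

set_option maxHeartbeats 1000000 in
-- The mirror image of `embed_associator`: `comp_γπ` prepends `ζbar`, and the factors become `J₁₂`,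
-- `J₂₃`, `(id ⊗ ∇)(J⁻¹)` and `J₂₃⁻¹`. This also shows that the inverse of the twisted associator
-- lies in the image of the embedding.
theorem embed_associatorInv :
    TensorProduct.map (embed hD).toLinearMap (TensorProduct.map (embed hD).toLinearMap
      (embed hD).toLinearMap) (associatorInv D) =
      (twistAssociator (nabla k H B H) (twist hD))⁻¹.val := by
  let E := Algebra.TensorProduct.map (embed hD) (embed hD)
  let Q : H →ₗ[k] Smash k H B H ⊗[k] Smash k H B H :=
    hat H B ∘ₗ shift H (inr k H B H ∘ₗ D.ζ)
  have h1 : E.toLinearMap ∘ₗ (TensorProduct.mk k (Smash k H B C) (Smash k H B C) 1 ∘ₗ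
      inr k H B C ∘ₗ D.ζ) = (inrSnd k H B H).toLinearMap ∘ₗ D.ζ := by
    ext x
    simp [E, inrSnd, embed_inr]
  have h2 : E.toLinearMap ∘ₗ (hat H B ∘ₗ D.γ.lcomp k _ ∘ₗ shift H (inr k H B C ∘ₗ D.ζ)) =
    LinearMap.mulLeft k (twist hD).val ∘ₗ Q := embed_comp_hat_shift_ζ hD
  have h4 : (Q ⊚ ((inrSnd k H B H).toLinearMap ∘ₗ D.ζ)) ∘ₗ D.γ ∘ₗ D.π =
      ((inrSnd k H B H).toLinearMap ∘ₗ D.ζbar) ⊚ (Q ⊚ ((inrSnd k H B H).toLinearMap ∘ₗ D.ζ)) :=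
    hD.comp_γπ _ (inrSnd k H B H).toLinearMap
      (conv_ζ_ι_mul hD Q (inrSnd k H B H) (inrSnd_mul_hat_shift _))
  have h5 : E.toLinearMap ∘ₗ (((hat H B ∘ₗ D.γ.lcomp k _ ∘ₗ shift H (inr k H B C ∘ₗ D.ζ)) ⊚
      (TensorProduct.mk k (Smash k H B C) (Smash k H B C) 1 ∘ₗ inr k H B C ∘ₗ D.ζ)) ∘ₗ D.γ) ∘ₗ
        D.π = LinearMap.mulLeft k (twist hD).val ∘ₗ (((inrSnd k H B H).toLinearMap ∘ₗ D.ζbar) ⊚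
          (Q ⊚ ((inrSnd k H B H).toLinearMap ∘ₗ D.ζ))) := by
    rw [LinearMap.comp_assoc, ← LinearMap.comp_assoc, comp_conv, h1, h2, conv_mulLeft_comp,
      LinearMap.comp_assoc, h4]
  have ha : ∀ x y : (Smash k H B H ⊗[k] Smash k H B H) ⊗[k] Smash k H B H,
      TensorProduct.assoc k _ _ _ (x * y) =
        TensorProduct.assoc k _ _ _ x * TensorProduct.assoc k _ _ _ y :=
    map_mul (Algebra.TensorProduct.assoc k k k (Smash k H B H) (Smash k H B H) (Smash k H B H))
  have h6 : TensorProduct.assoc k _ _ _ (hat H B ((inrSnd k H B H).toLinearMap ∘ₗ D.ζbar)) =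
      leg23 k _ (twist hD).val := assoc_hat_tmul (k := k) (H := H) (B := B) 1 (inr k H B H ∘ₗ D.ζbar)
  have h7 : TensorProduct.assoc k _ _ _ (hat H B ((inrSnd k H B H).toLinearMap ∘ₗ D.ζ)) =
      leg23 k _ (twist hD)⁻¹.val := assoc_hat_tmul (k := k) (H := H) (B := B) 1 (inr k H B H ∘ₗ D.ζ)
  have h8 : TensorProduct.assoc k _ _ _ (hat H B Q) =
      applyRight _ (nabla k H B H) (twist hD)⁻¹.val :=
    (lTensor_nabla_hat (k := k) (H := H) (B := B) (inr k H B H ∘ₗ D.ζ)).symm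
  have h10 := twistAssociator_inv_val (nabla k H B H) (twist hD) (applyLeft_twist hD)
  have h11 := map_embed_hat hD E
    (((hat H B ∘ₗ D.γ.lcomp k _ ∘ₗ shift H (inr k H B C ∘ₗ D.ζ)) ⊚
      (TensorProduct.mk k (Smash k H B C) (Smash k H B C) 1 ∘ₗ inr k H B C ∘ₗ D.ζ)) ∘ₗ D.γ)
  rw [h10, ← h6, ← h7, ← h8, ← assoc_tmul_one, mul_assoc, mul_assoc, ← ha, ← ha, ← ha,
    ← hat_conv, ← hat_conv, ← hat_mulLeft, ← h5]
  exact (map_assoc (embed hD) _).trans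
    (congrArg (TensorProduct.assoc k (Smash k H B H) (Smash k H B H) (Smash k H B H)) h11)

variable [FiniteDimensional k B]

include hD in
theorem associator_mul_associatorInv : D.associator * associatorInv D = 1 := by
  apply map_embed_injective₃ hD
  have h1 := embed_associator hD
  have h2 := embed_associatorInv hD
  have hmul := map_mul (Algebra.TensorProduct.map (embed hD)
    (Algebra.TensorProduct.map (embed hD) (embed hD))) D.associator (associatorInv D)
  have hone := map_one (Algebra.TensorProduct.map (embed hD)
    (Algebra.TensorProduct.map (embed hD) (embed hD)))
  refine hmul.trans (Eq.trans ?_ hone.symm)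
  exact (congrArg₂ (· * ·) h1 h2).trans (Units.mul_inv _)

include hD in
theorem associatorInv_mul_associator : associatorInv D * D.associator = 1 := by
  apply map_embed_injective₃ hD
  have h1 := embed_associator hD
  have h2 := embed_associatorInv hD
  have hmul := map_mul (Algebra.TensorProduct.map (embed hD)
    (Algebra.TensorProduct.map (embed hD) (embed hD))) (associatorInv D) D.associator
  have hone := map_one (Algebra.TensorProduct.map (embed hD)
    (Algebra.TensorProduct.map (embed hD) (embed hD)))
  refine hmul.trans (Eq.trans ?_ hone.symm)
  exact (congrArg₂ (· * ·) h2 h1).trans (Units.inv_mul _)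

omit [FiniteDimensional k B] in
theorem nabla_coassoc_comp :
    (applyLeft (nabla k H B H) (Smash k H B H)).comp (nabla k H B H) =
      (applyRight (Smash k H B H) (nabla k H B H)).comp (nabla k H B H) := by
  ext a
  exact (nabla_coassoc a).symm

include hD in
theorem isQuasiBialgebra_partialDual : D.partialDual.IsQuasiBialgebra where
  comul_one := map_one (comulAlg hD)
  comul_mul := map_mul (comulAlg hD)
  counit_one := by
    change D.counit 1 = 1
    rw [← counitAlg_toLinearMap hD]
    exact map_one (counitAlg hD)
  counit_mul a b := by
    change D.counit (a * b) = D.counit a * D.counit b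
    rw [← counitAlg_toLinearMap hD]
    exact map_mul (counitAlg hD) a b
  isUnit_associator := ⟨⟨D.associator, associatorInv D, associator_mul_associatorInv hD,
    associatorInv_mul_associator hD⟩, rfl⟩
  quasi_coassoc := twist_quasi_coassoc (map_embed_injective₃ hD) nabla_coassoc_comp
    (embed_comul hD) (embed_associator hD)
  pentagon := twist_pentagon_eq (map_embed_injective₄ hD) nabla_coassoc_comp
    (embed_comul hD) (embed_associator hD)
  counit_comul a := by
    have h := counit_comulAlg hD a
    rw [counitAlg_toLinearMap] at h
    exact h
  comul_counit a := by
    have h := comulAlg_counit hD a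
    rw [counitAlg_toLinearMap] at h
    exact h
  counit_associator := by
    have h := counit_associator hD
    rw [counitAlg_toLinearMap] at h
    exact h

end

end LeftPartialDual

end

open TensorProduct Coalgebra

noncomputable section

namespace LeftPartialDual

open LeftComoduleAlgebra RightModuleCoalgebra HopfAlgebra
open MappingSystem (inl inr antipodeInv)

/-! ### Contracting maps `C → C* # B` -/

section Contract

variable {k H B C : Type*} [Field k] [Ring H] [Bialgebra k H]
  [Ring B] [Algebra k B] [LeftComoduleAlgebra k H B]
  [AddCommGroup C] [Module k C] [Coalgebra k C] [RightModuleCoalgebra k H C]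
  [FiniteDimensional k C]

/-- `G ↦ ∑ᵢ G(xᵢ) (fᵢ # 1)` for a basis `(xᵢ)` of `C` with dual basis `(fᵢ)`. -/
def contract : (C →ₗ[k] Smash k H B C) →ₗ[k] Smash k H B C :=
  LinearMap.mul' k (Smash k H B C) ∘ₗ hat H B

theorem contract_smulRight (f : Module.Dual k C) (r : Smash k H B C) :
    contract (f.smulRight r) = r * inl k H B C f := by
  rw [contract, LinearMap.comp_apply, hat_smulRight, LinearMap.mul'_apply]

theorem contract_mulLeft (a : Smash k H B C) (G : C →ₗ[k] Smash k H B C) :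
    contract (LinearMap.mulLeft k a ∘ₗ G) = a * contract G := by
  induction G using hom_induction with
  | hadd f g hf hg => simp only [LinearMap.comp_add, map_add, mul_add, hf, hg]
  | hr f r =>
    have : LinearMap.mulLeft k a ∘ₗ f.smulRight r = f.smulRight (a * r) := by
      ext x
      simp
    rw [this, contract_smulRight, contract_smulRight, mul_assoc]

theorem contract_convUnit : contract (convUnit k C (Smash k H B C)) = 1 := by
  rw [contract, LinearMap.comp_apply, hat_convUnit, Algebra.TensorProduct.one_def,
    LinearMap.mul'_apply, one_mul]

/-- `∑ q(G(· ◁ b₁)) b₂ = q(G(·) b)` -/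
theorem contract_shift_mul_inr (G : C →ₗ[k] Smash k H B C) (b : B) :
    LinearMap.mul' k _ (TensorProduct.map (contract ∘ₗ shift H G) (inr k H B C)
      (coact (k := k) b)) = contract (LinearMap.mulRight k (inr k H B C b) ∘ₗ G) := by
  induction G using hom_induction with
  | hadd f g hf hg =>
    simp only [shift_add, LinearMap.comp_add, TensorProduct.map_add_left, LinearMap.add_apply,
      map_add, hf, hg]
  | hr f r =>
    have : LinearMap.mulRight k (inr k H B C b) ∘ₗ f.smulRight r =
        f.smulRight (r * inr k H B C b) := by
      ext x
      simp
    rw [this, contract_smulRight, mul_assoc, inr_mul_inl]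
    induction coact (k := k) (H := H) b with
    | zero => simp
    | add s t hs ht => simp only [map_add, mul_add, hs, ht]
    | tmul h c => simp [shift_smulRight, contract_smulRight, mul_assoc]

/-- `q(x ↦ q(G(x))) = q(x ↦ ∑ G(x₂)(x₁))` -/
theorem contract_contract (G : C →ₗ[k] C →ₗ[k] Smash k H B C) :
    contract (contract ∘ₗ G) = contract (TensorProduct.lift G.flip ∘ₗ comul) := by
  induction G using hom_induction with
  | hadd f g hf hg =>
    have : TensorProduct.lift (f + g).flip = TensorProduct.lift f.flip + TensorProduct.lift g.flip := by
      ext x y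
      simp
    rw [this, LinearMap.comp_add, LinearMap.add_comp, map_add, map_add, hf, hg]
  | hr g Ψ =>
    induction Ψ using hom_induction with
    | hadd f f' hf hf' =>
      have h1 : g.smulRight (f + f') = g.smulRight f + g.smulRight f' := by
        ext x y
        simp
      have : TensorProduct.lift (g.smulRight (f + f')).flip =
          TensorProduct.lift (g.smulRight f).flip + TensorProduct.lift (g.smulRight f').flip := by
        ext x y
        simp
      rw [this, h1, LinearMap.comp_add, LinearMap.add_comp, map_add, map_add, hf, hf']
    | hr f r =>
      have h1 : contract ∘ₗ g.smulRight (f.smulRight r) =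
          g.smulRight (r * inl k H B C f) := by
        ext x
        simp [contract_smulRight]
      have h2 : TensorProduct.lift (g.smulRight (f.smulRight r)).flip ∘ₗ comul =
          (dualMul k C f g).smulRight r := by
        ext x
        rw [LinearMap.comp_apply, LinearMap.smulRight_apply, dualMul, transposeMul_apply]
        induction comul (R := k) x with
        | zero => simp
        | add s t hs ht => simp only [map_add, add_smul, hs, ht]
        | tmul a b => simp [smul_smul, mul_comm]
      rw [h1, h2, contract_smulRight, contract_smulRight, mul_assoc, inl_mul_inl]

variable (k H C) in
/-- `x ⊗ h ↦ ∑ h₁ ⊗ (x ◁ h₂)` -/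
def actSnd : C ⊗[k] H →ₗ[k] H ⊗[k] C :=
  (TensorProduct.lift (act (k := k) (H := H) (C := C))).lTensor H ∘ₗ
    (TensorProduct.leftComm k C H H).toLinearMap ∘ₗ comul.lTensor C

/-- The contraction multiplies on the right by `fᵢ`, so a functional factor `h₂ ⇀ f` merges with
`fᵢ` in `C*`. Evaluated on `x`, it becomes the scalar `f(x₁ ◁ h₂)` with `h = l(x₂)`. -/
theorem contract_conv_hitInl (p : H →ₗ[k] Smash k H B C) (f : Module.Dual k C) (l : C →ₗ[k] H) :
    contract ((p ⊚ hitInl H B f) ∘ₗ l) = contract (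
      (TensorProduct.rid k _).toLinearMap ∘ₗ TensorProduct.map p f ∘ₗ actSnd k H C ∘ₗ
        l.lTensor C ∘ₗ comul) := by
  induction l using hom_induction with
  | hadd f g hf hg =>
    simp only [LinearMap.comp_add, LinearMap.lTensor_add, LinearMap.add_comp, map_add, hf, hg]
  | hr g h =>
    have h1 : (p ⊚ hitInl H B f) ∘ₗ g.smulRight h = g.smulRight ((p ⊚ hitInl H B f) h) := by
      ext x
      simp
    have h2 : (TensorProduct.rid k _).toLinearMap ∘ₗ TensorProduct.map p f ∘ₗ actSnd k H C ∘ₗ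
        (g.smulRight h).lTensor C ∘ₗ comul =
        TensorProduct.lift (LinearMap.mk₂ k (fun a c => (dualMul k C (hit k H C c f) g).smulRight
          (p a)) (by intros; ext; simp) (by intros; ext; simp [smul_smul, mul_comm])
          (by intros; ext; simp [add_smul]) (by intros; ext; simp [smul_smul]))
          (comul (R := k) h) := by
      ext x
      have h3 : ∀ s : C ⊗[k] C, actSnd k H C ((g.smulRight h).lTensor C s) =
          ((TensorProduct.lift (act (k := k) (H := H) (C := C))).lTensor H ∘ₗ
            (TensorProduct.leftComm k C H H).toLinearMap)
            (TensorProduct.rid k C (g.lTensor C s) ⊗ₜ comul (R := k) h) := by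
        intro s
        induction s with
        | zero => simp
        | add s t hs ht => simp only [map_add, add_tmul, hs, ht]
        | tmul a b => simp [actSnd, smul_tmul']
      simp only [LinearMap.comp_apply, h3]
      induction comul (R := k) h with
      | zero => simp
      | add s t hs ht => simp only [map_add, tmul_add, LinearMap.add_apply, hs, ht]
      | tmul a c =>
        simp [dualMul, transposeMul_apply]
        induction comul (R := k) x with
        | zero => simp
        | add s t hs ht => simp only [map_add, LinearMap.add_apply, add_smul, hs, ht]
        | tmul y z => simp [hit_apply, mul_comm]
    rw [h1, h2, contract_smulRight, conv_apply]
    induction comul (R := k) h with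
    | zero => simp
    | add s t hs ht => simp only [map_add, add_mul, hs, ht]
    | tmul a c => simp [contract_smulRight, mul_assoc, inl_mul_inl]

end Contract

/-! ### The right action of `C* # B` on `H` -/

section RightAct

variable {k H B C : Type*} [Field k] [Ring H] [HopfAlgebra k H] [Ring B]
    [Algebra k B] [LeftComoduleAlgebra k H B] [AddCommGroup C] [Module k C] [Coalgebra k C]
    [RightModuleCoalgebra k H C] {D : MappingSystem k H B C} (hD : D.IsPAMS)

variable (D) in
/-- `f ↦ (h ↦ ∑ f(π(h₁)) h₂)` -/
def dualAct : Module.Dual k C →ₗ[k] Module.End k H where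
  toFun f := (TensorProduct.lid k H).toLinearMap ∘ₗ (f ∘ₗ D.π).rTensor H ∘ₗ comul
  map_add' f g := by
    rw [LinearMap.add_comp, LinearMap.rTensor_add, LinearMap.add_comp, LinearMap.comp_add]
  map_smul' r f := by
    rw [LinearMap.smul_comp, LinearMap.rTensor_smul, LinearMap.smul_comp, LinearMap.comp_smul]
    rfl

theorem dualAct_apply (f : Module.Dual k C) (h : H) :
    dualAct D f h = TensorProduct.lid k H ((f ∘ₗ D.π).rTensor H (comul (R := k) h)) := rfl

theorem comul_dualAct (f : Module.Dual k C) (h : H) : comul (R := k) (dualAct D f h) =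
    TensorProduct.lid k _ ((f ∘ₗ D.π).rTensor _ (comul.lTensor H (comul (R := k) h))) := by
  rw [dualAct_apply]
  induction comul (R := k) h with
  | zero => simp
  | add s t hs ht => simp only [map_add, hs, ht]
  | tmul a b => simp

/-- The right action of `C* # B` on `H`, `h · (f # b) = ∑ f(π(h₁)) h₂ ι(b)`. -/
def rightAct : Smash k H B C →ₐ[k] (Module.End k H)ᵐᵒᵖ :=
  liftAlg ((MulOpposite.opLinearEquiv k).toLinearMap ∘ₗ dualAct D)
    ((MulOpposite.opLinearEquiv k).toLinearMap ∘ₗ (LinearMap.mul k H).flip ∘ₗ D.ι)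
    (by
      apply MulOpposite.unop_injective
      ext h
      have h1 : (counit (R := k) (A := C)) ∘ₗ D.π = counit := by
        ext x
        exact hD.π_counit x
      simp [dualAct_apply, h1])
    (fun f g => by
      apply MulOpposite.unop_injective
      ext h
      have h1 : dualMul k C f g ∘ₗ D.π = dualMul k H (f ∘ₗ D.π) (g ∘ₗ D.π) :=
        dualMul_comp D.π hD.π_comul f g
      simp only [LinearMap.comp_apply, MulOpposite.unop_mul, Module.End.mul_apply,
        LinearEquiv.coe_coe, MulOpposite.coe_opLinearEquiv, MulOpposite.unop_op]
      rw [dualAct_apply, h1, dualAct_apply, comul_dualAct]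
      have h2 : ∀ t : H ⊗[k] (H ⊗[k] H), TensorProduct.lid k H ((g ∘ₗ D.π).rTensor H
          (TensorProduct.lid k _ ((f ∘ₗ D.π).rTensor _ t))) = TensorProduct.lid k H
          ((dualDistrib k H H ((f ∘ₗ D.π) ⊗ₜ (g ∘ₗ D.π))).rTensor H
          ((TensorProduct.assoc k H H H).symm t)) := by
        intro t
        induction t with
        | zero => simp
        | add s t hs ht => simp only [map_add, hs, ht]
        | tmul a u =>
          induction u with
          | zero => simp
          | add s t hs ht => simp only [map_add, tmul_add, hs, ht]
          | tmul b c => simp [smul_smul]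
      have h3 : dualMul k H (f ∘ₗ D.π) (g ∘ₗ D.π) =
        dualDistrib k H H ((f ∘ₗ D.π) ⊗ₜ (g ∘ₗ D.π)) ∘ₗ comul := rfl
      rw [h2, coassoc_symm_apply, h3, LinearMap.rTensor_comp]
      rfl)
    (by
      apply MulOpposite.unop_injective
      ext h
      simp [hD.ι_one])
    (fun b c => by
      apply MulOpposite.unop_injective
      ext h
      simp [hD.ι_mul, mul_assoc])
    (fun b f => by
      apply MulOpposite.unop_injective
      ext h
      simp only [LinearMap.comp_apply, MulOpposite.unop_mul, Module.End.mul_apply,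
        LinearEquiv.coe_coe, MulOpposite.coe_opLinearEquiv, MulOpposite.unop_op,
        LinearMap.flip_apply, LinearMap.mul_apply']
      rw [dualAct_apply, Bialgebra.comul_mul, hD.ι_coact]
      induction coact (k := k) (H := H) b with
      | zero => simp
      | add s t hs ht => simp only [map_add, mul_add, MulOpposite.unop_add, LinearMap.add_apply,
          hs, ht]
      | tmul u c =>
        simp only [TensorProduct.map_tmul, LinearMap.mul'_apply, MulOpposite.unop_mul,
          Module.End.mul_apply, LinearMap.comp_apply, LinearEquiv.coe_coe,
          MulOpposite.coe_opLinearEquiv, MulOpposite.unop_op, LinearMap.flip_apply,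
          LinearMap.mul_apply', dualAct_apply, LinearMap.lTensor_tmul]
        induction comul (R := k) h with
        | zero => simp
        | add s t hs ht => simp only [map_add, add_mul, hs, ht]
        | tmul x y => simp [hit_apply, hD.π_act])

end RightAct

end LeftPartialDual

end

open TensorProduct Coalgebra

noncomputable section

namespace LeftPartialDual

open LeftComoduleAlgebra RightModuleCoalgebra HopfAlgebra
open MappingSystem (inl inr antipodeInv)

section RightAction

variable {k H B C : Type*} [Field k] [Ring H] [HopfAlgebra k H] [Ring B]
    [Algebra k B] [LeftComoduleAlgebra k H B] [AddCommGroup C] [Module k C] [Coalgebra k C]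
    [RightModuleCoalgebra k H C] {D : MappingSystem k H B C} (hD : D.IsPAMS)

/-- Right multiplication `h ↦ h · a` by `a : C* # B`. -/
def rAct : Smash k H B C →ₗ[k] Module.End k H :=
  (MulOpposite.opLinearEquiv k).symm.toLinearMap ∘ₗ (rightAct hD).toLinearMap

theorem rAct_mul (a b : Smash k H B C) : rAct hD (a * b) = rAct hD b ∘ₗ rAct hD a := by
  simp only [rAct, LinearMap.comp_apply, AlgHom.toLinearMap_apply, map_mul]
  rfl

theorem rAct_one : rAct hD 1 = LinearMap.id := by
  simp only [rAct, LinearMap.comp_apply, AlgHom.toLinearMap_apply, map_one]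
  rfl

theorem rAct_inl (f : Module.Dual k C) : rAct hD (inl k H B C f) = dualAct D f := by
  simp only [rAct, LinearMap.comp_apply, AlgHom.toLinearMap_apply, rightAct, liftAlg_inl]
  rfl

theorem rAct_inr (b : B) : rAct hD (inr k H B C b) = LinearMap.mulRight k (D.ι b) := by
  simp only [rAct, LinearMap.comp_apply, AlgHom.toLinearMap_apply, rightAct, liftAlg_inr]
  rfl

include hD in
-- In `Δ(S⁻¹(b)h) = ∑ S⁻¹(b₂)h₁ ⊗ S⁻¹(b₁)h₂`, `π` absorbs the factor `S⁻¹(b₂)`.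
theorem dualAct_antipodeInv_mul [FiniteDimensional k H] (f : Module.Dual k C) (b : B) (h : H) :
    dualAct D f (antipodeInv k H (D.ι b) * h) = antipodeInv k H (D.ι b) * dualAct D f h := by
  have h1 : ∀ (t : H ⊗[k] B) (u : H ⊗[k] H), TensorProduct.lid k H ((f ∘ₗ D.π).rTensor H
      (TensorProduct.map (antipodeInv k H) (antipodeInv k H)
        (TensorProduct.comm k H H (D.ι.lTensor H t)) * u)) =
      antipodeInv k H (TensorProduct.rid k H ((counit ∘ₗ D.ι).lTensor H t)) *
        TensorProduct.lid k H ((f ∘ₗ D.π).rTensor H u) := by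
    intro t u
    induction t with
    | zero => simp
    | add s t hs ht => simp only [map_add, add_mul, hs, ht]
    | tmul x c =>
      induction u with
      | zero => simp
      | add s t hs ht => simp only [map_add, mul_add, hs, ht]
      | tmul y z => simp [hD.π_antipodeInv_mul, smul_smul, mul_comm]
  rw [dualAct_apply, Bialgebra.comul_mul, MappingSystem.comul_antipodeInv, hD.ι_coact, h1,
    hD.coact_counit, dualAct_apply]

theorem rAct_antipodeInv_mul [FiniteDimensional k H] (a : Smash k H B C) (b : B) (h : H) :
    rAct hD a (antipodeInv k H (D.ι b) * h) = antipodeInv k H (D.ι b) * rAct hD a h := by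
  induction a using smash_induction generalizing h with
  | hadd x y hx hy => simp only [map_add, LinearMap.add_apply, mul_add, hx, hy]
  | hmul f c =>
    rw [rAct_mul, rAct_inl, rAct_inr, LinearMap.comp_apply, dualAct_antipodeInv_mul hD]
    simp [mul_assoc]

theorem rAct_hitInl_conv_ζ (f : Module.Dual k C) (h m : H) :
    rAct hD ((hitInl H B f ⊚ (inr k H B C ∘ₗ D.ζ)) h) m = TensorProduct.lid k H
      ((f ∘ₗ D.π).rTensor H (comul (R := k) m *
        (D.ι ∘ₗ D.ζ).lTensor H (comul (R := k) h))) := by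
  rw [conv_apply]
  induction comul (R := k) h with
  | zero => simp
  | add s t hs ht => simp only [map_add, LinearMap.add_apply, mul_add, hs, ht]
  | tmul x y =>
    rw [TensorProduct.map_tmul, LinearMap.mul'_apply, rAct_mul, hitInl_apply, rAct_inl,
      LinearMap.comp_apply, LinearMap.comp_apply, rAct_inr, dualAct_apply]
    induction comul (R := k) m with
    | zero => simp
    | add s t hs ht => simp only [map_add, add_mul, hs, ht]
    | tmul u v => simp [hit_apply, hD.π_act]

theorem actSnd_tmul (x : C) (h : H) : actSnd k H C (x ⊗ₜ h) =
    (act (k := k) x).lTensor H (comul (R := k) h) := by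
  rw [actSnd, LinearMap.comp_apply, LinearMap.comp_apply, LinearMap.lTensor_tmul]
  induction comul (R := k) h with
  | zero => simp
  | add s t hs ht => simp only [map_add, tmul_add, hs, ht]
  | tmul a b => simp

theorem actSnd_dualAct (f : Module.Dual k C) (x : C) (h : H) :
    actSnd k H C (x ⊗ₜ dualAct D f h) =
      (dualAct D f).rTensor C (actSnd k H C (x ⊗ₜ h)) := by
  have h1 : ∀ t : H ⊗[k] (H ⊗[k] H), (act (k := k) x).lTensor H
      (TensorProduct.lid k _ ((f ∘ₗ D.π).rTensor _ t)) = TensorProduct.map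
        ((TensorProduct.lid k H).toLinearMap ∘ₗ (f ∘ₗ D.π).rTensor H) (act (k := k) x)
        ((TensorProduct.assoc k H H H).symm t) := by
    intro t
    induction t with
    | zero => simp
    | add s t hs ht => simp only [map_add, hs, ht]
    | tmul a u =>
      induction u with
      | zero => simp
      | add s t hs ht => simp only [map_add, tmul_add, hs, ht]
      | tmul b c => simp [smul_tmul']
  rw [actSnd_tmul, actSnd_tmul, comul_dualAct, h1, coassoc_symm_apply]
  induction comul (R := k) h with
  | zero => simp
  | add s t hs ht => simp only [map_add, hs, ht]
  | tmul a b => simp [dualAct_apply]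

theorem actSnd_mul (x : C) (h h' : H) : actSnd k H C (x ⊗ₜ (h * h')) =
    TensorProduct.map₂ (LinearMap.mul k H) (act (k := k) (H := H) (C := C))
      (actSnd k H C (x ⊗ₜ h)) (comul (R := k) h') := by
  rw [actSnd_tmul, actSnd_tmul, Bialgebra.comul_mul]
  induction comul (R := k) h with
  | zero => simp
  | add s t hs ht => simp only [map_add, add_mul, LinearMap.add_apply, hs, ht]
  | tmul a c =>
    induction comul (R := k) h' with
    | zero => simp
    | add s t hs ht => simp only [map_add, mul_add, hs, ht]
    | tmul d e => simp [act_mul]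

include hD in
theorem π_one_map₂ (y : H) (t : H ⊗[k] H) :
    TensorProduct.map₂ (LinearMap.mul k H) (act (k := k) (H := H) (C := C)) (y ⊗ₜ D.π 1) t =
      (LinearMap.mulLeft k y).rTensor C (D.π.lTensor H t) := by
  induction t with
  | zero => simp
  | add s t hs ht => simp only [map_add, hs, ht]
  | tmul a c => simp [π_one_act hD]

include hD in
-- Write `γbarπ = S * ιζ`. The action of `h₁` cancels one leg of the comultiplied antipode, and the
-- remaining comultiplication of `ι(ζ(-))` is trivial after `π` because `ι(B)` is coinvariant.
theorem actSnd_γbar (x : C) :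
    actSnd k H C (D.γbar.lTensor C (comul (R := k) x)) = D.γbar x ⊗ₜ D.π 1 := by
  obtain ⟨h, rfl⟩ := hD.π_surjective x
  have h1 : ∀ (a : H) (t : H ⊗[k] H), (act (k := k) (D.π a)).lTensor H t =
      D.π.lTensor H ((1 ⊗ₜ a) * t) := by
    intro a t
    induction t with
    | zero => simp
    | add s t hs ht => simp only [map_add, mul_add, hs, ht]
    | tmul u v => simp [hD.π_act]
  have h2 : actSnd k H C (D.γbar.lTensor C (comul (R := k) (D.π h))) = D.π.lTensor H
      ((((i₂ k H H).toLinearMap ∘ₗ LinearMap.id) ⊚ (comul ∘ₗ D.γbar ∘ₗ D.π)) h) := by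
    rw [hD.π_comul, conv_apply]
    induction comul (R := k) h with
    | zero => simp
    | add s t hs ht => simp only [map_add, hs, ht]
    | tmul u v =>
      rw [TensorProduct.map_tmul, LinearMap.lTensor_tmul, actSnd_tmul, h1]
      rfl
  have h3 : comul ∘ₗ (antipode k (A := H) ⊚ (D.ι ∘ₗ D.ζ)) =
      (comul ∘ₗ antipode k (A := H)) ⊚ (comul ∘ₗ D.ι ∘ₗ D.ζ) :=
    comp_conv (Bialgebra.comulAlgHom k H) _ _
  have h4 : ∀ (z : H) (t : H ⊗[k] H), D.π.lTensor H ((z ⊗ₜ 1) * t) =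
      (LinearMap.mulLeft k z).rTensor C (D.π.lTensor H t) := by
    intro z t
    induction t with
    | zero => simp
    | add s t hs ht => simp only [map_add, mul_add, hs, ht]
    | tmul u v => simp
  rw [h2, ← LinearMap.comp_apply D.γbar, hD.γbarπ_eq, h3, comul_comp_antipode, conv_assoc,
    ← conv_assoc ((i₂ k H H).toLinearMap ∘ₗ LinearMap.id), ← comp_conv (i₂ k H H),
    id_conv_antipode, comp_convUnit, unit_conv, conv_apply, conv_apply]
  induction comul (R := k) h with
  | zero => simp
  | add s t hs ht => simp only [map_add, add_tmul, hs, ht]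
  | tmul u v =>
    have h5 := h4 (antipode k u) (comul (R := k) (D.ι (D.ζ v)))
    rw [(hD.mem_range_ι_iff _).1 ⟨D.ζ v, rfl⟩] at h5
    exact h5

/-- The property of `γbar` survives the right action: the functional part of the action commutes
with `actSnd`, and right multiplication by `ι(b)` is harmless by coinvariance. -/
theorem actSnd_rAct_γbar (a : Smash k H B C) (x : C) :
    actSnd k H C ((rAct hD a ∘ₗ D.γbar).lTensor C (comul (R := k) x)) =
      rAct hD a (D.γbar x) ⊗ₜ D.π 1 := by
  suffices h : ∀ l : C →ₗ[k] H,
      (∀ x, actSnd k H C (l.lTensor C (comul (R := k) x)) = l x ⊗ₜ D.π 1) →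
      ∀ x, actSnd k H C ((rAct hD a ∘ₗ l).lTensor C (comul (R := k) x)) =
        rAct hD a (l x) ⊗ₜ D.π 1 from h _ (actSnd_γbar hD) x
  clear x
  intro l hl x
  induction a using smash_induction with
  | hadd a b ha hb =>
    simp only [map_add, LinearMap.add_comp, LinearMap.lTensor_add, LinearMap.add_apply, add_tmul,
      ha, hb]
  | hmul f b =>
    have h1 : ∀ t : C ⊗[k] C, actSnd k H C ((dualAct D f ∘ₗ l).lTensor C t) =
        (dualAct D f).rTensor C (actSnd k H C (l.lTensor C t)) := by
      intro t
      induction t with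
      | zero => simp
      | add s t hs ht => simp only [map_add, hs, ht]
      | tmul u v => simp [actSnd_dualAct]
    have h2 : ∀ t : C ⊗[k] C, actSnd k H C ((LinearMap.mulRight k (D.ι b) ∘ₗ
        dualAct D f ∘ₗ l).lTensor C t) = (TensorProduct.map₂ (LinearMap.mul k H)
          (act (k := k) (H := H) (C := C))) (actSnd k H C ((dualAct D f ∘ₗ l).lTensor C t))
          (comul (R := k) (D.ι b)) := by
      intro t
      induction t with
      | zero => simp
      | add s t hs ht => simp only [map_add, LinearMap.add_apply, hs, ht]
      | tmul u v =>
        simp only [LinearMap.lTensor_tmul, LinearMap.comp_apply, LinearMap.mulRight_apply,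
          actSnd_mul]
    rw [rAct_mul, rAct_inl, rAct_inr, LinearMap.comp_assoc, h2, h1, hl, LinearMap.rTensor_tmul,
      π_one_map₂ hD, (hD.mem_range_ι_iff (D.ι b)).1 ⟨b, rfl⟩]
    simp

end RightAction

/-! ### The map `T` through the right action -/

section TwistedAntipode

variable {k H B C : Type*} [Field k] [Ring H] [HopfAlgebra k H] [Ring B]
    [Algebra k B] [LeftComoduleAlgebra k H B] [AddCommGroup C] [Module k C] [Coalgebra k C]
    [RightModuleCoalgebra k H C] {D : MappingSystem k H B C} (hD : D.IsPAMS)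
    [FiniteDimensional k B] [FiniteDimensional k C]

/-- The sum in the definition of `T` expands `ζbar(γbar(-) · a)` in the basis of `B`. Once it is
absorbed, products inside `T` become compositions of right actions. -/
theorem T_eq (a : Smash k H B C) : D.T a =
    contract (inr k H B C ∘ₗ D.ζbar ∘ₗ rAct hD a ∘ₗ D.γbar) := by
  let X (i) : Smash k H B C →ₗ[k] Module.Dual k H :=
    TensorProduct.lift ((dualMul k H).compl₁₂ D.π.dualMap
      ((Module.Dual.transpose ∘ₗ (LinearMap.mul k H).flip).flip
        (D.ζbar.dualMap ((Module.finBasis k B).coord i)) ∘ₗ D.ι))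
  have h1 : ∀ i l, X i a l = (Module.finBasis k B).coord i (D.ζbar (rAct hD a l)) := by
    intro i l
    induction a using smash_induction with
    | hadd x y hx hy => simp only [map_add, LinearMap.add_apply, hx, hy]
    | hmul f b =>
      rw [rAct_mul, rAct_inl, rAct_inr, inl_mul_inr]
      refine (LinearMap.congr_fun (TensorProduct.lift.tmul _ _) l).trans ?_
      rw [LinearMap.compl₁₂_apply, LinearMap.comp_apply, LinearMap.comp_apply, dualAct_apply, dualMul,
        transposeMul_apply]
      induction comul (R := k) l with
      | zero => simp
      | add s t hs ht => simp only [map_add, hs, ht]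
      | tmul u v =>
        simp
        exact Or.inl rfl
  rw [← sum_coord_smulRight (inr k H B C) (D.ζbar ∘ₗ rAct hD a ∘ₗ D.γbar), map_sum]
  simp only [contract_smulRight]
  rw [MappingSystem.T, LinearMap.sum_apply]
  refine Finset.sum_congr rfl fun i _ => ?_
  refine congrArg (fun z => inr k H B C (Module.finBasis k B i) * inl k H B C z) ?_
  ext x
  exact h1 i _

/-- For `u = γbar(x) · F`, acting by `fᵢ # c` gives `∑ fᵢ(π(u₁)) u₂ ι(c)`. The sum over `i` then
evaluates `Ψ` at `π(u₁)`, which is a convolution. -/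
theorem T_mul_hat (F : Smash k H B C) (c : B) (Ψ : C →ₗ[k] Smash k H B C) :
    LinearMap.mul' k _ ((D.T ∘ₗ LinearMap.mulLeft k F).lTensor _
      (hat H B Ψ * (1 ⊗ₜ inr k H B C c))) =
    contract (((Ψ ∘ₗ D.π) ⊚ (inr k H B C ∘ₗ D.ζbar ∘ₗ LinearMap.mulRight k (D.ι c))) ∘ₗ
      rAct hD F ∘ₗ D.γbar) := by
  induction Ψ using hom_induction with
  | hadd f g hf hg =>
    simp only [map_add, add_mul, LinearMap.add_comp, add_conv, hf, hg]
  | hr g r =>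
    rw [hat_smulRight, Algebra.TensorProduct.tmul_mul_tmul, mul_one, LinearMap.lTensor_tmul,
      LinearMap.mul'_apply, LinearMap.comp_apply, LinearMap.mulLeft_apply, T_eq hD,
      ← contract_mulLeft]
    congr 1
    ext x
    simp only [LinearMap.comp_apply, LinearMap.mulLeft_apply, rAct_mul, rAct_inl, rAct_inr,
      dualAct_apply, conv_apply]
    induction comul (R := k) (rAct hD F (D.γbar x)) with
    | zero => simp
    | add s t hs ht => simp only [map_add, mul_add, hs, ht]
    | tmul u v => simp

end TwistedAntipode

end LeftPartialDual

end

open TensorProduct Coalgebra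

noncomputable section

namespace LeftPartialDual

open LeftComoduleAlgebra RightModuleCoalgebra HopfAlgebra
open MappingSystem (inl inr antipodeInv)

/-! ### The auxiliary maps `μ_h` -/

section Mu

variable {k H B C : Type*} [Field k] [Ring H] [HopfAlgebra k H] [Ring B]
    [Algebra k B] [LeftComoduleAlgebra k H B] [AddCommGroup C] [Module k C] [Coalgebra k C]
    [RightModuleCoalgebra k H C] {D : MappingSystem k H B C} (hD : D.IsPAMS)

variable (D) in
/-- `h ↦ (x ↦ ∑ γbar(x₁) ι(ζ(γ(x₂) h)))` -/
def mu : H →ₗ[k] C →ₗ[k] H where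
  toFun h := D.γbar ⊚ (shift H (D.ι ∘ₗ D.ζ) h ∘ₗ D.γ)
  map_add' g h := by
    rw [map_add, LinearMap.add_comp, conv_add]
  map_smul' r h := by
    ext x
    simp only [map_smul, RingHom.id_apply, LinearMap.smul_apply, conv_apply, LinearMap.smul_comp,
      TensorProduct.map_smul_right]

theorem mu_apply (h : H) : mu D h = D.γbar ⊚ (shift H (D.ι ∘ₗ D.ζ) h ∘ₗ D.γ) := rfl

include hD in
theorem shift_ζ_mul (h : H) (b : B) (g : H) :
    shift H (inr k H B C ∘ₗ D.ζ) h (D.ι b * g) =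
      inr k H B C b * shift H (inr k H B C ∘ₗ D.ζ) h g := by
  simp [inr_mul_inr, mul_assoc, hD.ζ_mul]

include hD in
/-- `∑ γbar(x₁) ι(ζ(γ(x₂) h)) = ∑ h₁ γbar(x ◁ h₂)` -/
theorem mu_eq (h : H) (x : C) : mu D h x =
    LinearMap.mul' k H ((D.γbar ∘ₗ act (k := k) x).lTensor H (comul (R := k) h)) := by
  obtain ⟨g, rfl⟩ := hD.π_surjective x
  have h1 : (shift H (D.ι ∘ₗ D.ζ) h ∘ₗ D.γ) ∘ₗ D.π =
      (D.ι ∘ₗ D.ζbar) ⊚ shift H (D.ι ∘ₗ D.ζ) h := by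
    rw [LinearMap.comp_assoc]
    refine hD.comp_γπ _ D.ι fun b g => ?_
    simp [mul_assoc, hD.ζ_mul, hD.ι_mul]
  -- `comp_γπ` creates a factor `ιζbar`, and `γbarπ * ιζbar` is the antipode.
  have h2 : mu D h ∘ₗ D.π = antipode k ⊚ shift H (D.ι ∘ₗ D.ζ) h := by
    rw [mu_apply, conv_comp D.π hD.π_comul, h1, ← conv_assoc, ← hD.antipode_eq]
  have h3 : ∀ u, D.γbar (D.π u) = (antipode k ⊚ (D.ι ∘ₗ D.ζ)) u :=
    LinearMap.congr_fun hD.γbarπ_eq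
  have h4 := LinearMap.congr_fun h2 g
  rw [LinearMap.comp_apply] at h4
  rw [h4]
  -- `Y` encodes `∑ h₁ S(g₁ h₂) ι(ζ(g₂ h₃))`, in which `h₁ S(h₂)` collapses by coassociativity.
  let Y : H ⊗[k] H → H ⊗[k] (H ⊗[k] H) →ₗ[k] H := fun t =>
    LinearMap.mul' k H ∘ₗ (LinearMap.mul' k H ∘ₗ (TensorProduct.map (antipode k) (D.ι ∘ₗ D.ζ)) ∘ₗ
      LinearMap.mul k _ t).lTensor H
  have h5 : LinearMap.mul' k H ((D.γbar ∘ₗ act (k := k) (D.π g)).lTensor H (comul (R := k) h)) =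
      Y (comul (R := k) g) (comul.lTensor H (comul (R := k) h)) := by
    induction comul (R := k) h with
    | zero => simp
    | add s t hs ht => simp only [map_add, hs, ht]
    | tmul a b =>
      simp only [LinearMap.lTensor_tmul, LinearMap.mul'_apply, LinearMap.comp_apply, ← hD.π_act,
        h3, conv_apply, Bialgebra.comul_mul, Y, LinearMap.mul_apply']
  have h6 : ∀ (t : H ⊗[k] H) (w : H ⊗[k] H), Y t (TensorProduct.assoc k H H H
      (comul.rTensor H w)) = LinearMap.mul' k H (TensorProduct.map (antipode k) (D.ι ∘ₗ D.ζ)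
        (t * (1 ⊗ₜ TensorProduct.lid k H (counit.rTensor H w)))) := by
    intro t w
    induction w with
    | zero => simp
    | add s t hs ht => simp only [map_add, tmul_add, mul_add, hs, ht]
    | tmul a c =>
      have h7 : ∀ (x : H) (v : H ⊗[k] H), LinearMap.mul' k H
          ((antipode k ∘ₗ LinearMap.mulLeft k x).lTensor H v) =
          LinearMap.mul' k H ((antipode k).lTensor H v) * antipode k x := by
        intro x v
        induction v with
        | zero => simp
        | add s t hs ht => simp only [map_add, add_mul, hs, ht]
        | tmul d e => simp [antipode_mul_antidistrib, mul_assoc]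
      induction t with
      | zero => simp [Y]
      | add s t hs ht =>
        rw [add_mul, map_add, map_add, ← hs, ← ht]
        simp only [Y, map_add, LinearMap.comp_add, LinearMap.lTensor_add,
          LinearMap.add_apply, LinearMap.comp_apply]
      | tmul x y =>
        have h8 : ∀ v : H ⊗[k] H, Y (x ⊗ₜ y) (TensorProduct.assoc k H H H (v ⊗ₜ c)) =
            LinearMap.mul' k H ((antipode k ∘ₗ LinearMap.mulLeft k x).lTensor H v) *
              D.ι (D.ζ (y * c)) := by
          intro v
          induction v with
          | zero => simp
          | add s t hs ht => simp only [map_add, add_tmul, add_mul, hs, ht]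
          | tmul d e => simp [Y, mul_assoc]
        rw [LinearMap.rTensor_tmul, h8, h7, mul_antipode_lTensor_comul_apply]
        simp [Algebra.algebraMap_eq_smul_one]
  rw [h5, ← coassoc_apply, h6, rTensor_counit_comul, conv_apply]
  simp only [TensorProduct.lid_tmul, one_smul]
  induction comul (R := k) g with
  | zero => simp
  | add s t hs ht => simp only [map_add, add_mul, hs, ht]
  | tmul a c => simp

include hD in
theorem mu_one : mu D 1 = D.γbar := by
  ext x
  rw [mu_eq hD]
  simp [Algebra.TensorProduct.one_def, act_one]

include hD in
/-- `μ_{gh}(x) = ∑ g₁ μ_h(x ◁ g₂)` -/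
theorem mu_mul (g h : H) (x : C) : mu D (g * h) x =
    LinearMap.mul' k H ((mu D h ∘ₗ act (k := k) x).lTensor H (comul (R := k) g)) := by
  rw [mu_eq hD, Bialgebra.comul_mul]
  induction comul (R := k) g with
  | zero => simp
  | add s t hs ht => simp only [map_add, add_mul, hs, ht]
  | tmul a c =>
    rw [LinearMap.lTensor_tmul, LinearMap.mul'_apply, LinearMap.comp_apply, mu_eq hD]
    induction comul (R := k) h with
    | zero => simp
    | add s t hs ht => simp only [map_add, mul_add, hs, ht]
    | tmul d e => simp [act_mul, mul_assoc]

variable [FiniteDimensional k H] [FiniteDimensional k C]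

omit [FiniteDimensional k C] in
include hD in
/-- `∑ N(b₁ h) b₂ = ε(b) N(h)` if `N(S⁻¹(b) h) = N(h) b`. -/
theorem mul_coact_of_antipodeInv (N : H →ₗ[k] B)
    (hN : ∀ b h, N (antipodeInv k H (D.ι b) * h) = N h * b) (b : B) (h : H) :
    LinearMap.mul' k B ((N ∘ₗ LinearMap.mulRight k h).rTensor B (coact (k := k) b)) =
      counit (R := k) (D.ι b) • N h := by
  -- The hypothesis on `N` lets `b₂` enter the argument as `S⁻¹(b₂)`, and `∑ S⁻¹(b₂) b₁ = ε(b)`.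
  have h1 : ∀ t : H ⊗[k] B,
      LinearMap.mul' k B ((N ∘ₗ LinearMap.mulRight k h).rTensor B t) =
      N (LinearMap.mul' k H (TensorProduct.comm k H H ((antipodeInv k H).lTensor H
        (D.ι.lTensor H t))) * h) := by
    intro t
    induction t with
    | zero => simp
    | add s t hs ht => simp only [map_add, add_mul, hs, ht]
    | tmul a c => simp [mul_assoc, hN]
  rw [h1, ← hD.ι_coact, MappingSystem.antipodeInv_mul_comul, smul_mul_assoc, one_mul, map_smul]

include hD in
/-- `∑ q(N ∘ μ_{b₁ h}) b₂ = ε(b) q(N ∘ μ_h)` if `N(S⁻¹(b) h) = N(h) b`. -/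
theorem contract_mu_mul (N : H →ₗ[k] B)
    (hN : ∀ b h, N (antipodeInv k H (D.ι b) * h) = N h * b) (b : B) (h : H) :
    LinearMap.mul' k _ (TensorProduct.map (contract ∘ₗ
      (LinearMap.llcomp k C H (Smash k H B C) (inr k H B C ∘ₗ N)) ∘ₗ mu D ∘ₗ
        LinearMap.mulRight k h) (inr k H B C) (coact (k := k) b)) =
      counit (R := k) (D.ι b) • contract (inr k H B C ∘ₗ N ∘ₗ mu D h) := by
  -- By `mu_mul`, the expression contracts `N(b₁ μ_h(x ◁ b₂))` and multiplies by `b₃`.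
  -- `contract_shift_mul_inr` brings the last two legs inside as one factor of `B`, where
  -- `mul_coact_of_antipodeInv` applies pointwise.
  let G : H →ₗ[k] C →ₗ[k] Smash k H B C :=
    (LinearMap.llcomp k C H (Smash k H B C) (inr k H B C ∘ₗ N)) ∘ₗ (mu D h).lcomp k H ∘ₗ
      LinearMap.mul k H
  have hG : ∀ g x, G g x = inr k H B C (N (g * mu D h x)) := fun _ _ => rfl
  let W : H ⊗[k] (H ⊗[k] B) →ₗ[k] Smash k H B C :=
    LinearMap.mul' k _ ∘ₗ TensorProduct.map (contract ∘ₗ TensorProduct.lift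
      (LinearMap.mk₂ k (fun g g' => shift H (G g) g') (by intros; ext; simp) (by intros; ext; simp)
        (by intros; ext; simp) (by intros; ext; simp))) (inr k H B C) ∘ₗ
      (TensorProduct.assoc k H H B).symm.toLinearMap
  have h1 : ∀ t : H ⊗[k] B, LinearMap.mul' k _ (TensorProduct.map (contract ∘ₗ
      (LinearMap.llcomp k C H (Smash k H B C) (inr k H B C ∘ₗ N)) ∘ₗ mu D ∘ₗ
        LinearMap.mulRight k h) (inr k H B C) t) =
      W (TensorProduct.assoc k H H B (comul.rTensor B t)) := by
    intro t
    induction t with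
    | zero => simp
    | add s t hs ht => simp only [map_add, hs, ht]
    | tmul a c =>
      simp only [W, LinearMap.comp_apply, LinearEquiv.coe_coe, LinearEquiv.symm_apply_apply,
        LinearMap.rTensor_tmul, TensorProduct.map_tmul, LinearMap.mul'_apply]
      congr 2
      ext x
      rw [LinearMap.llcomp_apply, LinearMap.mulRight_apply, mu_mul hD]
      induction comul (R := k) a with
      | zero => simp
      | add s t hs ht => simp only [map_add, LinearMap.add_apply, hs, ht]
      | tmul d e => simp [hG]
  have h2 : ∀ t : H ⊗[k] B, W ((coact (k := k)).lTensor H t) = contract (TensorProduct.lift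
      (LinearMap.mk₂ k (fun g c => LinearMap.mulRight k (inr k H B C c) ∘ₗ G g)
        (by intros; ext; simp [add_mul]) (by intros; ext; simp)
        (by intros; ext; simp [mul_add]) (by intros; ext; simp)) t) := by
    intro t
    induction t with
    | zero => simp
    | add s t hs ht => simp only [map_add, hs, ht]
    | tmul a c =>
      rw [TensorProduct.lift.tmul, LinearMap.mk₂_apply, ← contract_shift_mul_inr,
        LinearMap.lTensor_tmul]
      induction coact (k := k) (H := H) c with
      | zero => simp
      | add s t hs ht => simp only [map_add, tmul_add, hs, ht]
      | tmul d e => simp [W]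
  rw [h1, LeftComoduleAlgebra.coassoc, h2, ← map_smul]
  congr 1
  ext x
  have h3 := congrArg (inr k H B C) (mul_coact_of_antipodeInv hD N hN b (mu D h x))
  rw [map_smul] at h3
  refine Eq.trans ?_ h3
  induction coact (k := k) (H := H) b with
  | zero => simp
  | add s t hs ht => simp only [map_add, LinearMap.add_apply, hs, ht]
  | tmul d e => simp [hG, inr_mul_inr]

end Mu

end LeftPartialDual

end

open TensorProduct Coalgebra

noncomputable section

namespace LeftPartialDual

open LeftComoduleAlgebra RightModuleCoalgebra HopfAlgebra
open MappingSystem (inl inr antipodeInv)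

section

variable {k A : Type*} [Field k] [Ring A] [Algebra k A] (T : A →ₗ[k] A)

theorem mul_map_assoc_outer (t : (A ⊗[k] A) ⊗[k] A) :
    LinearMap.mul' k A ((LinearMap.mul' k A).lTensor A (TensorProduct.map T
      (TensorProduct.map LinearMap.id T) (TensorProduct.assoc k A A A t))) =
    LinearMap.mul' k A (T.lTensor A ((LinearMap.mul' k A ∘ₗ T.rTensor A).rTensor A t)) := by
  induction t with
  | zero => simp
  | add s t hs ht => simp only [map_add, hs, ht]
  | tmul u z =>
    induction u with
    | zero => simp
    | add s t hs ht => simp only [map_add, add_tmul, hs, ht]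
    | tmul x y => simp [mul_assoc]

theorem mul_map_assoc_middle (t : (A ⊗[k] A) ⊗[k] A) :
    LinearMap.mul' k A ((LinearMap.mul' k A).lTensor A (TensorProduct.map LinearMap.id
      (TensorProduct.map T LinearMap.id) (TensorProduct.assoc k A A A t))) =
    LinearMap.mul' k A ((LinearMap.mul' k A ∘ₗ T.lTensor A).rTensor A t) := by
  induction t with
  | zero => simp
  | add s t hs ht => simp only [map_add, hs, ht]
  | tmul u z =>
    induction u with
    | zero => simp
    | add s t hs ht => simp only [map_add, add_tmul, hs, ht]
    | tmul x y => simp [mul_assoc]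

end

/-! ### The antipode identities for `T` -/

section AntipodeAxioms

variable {k H B C : Type*} [Field k] [Ring H] [HopfAlgebra k H] [Ring B]
    [Algebra k B] [LeftComoduleAlgebra k H B] [AddCommGroup C] [Module k C] [Coalgebra k C]
    [RightModuleCoalgebra k H C] {D : MappingSystem k H B C} (hD : D.IsPAMS)
    [FiniteDimensional k H] [FiniteDimensional k B] [FiniteDimensional k C]

omit D [FiniteDimensional k H] [FiniteDimensional k B] in
theorem mul_rTensor_hat (p : Smash k H B C →ₗ[k] Smash k H B C) (Ψ : C →ₗ[k] Smash k H B C) :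
    LinearMap.mul' k _ (p.rTensor _ (hat H B Ψ)) = contract (p ∘ₗ Ψ) := by
  rw [rTensor_hat]
  rfl

omit D [FiniteDimensional k H] [FiniteDimensional k B] in
theorem mul_rTensor_hat_mul (p : Smash k H B C →ₗ[k] Smash k H B C) (Ψ : C →ₗ[k] Smash k H B C)
    (z : Smash k H B C) :
    LinearMap.mul' k _ (p.rTensor _ (hat H B Ψ * (1 ⊗ₜ z))) = contract (p ∘ₗ Ψ) * z := by
  rw [← mul_rTensor_hat]
  induction hat H B Ψ with
  | zero => simp
  | add s t hs ht => simp only [map_add, add_mul, hs, ht]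
  | tmul u v => simp [mul_assoc]

omit [FiniteDimensional k H] [FiniteDimensional k B] [FiniteDimensional k C] in
include hD in
theorem inrζ_conv_inrζbar :
    (inr k H B C ∘ₗ D.ζ) ⊚ (inr k H B C ∘ₗ D.ζbar) = convUnit k H (Smash k H B C) :=
  (comp_conv (inrAlg k H B C) D.ζ D.ζbar).symm.trans
    ((congrArg _ hD.ζ_conv_ζbar).trans (comp_convUnit _))

/-- After `T_mul_hat` and `comp_γπ`, the factors `ζ` and `ζbar` at the end cancel. The surviving
functional `f` is evaluated at `π(1)` by `actSnd_rAct_γbar`. -/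
theorem mul_T_comul_inl (f : Module.Dual k C) (F : Smash k H B C) :
    LinearMap.mul' k _ ((D.T ∘ₗ LinearMap.mulLeft k F).lTensor _ (comulAlg hD (inl k H B C f))) =
      f (D.π 1) • D.T F := by
  have h1 := T_mul_hat hD F 1 ((hitInl H B f ⊚ (inr k H B C ∘ₗ D.ζ)) ∘ₗ D.γ)
  rw [inr_one, ← Algebra.TensorProduct.one_def, mul_one, hD.ι_one, LinearMap.mulRight_one,
    LinearMap.comp_id, LinearMap.comp_assoc D.π,
    hD.comp_γπ _ (inr k H B C) (hitInl_conv_ζ_mul hD f), ← conv_assoc,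
    conv_cancel_right (inrζ_conv_inrζbar hD), contract_conv_hitInl] at h1
  rw [comulAlg_inl, h1, T_eq hD, ← map_smul]
  congr 1
  ext x
  simp only [LinearMap.comp_apply, LinearEquiv.coe_coe]
  rw [actSnd_rAct_γbar]
  simp

/-- Here `T_mul_hat` leaves `ζbar * Z` with `Z(x) = ∑ ζ(x₁ b₁) ζbar(x₂ b₂)`. This is `(ζ * ζbar)(x
b)`, hence `ε(x) ε(b)`. -/
theorem mul_T_comul_inr (b : B) (F : Smash k H B C) :
    LinearMap.mul' k _ ((D.T ∘ₗ LinearMap.mulLeft k F).lTensor _ (comulAlg hD (inr k H B C b))) =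
      counit (R := k) (D.ι b) • D.T F := by
  let Z : H ⊗[k] B → H →ₗ[k] Smash k H B C := fun t => inr k H B C ∘ₗ LinearMap.mul' k B ∘ₗ
    TensorProduct.map D.ζ D.ζbar ∘ₗ (LinearMap.mul k (H ⊗[k] H)).flip (D.ι.lTensor H t) ∘ₗ comul
  have h1 : ∀ t : H ⊗[k] B,
      LinearMap.mul' k _ ((D.T ∘ₗ LinearMap.mulLeft k F).lTensor _ (LinearMap.mul' k _
        (TensorProduct.map (hat H B ∘ₗ D.γ.lcomp k _ ∘ₗ shift H (inr k H B C ∘ₗ D.ζ))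
          (TensorProduct.mk k _ _ 1 ∘ₗ inr k H B C) t))) =
      contract (((inr k H B C ∘ₗ D.ζbar) ⊚ Z t) ∘ₗ rAct hD F ∘ₗ D.γbar) := by
    intro t
    induction t with
    | zero =>
      have : (inr k H B C ∘ₗ D.ζbar) ⊚ Z 0 = 0 := by
        ext x
        simp [Z, conv_apply]
      rw [this]
      simp
    | add s t hs ht =>
      have : Z (s + t) = Z s + Z t := by
        simp only [Z, map_add, LinearMap.add_comp, LinearMap.comp_add]
      rw [this, conv_add, LinearMap.add_comp]
      simp only [map_add, hs, ht]
    | tmul h c =>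
      have h2 : Z (h ⊗ₜ c) = shift H (inr k H B C ∘ₗ D.ζ) h ⊚
          (inr k H B C ∘ₗ D.ζbar ∘ₗ LinearMap.mulRight k (D.ι c)) := by
        ext x
        rw [conv_apply]
        simp only [Z, LinearMap.comp_apply]
        induction comul (R := k) x with
        | zero => simp
        | add s t hs ht => simp only [map_add, hs, ht]
        | tmul u v => simp [inr_mul_inr]
      have h3 := T_mul_hat hD F c (shift H (inr k H B C ∘ₗ D.ζ) h ∘ₗ D.γ)
      rw [LinearMap.comp_assoc D.π, hD.comp_γπ _ (inr k H B C) (shift_ζ_mul hD h),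
        conv_assoc, ← h2] at h3
      rw [← h3]
      simp
      rfl
  have h4 : Z (coact (k := k) b) = counit (R := k) (D.ι b) • convUnit k H _ := by
    ext x
    have h5 := LinearMap.congr_fun hD.ζ_conv_ζbar (x * D.ι b)
    simp only [Z, LinearMap.comp_apply, ← hD.ι_coact, LinearMap.flip_apply, LinearMap.mul_apply',
      ← Bialgebra.comul_mul]
    rw [conv_apply] at h5
    rw [h5]
    simp [convUnit_apply, Algebra.algebraMap_eq_smul_one, inr_one, smul_smul, mul_comm]
  have h6 : (inr k H B C ∘ₗ D.ζbar) ⊚ (counit (R := k) (D.ι b) • convUnit k H _) =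
      counit (R := k) (D.ι b) • (inr k H B C ∘ₗ D.ζbar) := by
    ext x
    have h5 := LinearMap.congr_fun (conv_unit (inr k H B C ∘ₗ D.ζbar)) x
    rw [conv_apply] at h5
    rw [conv_apply, TensorProduct.map_smul_right, LinearMap.smul_apply, map_smul, h5]
    rfl
  rw [comulAlg_inr, h1, h4, h6, LinearMap.smul_comp, map_smul, T_eq hD]
  rfl

/-- `∑ a₁ T(F a₂) = ε(a) T(F)` -/
theorem mul_T_comul (a F : Smash k H B C) :
    LinearMap.mul' k _ ((D.T ∘ₗ LinearMap.mulLeft k F).lTensor _ (comulAlg hD a)) =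
      counitAlg hD a • D.T F := by
  induction a using smash_induction with
  | hadd x y hx hy => simp only [map_add, add_smul, hx, hy]
  | hmul f b =>
    have h1 : ∀ s : Smash k H B C ⊗[k] Smash k H B C,
        LinearMap.mul' k _ ((D.T ∘ₗ LinearMap.mulLeft k F).lTensor _
          (s * comulAlg hD (inr k H B C b))) = counit (R := k) (D.ι b) •
        LinearMap.mul' k _ ((D.T ∘ₗ LinearMap.mulLeft k F).lTensor _ s) := by
      intro s
      induction s with
      | zero => simp
      | add s t hs ht => simp only [map_add, add_mul, smul_add, hs, ht]
      | tmul x y =>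
        have h2 := congrArg (x * ·) (mul_T_comul_inr hD b (F * y))
        simp only [mul_smul_comm] at h2
        refine Eq.trans ?_ h2
        induction comulAlg hD (inr k H B C b) with
        | zero => simp
        | add s t hs ht => simp only [map_add, mul_add, hs, ht]
        | tmul u v => simp [mul_assoc]
    rw [map_mul (comulAlg hD), map_mul (counitAlg hD), h1, mul_T_comul_inl, counitAlg_inl, counitAlg_inr, smul_smul, mul_comm]

omit [FiniteDimensional k B] [FiniteDimensional k C] in
/-- `N_F = ζbar ∘ R_F` satisfies `N_F(S⁻¹(b) h) = N_F(h) b`. -/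
theorem ζbar_rAct_antipodeInv_mul (F : Smash k H B C) (b : B) (h : H) :
    (D.ζbar ∘ₗ rAct hD F) (antipodeInv k H (D.ι b) * h) = (D.ζbar ∘ₗ rAct hD F) h * b := by
  rw [LinearMap.comp_apply, rAct_antipodeInv_mul, hD.ζbar_antipodeInv_mul, LinearMap.comp_apply]

omit [FiniteDimensional k H] in
-- Expanding `T` gives two nested contractions. Merging them by `contract_contract` convolves `γbar`
-- with `x ↦ ι(ζ(γ(x)h))`, which is `μ_h`.
theorem contract_T_shift_ζ (F : Smash k H B C) (h : H) :
    contract (D.T ∘ₗ LinearMap.mulRight k F ∘ₗ shift H (inr k H B C ∘ₗ D.ζ) h ∘ₗ D.γ) =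
      contract (inr k H B C ∘ₗ (D.ζbar ∘ₗ rAct hD F) ∘ₗ mu D h) := by
  let G : C →ₗ[k] C →ₗ[k] Smash k H B C :=
    LinearMap.llcomp k C H _ (inr k H B C ∘ₗ D.ζbar ∘ₗ rAct hD F) ∘ₗ D.γbar.lcomp k H ∘ₗ
      (LinearMap.mul k H).flip ∘ₗ D.ι ∘ₗ D.ζ ∘ₗ LinearMap.mulRight k h ∘ₗ D.γ
  have h1 : D.T ∘ₗ LinearMap.mulRight k F ∘ₗ shift H (inr k H B C ∘ₗ D.ζ) h ∘ₗ D.γ =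
      contract ∘ₗ G := by
    ext x
    simp only [LinearMap.comp_apply, LinearMap.mulRight_apply, shift_apply, T_eq hD, rAct_mul,
      rAct_inr]
    rfl
  rw [h1, contract_contract]
  congr 1
  ext x
  rw [LinearMap.comp_apply, LinearMap.comp_apply, LinearMap.comp_apply (D.ζbar ∘ₗ _), mu_apply,
    conv_apply]
  induction comul (R := k) x with
  | zero => simp
  | add s t hs ht => simp only [map_add, hs, ht]
  | tmul u v => simp [G]

theorem T_comul_mul_inr (b : B) (F : Smash k H B C) :
    LinearMap.mul' k _ ((D.T ∘ₗ LinearMap.mulRight k F).rTensor _ (comulAlg hD (inr k H B C b))) =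
      counit (R := k) (D.ι b) • D.T F := by
  have h1 := contract_mu_mul hD (D.ζbar ∘ₗ rAct hD F) (ζbar_rAct_antipodeInv_mul hD F) b 1
  rw [mu_one hD] at h1
  rw [T_eq hD, comulAlg_inr]
  refine Eq.trans ?_ h1
  induction coact (k := k) (H := H) b with
  | zero => simp
  | add s t hs ht => simp only [map_add, hs, ht]
  | tmul h c =>
    simp only [TensorProduct.map_tmul, LinearMap.mul'_apply, LinearMap.comp_apply,
      LinearMap.mulRight_apply, mul_one, TensorProduct.mk_apply, LinearMap.lcomp_apply']
    have h2 := contract_T_shift_ζ hD F h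
    refine Eq.trans ?_ (congrArg (· * inr k H B C c) h2)
    exact mul_rTensor_hat_mul _ _ _

omit [FiniteDimensional k H] [FiniteDimensional k B] [FiniteDimensional k C] in
include hD in
-- Since `ιζ = id * γbarπ`, applying `ιζ` to the second leg of `Δ` gives `Δ * (1 ⊗ γbarπ)`.
-- Colinearity of `γ` turns this, on `γ`, into `Δγ * (1 ⊗ γbar)`, and `Δγbar` cancels `Δγ`.
theorem comul_γbar_conv : (comul ∘ₗ D.γbar) ⊚ ((D.ι ∘ₗ D.ζ).lTensor H ∘ₗ comul ∘ₗ D.γ) =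
    (i₂ k H H).toLinearMap ∘ₗ D.γbar := by
  have h1 : (D.ι ∘ₗ D.ζ).lTensor H ∘ₗ comul =
      comul ⊚ ((i₂ k H H).toLinearMap ∘ₗ D.γbar ∘ₗ D.π) := by
    have h0 : (comul : H →ₗ[k] H ⊗[k] H) = ((i₁ k H H).toLinearMap ∘ₗ LinearMap.id) ⊚
        ((i₂ k H H).toLinearMap ∘ₗ LinearMap.id) := by
      rw [i₁_conv_i₂, TensorProduct.map_id, LinearMap.id_comp]
    conv_rhs => arg 1; rw [h0]
    rw [conv_assoc, ← comp_conv, ← hD.ιζ_eq, i₁_conv_i₂]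
    rfl
  have h2 : (D.ι ∘ₗ D.ζ).lTensor H ∘ₗ comul ∘ₗ D.γ =
      (comul ∘ₗ D.γ) ⊚ ((i₂ k H H).toLinearMap ∘ₗ D.γbar) := by
    rw [← LinearMap.comp_assoc, h1]
    ext x
    have h3 : ∀ t : H ⊗[k] H, TensorProduct.map comul
        ((i₂ k H H).toLinearMap ∘ₗ D.γbar ∘ₗ D.π) t = TensorProduct.map comul
        ((i₂ k H H).toLinearMap ∘ₗ D.γbar) (D.π.lTensor H t) := by
      intro t
      induction t with
      | zero => simp
      | add s t hs ht => simp only [map_add, hs, ht]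
      | tmul u v => simp
    rw [LinearMap.comp_apply, conv_apply, h3, hD.γ_coact, conv_apply]
    congr 1
    induction comul (R := k) x with
    | zero => simp
    | add s t hs ht => simp only [map_add, hs, ht]
    | tmul u v => simp
  have h4 : (comul ∘ₗ D.γbar) ⊚ (comul ∘ₗ D.γ) = convUnit k C (H ⊗[k] H) :=
    (comp_conv (Bialgebra.comulAlgHom k H) D.γbar D.γ).symm.trans
      ((congrArg _ hD.γbar_conv_γ).trans (comp_convUnit _))
  rw [h2, conv_cancel_left h4]

/-- The nested contractions merge, and `rAct_hitInl_conv_ζ` writes the action on `γbar` as `f ∘ π`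
applied to the first leg of the convolution in `comul_γbar_conv`. That convolution is `1 ⊗ γbar`, so
`f(π(1))` comes out. -/
theorem T_comul_mul_inl (f : Module.Dual k C) (F : Smash k H B C) :
    LinearMap.mul' k _ ((D.T ∘ₗ LinearMap.mulRight k F).rTensor _ (comulAlg hD (inl k H B C f))) =
      f (D.π 1) • D.T F := by
  let X := hitInl H B f ⊚ (inr k H B C ∘ₗ D.ζ)
  let G : C →ₗ[k] C →ₗ[k] Smash k H B C :=
    LinearMap.llcomp k C H _ (inr k H B C ∘ₗ D.ζbar ∘ₗ rAct hD F) ∘ₗ D.γbar.lcomp k H ∘ₗ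
      rAct hD ∘ₗ X ∘ₗ D.γ
  have h1 : (D.T ∘ₗ LinearMap.mulRight k F) ∘ₗ X ∘ₗ D.γ = contract ∘ₗ G := by
    ext x
    simp only [LinearMap.comp_apply, LinearMap.mulRight_apply, T_eq hD, rAct_mul]
    rfl
  rw [comulAlg_inl, mul_rTensor_hat, h1, contract_contract, T_eq hD, ← map_smul]
  congr 1
  ext x
  have h2 := LinearMap.congr_fun (comul_γbar_conv hD) x
  rw [conv_apply] at h2
  have h3 : ∀ t : C ⊗[k] C, TensorProduct.lift G.flip t = inr k H B C (D.ζbar (rAct hD F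
      (TensorProduct.lid k H ((f ∘ₗ D.π).rTensor H (LinearMap.mul' k (H ⊗[k] H)
        (TensorProduct.map (comul ∘ₗ D.γbar) ((D.ι ∘ₗ D.ζ).lTensor H ∘ₗ comul ∘ₗ D.γ) t)))))) := by
    intro t
    induction t with
    | zero => simp
    | add s t hs ht => simp only [map_add, hs, ht]
    | tmul u v =>
      have h4 := rAct_hitInl_conv_ζ hD f (D.γ v) (D.γbar u)
      exact congrArg (fun z => inr k H B C (D.ζbar (rAct hD F z))) h4
  rw [LinearMap.comp_apply, h3, h2]
  simp

/-- `∑ T(a₁ F) a₂ = ε(a) T(F)` -/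
theorem T_comul_mul (a F : Smash k H B C) :
    LinearMap.mul' k _ ((D.T ∘ₗ LinearMap.mulRight k F).rTensor _ (comulAlg hD a)) =
      counitAlg hD a • D.T F := by
  induction a using smash_induction with
  | hadd x y hx hy => simp only [map_add, add_smul, hx, hy]
  | hmul f b =>
    have h1 : ∀ s : Smash k H B C ⊗[k] Smash k H B C,
        LinearMap.mul' k _ ((D.T ∘ₗ LinearMap.mulRight k F).rTensor _
          (comulAlg hD (inl k H B C f) * s)) = f (D.π 1) •
        LinearMap.mul' k _ ((D.T ∘ₗ LinearMap.mulRight k F).rTensor _ s) := by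
      intro s
      induction s with
      | zero => simp
      | add s t hs ht => simp only [map_add, mul_add, smul_add, hs, ht]
      | tmul x y =>
        have h2 := congrArg (· * y) (T_comul_mul_inl hD f (x * F))
        simp only [smul_mul_assoc] at h2
        refine Eq.trans ?_ (h2.trans (by simp))
        induction comulAlg hD (inl k H B C f) with
        | zero => simp
        | add s t hs ht => simp only [map_add, add_mul, hs, ht]
        | tmul u v => simp [mul_assoc]
    rw [map_mul (comulAlg hD), map_mul (counitAlg hD), h1, T_comul_mul_inr, counitAlg_inl,
      counitAlg_inr, smul_smul]

include hD in
-- For `Θ` at `h`, the first two legs contract to `∑ ζbar(γbar(xᵢ) γ(π(h))) fᵢ`, which depends only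
-- on `π(h)`. As `S⁻¹γbar` is a section of `π`, merging with the contraction of the third leg gives
-- `ζbar` of `γbar * γ = ε`.
theorem associator_mul_T :
    LinearMap.mul' k _ ((LinearMap.mul' k _).lTensor _ (TensorProduct.map LinearMap.id
      (TensorProduct.map D.T LinearMap.id) D.associator)) = 1 := by
  let Θ := (TensorProduct.mk k (Smash k H B C) (Smash k H B C) 1 ∘ₗ inr k H B C ∘ₗ D.ζbar) ⊚
    associatorAux D
  let M := LinearMap.mul' k (Smash k H B C) ∘ₗ D.T.lTensor _
  have h1 := mul_map_assoc_middle D.T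
  have h2 : ∀ h, M (Θ h) = contract (inr k H B C ∘ₗ D.ζbar ∘ₗ
      (LinearMap.mul k H).flip (D.γ (D.π h)) ∘ₗ D.γbar) := by
    intro h
    have h3 : ∀ u v, M ((1 ⊗ₜ inr k H B C (D.ζbar u)) * associatorAux D v) =
        contract (inr k H B C ∘ₗ D.ζbar ∘ₗ (LinearMap.mul k H).flip (D.ι (D.ζbar u) * v) ∘ₗ
          D.γbar) := by
      intro u v
      have h4 := T_mul_hat hD (inr k H B C (D.ζbar u)) 1
        (shift H (inr k H B C ∘ₗ D.ζbar) v ∘ₗ (antipodeInv k H ∘ₗ D.γbar))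
      have h5 : ∀ c g, shift H (inr k H B C ∘ₗ D.ζbar) v (antipodeInv k H (D.ι c) * g) =
          shift H (inr k H B C ∘ₗ D.ζbar) v g * inr k H B C c := by
        intro c g
        simp [inr_mul_inr, mul_assoc, hD.ζbar_antipodeInv_mul]
      rw [inr_one, ← Algebra.TensorProduct.one_def, mul_one, hD.ι_one, LinearMap.mulRight_one,
        LinearMap.comp_id, LinearMap.comp_assoc D.π,
        comp_antipodeInv_γbarπ hD _ (inr k H B C) h5,
        conv_cancel_right (inrζ_conv_inrζbar hD), rAct_inr] at h4
      refine Eq.trans ?_ (h4.trans ?_)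
      · have h6 : ∀ t : Smash k H B C ⊗[k] Smash k H B C, M ((1 ⊗ₜ inr k H B C (D.ζbar u)) * t) =
            LinearMap.mul' k _ ((D.T ∘ₗ LinearMap.mulLeft k (inr k H B C (D.ζbar u))).lTensor _
              t) := by
          intro t
          induction t with
          | zero => simp
          | add s t hs ht => simp only [map_add, mul_add, hs, ht]
          | tmul x y => simp [M]
        exact h6 _
      · congr 1
        ext x
        simp [mul_assoc]
    have h6 := LinearMap.congr_fun hD.γπ_eq h
    rw [LinearMap.comp_apply] at h6
    rw [h6, conv_apply, conv_apply]
    induction comul (R := k) h with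
    | zero => simp
    | add s t hs ht => simp only [map_add, LinearMap.add_comp, LinearMap.comp_add, hs, ht]
    | tmul u v =>
      simp only [TensorProduct.map_tmul, LinearMap.mul'_apply]
      exact h3 u v
  let G : C →ₗ[k] C →ₗ[k] Smash k H B C :=
    LinearMap.llcomp k C H _ (inr k H B C ∘ₗ D.ζbar) ∘ₗ D.γbar.lcomp k H ∘ₗ
      (LinearMap.mul k H).flip ∘ₗ D.γ
  have h7 : M ∘ₗ Θ ∘ₗ antipodeInv k H ∘ₗ D.γbar = contract ∘ₗ G := by
    ext x
    obtain ⟨x, rfl⟩ := hD.π_surjective x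
    have h8 := h2 (antipodeInv k H (D.γbar (D.π x)))
    rw [hD.π_antipodeInv_γbar_π] at h8
    exact h8
  have h8 := rTensor_hat (H := H) (B := B) M (Θ ∘ₗ antipodeInv k H ∘ₗ D.γbar)
  rw [associator_eq, h1, h8, h7]
  refine (contract_contract G).trans ?_
  rw [← contract_convUnit]
  congr 1
  ext x
  have h9 := LinearMap.congr_fun hD.γbar_conv_γ x
  rw [conv_apply] at h9
  have h10 : ∀ t, TensorProduct.lift G.flip t = inr k H B C (D.ζbar (LinearMap.mul' k H
      (TensorProduct.map D.γbar D.γ t))) := by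
    intro t
    induction t with
    | zero => simp
    | add s t hs ht => simp only [map_add, hs, ht]
    | tmul u v => rfl
  rw [LinearMap.comp_apply, h10, h9, convUnit_apply, convUnit_apply,
    Algebra.algebraMap_eq_smul_one, map_smul, map_smul, hD.ζbar_one, inr_one,
    Algebra.algebraMap_eq_smul_one]

include hD in
-- The first two legs give `K * ζ` with `K(h) = ∑ ζbar(μ_h(xᵢ)) fᵢ`. The `ζbar` coming from `T` in
-- the third leg cancels `ζ`, and the remaining double contraction of `μ` over `γbar` reduces to
-- `γbar` by `mu_eq` and `actSnd_γbar`.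
theorem T_associatorInv_mul_T :
    LinearMap.mul' k _ ((LinearMap.mul' k _).lTensor _ (TensorProduct.map D.T
      (TensorProduct.map LinearMap.id D.T) (associatorInv D))) = D.upsilon := by
  let Θ := (hat H B ∘ₗ D.γ.lcomp k _ ∘ₗ shift H (inr k H B C ∘ₗ D.ζ)) ⊚
      (TensorProduct.mk k (Smash k H B C) (Smash k H B C) 1 ∘ₗ inr k H B C ∘ₗ D.ζ)
  let M := LinearMap.mul' k (Smash k H B C) ∘ₗ D.T.rTensor _
  have h1 := mul_map_assoc_outer D.T
  let K : H →ₗ[k] Smash k H B C := contract ∘ₗ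
    LinearMap.llcomp k C H _ (inr k H B C ∘ₗ D.ζbar) ∘ₗ mu D
  have hN := ζbar_rAct_antipodeInv_mul hD 1
  rw [rAct_one, LinearMap.comp_id] at hN
  have hMΘ : M ∘ₗ Θ = K ⊚ (inr k H B C ∘ₗ D.ζ) := by
    ext h
    rw [LinearMap.comp_apply, conv_apply, conv_apply]
    induction comul (R := k) h with
    | zero => simp
    | add s t hs ht => simp only [map_add, hs, ht]
    | tmul u v =>
      have h2 := contract_T_shift_ζ hD 1 u
      rw [rAct_one, LinearMap.comp_id, LinearMap.mulRight_one, LinearMap.id_comp] at h2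
      simp only [TensorProduct.map_tmul, LinearMap.mul'_apply, LinearMap.comp_apply,
        LinearMap.lcomp_apply', TensorProduct.mk_apply, M]
      exact (mul_rTensor_hat_mul _ _ _).trans (congrArg (· * inr k H B C (D.ζ v)) h2)
  -- Here `B` acts through its counit, so `comp_γπ` adds only the trivial factor `ε` and `MΘ`
  -- factors through `π`.
  have hM : ∀ b g, (M ∘ₗ Θ) (D.ι b * g) = (Algebra.linearMap k _ ∘ₗ counit ∘ₗ D.ι) b *
      (M ∘ₗ Θ) g := by
    intro b g
    rw [hMΘ, conv_apply, conv_apply, Bialgebra.comul_mul, hD.ι_coact]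
    induction comul (R := k) g with
    | zero => simp
    | add s t hs ht => simp only [map_add, mul_add, hs, ht]
    | tmul u v =>
      have h2 := congrArg (· * inr k H B C (D.ζ v)) (contract_mu_mul hD D.ζbar hN b u)
      simp only [smul_mul_assoc] at h2
      simp only [TensorProduct.map_tmul, LinearMap.mul'_apply, LinearMap.comp_apply,
        Algebra.linearMap_apply, Algebra.algebraMap_eq_smul_one, smul_mul_assoc, one_mul]
      refine Eq.trans ?_ h2
      induction coact (k := k) (H := H) b with
      | zero => simp
      | add s t hs ht => simp only [map_add, add_mul, hs, ht]
      | tmul x c =>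
        simp only [LinearMap.lTensor_tmul, Algebra.TensorProduct.tmul_mul_tmul,
          TensorProduct.map_tmul, LinearMap.mul'_apply, LinearMap.comp_apply, hD.ζ_mul,
          ← inr_mul_inr, mul_assoc]
        rfl
  have h3 : (Algebra.linearMap k (Smash k H B C) ∘ₗ counit ∘ₗ D.ι) ∘ₗ D.ζbar =
      convUnit k H _ := by
    ext h
    simp [hD.counit_ζbar, convUnit_apply]
  have h4 : (M ∘ₗ Θ ∘ₗ D.γ) ∘ₗ D.π = K ⊚ (inr k H B C ∘ₗ D.ζ) := by
    have h5 := hD.comp_γπ _ _ hM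
    rw [h3, unit_conv] at h5
    exact h5.trans hMΘ
  have h5 := rTensor_hat (H := H) (B := B) M (Θ ∘ₗ D.γ)
  have h6 := T_mul_hat hD 1 1 (M ∘ₗ Θ ∘ₗ D.γ)
  rw [inr_one, ← Algebra.TensorProduct.one_def, mul_one, hD.ι_one, LinearMap.mulRight_one,
    LinearMap.comp_id, h4, conv_cancel_right (inrζ_conv_inrζbar hD), rAct_one, LinearMap.id_comp,
    LinearMap.mulLeft_one, LinearMap.comp_id] at h6
  have h8 : K ∘ₗ D.γbar = contract ∘ₗ (LinearMap.llcomp k C H _ (inr k H B C ∘ₗ D.ζbar) ∘ₗ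
    mu D) ∘ₗ D.γbar := rfl
  rw [associatorInv, h1, h5, h6, h8, contract_contract, MappingSystem.upsilon, T_eq hD, rAct_one]
  congr 1
  ext x
  have h7 : ∀ t : C ⊗[k] C, TensorProduct.lift ((LinearMap.llcomp k C H _
      (inr k H B C ∘ₗ D.ζbar) ∘ₗ mu D) ∘ₗ D.γbar).flip t = inr k H B C (D.ζbar
        (LinearMap.mul' k H (D.γbar.lTensor H (actSnd k H C (D.γbar.lTensor C t))))) := by
    intro t
    induction t with
    | zero => simp
    | add s t hs ht => simp only [map_add, hs, ht]
    | tmul u v =>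
      rw [LinearMap.lTensor_tmul, actSnd_tmul, ← LinearMap.comp_apply (D.γbar.lTensor H),
        ← LinearMap.lTensor_comp, ← mu_eq hD]
      rfl
  refine (h7 _).trans ?_
  rw [actSnd_γbar hD, LinearMap.lTensor_tmul, γbar_π_one hD, LinearMap.mul'_apply, mul_one]
  rfl

end AntipodeAxioms

end LeftPartialDual

end

open TensorProduct Coalgebra

noncomputable section

namespace LeftPartialDual

open LeftComoduleAlgebra RightModuleCoalgebra HopfAlgebra
open MappingSystem (inl inr antipodeInv)

theorem lTensor_mul_assoc_tmul {k M R : Type*} [Field k] [AddCommGroup M] [Module k M] [Ring R]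
    [Algebra k R] (t : M ⊗[k] R) (m : R) : (LinearMap.mul' k R).lTensor M
      (TensorProduct.assoc k M R R (t ⊗ₜ m)) = (LinearMap.mulRight k m).lTensor M t := by
  induction t with
  | zero => simp
  | add s t hs ht => simp only [map_add, add_tmul, hs, ht]
  | tmul x y => simp

/-! ### Invariants in `H ⊗ (C* # B)` -/

section Operators

variable {k H B C : Type*} [Field k] [Ring H] [HopfAlgebra k H] [Ring B]
    [Algebra k B] [LeftComoduleAlgebra k H B] [AddCommGroup C] [Module k C] [Coalgebra k C]
    [RightModuleCoalgebra k H C] {D : MappingSystem k H B C} (hD : D.IsPAMS)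

variable (k H B C) in
/-- Right multiplication by `h` on the first factor of `H ⊗ (C* # B)`. -/
def rmul : H →ₗ[k] Module.End k (H ⊗[k] Smash k H B C) :=
  LinearMap.rTensorHom (Smash k H B C) ∘ₗ (LinearMap.mul k H).flip

theorem rmul_apply (h : H) : rmul k H B C h = (LinearMap.mulRight k h).rTensor _ := rfl

@[simp] theorem rmul_tmul (h x : H) (m : Smash k H B C) :
    rmul k H B C h (x ⊗ₜ m) = (x * h) ⊗ₜ m := rfl

theorem rmul_mul (h h' : H) (w : H ⊗[k] Smash k H B C) :
    rmul k H B C (h * h') w = rmul k H B C h' (rmul k H B C h w) := by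
  induction w with
  | zero => simp
  | add s t hs ht => simp only [map_add, hs, ht]
  | tmul x m => simp [mul_assoc]

theorem rmul_one (w : H ⊗[k] Smash k H B C) : rmul k H B C 1 w = w := by
  induction w with
  | zero => simp
  | add s t hs ht => simp only [map_add, hs, ht]
  | tmul x m => simp

variable (k H B C) in
/-- `f ↦ (h ⊗ m ↦ ∑ h₁ ⊗ (h₂ ⇀ f) m)` -/
def hitAct : Module.Dual k C →ₗ[k] Module.End k (H ⊗[k] Smash k H B C) where
  toFun f := (LinearMap.mul' k (Smash k H B C)).lTensor H ∘ₗ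
    (TensorProduct.assoc k H (Smash k H B C) (Smash k H B C)).toLinearMap ∘ₗ
      ((hitInl H B f).lTensor H ∘ₗ comul).rTensor (Smash k H B C)
  map_add' f g := by
    have : hitInl H B (f + g) = hitInl H B f + hitInl H B g := by
      ext h
      simp
    rw [this, LinearMap.lTensor_add, LinearMap.add_comp, LinearMap.rTensor_add,
      LinearMap.comp_add, LinearMap.comp_add]
  map_smul' r f := by
    have : hitInl H B (r • f) = r • hitInl H B f := by
      ext h
      simp
    rw [this, LinearMap.lTensor_smul, LinearMap.smul_comp, LinearMap.rTensor_smul,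
      LinearMap.comp_smul, LinearMap.comp_smul]
    rfl

theorem hitAct_tmul (f : Module.Dual k C) (h : H) (m : Smash k H B C) :
    hitAct k H B C f (h ⊗ₜ m) =
      (LinearMap.mulRight k m ∘ₗ hitInl H B f).lTensor H (comul (R := k) h) := by
  change ((LinearMap.mul' k (Smash k H B C)).lTensor H ∘ₗ _ ∘ₗ _) _ = _
  rw [LinearMap.lTensor_comp, LinearMap.comp_apply, LinearMap.comp_apply, LinearMap.rTensor_tmul,
    LinearMap.comp_apply]
  exact lTensor_mul_assoc_tmul _ _

/-- The commutation rule `f · (w h) = ∑ ((h₂ ⇀ f) · w) h₁`, from multiplicativity of `Δ`. -/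
theorem hitAct_rmul (f : Module.Dual k C) (h : H) (w : H ⊗[k] Smash k H B C) :
    hitAct k H B C f (rmul k H B C h w) = TensorProduct.lift ((rmul k H B C).flip ∘ₗ
      (hitAct k H B C).flip w ∘ₗ (hit k H C).flip f).flip (comul (R := k) h) := by
  induction w with
  | zero =>
    have : ((rmul k H B C).flip ∘ₗ (hitAct k H B C).flip 0 ∘ₗ (hit k H C).flip f).flip = 0 := by
      ext
      simp
    have h0 : TensorProduct.lift (0 : H →ₗ[k] H →ₗ[k] H ⊗[k] Smash k H B C) = 0 :=
      TensorProduct.ext' fun x y => TensorProduct.lift.tmul x y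
    rw [map_zero, map_zero, this, h0]
    rfl
  | add s t hs ht =>
    have : ∀ F G : H →ₗ[k] H →ₗ[k] H ⊗[k] Smash k H B C, (F + G).flip = F.flip + G.flip :=
      fun _ _ => rfl
    simp only [map_add, LinearMap.add_comp, LinearMap.comp_add, hs, ht, this]
    rw [← LinearMap.add_apply]
    congr 1
    ext
    simp
  | tmul x m =>
    rw [rmul_tmul, hitAct_tmul, Bialgebra.comul_mul]
    induction comul (R := k) h with
    | zero => simp
    | add s t hs ht => simp only [map_add, mul_add, hs, ht]
    | tmul a b =>
      simp only [TensorProduct.lift.tmul, LinearMap.flip_apply, LinearMap.comp_apply, hitAct_tmul]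
      induction comul (R := k) x with
      | zero => simp
      | add s t hs ht => simp only [map_add, add_mul, hs, ht]
      | tmul u v => simp [hit_mul]

theorem hitAct_dualAct (f g : Module.Dual k C) (w : H ⊗[k] Smash k H B C) :
    hitAct k H B C f ((dualAct D g).rTensor _ w) = (dualAct D g).rTensor _ (hitAct k H B C f w) := by
  induction w with
  | zero => simp
  | add s t hs ht => simp only [map_add, hs, ht]
  | tmul x m =>
    rw [LinearMap.rTensor_tmul, hitAct_tmul, hitAct_tmul, comul_dualAct]
    let p := LinearMap.mulRight k m ∘ₗ hitInl H B f
    have h1 : ∀ t : H ⊗[k] (H ⊗[k] H), p.lTensor H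
        (TensorProduct.lid k _ ((g ∘ₗ D.π).rTensor _ t)) = TensorProduct.map
          ((TensorProduct.lid k H).toLinearMap ∘ₗ (g ∘ₗ D.π).rTensor H) p
          ((TensorProduct.assoc k H H H).symm t) := by
      intro t
      induction t with
      | zero => simp
      | add s t hs ht => simp only [map_add, hs, ht]
      | tmul a u =>
        induction u with
        | zero => simp
        | add s t hs ht => simp only [map_add, tmul_add, hs, ht]
        | tmul b c => simp [smul_tmul']
    rw [h1, coassoc_symm_apply]
    induction comul (R := k) x with
    | zero => simp
    | add s t hs ht => simp only [map_add, hs, ht]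
    | tmul a b => simp [dualAct_apply, p]

theorem hitAct_lTensor_mulRight (f : Module.Dual k C) (m : Smash k H B C)
    (w : H ⊗[k] Smash k H B C) : hitAct k H B C f ((LinearMap.mulRight k m).lTensor H w) =
      (LinearMap.mulRight k m).lTensor H (hitAct k H B C f w) := by
  induction w with
  | zero => simp
  | add s t hs ht => simp only [map_add, hs, ht]
  | tmul x n =>
    rw [LinearMap.lTensor_tmul, hitAct_tmul, hitAct_tmul]
    induction comul (R := k) x with
    | zero => simp
    | add s t hs ht => simp only [map_add, hs, ht]
    | tmul u v => simp [mul_assoc]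

theorem hitAct_hat [FiniteDimensional k C] (f : Module.Dual k C) (l : C →ₗ[k] H) :
    hitAct k H B C f (hat H B l) = hat H B ((TensorProduct.rid k H).toLinearMap ∘ₗ f.lTensor H ∘ₗ
      actSnd k H C ∘ₗ l.lTensor C ∘ₗ comul) := by
  induction l using hom_induction with
  | hadd f g hf hg =>
    simp only [LinearMap.comp_add, LinearMap.lTensor_add, LinearMap.add_comp, map_add, hf, hg]
  | hr g h =>
    have h2 : (TensorProduct.rid k H).toLinearMap ∘ₗ f.lTensor H ∘ₗ actSnd k H C ∘ₗ
        (g.smulRight h).lTensor C ∘ₗ comul =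
        TensorProduct.lift (LinearMap.mk₂ k (fun a c => (dualMul k C (hit k H C c f) g).smulRight
          a) (by intros; ext; simp) (by intros; ext; simp [smul_smul, mul_comm])
          (by intros; ext; simp [add_smul]) (by intros; ext; simp [smul_smul]))
          (comul (R := k) h) := by
      ext x
      have h3 : ∀ s : C ⊗[k] C, TensorProduct.rid k H (f.lTensor H (actSnd k H C
          ((g.smulRight h).lTensor C s))) = TensorProduct.rid k H (f.lTensor H
            (((act (k := k) (H := H) (C := C)) (TensorProduct.rid k C (g.lTensor C s))).lTensor H
              (comul (R := k) h))) := by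
        intro s
        induction s with
        | zero => simp
        | add s t hs ht => simp only [map_add, LinearMap.lTensor_add, LinearMap.add_apply, hs, ht]
        | tmul a b =>
          rw [LinearMap.lTensor_tmul, LinearMap.smulRight_apply, tmul_smul, map_smul, actSnd_tmul]
          simp [LinearMap.lTensor_smul]
      simp only [LinearMap.comp_apply, LinearEquiv.coe_coe, h3]
      induction comul (R := k) h with
      | zero => simp
      | add s t hs ht => simp only [map_add, LinearMap.add_apply, hs, ht]
      | tmul a c =>
        simp [dualMul, transposeMul_apply]
        induction comul (R := k) x with
        | zero => simp
        | add s t hs ht => simp only [map_add, LinearMap.add_apply, add_smul, hs, ht]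
        | tmul y z => simp [hit_apply, mul_comm]
    rw [h2, hat_smulRight, hitAct_tmul]
    induction comul (R := k) h with
    | zero => simp
    | add s t hs ht => simp only [map_add, hs, ht]
    | tmul a c => simp [hat_smulRight, inl_mul_inl]

variable (D) in
/-- The elements `w` of `H ⊗ (C* # B)` with `∑ h₁ ⊗ (h₂ ⇀ f) m = f(π(1)) h ⊗ m` for
`w = ∑ h ⊗ m`. -/
def hitInvariants : Submodule k (H ⊗[k] Smash k H B C) where
  carrier := {w | ∀ f, hitAct k H B C f w = f (D.π 1) • w}
  zero_mem' := by simp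
  add_mem' hv hw f := by rw [map_add, hv, hw, smul_add]
  smul_mem' r w hw f := by rw [map_smul, hw, smul_comm]

theorem mem_hitInvariants {w : H ⊗[k] Smash k H B C} :
    w ∈ hitInvariants D ↔ ∀ f, hitAct k H B C f w = f (D.π 1) • w := Iff.rfl

include hD in
theorem hitAct_rmul_of_mem {w : H ⊗[k] Smash k H B C} (hw : w ∈ hitInvariants D)
    (f : Module.Dual k C) (h : H) : hitAct k H B C f (rmul k H B C h w) =
      rmul k H B C (TensorProduct.rid k H ((f ∘ₗ D.π).lTensor H (comul (R := k) h))) w := by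
  rw [hitAct_rmul]
  induction comul (R := k) h with
  | zero => simp
  | add s t hs ht => simp only [map_add, LinearMap.add_apply, hs, ht]
  | tmul a c => simp [mem_hitInvariants.1 hw, hit_apply, π_one_act hD]

/-- The functional part of the action commutes with `hitAct` by coassociativity. Right
multiplication by `ι(b)` preserves invariance because `ι(b)` is coinvariant. -/
theorem rAct_mem_hitInvariants (a : Smash k H B C) {w : H ⊗[k] Smash k H B C}
    (hw : w ∈ hitInvariants D) : (rAct hD a).rTensor _ w ∈ hitInvariants D := by
  induction a using smash_induction with
  | hadd a b ha hb =>
    rw [map_add, LinearMap.rTensor_add, LinearMap.add_apply]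
    exact add_mem ha hb
  | hmul g b =>
    rw [rAct_mul, rAct_inl, rAct_inr, LinearMap.rTensor_comp, LinearMap.comp_apply]
    have h1 : (dualAct D g).rTensor _ w ∈ hitInvariants D := by
      intro f
      rw [hitAct_dualAct, mem_hitInvariants.1 hw, map_smul]
    intro f
    have h2 := hitAct_rmul_of_mem hD h1 f (D.ι b)
    rw [LinearMap.lTensor_comp, LinearMap.comp_apply,
      (hD.mem_range_ι_iff (D.ι b)).1 ⟨b, rfl⟩] at h2
    rw [← rmul_apply, h2]
    simp

variable [FiniteDimensional k C]

variable (D) in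
/-- `m ↦ ∑ᵢ γbar(xᵢ) ⊗ fᵢ m` -/
def γbarHat : Smash k H B C →ₗ[k] H ⊗[k] Smash k H B C :=
  (LinearMap.lTensorHom H ∘ₗ (LinearMap.mul k (Smash k H B C)).flip).flip (hat H B D.γbar)

theorem γbarHat_apply (m : Smash k H B C) :
    γbarHat D m = (LinearMap.mulRight k m).lTensor H (hat H B D.γbar) := rfl

include hD in
theorem γbarHat_mem_hitInvariants (m : Smash k H B C) : γbarHat D m ∈ hitInvariants D := by
  intro f
  have h1 : (TensorProduct.rid k H).toLinearMap ∘ₗ f.lTensor H ∘ₗ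
      actSnd k H C ∘ₗ D.γbar.lTensor C ∘ₗ comul = f (D.π 1) • D.γbar := by
    ext x
    simp only [LinearMap.comp_apply, actSnd_γbar hD]
    simp
  rw [γbarHat_apply, hitAct_lTensor_mulRight, hitAct_hat, h1, map_smul, map_smul]

variable (D) in
/-- `h ⊗ m ↦ ζbar(h) m` -/
def ζbarMul : H ⊗[k] Smash k H B C →ₗ[k] Smash k H B C :=
  LinearMap.mul' k _ ∘ₗ (inr k H B C ∘ₗ D.ζbar).rTensor _

/-- This factors `T` through the right action on the invariants `γbarHat D m`, so that `T(ab)` can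
be read off by acting first with `a` and then with `b`. -/
theorem ζbarMul_rAct_γbarHat [FiniteDimensional k B] (a m : Smash k H B C) :
    ζbarMul D ((rAct hD a).rTensor _ (γbarHat D m)) = D.T a * m := by
  have h1 : ∀ t : H ⊗[k] Smash k H B C, ζbarMul D ((rAct hD a).rTensor _
      ((LinearMap.mulRight k m).lTensor H t)) =
      LinearMap.mul' k _ ((inr k H B C ∘ₗ D.ζbar ∘ₗ rAct hD a).rTensor _ t) * m := by
    intro t
    induction t with
    | zero => simp
    | add s t hs ht => simp only [map_add, add_mul, hs, ht]
    | tmul x n => simp [ζbarMul, mul_assoc]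
  rw [γbarHat_apply, h1, rTensor_hat, T_eq hD]
  rfl

end Operators

end LeftPartialDual

end

open TensorProduct Coalgebra

noncomputable section

namespace LeftPartialDual

open LeftComoduleAlgebra RightModuleCoalgebra HopfAlgebra
open MappingSystem (inl inr antipodeInv)

/-! ### The dimension count and `T(ab) = T(b) υ⁻¹ T(a)` -/

section Relations

variable {k H B C : Type*} [Field k] [Ring H] [HopfAlgebra k H] [Ring B]
    [Algebra k B] [LeftComoduleAlgebra k H B] [AddCommGroup C] [Module k C] [Coalgebra k C]
    [RightModuleCoalgebra k H C] {D : MappingSystem k H B C} (hD : D.IsPAMS)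
    [FiniteDimensional k H]

variable (D) in
/-- The span of the elements `S⁻¹(ι(b)) h ⊗ m - h ⊗ b m`. -/
def relations : Submodule k (H ⊗[k] Smash k H B C) :=
  Submodule.span k {w | ∃ (b : B) (h : H) (m : Smash k H B C),
    w = (antipodeInv k H (D.ι b) * h) ⊗ₜ m - h ⊗ₜ (inr k H B C b * m)}

omit [FiniteDimensional k H] in
theorem sub_mem_relations (b : B) (h : H) (m : Smash k H B C) :
    (antipodeInv k H (D.ι b) * h) ⊗ₜ m - h ⊗ₜ (inr k H B C b * m) ∈ relations D :=
  Submodule.subset_span ⟨b, h, m, rfl⟩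

omit [FiniteDimensional k H] in
theorem rTensor_mem_relations (u : Module.End k H)
    (hu : ∀ b h, u (antipodeInv k H (D.ι b) * h) = antipodeInv k H (D.ι b) * u h)
    {w : H ⊗[k] Smash k H B C} (hw : w ∈ relations D) : u.rTensor _ w ∈ relations D := by
  have : relations D ≤ (relations D).comap (u.rTensor _) := by
    refine Submodule.span_le.2 ?_
    rintro _ ⟨b, h, m, rfl⟩
    simp only [SetLike.mem_coe, Submodule.mem_comap, map_sub, LinearMap.rTensor_tmul, hu]
    exact sub_mem_relations b _ m
  exact this hw

omit [FiniteDimensional k H] in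
theorem rmul_mem_relations (h : H) {w : H ⊗[k] Smash k H B C} (hw : w ∈ relations D) :
    rmul k H B C h w ∈ relations D :=
  rTensor_mem_relations _ (fun _ _ => by simp [mul_assoc]) hw

theorem ζbarMul_of_mem_relations (hD : D.IsPAMS) {w : H ⊗[k] Smash k H B C}
    (hw : w ∈ relations D) : ζbarMul D w = 0 := by
  have : relations D ≤ LinearMap.ker (ζbarMul D) := by
    refine Submodule.span_le.2 ?_
    rintro _ ⟨b, h, m, rfl⟩
    simp [ζbarMul, hD.ζbar_antipodeInv_mul, ← inr_mul_inr, mul_assoc]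
  exact this hw

include hD in
-- On the legs of `Δ(S⁻¹(b)h)`, one relation moves `b₂` to the right factor. Then
-- `coact_antipodeInv_mul` recombines it with the functional leg.
theorem hitAct_mem_relations (f : Module.Dual k C) {w : H ⊗[k] Smash k H B C}
    (hw : w ∈ relations D) : hitAct k H B C f w ∈ relations D := by
  have : relations D ≤ (relations D).comap (hitAct k H B C f) := by
    refine Submodule.span_le.2 ?_
    rintro _ ⟨b, h, m, rfl⟩
    rw [SetLike.mem_coe, Submodule.mem_comap, map_sub, hitAct_tmul, hitAct_tmul,
      Bialgebra.comul_mul, MappingSystem.comul_antipodeInv, hD.ι_coact]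
    induction comul (R := k) h with
    | zero => simp
    | add s t hs ht =>
      rw [mul_add, map_add, map_add, add_sub_add_comm]
      exact add_mem hs ht
    | tmul x y =>
      have h1 := coact_antipodeInv_mul (hitInl H B f) (inr k H B C) (fun b g => by
        rw [hitInl_apply, inr_mul_inl]
        induction coact (k := k) (H := H) b with
        | zero => simp
        | add s t hs ht => simp only [map_add, hs, ht]
        | tmul u c => simp [hit_mul]) b y
      have h2 : ∀ t : H ⊗[k] B, (LinearMap.mulRight k m ∘ₗ hitInl H B f).lTensor H
          (TensorProduct.map (antipodeInv k H) (antipodeInv k H)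
            (TensorProduct.comm k H H (D.ι.lTensor H t)) * x ⊗ₜ y) -
          x ⊗ₜ (LinearMap.mul' k _ (TensorProduct.comm k _ _ (TensorProduct.map
            (hitInl H B f ∘ₗ LinearMap.mulRight k y ∘ₗ antipodeInv k H) (inr k H B C) t)) * m) ∈
          relations D := by
        intro t
        induction t with
        | zero => simp
        | add s t hs ht =>
          simp only [map_add, add_mul, tmul_add]
          rw [add_sub_add_comm]
          exact add_mem hs ht
        | tmul u c =>
          have h3 := sub_mem_relations (D := D) c x
            (inl k H B C (hit k H C (antipodeInv k H u * y) f) * m)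
          simpa [mul_assoc] using h3
      have h4 := h2 (coact (k := k) b)
      rw [h1] at h4
      simpa [mul_assoc] using h4
  exact this hw

variable [FiniteDimensional k C]

variable (D) in
/-- `w ↦ ∑ᵢ (fᵢ · w) γbar((xᵢ)₁) ⊗ (xᵢ)₂` -/
def uncoact : H ⊗[k] Smash k H B C →ₗ[k] (H ⊗[k] Smash k H B C) ⊗[k] C :=
  ((TensorProduct.lift ((rmul k H B C).flip.compl₂ D.γbar)).rTensor C ∘ₗ
    (TensorProduct.assoc k _ C C).symm.toLinearMap ∘ₗ comul.lTensor (H ⊗[k] Smash k H B C)) ∘ₗ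
  ∑ i, (TensorProduct.mk k (H ⊗[k] Smash k H B C) C).flip (Module.finBasis k C i) ∘ₗ
    hitAct k H B C ((Module.finBasis k C).coord i)

omit [FiniteDimensional k H] in
include hD in
-- On `w γ(x)` with `w` invariant, the action of a basis of `C*` recovers `∑ w γ(x₁) ⊗ x₂`.
-- Multiplying by `γbar` gives `∑ w γ(x₁) γbar(x₂) ⊗ x₃ = w ⊗ x`.
theorem uncoact_rmul_γ {w : H ⊗[k] Smash k H B C} (hw : w ∈ hitInvariants D) (x : C) :
    uncoact D (rmul k H B C (D.γ x) w) = w ⊗ₜ x := by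
  have h1 : ∀ h, (∑ i, (TensorProduct.mk k (H ⊗[k] Smash k H B C) C).flip
      (Module.finBasis k C i) ∘ₗ hitAct k H B C ((Module.finBasis k C).coord i))
        (rmul k H B C h w) =
      ((rmul k H B C).flip w).rTensor C (D.π.lTensor H (comul (R := k) h)) := by
    intro h
    simp only [LinearMap.sum_apply, LinearMap.comp_apply, hitAct_rmul_of_mem hD hw]
    induction comul (R := k) h with
    | zero => simp
    | add s t hs ht => simp only [map_add, LinearMap.add_apply, Finset.sum_add_distrib, hs, ht]
    | tmul a c =>
      simp only [LinearMap.lTensor_tmul, LinearMap.comp_apply, TensorProduct.rid_tmul, map_smul,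
        LinearMap.smul_apply, LinearMap.flip_apply, TensorProduct.mk_apply, ← tmul_smul,
        ← tmul_sum, LinearMap.rTensor_tmul, Module.Basis.coord_apply, Module.Basis.sum_repr]
  have h2 : ∀ t : C ⊗[k] C, ((TensorProduct.lift ((rmul k H B C).flip.compl₂ D.γbar)).rTensor C ∘ₗ
      (TensorProduct.assoc k _ C C).symm.toLinearMap ∘ₗ comul.lTensor (H ⊗[k] Smash k H B C))
      (((rmul k H B C).flip w).rTensor C (D.γ.rTensor C t)) =
      ((rmul k H B C).flip w ∘ₗ LinearMap.mul' k H ∘ₗ TensorProduct.map D.γ D.γbar).rTensor C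
        ((TensorProduct.assoc k C C C).symm (comul.lTensor C t)) := by
    intro t
    induction t with
    | zero => simp
    | add s t hs ht => simp only [map_add, hs, ht]
    | tmul a c =>
      simp only [LinearMap.rTensor_tmul, LinearMap.comp_apply, LinearMap.lTensor_tmul,
        LinearEquiv.coe_coe]
      induction comul (R := k) c with
      | zero => simp
      | add s t hs ht => simp only [map_add, tmul_add, hs, ht]
      | tmul d e => simp [rmul_mul]
  have h3 : LinearMap.mul' k H ∘ₗ TensorProduct.map D.γ D.γbar ∘ₗ comul = convUnit k C H := by
    rw [← hD.γ_conv_γbar]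
    ext y
    rw [conv_apply]
    rfl
  have h4 : ∀ t : C ⊗[k] C, ((rmul k H B C).flip w ∘ₗ convUnit k C H).rTensor C t =
      w ⊗ₜ TensorProduct.lid k C (counit.rTensor C t) := by
    intro t
    induction t with
    | zero => simp
    | add s t hs ht => simp only [map_add, tmul_add, hs, ht]
    | tmul a c =>
      simp [convUnit_apply, Algebra.algebraMap_eq_smul_one, rmul_one, smul_tmul']
  rw [uncoact, LinearMap.comp_apply, h1, hD.γ_coact, h2, coassoc_symm_apply,
    ← LinearMap.comp_apply (LinearMap.rTensor _ _), ← LinearMap.rTensor_comp, LinearMap.comp_assoc,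
    LinearMap.comp_assoc, h3, h4]
  simp

include hD in
theorem mkQ_uncoact_of_mem_relations {w : H ⊗[k] Smash k H B C} (hw : w ∈ relations D) :
    (relations D).mkQ.rTensor C (uncoact D w) = 0 := by
  have h1 : ∀ n ∈ relations D, ∀ t : C ⊗[k] C, (relations D).mkQ.rTensor C
      ((TensorProduct.lift ((rmul k H B C).flip.compl₂ D.γbar)).rTensor C
        ((TensorProduct.assoc k _ C C).symm (n ⊗ₜ t))) = 0 := by
    intro n hn t
    induction t with
    | zero => simp
    | add s t hs ht => rw [tmul_add, map_add, map_add, map_add, hs, ht, add_zero]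
    | tmul a c =>
      have h2 : (relations D).mkQ (rmul k H B C (D.γbar a) n) = 0 :=
        (Submodule.Quotient.mk_eq_zero _).2 (rmul_mem_relations _ hn)
      rw [TensorProduct.assoc_symm_tmul, LinearMap.rTensor_tmul, LinearMap.rTensor_tmul,
        TensorProduct.lift.tmul, LinearMap.compl₂_apply, LinearMap.flip_apply, h2, zero_tmul]
  rw [uncoact, LinearMap.comp_apply, LinearMap.sum_apply, map_sum, map_sum]
  refine Finset.sum_eq_zero fun i _ => ?_
  exact h1 _ (hitAct_mem_relations hD _ hw) _

variable [FiniteDimensional k B]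

instance : FiniteDimensional k (Smash k H B C) :=
  inferInstanceAs (FiniteDimensional k (Module.Dual k C ⊗[k] B))

omit [FiniteDimensional k C] [FiniteDimensional k B] in
include hD in
-- By `eq_antipodeInv_mul`, `h = ∑ S⁻¹(ζbar(h₂)) S⁻¹(γbar(π(h₁)))`, and the relations carry the
-- factor from `B` to the right. This bounds the dimension of the quotient by `dim C · dim (C* #
-- B)`.
theorem mkQ_antipodeInv_γbar_surjective : Function.Surjective
    ((relations D).mkQ ∘ₗ (antipodeInv k H ∘ₗ D.γbar).rTensor (Smash k H B C)) := by
  intro w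
  obtain ⟨w, rfl⟩ := (relations D).mkQ_surjective w
  suffices h : ∀ w, ∃ v, (relations D).mkQ
      ((antipodeInv k H ∘ₗ D.γbar).rTensor (Smash k H B C) v) = (relations D).mkQ w from h w
  intro w
  induction w with
  | zero => exact ⟨0, by simp⟩
  | add s t hs ht =>
    obtain ⟨u, hu⟩ := hs
    obtain ⟨v, hv⟩ := ht
    exact ⟨u + v, by rw [map_add, map_add, map_add, hu, hv]⟩
  | tmul h m =>
    refine ⟨TensorProduct.map D.π (LinearMap.mulRight k m ∘ₗ inr k H B C ∘ₗ D.ζbar)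
      (comul (R := k) h), ?_⟩
    have h1 : ∀ t : H ⊗[k] H, (relations D).mkQ ((antipodeInv k H ∘ₗ D.γbar).rTensor _
        (TensorProduct.map D.π (LinearMap.mulRight k m ∘ₗ inr k H B C ∘ₗ D.ζbar) t)) =
        (relations D).mkQ ((LinearMap.mul' k H (TensorProduct.comm k H H
          (TensorProduct.map (antipodeInv k H ∘ₗ D.γbar ∘ₗ D.π)
            (antipodeInv k H ∘ₗ D.ι ∘ₗ D.ζbar) t))) ⊗ₜ m) := by
      intro t
      induction t with
      | zero => simp
      | add s t hs ht => simp only [map_add, add_tmul, hs, ht]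
      | tmul x y =>
        refine ((Submodule.Quotient.eq _).2 ?_).symm
        simpa using sub_mem_relations (D := D) (D.ζbar y) (antipodeInv k H (D.γbar (D.π x))) m
    rw [h1, ← hD.eq_antipodeInv_mul h]

omit [FiniteDimensional k H] [FiniteDimensional k C] [FiniteDimensional k B] in
include hD in
theorem nontrivial_quotient : Nontrivial C := by
  refine ⟨D.π 1, 0, fun h => ?_⟩
  have h1 := hD.π_counit 1
  rw [h] at h1
  simp at h1

include hD in
-- Let `P` be the image of the invariants in the quotient `W`. The map `uncoact` descends to `W → W
-- ⊗ C` with range containing `P ⊗ C`, so `dim P · dim C ≤ dim W ≤ dim C · dim (C* # B)`, and `dim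
-- C` cancels since `C` is nonzero.
theorem finrank_map_hitInvariants_le :
    Module.finrank k ((hitInvariants D).map (relations D).mkQ) ≤
      Module.finrank k (Smash k H B C) := by
  let W := (H ⊗[k] Smash k H B C) ⧸ relations D
  let P := (hitInvariants D).map (relations D).mkQ
  have := nontrivial_quotient hD
  have h1 : Module.finrank k W ≤ Module.finrank k C * Module.finrank k (Smash k H B C) := by
    rw [← Module.finrank_tensorProduct]
    exact LinearMap.finrank_le_finrank_of_surjective (mkQ_antipodeInv_γbar_surjective hD)
  let L : W →ₗ[k] W ⊗[k] C := (relations D).liftQ ((relations D).mkQ.rTensor C ∘ₗ uncoact D)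
    (fun w hw => mkQ_uncoact_of_mem_relations hD hw)
  have h2 : LinearMap.range (P.subtype.rTensor C) ≤ LinearMap.range L := by
    rintro _ ⟨t, rfl⟩
    induction t with
    | zero => simp
    | add s t hs ht => rw [map_add]; exact add_mem hs ht
    | tmul p x =>
      obtain ⟨_, w, hw, rfl⟩ := p
      refine ⟨(relations D).mkQ (rmul k H B C (D.γ x) w), ?_⟩
      exact congrArg ((relations D).mkQ.rTensor C) (uncoact_rmul_γ hD hw x)
  have h3 : Module.finrank k (P ⊗[k] C) = Module.finrank k (LinearMap.range (P.subtype.rTensor C)) :=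
    (LinearMap.finrank_range_of_inj (Module.Flat.rTensor_preserves_injective_linearMap _
      P.injective_subtype)).symm
  have h4 : Module.finrank k (P ⊗[k] C) ≤ Module.finrank k W :=
    h3.trans_le ((Submodule.finrank_mono h2).trans (LinearMap.finrank_range_le L))
  rw [Module.finrank_tensorProduct] at h4
  have h5 := h4.trans h1
  rw [mul_comm] at h5
  exact Nat.le_of_mul_le_mul_left h5 Module.finrank_pos

variable (hυ : IsUnit D.upsilon)

include hD hυ

/-- `ζbarMul` vanishes on the relations and sends `γbarHat D m` to `υ m`. For a unit `υ`, `γbarHat`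
is thus injective modulo relations, and the dimension bound makes its range all of the invariants.
-/
theorem hitInvariants_le_range_sup :
    hitInvariants D ≤ LinearMap.range (γbarHat D) ⊔ relations D := by
  have h1 : ∀ m, ζbarMul D (γbarHat D m) = D.upsilon * m := by
    intro m
    have h2 := ζbarMul_rAct_γbarHat hD 1 m
    rw [rAct_one, LinearMap.rTensor_id] at h2
    exact h2
  have h2 : Function.Injective ((relations D).mkQ ∘ₗ γbarHat D) := by
    rw [← LinearMap.ker_eq_bot, LinearMap.ker_eq_bot']
    intro m hm
    have h3 := ζbarMul_of_mem_relations hD ((Submodule.Quotient.mk_eq_zero _).1 hm)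
    rw [h1] at h3
    exact hυ.mul_right_eq_zero.1 h3
  have h3 : LinearMap.range ((relations D).mkQ ∘ₗ γbarHat D) =
      (hitInvariants D).map (relations D).mkQ := by
    refine Submodule.eq_of_le_of_finrank_le ?_ ?_
    · rintro _ ⟨m, rfl⟩
      exact ⟨_, γbarHat_mem_hitInvariants hD m, rfl⟩
    · rw [LinearMap.finrank_range_of_inj h2]
      exact finrank_map_hitInvariants_le hD
  intro w hw
  have h4 : (relations D).mkQ w ∈ LinearMap.range ((relations D).mkQ ∘ₗ γbarHat D) := by
    rw [h3]
    exact ⟨w, hw, rfl⟩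
  obtain ⟨m, hm⟩ := h4
  rw [← add_sub_cancel (γbarHat D m) w]
  exact Submodule.add_mem_sup ⟨m, rfl⟩ ((Submodule.Quotient.eq _).1 hm.symm)

/-- `T(ab) = T(b) υ⁻¹ T(a)` -/
theorem T_mul (a b : Smash k H B C) :
    D.T (a * b) = D.T b * Ring.inverse D.upsilon * D.T a := by
  -- The element obtained from `γbarHat D 1` by acting with `a` is again invariant, hence congruent
  -- to some `γbarHat D m`.
  have h1 : (rAct hD a).rTensor _ (γbarHat D 1) ∈ LinearMap.range (γbarHat D) ⊔ relations D :=
    hitInvariants_le_range_sup hD hυ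
      (rAct_mem_hitInvariants hD a (γbarHat_mem_hitInvariants hD 1))
  obtain ⟨_, ⟨m, rfl⟩, n, hn, h2⟩ := Submodule.mem_sup.1 h1
  -- Applying `ζbarMul` to the congruence gives `T(a) = υ m`; acting by `b` first gives `T(ab) =
  -- T(b) m`.
  have h3 := ζbarMul_rAct_γbarHat hD a 1
  have h4 := ζbarMul_rAct_γbarHat hD 1 m
  rw [rAct_one, LinearMap.rTensor_id, LinearMap.id_apply] at h4
  rw [← h2, map_add, h4, ζbarMul_of_mem_relations hD hn, add_zero, mul_one] at h3
  have h5 := ζbarMul_rAct_γbarHat hD (a * b) 1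
  rw [rAct_mul, LinearMap.rTensor_comp, LinearMap.comp_apply, ← h2, map_add, map_add,
    ζbarMul_rAct_γbarHat, ζbarMul_of_mem_relations hD
      (rTensor_mem_relations _ (fun c h => rAct_antipodeInv_mul hD b c h) hn), add_zero,
    mul_one] at h5
  rw [← h5, ← h3, mul_assoc]
  congr 1
  exact (Ring.inverse_mul_cancel_left _ _ hυ).symm

end Relations

end LeftPartialDual

end

open TensorProduct Coalgebra

noncomputable section

namespace LeftPartialDual

/-! ### Transport along isomorphisms and the biopposite -/

section Transport

variable {k A A' : Type*} [Field k] [Ring A] [Algebra k A] [Ring A'] [Algebra k A']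

theorem ringInverse_eq {M : Type*} [Ring M] {a b : M} (hab : a * b = 1) (hba : b * a = 1) :
    Ring.inverse a = b := Ring.inverse_unit ⟨a, b, hab, hba⟩

theorem map_map_assoc' {k M N P M' N' P' : Type*} [Field k] [AddCommGroup M] [Module k M]
    [AddCommGroup N] [Module k N] [AddCommGroup P] [Module k P] [AddCommGroup M'] [Module k M']
    [AddCommGroup N'] [Module k N'] [AddCommGroup P'] [Module k P'] (f : M →ₗ[k] M')
    (g : N →ₗ[k] N') (h : P →ₗ[k] P') (t : (M ⊗[k] N) ⊗[k] P) :
    TensorProduct.assoc k M' N' P' (TensorProduct.map (TensorProduct.map f g) h t) =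
      TensorProduct.map f (TensorProduct.map g h) (TensorProduct.assoc k M N P t) := by
  induction t with
  | zero => simp
  | add s t hs ht => simp only [map_add, hs, ht]
  | tmul u z =>
    induction u with
    | zero => simp
    | add s t hs ht => simp only [map_add, add_tmul, hs, ht]
    | tmul x y => simp

namespace QuasiBialgebraData

variable {Q : QuasiBialgebraData k A} {Q' : QuasiBialgebraData k A'} {e : A ≃ₐ[k] A'}

theorem IsIso.symm (h : IsIso Q Q' e) : IsIso Q' Q e.symm where
  comul a := by
    obtain ⟨a, rfl⟩ := e.surjective a
    have h1 : e.symm.toLinearMap ∘ₗ e.toLinearMap = LinearMap.id := by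
      ext x
      simp
    rw [h.comul, ← LinearMap.comp_apply, ← TensorProduct.map_comp, h1, TensorProduct.map_id]
    simp
  counit a := by
    obtain ⟨a, rfl⟩ := e.surjective a
    rw [h.counit]
    simp
  associator := by
    have h1 : e.symm.toLinearMap ∘ₗ e.toLinearMap = LinearMap.id := by
      ext x
      simp
    rw [h.associator, ← LinearMap.comp_apply, ← TensorProduct.map_comp, ← TensorProduct.map_comp,
      h1, TensorProduct.map_id, TensorProduct.map_id]
    rfl

/-- `e ⊗ e` as an algebra map. -/
abbrev map₂ (e : A ≃ₐ[k] A') : A ⊗[k] A →ₐ[k] A' ⊗[k] A' :=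
  Algebra.TensorProduct.map e.toAlgHom e.toAlgHom

/-- `e ⊗ e ⊗ e` as an algebra map. -/
abbrev map₃ (e : A ≃ₐ[k] A') : A ⊗[k] (A ⊗[k] A) →ₐ[k] A' ⊗[k] (A' ⊗[k] A') :=
  Algebra.TensorProduct.map e.toAlgHom (map₂ e)

/-- `e ⊗ e ⊗ e ⊗ e` as an algebra map. -/
abbrev map₄ (e : A ≃ₐ[k] A') :
    A ⊗[k] (A ⊗[k] (A ⊗[k] A)) →ₐ[k] A' ⊗[k] (A' ⊗[k] (A' ⊗[k] A')) :=
  Algebra.TensorProduct.map e.toAlgHom (map₃ e)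

theorem IsIso.comul_eq (h : IsIso Q Q' e) (a : A) : Q'.comul (e a) = map₂ e (Q.comul a) :=
  h.comul a

theorem IsIso.associator_eq (h : IsIso Q Q' e) : Q'.associator = map₃ e Q.associator :=
  h.associator

theorem IsIso.lTensor_comul (h : IsIso Q Q' e) (t : A ⊗[k] A) :
    Q'.comul.lTensor A' (map₂ e t) = map₃ e (Q.comul.lTensor A t) := by
  induction t with
  | zero => simp
  | add s t hs ht => simp only [map_add, hs, ht]
  | tmul x y => simp [h.comul_eq]

theorem IsIso.rTensor_comul (h : IsIso Q Q' e) (t : A ⊗[k] A) :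
    TensorProduct.assoc k A' A' A' (Q'.comul.rTensor A' (map₂ e t)) =
      map₃ e (TensorProduct.assoc k A A A (Q.comul.rTensor A t)) := by
  induction t with
  | zero => simp
  | add s t hs ht => simp only [map_add, hs, ht]
  | tmul x y =>
    have h1 := map_map_assoc' e.toLinearMap e.toLinearMap e.toLinearMap (Q.comul x ⊗ₜ y)
    simp only [TensorProduct.map_tmul, ← h.comul] at h1
    exact h1

theorem IsIso.isQuasiBialgebra (h : IsIso Q Q' e) (hQ : Q.IsQuasiBialgebra) :
    Q'.IsQuasiBialgebra where
  comul_one := by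
    rw [← map_one e, h.comul_eq, hQ.comul_one, map_one]
  comul_mul a b := by
    obtain ⟨a, rfl⟩ := e.surjective a
    obtain ⟨b, rfl⟩ := e.surjective b
    rw [← map_mul e, h.comul_eq, hQ.comul_mul, map_mul, h.comul_eq, h.comul_eq]
  counit_one := by rw [← map_one e, h.counit, hQ.counit_one]
  counit_mul a b := by
    obtain ⟨a, rfl⟩ := e.surjective a
    obtain ⟨b, rfl⟩ := e.surjective b
    rw [← map_mul e, h.counit, hQ.counit_mul, h.counit, h.counit]
  isUnit_associator := h.associator_eq ▸ hQ.isUnit_associator.map (map₃ e)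
  quasi_coassoc a := by
    obtain ⟨a, rfl⟩ := e.surjective a
    rw [h.comul_eq, h.lTensor_comul, h.rTensor_comul, h.associator_eq, ← map_mul, ← map_mul,
      hQ.quasi_coassoc]
  pentagon := by
    have h1 : ∀ t : A ⊗[k] (A ⊗[k] A), (Q'.comul.lTensor A').lTensor A' (map₃ e t) =
        map₄ e ((Q.comul.lTensor A).lTensor A t) := by
      intro t
      induction t with
      | zero => simp
      | add s t hs ht => simp only [map_add, hs, ht]
      | tmul x y =>
        exact congrArg (TensorProduct.mk k _ _ (e x)) (h.lTensor_comul y)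
    have h2 : ∀ t : A ⊗[k] (A ⊗[k] A), TensorProduct.assoc k A' A' (A' ⊗[k] A')
        (Q'.comul.rTensor (A' ⊗[k] A') (map₃ e t)) =
        map₄ e (TensorProduct.assoc k A A (A ⊗[k] A) (Q.comul.rTensor (A ⊗[k] A) t)) := by
      intro t
      induction t with
      | zero => simp
      | add s t hs ht => simp only [map_add, hs, ht]
      | tmul x y =>
        have h3 := map_map_assoc' e.toLinearMap e.toLinearMap
          (TensorProduct.map e.toLinearMap e.toLinearMap) (Q.comul x ⊗ₜ y)
        rw [TensorProduct.map_tmul, ← h.comul] at h3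
        exact h3
    have h3 : ∀ t : A ⊗[k] (A ⊗[k] A), ((TensorProduct.assoc k A' A' A').toLinearMap ∘ₗ
        Q'.comul.rTensor A').lTensor A' (map₃ e t) =
        map₄ e (((TensorProduct.assoc k A A A).toLinearMap ∘ₗ
          Q.comul.rTensor A).lTensor A t) := by
      intro t
      induction t with
      | zero => simp
      | add s t hs ht => simp only [map_add, hs, ht]
      | tmul x y =>
        exact congrArg (TensorProduct.mk k _ _ (e x)) (h.rTensor_comul y)
    have h4 : ∀ t : A ⊗[k] (A ⊗[k] A), (((TensorProduct.mk k A' A').flip 1).lTensor A').lTensor A'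
        (map₃ e t) = map₄ e ((((TensorProduct.mk k A A).flip 1).lTensor A).lTensor A t) := by
      intro t
      induction t with
      | zero => simp
      | add s t hs ht => simp only [map_add, hs, ht]
      | tmul x y =>
        induction y with
        | zero => simp
        | add s t hs ht => simp only [map_add, tmul_add, hs, ht]
        | tmul y z => simp
    have h5 : (1 : A') ⊗ₜ[k] map₃ e Q.associator = map₄ e (1 ⊗ₜ Q.associator) := by simp
    rw [h.associator_eq, h1, h2, h3, h4, h5, ← map_mul, ← map_mul, ← map_mul, hQ.pentagon]
  counit_comul a := by
    obtain ⟨a, rfl⟩ := e.surjective a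
    have h1 : ∀ t : A ⊗[k] A, TensorProduct.lid k A' (Q'.counit.rTensor A' (map₂ e t)) =
        e (TensorProduct.lid k A (Q.counit.rTensor A t)) := by
      intro t
      induction t with
      | zero => simp
      | add s t hs ht => simp only [map_add, hs, ht]
      | tmul x y => simp [h.counit]
    rw [h.comul_eq, h1, hQ.counit_comul]
  comul_counit a := by
    obtain ⟨a, rfl⟩ := e.surjective a
    have h1 : ∀ t : A ⊗[k] A, TensorProduct.rid k A' (Q'.counit.lTensor A' (map₂ e t)) =
        e (TensorProduct.rid k A (Q.counit.lTensor A t)) := by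
      intro t
      induction t with
      | zero => simp
      | add s t hs ht => simp only [map_add, hs, ht]
      | tmul x y => simp [h.counit]
    rw [h.comul_eq, h1, hQ.comul_counit]
  counit_associator := by
    have h1 : ∀ t : A ⊗[k] (A ⊗[k] A), ((TensorProduct.lid k A').toLinearMap ∘ₗ
        Q'.counit.rTensor A').lTensor A' (map₃ e t) =
        map₂ e (((TensorProduct.lid k A).toLinearMap ∘ₗ Q.counit.rTensor A).lTensor A t) := by
      intro t
      induction t with
      | zero => simp
      | add s t hs ht => simp only [map_add, hs, ht]
      | tmul x y =>
        induction y with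
        | zero => simp
        | add s t hs ht => simp only [map_add, tmul_add, hs, ht]
        | tmul y z => simp [h.counit]
    rw [h.associator_eq, h1, hQ.counit_associator, map_one]

theorem IsIso.isAntipode (h : IsIso Q Q' e) (hu : IsUnit Q.associator) {S : A →ₗ[k] A} {α β : A}
    (hS : Q.IsAntipode S α β) : Q'.IsAntipode (e.toLinearEquiv.conj S) (e α) (e β) := by
  have hc : ∀ a, e.toLinearEquiv.conj S (e a) = e (S a) := by
    intro a
    rw [LinearEquiv.conj_apply]
    simp
  have h3 : ∀ {f g l : A →ₗ[k] A} {f' g' l' : A' →ₗ[k] A'}, (∀ x, f' (e x) = e (f x)) →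
      (∀ x, g' (e x) = e (g x)) → (∀ x, l' (e x) = e (l x)) → ∀ t : A ⊗[k] (A ⊗[k] A),
      LinearMap.mul' k A' ((LinearMap.mul' k A').lTensor A'
        (TensorProduct.map f' (TensorProduct.map g' l') (map₃ e t))) =
      e (LinearMap.mul' k A ((LinearMap.mul' k A).lTensor A
        (TensorProduct.map f (TensorProduct.map g l) t))) := by
    intro f g l f' g' l' hf hg hl t
    induction t with
    | zero => simp
    | add s t hs ht => simp only [map_add, hs, ht]
    | tmul x y =>
      induction y with
      | zero => simp
      | add s t hs ht => simp only [map_add, tmul_add, hs, ht]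
      | tmul y z => simp [hf, hg, hl]
  have h2 : ∀ {f g : A →ₗ[k] A} {f' g' : A' →ₗ[k] A'}, (∀ x, f' (e x) = e (f x)) →
      (∀ x, g' (e x) = e (g x)) → ∀ t : A ⊗[k] A,
      LinearMap.mul' k A' (TensorProduct.map f' g' (map₂ e t)) =
      e (LinearMap.mul' k A (TensorProduct.map f g t)) := by
    intro f g f' g' hf hg t
    induction t with
    | zero => simp
    | add s t hs ht => simp only [map_add, hs, ht]
    | tmul x y => simp [hf, hg]
  have hα : ∀ x, (LinearMap.mulRight k (e α) ∘ₗ e.toLinearEquiv.conj S) (e x) =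
      e ((LinearMap.mulRight k α ∘ₗ S) x) := by
    intro x
    simp [hc]
  have hβ : ∀ x, LinearMap.mulRight k (e β) (e x) = e (LinearMap.mulRight k β x) := by
    intro x
    simp
  -- `Ring.inverse` is zero away from units, so invertibility of the associator is needed for its
  -- two product identities.
  have hi : Ring.inverse Q'.associator = map₃ e (Ring.inverse Q.associator) := by
    refine ringInverse_eq ?_ ?_
    · rw [h.associator_eq, ← map_mul, Ring.mul_inverse_cancel _ hu, map_one]
    · rw [h.associator_eq, ← map_mul, Ring.inverse_mul_cancel _ hu, map_one]
  refine ⟨?_, ?_, ?_, ?_, ?_, ?_⟩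
  · rw [← map_one e, hc, hS.map_one]
  · intro a b
    obtain ⟨a, rfl⟩ := e.surjective a
    obtain ⟨b, rfl⟩ := e.surjective b
    rw [← map_mul e, hc, hS.map_mul, map_mul, hc, hc]
  · intro a
    obtain ⟨a, rfl⟩ := e.surjective a
    rw [h.comul_eq, h2 (g := LinearMap.id) hα (fun _ => rfl), hS.left, h.counit, map_smul]
  · intro a
    obtain ⟨a, rfl⟩ := e.surjective a
    rw [h.comul_eq, h2 hβ hc, hS.right, h.counit, map_smul]
  · rw [h.associator_eq, h3 (l := LinearMap.id) hβ hα (fun _ => rfl), hS.associator, map_one]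
  · rw [hi, h3 hα hβ hc, hS.associator_inv, map_one]

open MulOpposite in
/-- Conditions for `(S, α, β)` to be an antipode of the biopposite quasi-bialgebra. -/
theorem isAntipode_biop {S : A →ₗ[k] A} {α β : A} {ψ : A ⊗[k] (A ⊗[k] A)}
    (h_one : S 1 = 1) (h_mul : ∀ a b, S (a * b) = S b * S a)
    (h_left : ∀ a, LinearMap.mul' k A
      (TensorProduct.map LinearMap.id (LinearMap.mulLeft k α ∘ₗ S) (Q.comul a)) = Q.counit a • α)
    (h_right : ∀ a, LinearMap.mul' k A
      (TensorProduct.map (LinearMap.mulRight k β ∘ₗ S) LinearMap.id (Q.comul a)) = Q.counit a • β)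
    (h_assoc : LinearMap.mul' k A ((LinearMap.mul' k A).lTensor A (TensorProduct.map LinearMap.id
      (TensorProduct.map (LinearMap.mulRight k β ∘ₗ LinearMap.mulLeft k α ∘ₗ S) LinearMap.id)
        Q.associator)) = 1)
    (hψ : Q.associator * ψ = 1) (hψ' : ψ * Q.associator = 1)
    (h_inv : LinearMap.mul' k A ((LinearMap.mul' k A).lTensor A
      (TensorProduct.map (LinearMap.mulRight k β ∘ₗ S) (TensorProduct.map (LinearMap.mulRight k α) S)
        ψ)) = 1) :
    Q.biop.IsAntipode ((opLinearEquiv k).conj S) (op α) (op β) := by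
  let o := (opLinearEquiv k (M := A)).toLinearMap
  -- Reversing legs while passing to opposite algebras is antimultiplicative, so `E` carries the
  -- inverse `ψ` to the inverse of the biopposite associator.
  let E : A ⊗[k] (A ⊗[k] A) →ₗ[k] Aᵐᵒᵖ ⊗[k] (Aᵐᵒᵖ ⊗[k] Aᵐᵒᵖ) :=
    TensorProduct.map o (TensorProduct.map o o) ∘ₗ reverse₃ k A
  have hE : ∀ x y z : A, E (x ⊗ₜ (y ⊗ₜ z)) = op z ⊗ₜ (op y ⊗ₜ op x) := fun _ _ _ => rfl
  have h_zero : ∀ w : Aᵐᵒᵖ ⊗[k] (Aᵐᵒᵖ ⊗[k] Aᵐᵒᵖ), w * 0 = 0 := fun w => mul_zero w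
  have h_add : ∀ u v w : Aᵐᵒᵖ ⊗[k] (Aᵐᵒᵖ ⊗[k] Aᵐᵒᵖ), u * (v + w) = u * v + u * w :=
    fun u v w => map_add (LinearMap.mul k (Aᵐᵒᵖ ⊗[k] (Aᵐᵒᵖ ⊗[k] Aᵐᵒᵖ)) u) v w
  have h_zero' : ∀ w : Aᵐᵒᵖ ⊗[k] (Aᵐᵒᵖ ⊗[k] Aᵐᵒᵖ), 0 * w = 0 := fun w => zero_mul w
  have h_add' : ∀ u v w : Aᵐᵒᵖ ⊗[k] (Aᵐᵒᵖ ⊗[k] Aᵐᵒᵖ), (u + v) * w = u * w + v * w :=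
    fun u v w => map_add ((LinearMap.mul k (Aᵐᵒᵖ ⊗[k] (Aᵐᵒᵖ ⊗[k] Aᵐᵒᵖ))).flip w) u v
  have hE_mul : ∀ s t, E (s * t) = E t * E s := by
    intro s t
    induction s with
    | zero => rw [zero_mul, map_zero, h_zero]
    | add s s' hs hs' => rw [add_mul, map_add, map_add, h_add, hs, hs']
    | tmul x u =>
      induction u with
      | zero => rw [tmul_zero, zero_mul, map_zero, h_zero]
      | add s s' hs hs' => rw [tmul_add, add_mul, map_add, map_add, h_add, hs, hs']
      | tmul y z =>
        induction t with
        | zero => rw [mul_zero, map_zero, h_zero']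
        | add s s' hs hs' => rw [mul_add, map_add, map_add, h_add', hs, hs']
        | tmul x' v =>
          induction v with
          | zero => rw [tmul_zero, mul_zero, map_zero, h_zero']
          | add s s' hs hs' => rw [tmul_add, mul_add, map_add, map_add, h_add', hs, hs']
          | tmul y' z' => simp [hE]
  have hE_one : E 1 = 1 := rfl
  have hi : Ring.inverse Q.biop.associator = E ψ := by
    refine ringInverse_eq ?_ ?_
    · change E Q.associator * E ψ = 1
      rw [← hE_mul, hψ', hE_one]
    · change E ψ * E Q.associator = 1
      rw [← hE_mul, hψ, hE_one]
  have hc : ∀ a : A, (opLinearEquiv k).conj S (op a) = op (S a) := fun _ => rfl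
  have h3 : ∀ {f g l : A →ₗ[k] A} {f' g' l' : Aᵐᵒᵖ →ₗ[k] Aᵐᵒᵖ}, (∀ x, f' (op x) = op (f x)) →
      (∀ x, g' (op x) = op (g x)) → (∀ x, l' (op x) = op (l x)) → ∀ t : A ⊗[k] (A ⊗[k] A),
      LinearMap.mul' k Aᵐᵒᵖ ((LinearMap.mul' k Aᵐᵒᵖ).lTensor Aᵐᵒᵖ
        (TensorProduct.map f' (TensorProduct.map g' l') (E t))) =
      op (LinearMap.mul' k A ((LinearMap.mul' k A).lTensor A
        (TensorProduct.map l (TensorProduct.map g f) t))) := by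
    intro f g l f' g' l' hf hg hl t
    induction t with
    | zero => simp
    | add s t hs ht => simp only [map_add, hs, ht, op_add]
    | tmul x y =>
      induction y with
      | zero => simp
      | add s t hs ht => simp only [map_add, tmul_add, hs, ht, op_add]
      | tmul y z => simp [hE, hf, hg, hl, mul_assoc]
  have h2 : ∀ {f g : A →ₗ[k] A} {f' g' : Aᵐᵒᵖ →ₗ[k] Aᵐᵒᵖ}, (∀ x, f' (op x) = op (f x)) →
      (∀ x, g' (op x) = op (g x)) → ∀ t : A ⊗[k] A,
      LinearMap.mul' k Aᵐᵒᵖ (TensorProduct.map f' g' (TensorProduct.map o o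
        (TensorProduct.comm k A A t))) =
      op (LinearMap.mul' k A (TensorProduct.map g f t)) := by
    intro f g f' g' hf hg t
    induction t with
    | zero => simp
    | add s t hs ht => simp only [map_add, hs, ht, op_add]
    | tmul x y => simp [o, hf, hg]
  refine ⟨?_, ?_, ?_, ?_, ?_, ?_⟩
  · rw [← op_one, hc, h_one]
  · intro a b
    induction a with | _ a
    induction b with | _ b
    rw [← op_mul, hc, h_mul, hc, hc, op_mul]
  · intro a
    induction a with | _ a
    refine (h2 (f := LinearMap.mulLeft k α ∘ₗ S) (g := LinearMap.id) (fun _ => rfl)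
      (fun _ => rfl) (Q.comul a)).trans ?_
    rw [h_left]
    rfl
  · intro a
    induction a with | _ a
    refine (h2 (f := LinearMap.mulLeft k β) (g := S) (fun _ => rfl)
      (fun _ => rfl) (Q.comul a)).trans ?_
    have h4 : ∀ t : A ⊗[k] A, LinearMap.mul' k A (TensorProduct.map S (LinearMap.mulLeft k β) t) =
        LinearMap.mul' k A (TensorProduct.map (LinearMap.mulRight k β ∘ₗ S) LinearMap.id t) := by
      intro t
      induction t with
      | zero => simp
      | add s t hs ht => simp only [map_add, hs, ht]
      | tmul x y => simp [mul_assoc]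
    rw [h4, h_right]
    rfl
  · refine (h3 (f := LinearMap.mulLeft k β) (g := LinearMap.mulLeft k α ∘ₗ S) (l := LinearMap.id)
      (fun _ => rfl) (fun _ => rfl) (fun _ => rfl) Q.associator).trans ?_
    rw [← op_one, ← h_assoc]
    congr 1
    induction Q.associator with
    | zero => simp
    | add s t hs ht => simp only [map_add, hs, ht]
    | tmul x y =>
      induction y with
      | zero => simp
      | add s t hs ht => simp only [map_add, tmul_add, hs, ht]
      | tmul y z => simp [mul_assoc]
  · rw [hi]
    refine (h3 (f := LinearMap.mulLeft k α ∘ₗ S) (g := LinearMap.mulLeft k β) (l := S)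
      (fun _ => rfl) (fun _ => rfl) (fun _ => rfl) ψ).trans ?_
    have h4 : ∀ t, LinearMap.mul' k A ((LinearMap.mul' k A).lTensor A (TensorProduct.map S
        (TensorProduct.map (LinearMap.mulLeft k β) (LinearMap.mulLeft k α ∘ₗ S)) t)) =
        LinearMap.mul' k A ((LinearMap.mul' k A).lTensor A (TensorProduct.map
          (LinearMap.mulRight k β ∘ₗ S) (TensorProduct.map (LinearMap.mulRight k α) S) t)) := by
      intro t
      induction t with
      | zero => simp
      | add s t hs ht => simp only [map_add, hs, ht]
      | tmul x y =>
        induction y with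
        | zero => simp
        | add s t hs ht => simp only [map_add, tmul_add, hs, ht]
        | tmul y z => simp [mul_assoc]
    rw [h4, h_inv, op_one]

end QuasiBialgebraData

end Transport

end LeftPartialDual

end

open TensorProduct Coalgebra

noncomputable section

namespace LeftPartialDual

/-! ### The two antipodes on the biopposite -/

section Antipode

variable {k H B C : Type*} [Field k] [Ring H] [HopfAlgebra k H] [FiniteDimensional k H]
    [Ring B] [Algebra k B] [FiniteDimensional k B] [LeftComoduleAlgebra k H B]
    [AddCommGroup C] [Module k C] [Coalgebra k C] [FiniteDimensional k C]
    [RightModuleCoalgebra k H C] {D : MappingSystem k H B C} (hD : D.IsPAMS)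

include hD

/-- Since `S₁(a) υ = T(a)`, each axiom is one of the identities for `T`, where needed multiplied on
the right by `υ⁻¹`. Antimultiplicativity is `T_mul`. -/
theorem isAntipode_S₁ (hυ : IsUnit D.upsilon) :
    D.partialDual.biop.IsAntipode ((MulOpposite.opLinearEquiv k).conj D.S₁) 1
      (MulOpposite.op D.upsilon) := by
  have h1 : D.upsilon * Ring.inverse D.upsilon = 1 := Ring.mul_inverse_cancel _ hυ
  have h2 : Ring.inverse D.upsilon * D.upsilon = 1 := Ring.inverse_mul_cancel _ hυ
  have hS : ∀ a, D.S₁ a = D.T a * Ring.inverse D.upsilon := fun _ => rfl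
  have hST : LinearMap.mulRight k D.upsilon ∘ₗ D.S₁ = D.T := by
    ext a
    simp [hS, mul_assoc, h2]
  have hc : ∀ a, D.partialDual.counit a = counitAlg hD a := fun a =>
    (LinearMap.congr_fun (counitAlg_toLinearMap hD) a).symm
  have hr : ∀ f : Smash k H B C →ₗ[k] Smash k H B C, ∀ u,
      LinearMap.mulRight k u ∘ₗ LinearMap.mul' k _ ∘ₗ f.lTensor _ =
        LinearMap.mul' k _ ∘ₗ (LinearMap.mulRight k u ∘ₗ f).lTensor _ := by
    intro f u
    ext a b
    simp [mul_assoc]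
  refine QuasiBialgebraData.isAntipode_biop (α := (1 : Smash k H B C)) (ψ := associatorInv D)
    ?_ ?_ ?_ ?_ ?_ (associator_mul_associatorInv hD) (associatorInv_mul_associator hD) ?_
  · exact h1
  · intro a b
    simp only [hS, T_mul hD hυ, mul_assoc]
  · intro a
    have h := congrArg (LinearMap.mulRight k (Ring.inverse D.upsilon)) (mul_T_comul hD a 1)
    rw [hc]
    refine Eq.trans ?_ (h.trans ?_)
    · rw [LinearMap.mulLeft_one, LinearMap.comp_id]
      exact (LinearMap.congr_fun (hr D.T (Ring.inverse D.upsilon)) _).symm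
    · rw [map_smul]
      exact congrArg _ h1
  · intro a
    have h := T_comul_mul hD a 1
    rw [LinearMap.mulRight_one, LinearMap.comp_id] at h
    rw [hc, hST]
    exact h
  · rw [LinearMap.mulLeft_one, LinearMap.id_comp, hST]
    exact associator_mul_T hD
  · have h := congrArg (LinearMap.mulRight k (Ring.inverse D.upsilon)) (T_associatorInv_mul_T hD)
    have h4 : ∀ (T : Smash k H B C →ₗ[k] Smash k H B C) (v : Smash k H B C) t, LinearMap.mulRight k v (LinearMap.mul' k _
        ((LinearMap.mul' k (Smash k H B C)).lTensor _ (TensorProduct.map T (TensorProduct.map LinearMap.id T) t))) =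
        LinearMap.mul' k _ ((LinearMap.mul' k (Smash k H B C)).lTensor _ (TensorProduct.map T
          (TensorProduct.map LinearMap.id (LinearMap.mulRight k v ∘ₗ T)) t)) := by
      intro T v t
      induction t with
      | zero => simp
      | add s t hs ht => simp only [map_add, hs, ht]
      | tmul x y =>
        induction y with
        | zero => simp
        | add s t hs ht => simp only [map_add, tmul_add, hs, ht]
        | tmul y z => simp [mul_assoc]
    rw [hST, LinearMap.mulRight_one]
    exact (h4 _ _ _).symm.trans (h.trans h1)

/-- The same identities with `υ S₂(a) = T(a)`, multiplied on the left by `υ⁻¹`. -/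
theorem isAntipode_S₂ (hυ : IsUnit D.upsilon) :
    D.partialDual.biop.IsAntipode ((MulOpposite.opLinearEquiv k).conj D.S₂)
      (MulOpposite.op D.upsilon) 1 := by
  have h1 : D.upsilon * Ring.inverse D.upsilon = 1 := Ring.mul_inverse_cancel _ hυ
  have h2 : Ring.inverse D.upsilon * D.upsilon = 1 := Ring.inverse_mul_cancel _ hυ
  have hS : ∀ a, D.S₂ a = Ring.inverse D.upsilon * D.T a := fun _ => rfl
  have hST : LinearMap.mulLeft k D.upsilon ∘ₗ D.S₂ = D.T := by
    ext a
    simp [hS, ← mul_assoc, h1]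
  have hc : ∀ a, D.partialDual.counit a = counitAlg hD a := fun a =>
    (LinearMap.congr_fun (counitAlg_toLinearMap hD) a).symm
  have hr : ∀ f : Smash k H B C →ₗ[k] Smash k H B C, ∀ u,
      LinearMap.mulLeft k u ∘ₗ LinearMap.mul' k _ ∘ₗ f.rTensor _ =
        LinearMap.mul' k _ ∘ₗ (LinearMap.mulLeft k u ∘ₗ f).rTensor _ := by
    intro f u
    ext a b
    simp [mul_assoc]
  refine QuasiBialgebraData.isAntipode_biop (β := (1 : Smash k H B C)) (ψ := associatorInv D)
    ?_ ?_ ?_ ?_ ?_ (associator_mul_associatorInv hD) (associatorInv_mul_associator hD) ?_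
  · exact h2
  · intro a b
    simp only [hS, T_mul hD hυ, mul_assoc]
  · intro a
    have h := mul_T_comul hD a 1
    rw [LinearMap.mulLeft_one, LinearMap.comp_id] at h
    rw [hc, hST]
    exact h
  · intro a
    have h := congrArg (LinearMap.mulLeft k (Ring.inverse D.upsilon)) (T_comul_mul hD a 1)
    rw [hc]
    refine Eq.trans ?_ (h.trans ?_)
    · rw [LinearMap.mulRight_one, LinearMap.comp_id]
      exact (LinearMap.congr_fun (hr D.T (Ring.inverse D.upsilon)) _).symm
    · rw [map_smul]
      exact congrArg _ h2
  · rw [LinearMap.mulRight_one, LinearMap.id_comp, hST]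
    exact associator_mul_T hD
  · have h := congrArg (LinearMap.mulLeft k (Ring.inverse D.upsilon)) (T_associatorInv_mul_T hD)
    have h4 : ∀ (T S : Smash k H B C →ₗ[k] Smash k H B C) (u v : Smash k H B C),
        (∀ a, S a = v * T a) → u * v = 1 → ∀ t, LinearMap.mulLeft k v (LinearMap.mul' k _
        ((LinearMap.mul' k (Smash k H B C)).lTensor _ (TensorProduct.map T (TensorProduct.map LinearMap.id T) t))) =
        LinearMap.mul' k _ ((LinearMap.mul' k (Smash k H B C)).lTensor _ (TensorProduct.map S
          (TensorProduct.map (LinearMap.mulRight k u) S) t)) := by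
      intro T S u v hS huv t
      induction t with
      | zero => simp
      | add s t hs ht => simp only [map_add, hs, ht]
      | tmul x y =>
        induction y with
        | zero => simp
        | add s t hs ht => simp only [map_add, tmul_add, hs, ht]
        | tmul y z =>
          have h5 : u * (v * T z) = T z := by rw [← mul_assoc, huv, one_mul]
          simp [mul_assoc, hS, h5]
    rw [LinearMap.mulRight_one, LinearMap.id_comp]
    exact (h4 _ _ _ _ hS h1 _).symm.trans (h.trans h2)

end Antipode

end LeftPartialDual

end

open TensorProduct Coalgebra

noncomputable section

namespace LeftPartialDual

open LeftComoduleAlgebra RightModuleCoalgebra HopfAlgebra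
open MappingSystem (inl inr antipodeInv)

/-! ### The dual mapping system -/

section

variable {k : Type*} [Field k]

section

variable {V V' W W' : Type*} [AddCommGroup V] [Module k V] [AddCommGroup V'] [Module k V']
  [AddCommGroup W] [Module k W] [AddCommGroup W'] [Module k W']

theorem biopDual_map_ev (f : V →ₗ[k] W) (g : BiopDual k W) (v : V) :
    (BiopDual.map f g).ev v = g.ev (f v) := rfl

theorem bpair_map (f : V →ₗ[k] V') (g : W →ₗ[k] W') (t : BiopDual k V' ⊗[k] BiopDual k W')
    (u : V ⊗[k] W) : bpair (TensorProduct.map (BiopDual.map f) (BiopDual.map g) t) u =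
      bpair t (TensorProduct.map f g u) := by
  induction t with
  | zero => simp
  | add s t hs ht => simp only [map_add, LinearMap.add_apply, hs, ht]
  | tmul a b =>
    induction u with
    | zero => simp
    | add s t hs ht => simp only [map_add, hs, ht]
    | tmul v w => rfl

theorem bpair_lTensor_map (g : W →ₗ[k] W') (t : BiopDual k V ⊗[k] BiopDual k W')
    (u : V ⊗[k] W) : bpair ((BiopDual.map g).lTensor _ t) u = bpair t (g.lTensor V u) :=
  bpair_map LinearMap.id g t u

theorem bpair_rTensor_map (g : V →ₗ[k] V') (t : BiopDual k V' ⊗[k] BiopDual k W)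
    (u : V ⊗[k] W) : bpair ((BiopDual.map g).rTensor _ t) u = bpair t (g.rTensor W u) :=
  bpair_map g LinearMap.id t u

end

section

variable {X R : Type*} [AddCommGroup X] [Module k X] [Coalgebra k X] [Ring R] [Algebra k R]
  [FiniteDimensional k R]

/-- The opposite product and the coopposite coproduct together reverse the order of convolution. The
factors of `(ιζ) * (γπ) = id`, which transposition exchanges, thus return to the required order. -/
theorem biopDual_map_conv (f g : X →ₗ[k] R) :
    BiopDual.map f ⊚ BiopDual.map g = BiopDual.map (g ⊚ f) := by
  have key : ∀ (t : BiopDual k R ⊗[k] BiopDual k R) (x : X),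
      (LinearMap.mul' k (BiopDual k X) (TensorProduct.map (BiopDual.map f) (BiopDual.map g) t)).ev x
        = bpair t (TensorProduct.map f g (TensorProduct.comm k X X (comul (R := k) x))) := by
    intro t x
    induction t with
    | zero => simp
    | add s t hs ht => simp only [map_add, LinearMap.add_apply, hs, ht]
    | tmul a b =>
      rw [TensorProduct.map_tmul, LinearMap.mul'_apply, biopDual_mul_ev]
      induction comul (R := k) x with
      | zero => simp
      | add s t hs ht => simp only [map_add, hs, ht]
      | tmul v w => exact mul_comm _ _
  ext φ
  apply biopDual_ext
  intro x
  rw [conv_apply, key, bpair_comul, biopDual_map_ev, conv_apply]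
  congr 1
  induction comul (R := k) x with
  | zero => simp
  | add s t hs ht => simp only [map_add, hs, ht]
  | tmul v w => simp

theorem biopDual_map_convUnit :
    BiopDual.map (convUnit k X R) = convUnit k (BiopDual k R) (BiopDual k X) := by
  ext φ
  apply biopDual_ext
  intro x
  rw [biopDual_map_ev, convUnit_apply, convUnit_apply, Algebra.algebraMap_eq_smul_one,
    Algebra.algebraMap_eq_smul_one, map_smul, map_smul, LinearMap.smul_apply, biopDual_one_ev,
    biopDual_counit, smul_eq_mul, smul_eq_mul, mul_comm]

end

variable {H B C : Type*} [Ring H] [HopfAlgebra k H] [FiniteDimensional k H]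
    [Ring B] [Algebra k B] [FiniteDimensional k B] [LeftComoduleAlgebra k H B]
    [AddCommGroup C] [Module k C] [Coalgebra k C] [FiniteDimensional k C]
    [RightModuleCoalgebra k H C] {D : MappingSystem k H B C}

theorem antipodeInv_biopDual :
    antipodeInv k (BiopDual k H) = BiopDual.map (antipodeInv k H) := by
  have h1 : antipodeInv k H ∘ₗ antipode k = LinearMap.id := by
    ext h
    simp
  have h2 : antipode k ∘ₗ antipodeInv k H = LinearMap.id := by
    ext h
    simp
  refine ringInverse_eq ?_ ?_
  · exact congrArg BiopDual.map h1
  · exact congrArg BiopDual.map h2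

/-- Most axioms are transposes of one another: linearity of `ζ` and colinearity of `γ` trade places,
as do units and counits. Only the description of the coinvariants needs `ker π = B⁺H`. -/
theorem isPAMS_dual (hD : D.IsPAMS) : D.dual.IsPAMS where
  ι_injective := LinearMap.dualMap_injective_of_surjective hD.π_surjective
  ι_one := biopDual_ext hD.π_counit
  ι_mul f g := biopDual_ext fun h => by
    change bpair (g ⊗ₜ f) (comul (R := k) (D.π h)) = bpair (BiopDual.map D.π g ⊗ₜ BiopDual.map D.π f) _
    rw [hD.π_comul, ← bpair_map]
    rfl
  ι_coact f := bpair_ext fun h h' => by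
    refine (bpair_comul_tmul _ _ _).trans ?_
    refine Eq.trans ?_ (bpair_lTensor_map D.π _ _).symm
    refine Eq.trans ?_ (bpair_biopCoact f h (D.π h')).symm
    exact congrArg f.ev (hD.π_act h' h)
  π_surjective := LinearMap.dualMap_surjective_of_injective hD.ι_injective
  π_act f g := biopDual_ext fun b => by
    change bpair (g ⊗ₜ f) (comul (R := k) (D.ι b)) = bpair (g ⊗ₜ BiopDual.map D.ι f) (coact b)
    rw [hD.ι_coact, ← bpair_lTensor_map]
    rfl
  π_counit f := congrArg f.ev hD.ι_one
  π_comul f := bpair_ext fun b c => by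
    refine (bpair_comul_tmul _ _ _).trans ?_
    refine Eq.trans ?_ (bpair_map D.ι D.ι _ _).symm
    rw [TensorProduct.map_tmul, bpair_comul_tmul, ← hD.ι_mul]
    rfl
  -- The range of `π*` is the annihilator of `ker π = B⁺H`, while coinvariance of `f` means
  -- `f(ι(b)h) = ε(b) f(h)`. These conditions agree.
  mem_range_ι_iff f := by
    have h1 : f ∈ LinearMap.range D.dual.ι ↔
        ∀ w ∈ LinearMap.ker D.π, f.ev w = 0 := by
      change f.ev ∈ LinearMap.range D.π.dualMap ↔ _
      rw [LinearMap.range_dualMap_eq_dualAnnihilator_ker, Submodule.mem_dualAnnihilator]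
    have h2 : D.dual.π.lTensor (BiopDual k H) (comul (R := k) f) = f ⊗ₜ[k] D.dual.π 1 ↔
        ∀ b h, f.ev (D.ι b * h) = f.ev h * counit (R := k) (D.ι b) := by
      constructor
      · intro h b x
        have h3 := congrArg (fun t => bpair t (x ⊗ₜ b)) h
        exact (bpair_comul_tmul f x (D.ι b)).symm.trans ((bpair_lTensor_map D.ι _ _).symm.trans h3)
      · intro h
        refine bpair_ext fun x b => ?_
        exact (bpair_lTensor_map D.ι _ _).trans ((bpair_comul_tmul f x (D.ι b)).trans (h b x))
    rw [h1, h2]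
    constructor
    · intro hf b h
      have h3 := hf (D.ι b * h - counit (R := k) (D.ι b) • h) (by
        rw [LinearMap.mem_ker, map_sub, hD.π_ι_mul, map_smul, sub_self])
      rw [map_sub, map_smul, sub_eq_zero] at h3
      rw [h3, smul_eq_mul, mul_comm]
    · intro hf w hw
      rw [hD.ker_π] at hw
      induction hw using Submodule.span_induction with
      | mem x hx =>
        obtain ⟨b, h, hb, rfl⟩ := hx
        rw [hf, hb, mul_zero]
      | zero => exact map_zero _
      | add x y _ _ hx hy => rw [map_add, hx, hy, add_zero]
      | smul a x _ hx => rw [map_smul, hx, smul_zero]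
  ζ_mul_ζbar := congrArg WithConv.toConv ((biopDual_map_conv D.γ D.γbar).trans
    ((congrArg BiopDual.map hD.γbar_conv_γ).trans biopDual_map_convUnit))
  ζbar_mul_ζ := congrArg WithConv.toConv ((biopDual_map_conv D.γbar D.γ).trans
    ((congrArg BiopDual.map hD.γ_conv_γbar).trans biopDual_map_convUnit))
  γ_mul_γbar := congrArg WithConv.toConv ((biopDual_map_conv D.ζ D.ζbar).trans
    ((congrArg BiopDual.map hD.ζbar_conv_ζ).trans biopDual_map_convUnit))
  γbar_mul_γ := congrArg WithConv.toConv ((biopDual_map_conv D.ζbar D.ζ).trans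
    ((congrArg BiopDual.map hD.ζ_conv_ζbar).trans biopDual_map_convUnit))
  ζ_mul f g := biopDual_ext fun x => by
    change bpair (g ⊗ₜ BiopDual.map D.π f) (comul (R := k) (D.γ x)) =
      bpair (BiopDual.map D.γ g ⊗ₜ f) (comul (R := k) x)
    have h1 := bpair_lTensor_map D.π (g ⊗ₜ f) (comul (R := k) (D.γ x))
    have h2 := bpair_rTensor_map D.γ (g ⊗ₜ f) (comul (R := k) x)
    rw [hD.γ_coact] at h1
    exact h1.trans h2.symm
  γ_coact f := bpair_ext fun h b => by
    refine (bpair_lTensor_map D.ι _ _).trans ((bpair_comul_tmul _ _ _).trans ?_)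
    refine Eq.trans ?_ ((bpair_rTensor_map D.ζ _ _).trans (bpair_comul_tmul _ _ _)).symm
    exact congrArg f.ev (hD.ζ_mul b h)
  ζ_one := biopDual_ext hD.γ_counit
  ζ_counit f := congrArg f.ev hD.γ_one
  γ_one := biopDual_ext hD.ζ_counit
  γ_counit f := congrArg f.ev hD.ζ_one
  conv_eq_id := congrArg WithConv.toConv ((biopDual_map_conv (D.γ ∘ₗ D.π) (D.ι ∘ₗ D.ζ)).trans
    (congrArg BiopDual.map hD.ιζ_conv_γπ))

end

end LeftPartialDual

end

open TensorProduct Coalgebra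

noncomputable section

namespace LeftPartialDual

open LeftComoduleAlgebra RightModuleCoalgebra HopfAlgebra
open MappingSystem (inl inr antipodeInv)

/-! ### The map `ϑ` as an algebra isomorphism -/

section Swap

set_option linter.unusedSectionVars false

attribute [local instance 2000] HopfAlgebraStruct.toBialgebra

variable (k H B C : Type*) [Field k] [Ring H] [HopfAlgebra k H] [FiniteDimensional k H]
    [Ring B] [Algebra k B] [FiniteDimensional k B] [LeftComoduleAlgebra k H B]
    [AddCommGroup C] [Module k C] [Coalgebra k C] [FiniteDimensional k C]
    [RightModuleCoalgebra k H C]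

/-- The smash product `B^biop # C*^biop`. -/
abbrev DualSmash : Type _ := Smash k (BiopDual k H) (BiopDual k C) (BiopDual k B)

/-- `b ↦ b # ε` -/
def dualInl : B →ₗ[k] DualSmash k H B C :=
  inl k (BiopDual k H) (BiopDual k C) (BiopDual k B) ∘ₗ bidual k B

/-- `f ↦ 1 # f` -/
def dualInr : Module.Dual k C →ₗ[k] DualSmash k H B C :=
  inr k (BiopDual k H) (BiopDual k C) (BiopDual k B) ∘ₗ (toBiopDual k C).toLinearMap

variable {k H B C}

theorem lid_rTensor_coact_biopDual (f : Module.Dual k C) (h : H) :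
    TensorProduct.lid k (BiopDual k C) ((bidual k H h).rTensor _
      (coact (k := k) (H := BiopDual k H) (toBiopDual k C f))) =
      toBiopDual k C (hit k H C h f) := by
  have key : ∀ (t : BiopDual k H ⊗[k] BiopDual k C) (x : C),
      (TensorProduct.lid k (BiopDual k C) ((bidual k H h).rTensor _ t)).ev x =
        bpair t (h ⊗ₜ x) := by
    intro t x
    induction t with
    | zero => simp
    | add s t hs ht => simp only [map_add, LinearMap.add_apply, hs, ht]
    | tmul a b =>
      rw [LinearMap.rTensor_tmul, TensorProduct.lid_tmul, map_smul]
      rfl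
  apply biopDual_ext
  intro x
  rw [key]
  exact bpair_biopCoact _ _ _

theorem hit_bidual (F : BiopDual k H) (b : B) :
    hit k (BiopDual k H) (BiopDual k B) F (bidual k B b) =
      bidual k B (TensorProduct.lid k B (F.ev.rTensor B (coact (k := k) b))) := by
  ext β
  change bpair (F ⊗ₜ β) (coact (k := k) b) = β.ev _
  induction coact (k := k) (H := H) b with
  | zero => simp
  | add s t hs ht => simp only [map_add, hs, ht]
  | tmul h c => simp [bpair_tmul]

theorem dualInl_mul (b c : B) :
    dualInl k H B C b * dualInl k H B C c = dualInl k H B C (c * b) := by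
  refine (inl_mul_inl _ _).trans (congrArg _ ?_)
  ext β
  change dualDistrib k _ _ (bidual k B b ⊗ₜ bidual k B c) (comul (R := k) (β : BiopDual k B)) =
    β.ev (c * b)
  rw [← bpair_comul_tmul]
  induction comul (R := k) (β : BiopDual k B) with
  | zero => simp
  | add s t hs ht => simp only [map_add, LinearMap.add_apply, hs, ht]
  | tmul f g => rfl

theorem dualInr_mul (f g : Module.Dual k C) :
    dualInr k H B C f * dualInr k H B C g = dualInr k H B C (dualMul k C g f) :=
  inr_mul_inr (toBiopDual k C f) (toBiopDual k C g)

/-- The straightening rule of the dual smash product is that of `C* # B` read backwards. Both pair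
the `H`-leg of the coaction on `b` with the `H*`-leg of the coaction on `f`. -/
theorem dualInr_mul_dualInl (f : Module.Dual k C) (b : B) :
    dualInr k H B C f * dualInl k H B C b = LinearMap.mul' k (DualSmash k H B C)
      (TensorProduct.comm k _ _ (TensorProduct.map (dualInr k H B C ∘ₗ (hit k H C).flip f)
        (dualInl k H B C) (coact (k := k) b))) := by
  refine (inr_mul_inl (toBiopDual k C f) (bidual k B b)).trans ?_
  -- With the two coactions replaced by independent tensors, the identity is bilinear and is checked
  -- on pure tensors.
  have key : ∀ (t : H ⊗[k] B) (s : BiopDual k H ⊗[k] BiopDual k C),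
      LinearMap.mul' k (DualSmash k H B C) (TensorProduct.map (dualInl k H B C ∘ₗ
        (TensorProduct.lid k B).toLinearMap ∘ₗ (LinearMap.rTensorHom B).flip t ∘ₗ BiopDual.ev)
        (inr k (BiopDual k H) (BiopDual k C) (BiopDual k B)) s) =
      LinearMap.mul' k (DualSmash k H B C) (TensorProduct.comm k _ _ (TensorProduct.map
        (inr k (BiopDual k H) (BiopDual k C) (BiopDual k B) ∘ₗ (TensorProduct.lid k _).toLinearMap ∘ₗ
          (LinearMap.rTensorHom (BiopDual k C)).flip s ∘ₗ bidual k H) (dualInl k H B C) t)) := by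
    intro t s
    induction t with
    | zero => simp
    | add t t' h h' =>
      simp only [map_add, LinearMap.add_comp, LinearMap.comp_add, TensorProduct.map_add_left,
        LinearMap.add_apply, h, h']
    | tmul h c =>
      induction s with
      | zero => simp
      | add s s' h h' =>
        simp only [map_add, LinearMap.add_comp, LinearMap.comp_add, TensorProduct.map_add_left,
          LinearMap.add_apply, h, h']
      | tmul F g =>
        simp [show bidual k H h F = F.ev h from rfl]
  have h1 : inl k (BiopDual k H) (BiopDual k C) (BiopDual k B) ∘ₗ
      (hit k (BiopDual k H) (BiopDual k B)).flip (bidual k B b) = dualInl k H B C ∘ₗ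
        (TensorProduct.lid k B).toLinearMap ∘ₗ
          (LinearMap.rTensorHom B).flip (coact (k := k) b) ∘ₗ BiopDual.ev :=
    LinearMap.ext fun F =>
      congrArg (inl k (BiopDual k H) (BiopDual k C) (BiopDual k B)) (hit_bidual F b)
  have h2 : dualInr k H B C ∘ₗ (hit k H C).flip f =
      inr k (BiopDual k H) (BiopDual k C) (BiopDual k B) ∘ₗ (TensorProduct.lid k _).toLinearMap ∘ₗ
        (LinearMap.rTensorHom (BiopDual k C)).flip (coact (k := k) (toBiopDual k C f)) ∘ₗ
          bidual k H :=
    LinearMap.ext fun h => congrArg (inr k (BiopDual k H) (BiopDual k C) (BiopDual k B))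
      (lid_rTensor_coact_biopDual f h).symm
  rw [h1, h2, key]

variable (k H B C)

open MulOpposite in
/-- The algebra map `f # b ↦ b # f` into the opposite algebra. -/
def swapOp : Smash k H B C →ₐ[k] (DualSmash k H B C)ᵐᵒᵖ :=
  liftAlg ((opLinearEquiv k).toLinearMap ∘ₗ dualInr k H B C)
    ((opLinearEquiv k).toLinearMap ∘ₗ dualInl k H B C)
    rfl
    (fun f g => congrArg op (dualInr_mul g f).symm)
    rfl
    (fun b c => congrArg op (dualInl_mul c b).symm)
    (fun b f => by
      refine (congrArg op (dualInr_mul_dualInl f b)).trans ?_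
      induction coact (k := k) (H := H) b with
      | zero => simp
      | add s t hs ht => simp only [map_add, op_add, hs, ht]
      | tmul h c => simp)

/-- The linear map `f # b ↦ b # f`. -/
def swap : Smash k H B C →ₗ[k] DualSmash k H B C :=
  (MulOpposite.opLinearEquiv k).symm.toLinearMap ∘ₗ (swapOp k H B C).toLinearMap

variable {k H B C}

theorem swap_mul (x y : Smash k H B C) :
    swap k H B C (x * y) = swap k H B C y * swap k H B C x :=
  congrArg MulOpposite.unop (map_mul (swapOp k H B C) x y)

theorem swap_one : swap k H B C 1 = 1 :=
  congrArg MulOpposite.unop (map_one (swapOp k H B C))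

theorem swap_inl (f : Module.Dual k C) : swap k H B C (inl k H B C f) = dualInr k H B C f := by
  have h : swapOp k H B C (inl k H B C f) = MulOpposite.op (dualInr k H B C f) := liftAlg_inl f
  exact congrArg MulOpposite.unop h

theorem swap_inr (b : B) : swap k H B C (inr k H B C b) = dualInl k H B C b := by
  have h : swapOp k H B C (inr k H B C b) = MulOpposite.op (dualInl k H B C b) := liftAlg_inr b
  exact congrArg MulOpposite.unop h

theorem swap_smk (f : Module.Dual k C) (b : B) : swap k H B C (smk k H B C f b) =
    smk k (BiopDual k H) (BiopDual k C) (BiopDual k B) (bidual k B b) (toBiopDual k C f) := by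
  rw [← inl_mul_inr, swap_mul, swap_inl, swap_inr]
  exact inl_mul_inr _ _

theorem swap_bijective : Function.Bijective (swap k H B C) := by
  have h : swap k H B C = ((TensorProduct.comm k (Module.Dual k C) B).trans
      (TensorProduct.congr (Module.evalEquiv k B) (toBiopDual k C))).toLinearMap :=
    TensorProduct.ext' fun f b => swap_smk f b
  rw [h]
  exact LinearEquiv.bijective _

variable (k H B C) in
open MulOpposite in
/-- The algebra isomorphism `(C* # B)^op ≃ B^biop # C*^biop`, `f # b ↦ b # f`. -/
def swapEquiv : (Smash k H B C)ᵐᵒᵖ ≃ₐ[k] DualSmash k H B C :=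
  AlgEquiv.ofBijective
    (AlgHom.ofLinearMap (swap k H B C ∘ₗ (opLinearEquiv k).symm.toLinearMap) swap_one
      (fun x y => swap_mul (unop y) (unop x)))
    (swap_bijective.comp (opLinearEquiv k).symm.bijective)

end Swap

end LeftPartialDual

end

open TensorProduct Coalgebra

noncomputable section

namespace LeftPartialDual

open LeftComoduleAlgebra RightModuleCoalgebra HopfAlgebra
open MappingSystem (inl inr antipodeInv)

/-! ### `ϑ` and the comultiplications and counits -/

section SwapHat

set_option linter.unusedSectionVars false

attribute [local instance 2000] HopfAlgebraStruct.toBialgebra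

variable {k H B C : Type*} [Field k] [Ring H] [HopfAlgebra k H] [FiniteDimensional k H]
    [Ring B] [Algebra k B] [FiniteDimensional k B] [LeftComoduleAlgebra k H B]
    [AddCommGroup C] [Module k C] [Coalgebra k C] [FiniteDimensional k C]
    [RightModuleCoalgebra k H C]
    {M : Type*} [AddCommGroup M] [Module k M] {R : Type*} [Ring R] [Algebra k R]

variable (H B) in
/-- The element `∑ᵢ (1 # fᵢ) ⊗ Ψ(xᵢ)` of `(B^biop # C*^biop) ⊗ M`, for a basis `(xᵢ)` of `C` with
dual basis `(fᵢ)`. -/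
def cohat : (C →ₗ[k] M) →ₗ[k] DualSmash k H B C ⊗[k] M :=
  (dualInr k H B C).rTensor M ∘ₗ (dualTensorHomEquiv k C M).symm.toLinearMap

theorem cohat_smulRight (f : Module.Dual k C) (r : M) :
    cohat H B (f.smulRight r) = dualInr k H B C f ⊗ₜ r := by
  have : f.smulRight r = dualTensorHomEquiv k C M (f ⊗ₜ r) := by
    ext x
    simp
  rw [this]
  simp only [cohat, LinearMap.comp_apply, LinearEquiv.coe_coe, LinearEquiv.symm_apply_apply,
    LinearMap.rTensor_tmul]

theorem mulRight_comp_smulRight (f : Module.Dual k C) (r s : R) :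
    LinearMap.mulRight k s ∘ₗ f.smulRight r = f.smulRight (r * s) := by
  ext x
  simp

theorem mulLeft_comp_smulRight (f : Module.Dual k C) (r s : R) :
    LinearMap.mulLeft k s ∘ₗ f.smulRight r = f.smulRight (s * r) := by
  ext x
  simp

theorem cohat_mulRight (s : R) (Ψ : C →ₗ[k] R) :
    cohat H B (LinearMap.mulRight k s ∘ₗ Ψ) = cohat H B Ψ * (1 ⊗ₜ s) := by
  induction Ψ using hom_induction with
  | hadd f g hf hg => simp only [LinearMap.comp_add, map_add, add_mul, hf, hg]
  | hr f r => simp [mulRight_comp_smulRight, cohat_smulRight]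

theorem cohat_mulLeft (s : R) (Ψ : C →ₗ[k] R) :
    cohat H B (LinearMap.mulLeft k s ∘ₗ Ψ) = (1 ⊗ₜ s) * cohat H B Ψ := by
  induction Ψ using hom_induction with
  | hadd f g hf hg => simp only [LinearMap.comp_add, map_add, mul_add, hf, hg]
  | hr f r => simp [mulLeft_comp_smulRight, cohat_smulRight]

/-- The element of `(B^biop # C*^biop) ⊗ (B^biop # C*^biop)` corresponding to a map `C → B`. -/
theorem hat_inr_map (q : C →ₗ[k] B) :
    hat (BiopDual k H) (BiopDual k C) (inr k (BiopDual k H) (BiopDual k C) (BiopDual k B) ∘ₗ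
      BiopDual.map q) = cohat H B (dualInl k H B C ∘ₗ q) := by
  induction q using hom_induction with
  | hadd f g hf hg =>
    have h : BiopDual.map (f + g) = BiopDual.map f + BiopDual.map g :=
      LinearMap.ext fun φ => LinearMap.ext fun x => map_add φ.ev _ _
    simp only [h, LinearMap.comp_add, map_add, hf, hg]
  | hr f b =>
    have h1 : inr k (BiopDual k H) (BiopDual k C) (BiopDual k B) ∘ₗ BiopDual.map (f.smulRight b) =
        (bidual k B b).smulRight (dualInr k H B C f) := by
      ext β : 1
      have h2 : BiopDual.map (f.smulRight b) β = β.ev b • toBiopDual k C f :=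
        biopDual_ext fun x => by
          rw [biopDual_map_ev, LinearMap.smulRight_apply, map_smul, map_smul, smul_eq_mul, mul_comm]
          rfl
      rw [LinearMap.comp_apply, h2, map_smul]
      rfl
    have h2 : dualInl k H B C ∘ₗ f.smulRight b = f.smulRight (dualInl k H B C b) := by
      ext x
      simp
    rw [h1, h2, hat_smulRight, cohat_smulRight]
    rfl

variable (k H B C) in
/-- `a ⊗ a' ↦ ϑ(a') ⊗ ϑ(a)` -/
def swap₂ : Smash k H B C ⊗[k] Smash k H B C →ₗ[k] DualSmash k H B C ⊗[k] DualSmash k H B C :=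
  TensorProduct.map (swap k H B C) (swap k H B C) ∘ₗ (TensorProduct.comm k _ _).toLinearMap

theorem swap₂_tmul (x y : Smash k H B C) :
    swap₂ k H B C (x ⊗ₜ y) = swap k H B C y ⊗ₜ swap k H B C x := rfl

theorem swap₂_mul (s t : Smash k H B C ⊗[k] Smash k H B C) :
    swap₂ k H B C (s * t) = swap₂ k H B C t * swap₂ k H B C s := by
  induction s with
  | zero => simp
  | add s s' h h' => simp only [map_add, add_mul, mul_add, h, h']
  | tmul a b =>
    induction t with
    | zero => simp
    | add s s' h h' => simp only [map_add, add_mul, mul_add, h, h']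
    | tmul c d => simp [swap₂_tmul, swap_mul]

theorem swap₂_hat (Ψ : C →ₗ[k] Smash k H B C) :
    swap₂ k H B C (hat H B Ψ) = cohat H B (swap k H B C ∘ₗ Ψ) := by
  induction Ψ using hom_induction with
  | hadd f g hf hg => simp only [LinearMap.comp_add, map_add, hf, hg]
  | hr f a =>
    have h : swap k H B C ∘ₗ f.smulRight a = f.smulRight (swap k H B C a) := by
      ext x
      simp
    rw [h, hat_smulRight, cohat_smulRight, swap₂_tmul, swap_inl]

variable {D : MappingSystem k H B C} (hD : D.IsPAMS) (hD' : D.dual.IsPAMS)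

theorem mul_biopDual_map_ev {X : Type*} [AddCommGroup X] [Module k X] [Coalgebra k X]
    (P Q : BiopDual k X) (x : X) : (P * Q).ev x =
      P.ev (TensorProduct.lid k X (Q.ev.rTensor X (comul (R := k) x))) := by
  rw [biopDual_mul_ev]
  induction comul (R := k) x with
  | zero => simp
  | add s t hs ht => simp only [map_add, hs, ht]
  | tmul a b => simp [bpair_tmul]

/-- `x ↦ ∑ F(x₍₁₎) x₍₂₎` -/
def coactBy (F : Module.Dual k H) : H →ₗ[k] H :=
  (TensorProduct.lid k H).toLinearMap ∘ₗ F.rTensor H ∘ₗ comul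

theorem hat_inr_map_mul (q : C →ₗ[k] H) (p : H →ₗ[k] B) (F : BiopDual k H) :
    hat (BiopDual k H) (BiopDual k C) (shift (BiopDual k H)
      (inr k (BiopDual k H) (BiopDual k C) (BiopDual k B) ∘ₗ BiopDual.map q) F ∘ₗ BiopDual.map p) =
      cohat H B (dualInl k H B C ∘ₗ p ∘ₗ coactBy F.ev ∘ₗ q) := by
  rw [← hat_inr_map]
  congr 1
  ext β : 1
  refine congrArg (inr k (BiopDual k H) (BiopDual k C) (BiopDual k B)) (biopDual_ext fun x => ?_)
  exact mul_biopDual_map_ev (BiopDual.map p β) F (q x)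

/-- `ϑ` exchanges the halves of `Δ`: the rule for the right-hand factor of the dual system becomes
the rule for `C* # 1`. `hat_inr_map_mul` replaces the sum over a basis of `B*` by one over a basis
of `C`, after which the `H*`-leg of `f` is evaluated on `γ(x)₁`. -/
theorem comul_dualInr (f : Module.Dual k C) :
    comulAlg hD' (dualInr k H B C f) =
      swap₂ k H B C (comulAlg hD (inl k H B C f)) := by
  rw [comulAlg_inl, swap₂_hat]
  refine (comulAlg_inr hD' (toBiopDual k C f)).trans ?_
  have key : ∀ s : BiopDual k H ⊗[k] BiopDual k C,
      LinearMap.mul' k _ (TensorProduct.map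
        (hat (BiopDual k H) (BiopDual k C) ∘ₗ D.dual.γ.lcomp k _ ∘ₗ shift (BiopDual k H)
          (inr k (BiopDual k H) (BiopDual k C) (BiopDual k B) ∘ₗ D.dual.ζ))
        (TensorProduct.mk k _ _ 1 ∘ₗ inr k (BiopDual k H) (BiopDual k C) (BiopDual k B)) s) =
      cohat H B (LinearMap.mul' k (DualSmash k H B C) ∘ₗ (TensorProduct.comm k _ _).toLinearMap ∘ₗ
        TensorProduct.map (inr k (BiopDual k H) (BiopDual k C) (BiopDual k B) ∘ₗ
          (TensorProduct.lid k _).toLinearMap ∘ₗ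
          (LinearMap.rTensorHom (BiopDual k C)).flip s ∘ₗ bidual k H)
          (dualInl k H B C ∘ₗ D.ζ) ∘ₗ comul ∘ₗ D.γ) := by
    intro s
    induction s with
    | zero => simp
    | add s s' h h' =>
      simp only [map_add, LinearMap.add_comp, LinearMap.comp_add, TensorProduct.map_add_left, h, h']
    | tmul F g =>
      rw [TensorProduct.map_tmul, LinearMap.mul'_apply]
      refine (congrArg (· * _) (hat_inr_map_mul D.γ D.ζ F)).trans ?_
      refine (cohat_mulRight _ _).symm.trans (congrArg _ ?_)
      ext x : 1
      simp only [LinearMap.comp_apply, coactBy]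
      induction comul (R := k) (D.γ x) with
      | zero => simp
      | add s t hs ht => simp only [map_add, hs, ht]
      | tmul a b => simp [show bidual k H a F = F.ev a from rfl]
  rw [key]
  congr 1
  ext x : 1
  simp only [LinearMap.comp_apply]
  rw [conv_apply]
  induction comul (R := k) (D.γ x) with
  | zero => simp
  | add s t hs ht => simp only [map_add, hs, ht]
  | tmul a b =>
    have h1 := lid_rTensor_coact_biopDual f a
    simp only [TensorProduct.map_tmul, LinearMap.comp_apply, LinearEquiv.coe_coe, TensorProduct.comm_tmul,
      LinearMap.mul'_apply, hitInl_apply, swap_mul, swap_inl, swap_inr, LinearMap.flip_apply]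
    exact congrArg (fun z => dualInl k H B C (D.ζ b) *
      inr k (BiopDual k H) (BiopDual k C) (BiopDual k B) z) h1

/-- The opposite exchange. Evaluating the coproduct in `H*` on the coaction leg `h` of `b`
translates the argument of `ζ` by `h`, as in `Δ(ε # b)`. -/
theorem comul_dualInl (b : B) :
    comulAlg hD' (dualInl k H B C b) =
      swap₂ k H B C (comulAlg hD (inr k H B C b)) := by
  rw [comulAlg_inr]
  refine (comulAlg_inl hD' (bidual k B b)).trans ?_
  have h1 : hitInl (BiopDual k H) (BiopDual k C) (bidual k B b) = dualInl k H B C ∘ₗ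
        (TensorProduct.lid k B).toLinearMap ∘ₗ
          (LinearMap.rTensorHom B).flip (coact (k := k) b) ∘ₗ BiopDual.ev :=
    LinearMap.ext fun F =>
      congrArg (inl k (BiopDual k H) (BiopDual k C) (BiopDual k B)) (hit_bidual F b)
  have key : ∀ t : H ⊗[k] B,
      hat (BiopDual k H) (BiopDual k C) (((dualInl k H B C ∘ₗ (TensorProduct.lid k B).toLinearMap ∘ₗ
          (LinearMap.rTensorHom B).flip t ∘ₗ BiopDual.ev) ⊚
        (inr k (BiopDual k H) (BiopDual k C) (BiopDual k B) ∘ₗ D.dual.ζ)) ∘ₗ D.dual.γ) =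
      swap₂ k H B C (LinearMap.mul' k _ (TensorProduct.map
        (hat H B ∘ₗ D.γ.lcomp k _ ∘ₗ shift H (inr k H B C ∘ₗ D.ζ))
        (TensorProduct.mk k _ _ 1 ∘ₗ inr k H B C) t)) := by
    intro t
    induction t with
    | zero =>
      simp only [map_zero, LinearMap.zero_comp, LinearMap.comp_zero]
      refine (congrArg _ ?_).trans (map_zero (hat (BiopDual k H) (BiopDual k C)))
      ext β : 1
      simp [conv_apply]
    | add s t hs ht =>
      simp only [map_add, LinearMap.add_comp, LinearMap.comp_add, add_conv, hs, ht]
    | tmul h c =>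
      rw [TensorProduct.map_tmul, LinearMap.mul'_apply, swap₂_mul]
      simp only [LinearMap.comp_apply, LinearMap.lcomp_apply', TensorProduct.mk_apply, swap₂_tmul,
        swap₂_hat, swap_one, swap_inr]
      have h2 : swap k H B C ∘ₗ shift H (inr k H B C ∘ₗ D.ζ) h ∘ₗ D.γ =
          dualInl k H B C ∘ₗ D.ζ ∘ₗ LinearMap.mulRight k h ∘ₗ D.γ := by
        ext x
        simp [swap_inr]
      rw [h2, ← hat_inr_map, ← hat_mulLeft]
      congr 1
      ext β : 1
      have h3 : ∀ G : BiopDual k H ⊗[k] BiopDual k H,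
          LinearMap.mul' k _ (TensorProduct.map (dualInl k H B C ∘ₗ
            (TensorProduct.lid k B).toLinearMap ∘ₗ
            (LinearMap.rTensorHom B).flip (h ⊗ₜ[k] c) ∘ₗ BiopDual.ev)
            (inr k (BiopDual k H) (BiopDual k C) (BiopDual k B) ∘ₗ D.dual.ζ) G) =
          dualInl k H B C c * inr k (BiopDual k H) (BiopDual k C) (BiopDual k B)
            (D.dual.ζ (TensorProduct.lid k _ ((bidual k H h).rTensor _ G))) := by
        intro G
        induction G with
        | zero => simp
        | add s t hs ht => simp only [map_add, mul_add, hs, ht]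
        | tmul F G => simp [show bidual k H h F = F.ev h from rfl]
      rw [LinearMap.comp_apply, conv_apply, h3]
      refine congrArg (fun z => _ * inr k (BiopDual k H) (BiopDual k C) (BiopDual k B) z)
        (biopDual_ext fun x => ?_)
      have h4 : ∀ (G : BiopDual k H ⊗[k] BiopDual k H) (y : H),
          (TensorProduct.lid k _ ((bidual k H h).rTensor _ G)).ev y = bpair G (h ⊗ₜ y) := by
        intro G y
        induction G with
        | zero => simp
        | add s t hs ht => simp only [map_add, LinearMap.add_apply, hs, ht]
        | tmul F G => rfl
      refine (h4 _ _).trans ((bpair_comul_tmul _ _ _).trans rfl)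
  rw [h1, key]

theorem comul_swap (a : Smash k H B C) :
    comulAlg hD' (swap k H B C a) = swap₂ k H B C (comulAlg hD a) := by
  induction a using smash_induction with
  | hadd x y hx hy => simp only [map_add, hx, hy]
  | hmul f b =>
    rw [swap_mul, swap_inl, swap_inr, map_mul, map_mul, swap₂_mul, comul_dualInr hD, comul_dualInl hD]

theorem counit_swap (a : Smash k H B C) :
    counitAlg hD' (swap k H B C a) = counitAlg hD a := by
  induction a using smash_induction with
  | hadd x y hx hy => simp only [map_add, hx, hy]
  | hmul f b =>
    rw [swap_mul, swap_inl, swap_inr, map_mul, map_mul, counitAlg_inl, counitAlg_inr, mul_comm]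
    have h1 : counitAlg hD' (dualInr k H B C f) = f (D.π 1) :=
      counitAlg_inr hD' (toBiopDual k C f)
    have h2 : counitAlg hD' (dualInl k H B C b) = counit (R := k) (D.ι b) :=
      counitAlg_inl hD' (bidual k B b)
    rw [h1, h2]

end SwapHat

end LeftPartialDual

end

open TensorProduct Coalgebra

noncomputable section

namespace LeftPartialDual

open LeftComoduleAlgebra RightModuleCoalgebra HopfAlgebra
open MappingSystem (inl inr antipodeInv)

/-! ### `ϑ` and the associators -/

section MulComp

variable {k H V R : Type*} [Field k] [AddCommGroup H] [Module k H] [AddCommGroup V] [Module k V]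
  [Ring R] [Algebra k R]

/-- `a ⊗ b ↦ (v ↦ f(a)(v) g(b))` -/
def mulComp (f : H →ₗ[k] V →ₗ[k] R) (g : H →ₗ[k] R) : H ⊗[k] H →ₗ[k] V →ₗ[k] R :=
  TensorProduct.lift (LinearMap.mk₂ k (fun a b => LinearMap.mulRight k (g b) ∘ₗ f a)
    (fun a a' b => by ext; simp [add_mul]) (fun c a b => by ext; simp)
    (fun a b b' => by ext; simp [mul_add]) (fun c a b => by ext; simp))

theorem mulComp_tmul (f : H →ₗ[k] V →ₗ[k] R) (g : H →ₗ[k] R) (a b : H) :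
    mulComp f g (a ⊗ₜ b) = LinearMap.mulRight k (g b) ∘ₗ f a := rfl

end MulComp

section SwapAssociator

set_option linter.unusedSectionVars false

attribute [local instance 2000] HopfAlgebraStruct.toBialgebra

variable {k H B C : Type*} [Field k] [Ring H] [HopfAlgebra k H] [FiniteDimensional k H]
    [Ring B] [Algebra k B] [FiniteDimensional k B] [LeftComoduleAlgebra k H B]
    [AddCommGroup C] [Module k C] [Coalgebra k C] [FiniteDimensional k C]
    [RightModuleCoalgebra k H C]

variable (k H B C) in
/-- `a ⊗ a' ⊗ a'' ↦ ϑ(a'') ⊗ ϑ(a') ⊗ ϑ(a)` -/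
def swap₃ : Smash k H B C ⊗[k] (Smash k H B C ⊗[k] Smash k H B C) →ₗ[k]
    DualSmash k H B C ⊗[k] (DualSmash k H B C ⊗[k] DualSmash k H B C) :=
  TensorProduct.map (swap k H B C) (TensorProduct.map (swap k H B C) (swap k H B C)) ∘ₗ
    QuasiBialgebraData.reverse₃ k (Smash k H B C)

theorem swap₃_assoc_hat (Ψ : C →ₗ[k] Smash k H B C ⊗[k] Smash k H B C) :
    swap₃ k H B C (TensorProduct.assoc k _ _ _ (hat H B Ψ)) =
      cohat H B (swap₂ k H B C ∘ₗ Ψ) := by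
  induction Ψ using hom_induction with
  | hadd f g hf hg => simp only [LinearMap.comp_add, map_add, hf, hg]
  | hr f t =>
    have h : swap₂ k H B C ∘ₗ f.smulRight t = f.smulRight (swap₂ k H B C t) := by
      ext x
      simp
    rw [h, hat_smulRight, cohat_smulRight]
    clear h
    induction t with
    | zero => rw [zero_tmul, map_zero, map_zero, map_zero, tmul_zero]
    | add s t hs ht => rw [add_tmul, map_add, map_add, map_add, tmul_add, hs, ht]
    | tmul x y =>
      rw [← swap_inl]
      rfl

set_option synthInstance.maxHeartbeats 200000 in
-- Coevaluations in the independent variables from `B*` and `C` may be taken in either order. The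
-- associator of the dual system is naturally a sum over `B*`, and this lets it be compared with a
-- sum over `C`.
theorem assoc_hat_cohat (Φ : BiopDual k B →ₗ[k] C →ₗ[k] DualSmash k H B C) :
    TensorProduct.assoc k _ _ _ (hat (BiopDual k H) (BiopDual k C) (cohat H B ∘ₗ Φ)) =
      cohat H B (hat (BiopDual k H) (BiopDual k C) ∘ₗ Φ.flip) := by
  induction Φ using hom_induction with
  | hadd f g hf hg =>
    have h : (f + g).flip = f.flip + g.flip := rfl
    simp only [h, LinearMap.comp_add, map_add, hf, hg]
  | hr f g =>
    have h : cohat H B ∘ₗ f.smulRight g = f.smulRight (cohat H B g) := by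
      ext x
      simp
    rw [h, hat_smulRight]
    clear h
    induction g using hom_induction with
    | hadd g g' hg hg' =>
      have h' : (f.smulRight (g + g')).flip = (f.smulRight g).flip + (f.smulRight g').flip := by
        ext x y
        simp
      rw [map_add, add_tmul, map_add, hg, hg', h', LinearMap.comp_add, map_add]
    | hr g m =>
      have h' : hat (BiopDual k H) (BiopDual k C) ∘ₗ (f.smulRight (g.smulRight m)).flip =
          g.smulRight (m ⊗ₜ inl k (BiopDual k H) (BiopDual k C) (BiopDual k B) f) := by
        ext x : 1
        have h'' : (f.smulRight (g.smulRight m)).flip x = f.smulRight (g x • m) := by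
          ext y
          simp
        rw [LinearMap.comp_apply, h'', hat_smulRight]
        rfl
      rw [h', cohat_smulRight, cohat_smulRight]
      rfl

variable (D : MappingSystem k H B C)

/-- `h ↦ (g ↦ ζ̄(S⁻¹(h γ̄(-))))`, transposed and included in `B^biop # C*^biop`. -/
def dualShift : H →ₗ[k] BiopDual k B →ₗ[k] DualSmash k H B C :=
  LinearMap.llcomp k _ _ _ (inr k (BiopDual k H) (BiopDual k C) (BiopDual k B)) ∘ₗ
    (Module.Dual.transpose : (C →ₗ[k] B) →ₗ[k] Module.Dual k B →ₗ[k] Module.Dual k C) ∘ₗ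
      LinearMap.llcomp k _ _ _ (D.ζbar ∘ₗ antipodeInv k H) ∘ₗ D.γbar.lcomp k H ∘ₗ
        LinearMap.mul k H

theorem dualShift_apply (a : H) : dualShift D a =
    inr k (BiopDual k H) (BiopDual k C) (BiopDual k B) ∘ₗ
      BiopDual.map ((D.ζbar ∘ₗ antipodeInv k H) ∘ₗ LinearMap.mulLeft k a ∘ₗ D.γbar) := rfl

/-- A rearrangement of the associator of the dual mapping system. -/
def swapAssociator : H ⊗[k] H →ₗ[k] BiopDual k B →ₗ[k] DualSmash k H B C :=
  mulComp (dualShift D) (dualInl k H B C ∘ₗ D.ζbar ∘ₗ antipodeInv k H)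

theorem hat_swapAssociator (t : H ⊗[k] H) :
    hat (BiopDual k H) (BiopDual k C) (swapAssociator D t) =
      swap₂ k H B C (LinearMap.mul' k _ (TensorProduct.map
        (TensorProduct.mk k (Smash k H B C) (Smash k H B C) 1 ∘ₗ inr k H B C ∘ₗ D.ζbar)
        (associatorAux D) (TensorProduct.map (antipodeInv k H) (antipodeInv k H)
          (TensorProduct.comm k H H t)))) := by
  induction t with
  | zero => simp only [map_zero]
  | add s t hs ht => simp only [map_add, hs, ht]
  | tmul a b =>
    rw [swapAssociator, mulComp_tmul, hat_mulRight, dualShift_apply, hat_inr_map,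
      TensorProduct.comm_tmul, TensorProduct.map_tmul, TensorProduct.map_tmul, LinearMap.mul'_apply,
      swap₂_mul]
    simp only [LinearMap.comp_apply, TensorProduct.mk_apply, swap₂_tmul, swap_one, swap_inr]
    congr 1
    have h : associatorAux D (antipodeInv k H a) = hat H B
        (shift H (inr k H B C ∘ₗ D.ζbar) (antipodeInv k H a) ∘ₗ antipodeInv k H ∘ₗ D.γbar) := rfl
    rw [h, swap₂_hat]
    congr 1
    ext x : 1
    simp [swap_inr, MappingSystem.antipodeInv_mul]

theorem associatorAux_dual (F : BiopDual k H) : associatorAux D.dual F =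
    cohat H B (dualInl k H B C ∘ₗ (D.ζbar ∘ₗ antipodeInv k H) ∘ₗ coactBy F.ev ∘ₗ D.γbar) := by
  rw [← hat_inr_map_mul]
  have h : antipodeInv k (BiopDual k H) ∘ₗ D.dual.γbar =
      BiopDual.map (D.ζbar ∘ₗ antipodeInv k H) := by
    rw [antipodeInv_biopDual]
    rfl
  have h' : associatorAux D.dual F = hat (BiopDual k H) (BiopDual k C)
      (shift (BiopDual k H) (inr k (BiopDual k H) (BiopDual k C) (BiopDual k B) ∘ₗ D.dual.ζbar) F ∘ₗ
        antipodeInv k (BiopDual k H) ∘ₗ D.dual.γbar) := rfl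
  rw [h', h]
  rfl

theorem rid_lTensor_comul_ev (F : BiopDual k H) (a y : H) :
    (TensorProduct.rid k (BiopDual k H) ((bidual k H a).lTensor _ (comul (R := k) F))).ev y =
      F.ev (a * y) := by
  have key : ∀ G : BiopDual k H ⊗[k] BiopDual k H,
      (TensorProduct.rid k (BiopDual k H) ((bidual k H a).lTensor _ G)).ev y =
        bpair G (y ⊗ₜ a) := by
    intro G
    induction G with
    | zero => simp
    | add s t hs ht => simp only [map_add, LinearMap.add_apply, hs, ht]
    | tmul F G => exact mul_comm _ _
  rw [key, bpair_comul_tmul]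

/-- Convolution over `H*` is rewritten as evaluation on the two legs of `Δ(γbar(x))`: the first
translates `γbar`, the second enters `ζbar S⁻¹`. -/
theorem conv_associatorAux_dual :
    ((TensorProduct.mk k (DualSmash k H B C) (DualSmash k H B C) 1 ∘ₗ
      inr k (BiopDual k H) (BiopDual k C) (BiopDual k B) ∘ₗ BiopDual.map D.γbar) ⊚
        associatorAux D.dual) ∘ₗ BiopDual.map (D.ζbar ∘ₗ antipodeInv k H) =
      cohat H B ∘ₗ (swapAssociator D ∘ₗ comul ∘ₗ D.γbar).flip := by
  have key : ∀ G : BiopDual k H ⊗[k] BiopDual k H,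
      LinearMap.mul' k _ (TensorProduct.map
        (TensorProduct.mk k (DualSmash k H B C) (DualSmash k H B C) 1 ∘ₗ
          inr k (BiopDual k H) (BiopDual k C) (BiopDual k B) ∘ₗ BiopDual.map D.γbar)
        (associatorAux D.dual) G) =
      cohat H B (LinearMap.mul' k (DualSmash k H B C) ∘ₗ TensorProduct.map
        (inr k (BiopDual k H) (BiopDual k C) (BiopDual k B) ∘ₗ BiopDual.map D.γbar ∘ₗ
          (TensorProduct.rid k (BiopDual k H)).toLinearMap ∘ₗ
            (LinearMap.lTensorHom (BiopDual k H)).flip G ∘ₗ bidual k H)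
        (dualInl k H B C ∘ₗ D.ζbar ∘ₗ antipodeInv k H) ∘ₗ comul ∘ₗ D.γbar) := by
    intro G
    induction G with
    | zero => simp only [map_zero, LinearMap.zero_comp, LinearMap.comp_zero,
        TensorProduct.map_zero_left]
    | add s t hs ht =>
      simp only [map_add, LinearMap.add_comp, LinearMap.comp_add, TensorProduct.map_add_left, hs,
        ht]
    | tmul F G =>
      rw [TensorProduct.map_tmul, LinearMap.mul'_apply, associatorAux_dual]
      refine (cohat_mulLeft _ _).symm.trans (congrArg _ ?_)
      ext x : 1
      simp only [LinearMap.comp_apply, coactBy]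
      induction comul (R := k) (D.γbar x) with
      | zero => simp only [map_zero]
      | add s t hs ht => simp only [map_add, hs, ht]
      | tmul a b => simp [show bidual k H a G = G.ev a from rfl]
  ext β : 1
  rw [LinearMap.comp_apply, conv_apply, key, LinearMap.comp_apply]
  congr 1
  ext x : 1
  simp only [LinearMap.comp_apply, LinearMap.flip_apply]
  induction comul (R := k) (D.γbar x) with
  | zero => simp only [map_zero, LinearMap.zero_apply]
  | add s t hs ht => simp only [map_add, LinearMap.add_apply, hs, ht]
  | tmul a b =>
    rw [swapAssociator, mulComp_tmul, dualShift_apply]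
    refine congrArg (fun z => inr k (BiopDual k H) (BiopDual k C) (BiopDual k B) z *
      dualInl k H B C (D.ζbar (antipodeInv k H b))) (biopDual_ext fun y => ?_)
    exact rid_lTensor_comul_ev _ a (D.γbar y)

/-- Both sides become coevaluations over `C`. Pointwise, the dual side involves `S⁻¹ ⊗ S⁻¹` of the
flipped `Δ(γbar(x))`, which is `Δ(S⁻¹(γbar(x)))`, the argument on the other side. -/
theorem associator_swap : D.dual.associator = swap₃ k H B C D.associator := by
  rw [associator_eq D, swap₃_assoc_hat]
  refine (associator_eq D.dual).trans ?_
  have h : antipodeInv k (BiopDual k H) ∘ₗ D.dual.γbar =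
      BiopDual.map (D.ζbar ∘ₗ antipodeInv k H) := by
    rw [antipodeInv_biopDual]
    rfl
  rw [h]
  refine (congrArg (fun z => TensorProduct.assoc k _ _ _ (hat (BiopDual k H) (BiopDual k C) z))
    (conv_associatorAux_dual D)).trans ?_
  rw [assoc_hat_cohat]
  congr 1
  ext x : 1
  refine (hat_swapAssociator D (comul (R := k) (D.γbar x))).trans ?_
  rw [← MappingSystem.comul_antipodeInv]
  rfl

end SwapAssociator

end LeftPartialDual

end

open TensorProduct Coalgebra

noncomputable section

namespace LeftPartialDual

/-! ### `ϑ` as an isomorphism of quasi-bialgebras -/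

section SwapIso

variable {k H B C : Type*} [Field k] [Ring H] [HopfAlgebra k H] [FiniteDimensional k H]
    [Ring B] [Algebra k B] [FiniteDimensional k B] [LeftComoduleAlgebra k H B]
    [AddCommGroup C] [Module k C] [Coalgebra k C] [FiniteDimensional k C]
    [RightModuleCoalgebra k H C] {D : MappingSystem k H B C}

theorem isIso_swapEquiv (hD : D.IsPAMS) (hD' : D.dual.IsPAMS) :
    QuasiBialgebraData.IsIso D.partialDual.biop D.dual.partialDual (swapEquiv k H B C) where
  comul a := by
    refine (comul_swap hD hD' a.unop).trans ?_
    have h : ∀ t : Smash k H B C ⊗[k] Smash k H B C, swap₂ k H B C t =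
      TensorProduct.map (swapEquiv k H B C).toLinearMap (swapEquiv k H B C).toLinearMap
        (TensorProduct.map (MulOpposite.opLinearEquiv k).toLinearMap
          (MulOpposite.opLinearEquiv k).toLinearMap (TensorProduct.comm k _ _ t)) := by
      intro t
      rw [← LinearMap.comp_apply, ← TensorProduct.map_comp]
      rfl
    exact h _
  counit a := by
    refine (LinearMap.congr_fun (counitAlg_toLinearMap hD') _).symm.trans
      ((counit_swap hD hD' a.unop).trans (LinearMap.congr_fun (counitAlg_toLinearMap hD) _))
  associator := by
    refine (associator_swap D).trans ?_
    have h : ∀ t : Smash k H B C ⊗[k] (Smash k H B C ⊗[k] Smash k H B C), swap₃ k H B C t =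
      TensorProduct.map (swapEquiv k H B C).toLinearMap (TensorProduct.map
        (swapEquiv k H B C).toLinearMap (swapEquiv k H B C).toLinearMap)
        (TensorProduct.map (MulOpposite.opLinearEquiv k).toLinearMap
          (TensorProduct.map (MulOpposite.opLinearEquiv k).toLinearMap
          (MulOpposite.opLinearEquiv k).toLinearMap) (QuasiBialgebraData.reverse₃ k _ t)) := by
      intro t
      rw [← LinearMap.comp_apply, ← TensorProduct.map_comp, ← TensorProduct.map_comp]
      rfl
    exact h _

end SwapIso

end LeftPartialDual

end

theorem mainTheorem6 {k H B C : Type*} [Field k]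
    [Ring H] [HopfAlgebra k H] [FiniteDimensional k H]
    [Ring B] [Algebra k B] [FiniteDimensional k B] [LeftPartialDual.LeftComoduleAlgebra k H B]
    [AddCommGroup C] [Module k C] [Coalgebra k C] [FiniteDimensional k C]
    [LeftPartialDual.RightModuleCoalgebra k H C]
    (D : LeftPartialDual.MappingSystem k H B C) (hD : D.IsPAMS) :
    D.dual.IsPAMS ∧
    D.partialDual.biop.IsQuasiBialgebra ∧
    D.dual.partialDual.IsQuasiBialgebra ∧
    ∃ ϑ : (LeftPartialDual.Smash k H B C)ᵐᵒᵖ ≃ₐ[k]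
        LeftPartialDual.Smash k (LeftPartialDual.BiopDual k H) (LeftPartialDual.BiopDual k C)
          (LeftPartialDual.BiopDual k B),
      (∀ (f : Module.Dual k C) (b : B),
        ϑ (MulOpposite.op (LeftPartialDual.smk k H B C f b)) =
          LeftPartialDual.smk k (LeftPartialDual.BiopDual k H) (LeftPartialDual.BiopDual k C)
            (LeftPartialDual.BiopDual k B) (LeftPartialDual.bidual k B b)
            (LeftPartialDual.toBiopDual k C f)) ∧
      LeftPartialDual.QuasiBialgebraData.IsIso D.partialDual.biop D.dual.partialDual ϑ ∧
      (IsUnit D.upsilon →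
        (D.partialDual.biop.IsAntipode ((MulOpposite.opLinearEquiv k).conj D.S₁)
            1 (MulOpposite.op D.upsilon) ∧
          D.dual.partialDual.IsAntipode
            (ϑ.toLinearEquiv.conj ((MulOpposite.opLinearEquiv k).conj D.S₁))
            1 (ϑ (MulOpposite.op D.upsilon))) ∧
        (D.partialDual.biop.IsAntipode ((MulOpposite.opLinearEquiv k).conj D.S₂)
            (MulOpposite.op D.upsilon) 1 ∧
          D.dual.partialDual.IsAntipode
            (ϑ.toLinearEquiv.conj ((MulOpposite.opLinearEquiv k).conj D.S₂))
            (ϑ (MulOpposite.op D.upsilon)) 1)) := by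
  have hD' : D.dual.IsPAMS := LeftPartialDual.isPAMS_dual hD
  have hiso := LeftPartialDual.isIso_swapEquiv hD hD'
  have hQ' : D.dual.partialDual.IsQuasiBialgebra :=
    LeftPartialDual.isQuasiBialgebra_partialDual hD'
  -- The twist argument is applied to the dual system, and the biopposite inherits the axioms
  -- through the inverse of `ϑ`.
  have hQ : D.partialDual.biop.IsQuasiBialgebra := hiso.symm.isQuasiBialgebra hQ'
  refine ⟨hD', hQ, hQ', LeftPartialDual.swapEquiv k H B C,
    fun f b => LeftPartialDual.swap_smk f b, hiso, fun hυ => ⟨?_, ?_⟩⟩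
  · have h := LeftPartialDual.isAntipode_S₁ hD hυ
    refine ⟨h, ?_⟩
    have h' := hiso.isAntipode hQ.isUnit_associator h
    rwa [map_one] at h'
  · have h := LeftPartialDual.isAntipode_S₂ hD hυ
    refine ⟨h, ?_⟩
    have h' := hiso.isAntipode hQ.isUnit_associator h
    rwa [map_one] at h'
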